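/- Fix $\mu>0$ and $\alpha\in(0,1)$, put $\omega(p)=p^\alpha$, and consider the massive Ising model (two-particle scattering function $S=-1$) with particle mass $\mu$. Let $\mathcal H=\bigoplus_{n\ge 0}\mathcal H_n$, where $\mathcal H_n$ is the space of antisymmetric functions in $L^2(\mathbb R^n)$; let $\Omega=(1,0,0,\dots)$; let $P^{\mathrm{odd}}$ be the projector onto $\bigoplus_{n\text{ odd}}\mathcal H_n$; and let $(z(\theta)\psi)_n(\boldsymbol\xi)=\sqrt{n+1}\,\psi_{n+1}(\theta,\boldsymbol\xi)$ be the annihilators and $z^\dagger(\theta)$ their formal adjoints. Put $E(\boldsymbol\theta)=\sum_j\cosh\theta_j$, let $e^{\omega(H/\mu)}$ act as multiplication by $e^{\omega(E(\boldsymbol\theta))}$, and let $\mathcal H^{\omega,\mathrm f}$ be the space of vectors of finite particle number in its domain. Let $\mathcal Q^\omega$ be the space of sesquilinear forms $A$ on $\mathcal H^{\omega,\mathrm f}\times\mathcal H^{\omega,\mathrm f}$ such that for each $N$ the forms $Ae^{-\omega(H/\mu)}$ and $e^{-\omega(H/\mu)}A$ are bounded between vectors with at most $N$ particles. The form $A$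 is called $\omega$-closable if there is a closed operator $A^-$ with $\mathcal H^{\omega,\mathrm f}\subset\operatorname{dom}A^-\cap\operatorname{dom}(A^-)^*$ that has $\mathcal H^{\omega,\mathrm f}$ as a core and agrees with $A$ as a form on it. Let $\Lambda^\pm$ be the algebra of symmetric Laurent functions over $\mathbb C$, freely generated by the power sums $p_k=\sum_j x_j^k$, $k\in\mathbb Z\setminus\{0\}$, and let $\Lambda_{\mathrm I}^\pm$ be the subalgebra of those $P$ with $P(y,-y,\boldsymbol x)=P(\boldsymbol x)$, i.e. invariant under $p_k\mapsto p_k+y^k+(-y)^k$ for all $y>0$. With $p\cdot x=p^0x^0-p^1x^1$ and $\tilde g(p)=\frac1{2\pi}\int e^{ip\cdot x}g(x)\,d^2x$, let $\mathcal D_\alpha(\mathcal O)$ be the set of $g\in C_c^\infty(\mathcal O)$ such that $e^{c\|p\|_\infty^\alpha}\,\partial_{p^0}^{k_0}\partial_{p^1}^{k_1}\tilde g(p)$ is bounded on $\mathbb R^2$ for all $c>0$ and $k_0,k_1\in\mathbb N_0$. For $P\in\Lambda_{\mathrm I}^\pm$ and $g\in\mathcal D_\alpha(\mathcal O)$ let,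 with $p(\boldsymbol\zeta)=\mu\sum_j(\cosh\zeta_j,\sinh\zeta_j)$, $$F_{2k+1}(\boldsymbol\zeta)=\frac{1}{(2\pi i)^k}\,\tilde g(p(\boldsymbol\zeta))\,P(e^{\boldsymbol\zeta})\prod_{1\le i<j\le 2k+1}\tanh\frac{\zeta_i-\zeta_j}2,\qquad F_{2k}(\boldsymbol\zeta)=0 ,$$ and let $A^{[1,P,g]}\in\mathcal Q^\omega$ be the form $$A^{[1,P,g]}=\sum_{m,n\ge 0}\int\frac{d^m\theta\,d^n\eta}{m!\,n!}\,F_{m+n}(\boldsymbol\theta+i\boldsymbol 0,\boldsymbol\eta+i\boldsymbol\pi-i\boldsymbol 0)\,z^\dagger(\theta_1)\cdots z^\dagger(\theta_m)\,z(\eta_1)\cdots z(\eta_n),$$ where the coefficients are distributional boundary values taken from within $\{0<\operatorname{Im}\zeta_1<\dots<\operatorname{Im}\zeta_{m+n}<\pi\}$, and the identity is understood in matrix elements between vectors with smooth compactly supported wave functions and finite particle number. Let $\mathcal W=\{x\in\mathbb R^2:|x^0|<x^1\}$, and let $\mathcal O=(x+\mathcal W)\cap(y-\mathcal W)$ with $y-x\in\mathcal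 W$ be any (non-empty) double cone. Put $\mathcal Q^{\mathrm{odd}}(\mathcal O)=\operatorname{span}\{A^{[1,P,g]}:P\in\Lambda_{\mathrm I}^\pm,\ g\in\mathcal D_\alpha(\mathcal O)\}$. **Proposition.** Each form $A^{[1,P,g]}$ with $P\in\Lambda_{\mathrm I}^\pm$, $g\in\mathcal D_\alpha(\mathcal O)$ exists in $\mathcal Q^\omega$ and is unique; each $A\in\mathcal Q^{\mathrm{odd}}(\mathcal O)$ is $\omega$-closable with a unique $\omega$-closure $A^-$; and the set $\{A^-\Omega:A\in\mathcal Q^{\mathrm{odd}}(\mathcal O)\}$ is contained in $P^{\mathrm{odd}}\mathcal H$ and dense in it. -/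

import Mathlib

/-! The massive Ising model: the integrable quantum field theory on 1+1-dimensional Minkowski
space with one species of particle of mass `μ > 0` and two-particle scattering function `S = -1`.
Space-time and momentum-space points are pairs `(time component, space component)`. -/

namespace IsingModel

open MeasureTheory Filter Topology
open scoped ContDiff

noncomputable section

/-! ### Hilbert space -/

lemma measurePreserving_perm {n : ℕ} (σ : Equiv.Perm (Fin n)) :
    MeasurePreserving (fun θ : Fin n → ℝ => θ ∘ σ) volume volume := by
  have h := volume_measurePreserving_piCongrLeft (fun _ : Fin n => ℝ) σ.symm
  convert h using 1
  funext θ i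
  have := MeasurableEquiv.piCongrLeft_apply_apply (β := fun _ : Fin n => ℝ) σ.symm θ (σ i)
  simpa using this.symm

/-- The operator `(V_σ ψ)(θ) = ψ(θ ∘ σ)` on `L²(ℝⁿ)`. -/
def permuteL2 {n : ℕ} (σ : Equiv.Perm (Fin n)) :
    Lp ℂ 2 (volume : Measure (Fin n → ℝ)) →L[ℂ] Lp ℂ 2 (volume : Measure (Fin n → ℝ)) :=
  (Lp.compMeasurePreservingₗᵢ ℂ _ (measurePreserving_perm σ)).toContinuousLinearMap

/-- The `n`-particle space `H_n`: the `S`-symmetric part of `L²(ℝⁿ)` for `S = -1`, i.e. the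
wave functions that change sign under a transposition of two arguments. -/
def nParticle (n : ℕ) : Submodule ℂ (Lp ℂ 2 (volume : Measure (Fin n → ℝ))) :=
  ⨅ p : {p : Fin n × Fin n // p.1 ≠ p.2},
    LinearMap.ker (permuteL2 (Equiv.swap p.1.1 p.1.2) + ContinuousLinearMap.id ℂ _).toLinearMap

lemma mem_nParticle_iff {n : ℕ} (ψ : Lp ℂ 2 (volume : Measure (Fin n → ℝ))) :
    ψ ∈ nParticle n ↔ ∀ i j : Fin n, i ≠ j →
      ∀ᵐ θ : Fin n → ℝ, ψ (θ ∘ Equiv.swap i j) = - ψ θ := by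
  have key : ∀ i j : Fin n, permuteL2 (Equiv.swap i j) ψ + ψ = 0 ↔
      ∀ᵐ θ : Fin n → ℝ, ψ (θ ∘ Equiv.swap i j) = - ψ θ := by
    intro i j
    have h1 : permuteL2 (Equiv.swap i j) ψ =ᵐ[volume] ψ ∘ (fun θ => θ ∘ Equiv.swap i j) :=
      Lp.coeFn_compMeasurePreserving ψ (measurePreserving_perm _)
    rw [← eq_neg_iff_add_eq_zero, Lp.ext_iff]
    constructor
    · intro h
      filter_upwards [h, h1, Lp.coeFn_neg ψ] with θ a b c
      rw [b, c] at a
      simpa using a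
    · intro h
      filter_upwards [h, h1, Lp.coeFn_neg ψ] with θ a b c
      rw [b, c]
      simpa using a
  simp only [nParticle, Submodule.mem_iInf, LinearMap.mem_ker, Subtype.forall, Prod.forall]
  exact forall_congr' fun i => forall_congr' fun j => imp_congr_right fun _ => key i j

instance (n : ℕ) : CompleteSpace (nParticle n) := by
  have : IsClosed (nParticle n : Set (Lp ℂ 2 (volume : Measure (Fin n → ℝ)))) := by
    rw [nParticle, Submodule.coe_iInf]
    exact isClosed_iInter fun p => ContinuousLinearMap.isClosed_ker
      (permuteL2 (Equiv.swap p.1.1 p.1.2) + ContinuousLinearMap.id ℂ _)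
  exact this.completeSpace_coe

/-- The Fock space: the Hilbert sum of the spaces `H_n`. -/
abbrev Fock : Type := lp (fun n => nParticle n) 2

/-- The `n`-particle wave function of a vector. -/
def wave (ψ : Fock) (n : ℕ) : (Fin n → ℝ) → ℂ :=
  ((ψ n : nParticle n) : Lp ℂ 2 (volume : Measure (Fin n → ℝ)))

lemma wave_add (ψ χ : Fock) (n : ℕ) : wave (ψ + χ) n =ᵐ[volume] wave ψ n + wave χ n :=
  Lp.coeFn_add _ _

lemma wave_smul (c : ℂ) (ψ : Fock) (n : ℕ) : wave (c • ψ) n =ᵐ[volume] c • wave ψ n :=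
  Lp.coeFn_smul _ _

lemma wave_zero (n : ℕ) : wave 0 n =ᵐ[volume] 0 :=
  Lp.coeFn_zero _ _ _

/-- The Fock vacuum `Ω`: its zero-particle component is `1`, all others vanish. -/
def vacuum : Fock :=
  lp.single 2 0 ⟨indicatorConstLp 2 MeasurableSet.univ (by simp [volume_pi]) (1 : ℂ), by
    rw [mem_nParticle_iff]; exact fun i => i.elim0⟩

/-- The range of the projector onto odd particle numbers. -/
def oddSubspace : Submodule ℂ Fock where
  carrier := {ψ | ∀ n, Even n → ψ n = 0}
  add_mem' := by
    intro a b ha hb n hn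
    simp [ha n hn, hb n hn]
  zero_mem' := by intro n _; rfl
  smul_mem' := by
    intro c a ha n hn
    simp [ha n hn]

/-- `ψ` has at most `N` particles. -/
def AtMost (N : ℕ) (ψ : Fock) : Prop := ∀ n, N < n → ψ n = 0

/-! ### Quadratic forms -/

/-- `E(θ) = ∑ cosh θ_j`; the Hamiltonian `H` acts by multiplication with `μ E`. -/
def energy {n : ℕ} (θ : Fin n → ℝ) : ℝ := ∑ j, Real.cosh (θ j)

/-- The indicatrix `ω(p) = p ^ α`. -/
def omega (α p : ℝ) : ℝ := p ^ α

/-- `ψ` is in the domain of `exp(ω(H/μ))` and `φ = exp(ω(H/μ)) ψ`. -/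
def IsExpOmega (α : ℝ) (ψ φ : Fock) : Prop :=
  ∀ n, wave φ n =ᵐ[volume] fun θ => (Real.exp (omega α (energy θ)) : ℂ) * wave ψ n θ

/-- The space of vectors of finite particle number in the domain of `exp(ω(H/μ))`. -/
def finiteOmega (α : ℝ) : Submodule ℂ Fock where
  carrier := {ψ | (∃ N, AtMost N ψ) ∧ ∃ φ, IsExpOmega α ψ φ}
  add_mem' := by
    rintro a b ⟨⟨N, hN⟩, φ, hφ⟩ ⟨⟨M, hM⟩, χ, hχ⟩
    refine ⟨⟨max N M, fun n hn => ?_⟩, φ + χ, fun n => ?_⟩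
    · simp [hN n (lt_of_le_of_lt (le_max_left _ _) hn), hM n (lt_of_le_of_lt (le_max_right _ _) hn)]
    · filter_upwards [wave_add a b n, wave_add φ χ n, hφ n, hχ n] with θ h1 h2 h3 h4
      rw [h1, h2, Pi.add_apply, Pi.add_apply, h3, h4, mul_add]
  zero_mem' := by
    refine ⟨⟨0, fun n _ => rfl⟩, 0, fun n => ?_⟩
    filter_upwards [wave_zero n] with θ h
    rw [h]; simp
  smul_mem' := by
    rintro c a ⟨⟨N, hN⟩, φ, hφ⟩
    refine ⟨⟨N, fun n hn => ?_⟩, c • φ, fun n => ?_⟩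
    · simp [hN n hn]
    · filter_upwards [wave_smul c a n, wave_smul c φ n, hφ n] with θ h1 h2 h3
      rw [h1, h2, Pi.smul_apply, Pi.smul_apply, h3, smul_eq_mul, smul_eq_mul]
      ring

/-- Sesquilinear forms `A(ψ, χ) = ⟨ψ, A χ⟩`, antilinear in `ψ` and linear in `χ`. -/
abbrev SForm (α : ℝ) : Type := finiteOmega α →ₗ⋆[ℂ] finiteOmega α →ₗ[ℂ] ℂ

/-- The space `Q^ω`: for every `N` the forms `A exp(-ω(H/μ))` and `exp(-ω(H/μ)) A`, compressed to
at most `N` particles, are bounded. (With `φ = exp(ω(H/μ)) χ`, the first condition bounds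
`⟨ψ, A exp(-ω(H/μ)) φ⟩` by `C ‖ψ‖ ‖φ‖`; similarly for the second.) -/
def Qomega (α : ℝ) : Submodule ℂ (SForm α) where
  carrier := {A | ∀ N : ℕ, ∃ C : ℝ, ∀ ψ χ : finiteOmega α, AtMost N (ψ : Fock) →
    AtMost N (χ : Fock) →
      (∀ φ : Fock, IsExpOmega α χ φ → ‖A ψ χ‖ ≤ C * ‖(ψ : Fock)‖ * ‖φ‖) ∧
      (∀ φ : Fock, IsExpOmega α ψ φ → ‖A ψ χ‖ ≤ C * ‖φ‖ * ‖(χ : Fock)‖)}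
  add_mem' := by
    intro A B hA hB N
    obtain ⟨C, hC⟩ := hA N
    obtain ⟨D, hD⟩ := hB N
    refine ⟨C + D, fun ψ χ hψ hχ => ⟨fun φ hφ => ?_, fun φ hφ => ?_⟩⟩
    · have h1 := (hC ψ χ hψ hχ).1 φ hφ
      have h2 := (hD ψ χ hψ hχ).1 φ hφ
      have h3 := norm_add_le (A ψ χ) (B ψ χ)
      simp only [LinearMap.add_apply]
      linarith
    · have h1 := (hC ψ χ hψ hχ).2 φ hφ
      have h2 := (hD ψ χ hψ hχ).2 φ hφ
      have h3 := norm_add_le (A ψ χ) (B ψ χ)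
      simp only [LinearMap.add_apply]
      linarith
  zero_mem' := by
    intro N
    exact ⟨0, fun ψ χ _ _ => ⟨fun φ _ => by simp, fun φ _ => by simp⟩⟩
  smul_mem' := by
    intro c A hA N
    obtain ⟨C, hC⟩ := hA N
    refine ⟨‖c‖ * C, fun ψ χ hψ hχ => ⟨fun φ hφ => ?_, fun φ hφ => ?_⟩⟩
    · have h1 := mul_le_mul_of_nonneg_left ((hC ψ χ hψ hχ).1 φ hφ) (norm_nonneg c)
      simp only [LinearMap.smul_apply, norm_smul]
      linarith
    · have h1 := mul_le_mul_of_nonneg_left ((hC ψ χ hψ hχ).2 φ hφ) (norm_nonneg c)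
      simp only [LinearMap.smul_apply, norm_smul]
      linarith

/-- `T` is an `ω`-closure of the form `A`: a closed operator with the finite-particle space
`finiteOmega α` contained in the domains of `T` and of its adjoint, with this space as a core,
and which agrees with `A` there. The form `A` is `ω`-closable if there is such a `T`. -/
structure IsOmegaClosure (α : ℝ) (A : SForm α) (T : Fock →ₗ.[ℂ] Fock) : Prop where
  closed : T.IsClosed
  le_domain : finiteOmega α ≤ T.domain
  le_adjoint_domain : finiteOmega α ≤ T.adjoint.domain
  core : T.HasCore (finiteOmega α)
  agrees : ∀ ψ χ : finiteOmega α,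
    inner ℂ (ψ : Fock) (T ⟨(χ : Fock), le_domain χ.2⟩) = A ψ χ

/-! ### Expansion in annihilators and creators -/

/-- Sequences of `n`-particle wave functions, understood pointwise. -/
abbrev WaveSeq : Type := (n : ℕ) → (Fin n → ℝ) → ℂ

/-- Smooth, compactly supported wave functions with at most `N` particles. -/
structure IsTestSeq (N : ℕ) (ψ : WaveSeq) : Prop where
  smooth : ∀ n, ContDiff ℝ ∞ (ψ n)
  compact : ∀ n, HasCompactSupport (ψ n)
  vanish : ∀ n, N < n → ψ n = 0

/-- The vector `Ψ` is given by the pointwise wave functions `ψ`. -/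
def Represents (ψ : WaveSeq) (Ψ : Fock) : Prop := ∀ n, wave Ψ n =ᵐ[volume] ψ n

/-- The annihilator `z(θ)`: `(z(θ)ψ)_n(ξ) = √(n+1) ψ_{n+1}(θ, ξ)`. -/
def annih (θ : ℝ) (ψ : WaveSeq) : WaveSeq :=
  fun n ξ => (Real.sqrt (n + 1) : ℂ) * ψ (n + 1) (Fin.cons θ ξ : Fin (n + 1) → ℝ)

/-- `z(η_1) ⋯ z(η_n) χ`. -/
def annihProd {n : ℕ} (η : Fin n → ℝ) (χ : WaveSeq) : WaveSeq :=
  (List.ofFn η).foldr annih χ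

/-- `z(θ_m) ⋯ z(θ_1) ψ`, where `z(θ_m) ⋯ z(θ_1)` is the adjoint of `z†(θ_1) ⋯ z†(θ_m)`. -/
def annihProdRev {m : ℕ} (θ : Fin m → ℝ) (ψ : WaveSeq) : WaveSeq :=
  (List.ofFn θ).foldl (fun φ t => annih t φ) ψ

/-- The Fock scalar product of wave functions with at most `N` particles. -/
def pairing (N : ℕ) (ψ χ : WaveSeq) : ℂ :=
  ∑ k ∈ Finset.range (N + 1), ∫ ξ : Fin k → ℝ, starRingEnd ℂ (ψ k ξ) * χ k ξ

/-- The matrix element `⟨ψ, z†(θ_1) ⋯ z†(θ_m) z(η_1) ⋯ z(η_n) χ⟩` as a function of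
`(θ, η) ∈ ℝ^(m+n)`. -/
def monomialKernel (N m n : ℕ) (ψ χ : WaveSeq) : (Fin (m + n) → ℝ) → ℂ :=
  fun x => pairing N (annihProdRev (fun i : Fin m => x (Fin.castAdd n i)) ψ)
    (annihProd (fun j : Fin n => x (Fin.natAdd m j)) χ)

/-- The region `0 < λ_1 < ⋯ < λ_k < π`. -/
def regionPlus (k : ℕ) : Set (Fin k → ℝ) :=
  {l | (∀ i, 0 < l i ∧ l i < Real.pi) ∧ StrictMono l}

/-- The node `(0,…,0,π,…,π)` with `m` zeros followed by `n` entries `π`. -/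
def node (m n : ℕ) : Fin (m + n) → ℝ :=
  Fin.append (fun _ : Fin m => 0) (fun _ : Fin n => Real.pi)

/-- The functional `f` on test functions is the distributional boundary value
`F(θ + i0, η + iπ - i0)`, approached from within `ℝ^(m+n) + i (regionPlus (m+n))`. -/
def IsBoundaryValue (m n : ℕ) (F : (Fin (m + n) → ℂ) → ℂ)
    (f : ((Fin (m + n) → ℝ) → ℂ) → ℂ) : Prop :=
  ∀ φ : (Fin (m + n) → ℝ) → ℂ, ContDiff ℝ ∞ φ → HasCompactSupport φ →
    Tendsto (fun l : Fin (m + n) → ℝ =>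
        ∫ x : Fin (m + n) → ℝ, F (fun j => (x j : ℂ) + (l j : ℂ) * Complex.I) * φ x)
      (𝓝[regionPlus (m + n)] node m n) (𝓝 (f φ))

/-- `A` is the element of `Q^ω` associated with the sequence of functions `F_k`, i.e.
`A = ∑_{m,n} ∫ dθ dη / (m! n!) F_{m+n}(θ + i0, η + iπ - i0) z†(θ_1)⋯z†(θ_m) z(η_1)⋯z(η_n)`,
evaluated between vectors with smooth compactly supported wave functions (which determine an
element of `Q^ω`). The sum is finite in each matrix element. -/
def IsAssociatedForm (α : ℝ) (F : (k : ℕ) → (Fin k → ℂ) → ℂ) (A : SForm α) : Prop :=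
  A ∈ Qomega α ∧
  ∃ f : (m n : ℕ) → ((Fin (m + n) → ℝ) → ℂ) → ℂ,
    (∀ m n, IsBoundaryValue m n (F (m + n)) (f m n)) ∧
    ∀ (N : ℕ) (ψ χ : WaveSeq), IsTestSeq N ψ → IsTestSeq N χ →
      ∀ Ψ X : finiteOmega α, Represents ψ Ψ → Represents χ X →
        A Ψ X = ∑ m ∈ Finset.range (N + 1), ∑ n ∈ Finset.range (N + 1),
          ((m.factorial : ℂ) * (n.factorial : ℂ))⁻¹ * f m n (monomialKernel N m n ψ χ)

/-! ### Symmetric Laurent functions -/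

/-- The algebra `Λ^±` of symmetric Laurent functions over `ℂ`, freely generated by the power
sums `p_k`, `k ∈ ℤ \ {0}`; the variable `X k` stands for `p_k`. -/
abbrev SymLaurent : Type := MvPolynomial {k : ℤ // k ≠ 0} ℂ

/-- The value `P(x_1,…,x_n)`, obtained from `p_k ↦ ∑_j x_j ^ k`. -/
def evalLaurent {n : ℕ} (x : Fin n → ℂ) (P : SymLaurent) : ℂ :=
  MvPolynomial.aeval (fun k : {k : ℤ // k ≠ 0} => ∑ j, x j ^ (k : ℤ)) P

/-- The substitution `x_1 ↦ y`, `x_2 ↦ -y`, `x_{j+2} ↦ x_j`, i.e. `p_k ↦ p_k + y^k + (-y)^k`. -/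
def substPair (y : ℝ) : SymLaurent →ₐ[ℂ] SymLaurent :=
  MvPolynomial.aeval fun k : {k : ℤ // k ≠ 0} =>
    MvPolynomial.X k + MvPolynomial.C ((y : ℂ) ^ (k : ℤ) + (-(y : ℂ)) ^ (k : ℤ))

/-- The subalgebra `Λ_I^±` of elements invariant under all substitutions `substPair y`, `y > 0`;
that is, `P(y, -y, x) = P(x)`. -/
def LaurentI : Subalgebra ℂ SymLaurent :=
  ⨅ y : {y : ℝ // 0 < y}, AlgHom.equalizer (substPair y) (AlgHom.id ℂ SymLaurent)

lemma mem_LaurentI_iff (P : SymLaurent) :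
    P ∈ LaurentI ↔ ∀ y : ℝ, 0 < y → substPair y P = P := by
  simp [LaurentI, Algebra.mem_iInf, AlgHom.mem_equalizer]

/-! ### Space-time regions and test functions -/

/-- The right wedge with tip at the origin. -/
def rightWedge : Set (ℝ × ℝ) := {x | |x.1| < x.2}

/-- The double cone `O_{x,y}`: the right wedge with tip `x` intersected with the left wedge with
tip `y`. It is non-empty if and only if `y - x` is in the right wedge. -/
def doubleCone (x y : ℝ × ℝ) : Set (ℝ × ℝ) := {z | z - x ∈ rightWedge ∧ y - z ∈ rightWedge}

/-- The Fourier transform `(2π)⁻¹ ∫ exp(i p·x) g(x) d²x` with the Minkowski product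
`p·x = p⁰x⁰ - p¹x¹`, at complex momenta. -/
def fourier (g : ℝ × ℝ → ℂ) (p : ℂ × ℂ) : ℂ :=
  (2 * (Real.pi : ℂ))⁻¹ *
    ∫ x : ℝ × ℝ, Complex.exp (Complex.I * (p.1 * (x.1 : ℂ) - p.2 * (x.2 : ℂ))) * g x

/-- The test function space `D_α(O)`: smooth functions with compact support in `O` all of whose
momentum space derivatives decay faster than `exp(-c ‖p‖_∞ ^ α)` for every `c`. -/
def testSpace (α : ℝ) (O : Set (ℝ × ℝ)) : Set (ℝ × ℝ → ℂ) :=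
  {g | ContDiff ℝ ∞ g ∧ HasCompactSupport g ∧ tsupport g ⊆ O ∧
    ∀ (k₀ k₁ : ℕ) (c : ℝ), 0 < c → ∃ C : ℝ, ∀ p₀ p₁ : ℝ,
      ‖(Real.exp (c * (max |p₀| |p₁|) ^ α) : ℂ) *
        iteratedDeriv k₀ (fun q₀ : ℝ =>
          iteratedDeriv k₁ (fun q₁ : ℝ => fourier g ((q₀ : ℂ), (q₁ : ℂ))) p₁) p₀‖ ≤ C}

/-! ### The odd form factors and the associated forms -/

/-- The momentum `p(ζ) = ∑_j μ (cosh ζ_j, sinh ζ_j)`. -/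
def momentum (μ : ℝ) {n : ℕ} (ζ : Fin n → ℂ) : ℂ × ℂ :=
  ((μ : ℂ) * ∑ j, Complex.cosh (ζ j), (μ : ℂ) * ∑ j, Complex.sinh (ζ j))

/-- `M^odd_n(ζ) = ∏_{i<j} tanh((ζ_i - ζ_j)/2)`. -/
def Modd {n : ℕ} (ζ : Fin n → ℂ) : ℂ :=
  ∏ i : Fin n, ∏ j ∈ Finset.Ioi i, Complex.tanh ((ζ i - ζ j) / 2)

/-- The functions `F_j^{[1,P,g]}`: for `j = 2k+1` equal to
`(2πi)^{-k} g̃(p(ζ)) P(e^ζ) M^odd_{2k+1}(ζ)`, and zero for even `j`. -/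
def Fodd (μ : ℝ) (P : SymLaurent) (g : ℝ × ℝ → ℂ) (j : ℕ) (ζ : Fin j → ℂ) : ℂ :=
  if Odd j then
    ((2 * (Real.pi : ℂ) * Complex.I) ^ ((j - 1) / 2))⁻¹ * fourier g (momentum μ ζ) *
      evalLaurent (fun i => Complex.exp (ζ i)) P * Modd ζ
  else 0

/-- `Q^odd(O)`: the span of the forms `A^{[1,P,g]}` associated with the `F_j^{[1,P,g]}`, for
`P ∈ Λ_I^±` and `g ∈ D_α(O)`. -/
def Qodd (μ α : ℝ) (O : Set (ℝ × ℝ)) : Submodule ℂ (SForm α) :=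
  Submodule.span ℂ {A | ∃ P ∈ LaurentI, ∃ g ∈ testSpace α O, IsAssociatedForm α (Fodd μ P g) A}

end

end IsingModel

set_option linter.unusedSectionVars false

namespace IsingModel

open MeasureTheory Filter Topology
open scoped ContDiff ENNReal
open Complex (exp I)
open Finset (univ range sum_congr prod_congr mem_univ sum_le_sum)
open Real (exp_pos exp_le_exp norm_of_nonneg)

noncomputable section


/-! ### Square-integrable functions -/

section L2

variable {X Y : Type*} [MeasurableSpace X] [MeasurableSpace Y] {μ : Measure X} {ν : Measure Y}

/-- Measurable, square-integrable functions. -/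
structure SqInt (μ : Measure X) (ψ : X → ℂ) : Prop where
  meas : Measurable ψ
  int : Integrable (fun x => ‖ψ x‖ ^ 2) μ

/-- The `L²` norm of a function. -/
def l2 (μ : Measure X) (ψ : X → ℂ) : ℝ := √(∫ x, ‖ψ x‖ ^ 2 ∂μ)

lemma l2_nonneg (ψ : X → ℂ) : 0 ≤ l2 μ ψ := Real.sqrt_nonneg _

lemma l2_sq (ψ : X → ℂ) : l2 μ ψ ^ 2 = ∫ x, ‖ψ x‖ ^ 2 ∂μ :=
  Real.sq_sqrt (integral_nonneg fun _ => by positivity)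

lemma SqInt.memLp {ψ : X → ℂ} (h : SqInt μ ψ) : MemLp ψ 2 μ :=
  (memLp_two_iff_integrable_sq_norm h.meas.aestronglyMeasurable).2 h.int

lemma SqInt.of_memLp {ψ : X → ℂ} (hm : Measurable ψ) (h : MemLp ψ 2 μ) : SqInt μ ψ :=
  ⟨hm, (memLp_two_iff_integrable_sq_norm hm.aestronglyMeasurable).1 h⟩

lemma SqInt.of_le {ψ : X → ℂ} (hm : Measurable ψ) {f : X → ℝ} (hf : Integrable f μ)
    (h : ∀ x, ‖ψ x‖ ^ 2 ≤ f x) : SqInt μ ψ :=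
  ⟨hm, hf.mono' (hm.norm.pow_const 2).aestronglyMeasurable
    (.of_forall fun x => by rw [norm_of_nonneg (by positivity)]; exact h x)⟩

lemma SqInt.add {ψ φ : X → ℂ} (h : SqInt μ ψ) (h' : SqInt μ φ) : SqInt μ (fun x => ψ x + φ x) :=
  .of_memLp (h.meas.add h'.meas) (h.memLp.add h'.memLp)

lemma SqInt.sub {ψ φ : X → ℂ} (h : SqInt μ ψ) (h' : SqInt μ φ) : SqInt μ (fun x => ψ x - φ x) :=
  .of_memLp (h.meas.sub h'.meas) (h.memLp.sub h'.memLp)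

lemma SqInt.mul_bdd {ψ : X → ℂ} (h : SqInt μ ψ) {a : X → ℂ} (ha : Measurable a) {c : ℝ}
    (hc : ∀ x, ‖a x‖ ≤ c) : SqInt μ (fun x => a x * ψ x) := by
  refine .of_le (ha.mul h.meas) (h.int.const_mul (c ^ 2)) fun x => ?_
  rw [norm_mul, mul_pow]
  gcongr
  exact hc x

lemma SqInt.const_mul {ψ : X → ℂ} (h : SqInt μ ψ) (c : ℂ) : SqInt μ (fun x => c * ψ x) :=
  h.mul_bdd measurable_const fun _ => le_rfl

lemma SqInt.star {ψ : X → ℂ} (h : SqInt μ ψ) : SqInt μ (fun x => starRingEnd ℂ (ψ x)) :=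
  ⟨by have := h.meas; fun_prop, by simpa using h.int⟩

lemma l2_star (ψ : X → ℂ) : l2 μ (fun x => starRingEnd ℂ (ψ x)) = l2 μ ψ := by simp [l2]

lemma l2_mono {ψ φ : X → ℂ} (hφ : Integrable (fun x => ‖φ x‖ ^ 2) μ)
    (h : ∀ᵐ x ∂μ, ‖ψ x‖ ≤ ‖φ x‖) : l2 μ ψ ≤ l2 μ φ := by
  refine Real.sqrt_le_sqrt (integral_mono_of_nonneg (.of_forall fun _ => by positivity)
    hφ ?_)
  filter_upwards [h] with x hx
  gcongr

lemma l2_mul_le {ψ : X → ℂ} (h : SqInt μ ψ) {a : X → ℂ} {c : ℝ} (hc0 : 0 ≤ c)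
    (hc : ∀ x, ‖a x‖ ≤ c) : l2 μ (fun x => a x * ψ x) ≤ c * l2 μ ψ := by
  have h1 : l2 μ (fun x => (c : ℂ) * ψ x) = c * l2 μ ψ := by
    simp only [l2, norm_mul, mul_pow, integral_const_mul, Complex.norm_real, Real.norm_eq_abs,
      sq_abs]
    rw [Real.sqrt_mul (by positivity), Real.sqrt_sq hc0]
  rw [← h1]
  refine l2_mono (h.const_mul _).int (.of_forall fun x => ?_)
  rw [norm_mul, norm_mul, Complex.norm_real, norm_of_nonneg hc0]
  gcongr
  exact hc x

lemma l2_const_mul (c : ℂ) (ψ : X → ℂ) : l2 μ (fun x => c * ψ x) = ‖c‖ * l2 μ ψ := by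
  simp only [l2, norm_mul, mul_pow, integral_const_mul]
  rw [Real.sqrt_mul (by positivity), Real.sqrt_sq (norm_nonneg c)]

lemma integral_mul_le_sqrt {f g : X → ℝ} (hf0 : ∀ x, 0 ≤ f x) (hg0 : ∀ x, 0 ≤ g x)
    (hf : MemLp f 2 μ) (hg : MemLp g 2 μ) :
    ∫ x, f x * g x ∂μ ≤ √(∫ x, f x ^ 2 ∂μ) * √(∫ x, g x ^ 2 ∂μ) := by
  have := integral_mul_le_Lp_mul_Lq_of_nonneg (p := 2) (q := 2) (μ := μ)
    (Real.holderConjugate_iff.2 ⟨by norm_num, by norm_num⟩) (.of_forall hf0)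
    (.of_forall hg0) (by simpa using hf) (by simpa using hg)
  simpa [Real.sqrt_eq_rpow] using this

lemma SqInt.integrable_mul {ψ χ : X → ℂ} (hψ : SqInt μ ψ) (hχ : SqInt μ χ) :
    Integrable (fun x => ψ x * χ x) μ :=
  hψ.memLp.integrable_mul hχ.memLp

lemma SqInt.tensor [SFinite μ] [SFinite ν] {ψ : X → ℂ} {χ : Y → ℂ} (hψ : SqInt μ ψ)
    (hχ : SqInt ν χ) : SqInt (μ.prod ν) (fun z => ψ z.1 * χ z.2) := by
  refine ⟨(hψ.meas.comp measurable_fst).mul (hχ.meas.comp measurable_snd), ?_⟩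
  simp only [norm_mul, mul_pow]
  exact hψ.int.mul_prod hχ.int

lemma l2_tensor [SFinite μ] [SFinite ν] (ψ : X → ℂ) (χ : Y → ℂ) :
    l2 (μ.prod ν) (fun z => ψ z.1 * χ z.2) = l2 μ ψ * l2 ν χ := by
  simp only [l2, norm_mul, mul_pow]
  rw [integral_prod_mul (fun x => ‖ψ x‖ ^ 2) (fun y => ‖χ y‖ ^ 2),
    Real.sqrt_mul (integral_nonneg fun _ => by positivity)]

lemma SqInt.slice [SFinite ν] [SFinite μ] {Ψ : X × Y → ℂ} (h : SqInt (μ.prod ν) Ψ) :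
    ∀ᵐ x ∂μ, SqInt ν (fun y => Ψ (x, y)) := by
  filter_upwards [h.int.prod_right_ae] with x hx
  exact ⟨h.meas.comp measurable_prodMk_left, hx⟩

lemma SqInt.integrable_l2_slice [SFinite ν] [SFinite μ] {Ψ : X × Y → ℂ}
    (h : SqInt (μ.prod ν) Ψ) : Integrable (fun x => l2 ν (fun y => Ψ (x, y)) ^ 2) μ := by
  simp only [l2_sq]
  exact h.int.integral_prod_left

lemma integral_l2_slice [SFinite ν] [SFinite μ] {Ψ : X × Y → ℂ} (h : SqInt (μ.prod ν) Ψ) :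
    ∫ x, l2 ν (fun y => Ψ (x, y)) ^ 2 ∂μ = l2 (μ.prod ν) Ψ ^ 2 := by
  simp only [l2_sq]
  exact (integral_prod _ h.int).symm

lemma measurable_l2_slice [SFinite ν] {Ψ : X × Y → ℂ} (h : Measurable Ψ) :
    Measurable (fun x => l2 ν (fun y => Ψ (x, y))) :=
  (StronglyMeasurable.integral_prod_right' (f := fun z => ‖Ψ z‖ ^ 2)
    (h.norm.pow_const 2).stronglyMeasurable).measurable.sqrt

lemma SqInt.memLp_l2_slice [SFinite ν] [SFinite μ] {Ψ : X × Y → ℂ} (h : SqInt (μ.prod ν) Ψ) :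
    MemLp (fun x => l2 ν (fun y => Ψ (x, y))) 2 μ :=
  (memLp_two_iff_integrable_sq (measurable_l2_slice h.meas).aestronglyMeasurable).2
    h.integrable_l2_slice

lemma MeasurePreserving.l2_comp {e : X → Y} (he : MeasurePreserving e μ ν) {ψ : Y → ℂ}
    (hψ : Measurable ψ) : l2 μ (fun x => ψ (e x)) = l2 ν ψ := by
  unfold l2
  rw [← he.map_eq, integral_map he.measurable.aemeasurable
    (hψ.norm.pow_const 2).aestronglyMeasurable]

lemma SqInt.comp {e : X → Y} (he : MeasurePreserving e μ ν) {ψ : Y → ℂ} (hψ : SqInt ν ψ) :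
    SqInt μ (fun x => ψ (e x)) :=
  ⟨hψ.meas.comp he.measurable, he.integrable_comp_of_integrable hψ.int⟩

end L2

/-! ### Sesquilinear forms given by integral kernels -/

section Forms

variable {X Y : Type*} [MeasurableSpace X] [MeasurableSpace Y] {μ : Measure X} {ν : Measure Y}

/-- The bilinear form with integral kernel `K`. -/
def formInt (μ : Measure X) (ν : Measure Y) (K : X → Y → ℂ) (ψ : X → ℂ) (χ : Y → ℂ) : ℂ :=
  ∫ z, ψ z.1 * K z.1 z.2 * χ z.2 ∂(μ.prod ν)

/-- A square-integrable kernel whose form is bounded by `C`. -/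
structure FormBdd (μ : Measure X) (ν : Measure Y) (K : X → Y → ℂ) (C : ℝ) : Prop where
  sq : SqInt (μ.prod ν) (fun z => K z.1 z.2)
  nonneg : 0 ≤ C
  bound : ∀ ψ χ, SqInt μ ψ → SqInt ν χ → ‖formInt μ ν K ψ χ‖ ≤ C * (l2 μ ψ * l2 ν χ)

/-- A family of kernels that is eventually uniformly bounded and weakly convergent. -/
structure Good {Λ : Type*} (l : Filter Λ) (μ : Measure X) (ν : Measure Y) (K : Λ → X → Y → ℂ)
    (C : ℝ) : Prop where
  bdd : ∀ᶠ t in l, FormBdd μ ν (K t) C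
  conv : ∀ ψ χ, SqInt μ ψ → SqInt ν χ → ∃ L, Tendsto (fun t => formInt μ ν (K t) ψ χ) l (𝓝 L)

variable [SFinite μ] [SFinite ν] {Λ : Type*} {l : Filter Λ}

lemma formInt_integrable {K : X → Y → ℂ} (hK : SqInt (μ.prod ν) (fun z => K z.1 z.2))
    {ψ : X → ℂ} {χ : Y → ℂ} (hψ : SqInt μ ψ) (hχ : SqInt ν χ) :
    Integrable (fun z : X × Y => ψ z.1 * K z.1 z.2 * χ z.2) (μ.prod ν) := by
  refine ((hψ.tensor hχ).integrable_mul hK).congr (.of_forall fun z => ?_)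
  ring

lemma formInt_sub_left {K : X → Y → ℂ} (hK : SqInt (μ.prod ν) (fun z => K z.1 z.2))
    {ψ ψ' : X → ℂ} {χ : Y → ℂ} (hψ : SqInt μ ψ) (hψ' : SqInt μ ψ') (hχ : SqInt ν χ) :
    formInt μ ν K ψ χ - formInt μ ν K ψ' χ = formInt μ ν K (fun x => ψ x - ψ' x) χ := by
  unfold formInt
  rw [← integral_sub (formInt_integrable hK hψ hχ) (formInt_integrable hK hψ' hχ)]
  simp only [sub_mul]

lemma formInt_swap (K : X → Y → ℂ) (ψ : X → ℂ) (χ : Y → ℂ) :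
    formInt ν μ (fun y x => K x y) χ ψ = formInt μ ν K ψ χ := by
  unfold formInt
  rw [← integral_prod_swap]
  refine integral_congr_ae (.of_forall fun z => ?_)
  simp only [Prod.fst_swap, Prod.snd_swap]
  ring

lemma formInt_star (K : X → Y → ℂ) (ψ : X → ℂ) (χ : Y → ℂ) :
    formInt μ ν (fun x y => starRingEnd ℂ (K x y)) ψ χ =
      starRingEnd ℂ (formInt μ ν K (fun x => starRingEnd ℂ (ψ x)) (fun y => starRingEnd ℂ (χ y))) := by
  unfold formInt
  rw [← integral_conj]
  simp

lemma SqInt.swap {f : X × Y → ℂ} (h : SqInt (μ.prod ν) f) :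
    SqInt (ν.prod μ) (fun z => f z.swap) :=
  h.comp Measure.measurePreserving_swap

lemma FormBdd.mono {K : X → Y → ℂ} {C C' : ℝ} (h : FormBdd μ ν K C) (hC : C ≤ C') :
    FormBdd μ ν K C' :=
  ⟨h.sq, h.nonneg.trans hC, fun ψ χ hψ hχ => (h.bound ψ χ hψ hχ).trans (by
    have := l2_nonneg (μ := μ) ψ; have := l2_nonneg (μ := ν) χ; gcongr)⟩

lemma Good.mono {K : Λ → X → Y → ℂ} {C C' : ℝ} (h : Good l μ ν K C) (hC : C ≤ C') :
    Good l μ ν K C' :=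
  ⟨h.bdd.mono fun _ ht => ht.mono hC, h.conv⟩

lemma Good.congr {K K' : Λ → X → Y → ℂ} {C : ℝ} (h : Good l μ ν K C)
    (hK : ∀ᶠ t in l, K t = K' t) : Good l μ ν K' C := by
  refine ⟨?_, fun ψ χ hψ hχ => ?_⟩
  · filter_upwards [h.bdd, hK] with t h1 h2
    rwa [← h2]
  · obtain ⟨L, hL⟩ := h.conv ψ χ hψ hχ
    exact ⟨L, hL.congr' (hK.mono fun t ht => by simp only [ht])⟩

lemma Good.swap {K : Λ → X → Y → ℂ} {C : ℝ} (h : Good l μ ν K C) :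
    Good l ν μ (fun t y x => K t x y) C := by
  refine ⟨h.bdd.mono fun t ht => ⟨ht.sq.swap, ht.nonneg, fun ψ χ hψ hχ => ?_⟩,
    fun ψ χ hψ hχ => ?_⟩
  · rw [formInt_swap, mul_comm (l2 ν ψ)]
    exact ht.bound χ ψ hχ hψ
  · simp only [formInt_swap]
    exact h.conv χ ψ hχ hψ

lemma Good.star {K : Λ → X → Y → ℂ} {C : ℝ} (h : Good l μ ν K C) :
    Good l μ ν (fun t x y => starRingEnd ℂ (K t x y)) C := by
  refine ⟨h.bdd.mono fun t ht => ⟨ht.sq.star, ht.nonneg, fun ψ χ hψ hχ => ?_⟩,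
    fun ψ χ hψ hχ => ?_⟩
  · rw [formInt_star, RCLike.norm_conj]
    simpa only [l2_star] using ht.bound _ _ hψ.star hχ.star
  · simp only [formInt_star]
    obtain ⟨L, hL⟩ := h.conv _ _ hψ.star hχ.star
    exact ⟨_, (Complex.continuous_conj.tendsto L).comp hL⟩

lemma Good.add {K K' : Λ → X → Y → ℂ} {C C' : ℝ} (h : Good l μ ν K C) (h' : Good l μ ν K' C') :
    Good l μ ν (fun t x y => K t x y + K' t x y) (C + C') := by
  have key : ∀ t, SqInt (μ.prod ν) (fun z => K t z.1 z.2) →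
      SqInt (μ.prod ν) (fun z => K' t z.1 z.2) → ∀ ψ χ, SqInt μ ψ → SqInt ν χ →
      formInt μ ν (fun x y => K t x y + K' t x y) ψ χ =
        formInt μ ν (K t) ψ χ + formInt μ ν (K' t) ψ χ := by
    intro t h1 h2 ψ χ hψ hχ
    unfold formInt
    rw [← integral_add (formInt_integrable h1 hψ hχ) (formInt_integrable h2 hψ hχ)]
    simp only [mul_add, add_mul]
  refine ⟨?_, fun ψ χ hψ hχ => ?_⟩
  · filter_upwards [h.bdd, h'.bdd] with t h1 h2
    refine ⟨h1.sq.add h2.sq, add_nonneg h1.nonneg h2.nonneg, fun ψ χ hψ hχ => ?_⟩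
    rw [key t h1.sq h2.sq ψ χ hψ hχ, add_mul]
    exact (norm_add_le _ _).trans (add_le_add (h1.bound ψ χ hψ hχ) (h2.bound ψ χ hψ hχ))
  · obtain ⟨L, hL⟩ := h.conv ψ χ hψ hχ
    obtain ⟨L', hL'⟩ := h'.conv ψ χ hψ hχ
    refine ⟨L + L', (hL.add hL').congr' ?_⟩
    filter_upwards [h.bdd, h'.bdd] with t h1 h2
    exact (key t h1.sq h2.sq ψ χ hψ hχ).symm

lemma Good.const_mul {K : Λ → X → Y → ℂ} {C : ℝ} (h : Good l μ ν K C) (c : ℂ) :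
    Good l μ ν (fun t x y => c * K t x y) (‖c‖ * C) := by
  have key : ∀ t ψ χ, formInt μ ν (fun x y => c * K t x y) ψ χ = c * formInt μ ν (K t) ψ χ := by
    intro t ψ χ
    unfold formInt
    rw [← integral_const_mul]
    congr 1; ext z; ring
  refine ⟨h.bdd.mono fun t ht => ⟨ht.sq.const_mul c, mul_nonneg (norm_nonneg _) ht.nonneg,
    fun ψ χ hψ hχ => ?_⟩, fun ψ χ hψ hχ => ?_⟩
  · rw [key, norm_mul, mul_assoc]
    gcongr
    exact ht.bound ψ χ hψ hχ
  · obtain ⟨L, hL⟩ := h.conv ψ χ hψ hχ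
    exact ⟨c * L, by simpa only [key] using hL.const_mul c⟩

lemma Good.zero : Good l μ ν (fun _ _ _ => 0) 0 :=
  ⟨.of_forall fun _ => ⟨⟨measurable_const, by simp⟩, le_rfl, fun ψ χ _ _ => by
    simp [formInt]⟩, fun ψ χ _ _ => ⟨0, by simpa [formInt] using tendsto_const_nhds⟩⟩

lemma Good.sum {ι : Type*} (s : Finset ι) {K : ι → Λ → X → Y → ℂ} {C : ι → ℝ}
    (h : ∀ i ∈ s, Good l μ ν (K i) (C i)) :
    Good l μ ν (fun t x y => ∑ i ∈ s, K i t x y) (∑ i ∈ s, C i) := by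
  classical
  induction s using Finset.induction_on with
  | empty => simpa using Good.zero
  | insert a s ha ih =>
    simp only [Finset.sum_insert ha]
    exact (h a (Finset.mem_insert_self _ _)).add
      (ih fun i hi => h i (Finset.mem_insert_of_mem hi))

/-- Transport along measure-preserving equivalences. -/
lemma Good.comp {X' Y' : Type*} [MeasurableSpace X'] [MeasurableSpace Y'] {μ' : Measure X'}
    {ν' : Measure Y'} [SFinite μ'] [SFinite ν'] {K : Λ → X → Y → ℂ} {C : ℝ} (h : Good l μ ν K C)
    (e : X' ≃ᵐ X) (f : Y' ≃ᵐ Y) (he : MeasurePreserving e μ' μ) (hf : MeasurePreserving f ν' ν) :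
    Good l μ' ν' (fun t x y => K t (e x) (f y)) C := by
  have key : ∀ t ψ χ, formInt μ' ν' (fun x y => K t (e x) (f y)) ψ χ =
      formInt μ ν (K t) (fun x => ψ (e.symm x)) (fun y => χ (f.symm y)) := by
    intro t ψ χ
    unfold formInt
    rw [← (he.prod hf).integral_comp ((e.prodCongr f).measurableEmbedding)]
    simp [Prod.map]
  refine ⟨h.bdd.mono fun t ht => ⟨ht.sq.comp (he.prod hf), ht.nonneg, fun ψ χ hψ hχ => ?_⟩,
    fun ψ χ hψ hχ => ?_⟩
  · rw [key, ← MeasurePreserving.l2_comp (he.symm e) hψ.meas,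
      ← MeasurePreserving.l2_comp (hf.symm f) hχ.meas]
    exact ht.bound _ _ (hψ.comp (he.symm e)) (hχ.comp (hf.symm f))
  · simp only [key]
    exact h.conv _ _ (hψ.comp (he.symm e)) (hχ.comp (hf.symm f))

lemma measurable_formInt {Z : Type*} [MeasurableSpace Z] {K : X → Y → ℂ}
    (hK : Measurable (fun z : X × Y => K z.1 z.2)) {ψ : Z → X → ℂ} {χ : Z → Y → ℂ}
    (hψ : Measurable (fun p : Z × X => ψ p.1 p.2)) (hχ : Measurable (fun p : Z × Y => χ p.1 p.2)) :
    Measurable (fun z => formInt μ ν K (ψ z) (χ z)) := by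
  refine (StronglyMeasurable.integral_prod_right' (ν := μ.prod ν)
    (f := fun p : Z × (X × Y) => ψ p.1 p.2.1 * K p.2.1 p.2.2 * χ p.1 p.2.2)
    (Measurable.stronglyMeasurable ?_)).measurable
  have h1 : Measurable fun p : Z × (X × Y) => ψ p.1 p.2.1 :=
    hψ.comp (measurable_fst.prodMk (measurable_fst.comp measurable_snd))
  have h2 : Measurable fun p : Z × (X × Y) => χ p.1 p.2.2 :=
    hχ.comp (measurable_fst.prodMk (measurable_snd.comp measurable_snd))
  exact (h1.mul (hK.comp measurable_snd)).mul h2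

/-- Superpositions of bounded forms are bounded. -/
lemma FormBdd.superpose {Z : Type*} [MeasurableSpace Z] {ρ : Measure Z}
    {K : X → Y → ℂ} {C : ℝ} (hK : FormBdd μ ν K C) {ψ : Z → X → ℂ} {χ : Z → Y → ℂ}
    (hψ : ∀ᵐ z ∂ρ, SqInt μ (ψ z)) (hχ : ∀ᵐ z ∂ρ, SqInt ν (χ z))
    (hint : Integrable (fun z => l2 μ (ψ z) * l2 ν (χ z)) ρ) {c : Z → ℂ} {R : ℝ} (hR0 : 0 ≤ R)
    (hc : ∀ z, ‖c z‖ ≤ R) :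
    ‖∫ z, c z * formInt μ ν K (ψ z) (χ z) ∂ρ‖ ≤ R * C * ∫ z, l2 μ (ψ z) * l2 ν (χ z) ∂ρ := by
  rw [← integral_const_mul]
  refine norm_integral_le_of_norm_le (hint.const_mul _) ?_
  filter_upwards [hψ, hχ] with z h1 h2
  rw [norm_mul, mul_assoc]
  exact mul_le_mul (hc z) (hK.bound _ _ h1 h2) (norm_nonneg _) hR0

/-- Superpositions of convergent bounded families converge. -/
lemma Good.superpose [l.IsCountablyGenerated] {Z : Type*} [MeasurableSpace Z] {ρ : Measure Z}
    {K : Λ → X → Y → ℂ} {C : ℝ} (hK : Good l μ ν K C) {ψ : Z → X → ℂ} {χ : Z → Y → ℂ}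
    (hψm : Measurable (fun p : Z × X => ψ p.1 p.2)) (hχm : Measurable (fun p : Z × Y => χ p.1 p.2))
    (hψ : ∀ᵐ z ∂ρ, SqInt μ (ψ z)) (hχ : ∀ᵐ z ∂ρ, SqInt ν (χ z))
    (hint : Integrable (fun z => l2 μ (ψ z) * l2 ν (χ z)) ρ) {c : Λ → Z → ℂ} {R : ℝ} (hR0 : 0 ≤ R)
    (hcm : ∀ t, Measurable (c t)) (hc : ∀ᶠ t in l, ∀ z, ‖c t z‖ ≤ R)
    (hlim : ∀ᵐ z ∂ρ, ∃ L, Tendsto (fun t => c t z) l (𝓝 L)) :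
    ∃ L, Tendsto (fun t => ∫ z, c t z * formInt μ ν (K t) (ψ z) (χ z) ∂ρ) l (𝓝 L) := by
  have hex : ∀ᵐ z ∂ρ, ∃ L, Tendsto (fun t => c t z * formInt μ ν (K t) (ψ z) (χ z)) l (𝓝 L) := by
    filter_upwards [hψ, hχ, hlim] with z h1 h2 ⟨L, hL⟩
    obtain ⟨L', hL'⟩ := hK.conv _ _ h1 h2
    exact ⟨L * L', hL.mul hL'⟩
  let f : Z → ℂ := fun z => limUnder l fun t => c t z * formInt μ ν (K t) (ψ z) (χ z)
  rcases l.eq_or_neBot with rfl | hne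
  · exact ⟨0, tendsto_bot⟩
  refine ⟨∫ z, f z ∂ρ, tendsto_integral_filter_of_dominated_convergence
    (fun z => R * C * (l2 μ (ψ z) * l2 ν (χ z))) ?_ ?_ (hint.const_mul _) ?_⟩
  · filter_upwards [hK.bdd] with t ht
    exact ((hcm t).mul (measurable_formInt ht.sq.meas hψm hχm)).aestronglyMeasurable
  · filter_upwards [hK.bdd, hc] with t ht hct
    filter_upwards [hψ, hχ] with z h1 h2
    rw [norm_mul, mul_assoc]
    exact mul_le_mul (hct z) (ht.bound _ _ h1 h2) (norm_nonneg _) hR0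
  · filter_upwards [hex] with z hz
    exact tendsto_nhds_limUnder hz

end Forms


/-! ### Bessel's equality for integrable functions -/

open scoped FourierTransform in
lemma fourier_ae_eq_L2 {f : ℝ → ℂ} (h1 : Integrable f) (h2 : MemLp f 2 volume) :
    (𝓕 (h2.toLp f) : Lp ℂ 2 (volume : Measure ℝ)) =ᵐ[volume] 𝓕 f := by
  have hc : Continuous (𝓕 f) := VectorFourier.fourierIntegral_continuous
    Real.continuous_fourierChar (by fun_prop) h1
  refine ae_eq_of_integral_contDiff_smul_eq ((Lp.memLp _).locallyIntegrable (by norm_num))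
    hc.locallyIntegrable fun g hg hgc => ?_
  have hgC : ContDiff ℝ ∞ (fun x => (g x : ℂ)) := Complex.ofRealCLM.contDiff.comp hg
  have hgCc : HasCompactSupport (fun x => (g x : ℂ)) := hgc.comp_left Complex.ofReal_zero
  let φ : SchwartzMap ℝ ℂ := hgCc.toSchwartzMap hgC
  have hφ : ∀ x, φ x = g x := fun x => rfl
  have hconj : ∀ x, starRingEnd ℂ (φ x) = φ x := fun x => by rw [hφ]; simp
  let χ : SchwartzMap ℝ ℂ := 𝓕⁻ φ
  have hχ : 𝓕 χ = φ := FourierTransform.fourier_fourierInv_eq φ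
  have e1 : inner ℂ (φ.toLp 2 volume : Lp ℂ 2 (volume : Measure ℝ)) (𝓕 (h2.toLp f)) =
      ∫ x, g x • ((𝓕 (h2.toLp f) : Lp ℂ 2 (volume : Measure ℝ)) : ℝ → ℂ) x := by
    rw [L2.inner_def]
    refine integral_congr_ae ?_
    filter_upwards [φ.coeFn_toLp 2 volume] with x hx
    rw [hx, RCLike.inner_apply, hconj, hφ, mul_comm, Complex.real_smul]
  have e2 : inner ℂ (φ.toLp 2 volume : Lp ℂ 2 (volume : Measure ℝ)) (𝓕 (h2.toLp f)) =
      ∫ x, starRingEnd ℂ (χ x) * f x := by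
    rw [← hχ, ← SchwartzMap.toLp_fourier_eq, Lp.inner_fourier_eq, L2.inner_def]
    refine integral_congr_ae ?_
    filter_upwards [χ.coeFn_toLp 2 volume, h2.coeFn_toLp] with x hx hx2
    rw [hx, hx2, RCLike.inner_apply, mul_comm]
  have e3 : ∀ x, starRingEnd ℂ (χ x) = 𝓕 (φ : ℝ → ℂ) x := by
    intro x
    have : χ x = 𝓕⁻ (φ : ℝ → ℂ) x := by
      rw [← SchwartzMap.fourierInv_coe]
    rw [this, Real.fourierInv_eq', Real.fourier_eq', ← integral_conj]
    refine integral_congr_ae (.of_forall fun v => ?_)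
    simp only [smul_eq_mul, map_mul, hconj, ← Complex.exp_conj]
    congr 2
    simp only [Complex.conj_ofReal, Complex.conj_I]
    push_cast
    ring
  rw [← e1, e2]
  have e4 : ∫ ξ, 𝓕 (φ : ℝ → ℂ) ξ • f ξ = ∫ x, φ x • 𝓕 f x := by
    simpa using! VectorFourier.integral_fourierIntegral_smul_eq_flip (L := innerₗ ℝ)
      Real.continuous_fourierChar continuous_inner φ.integrable h1
  simp only [smul_eq_mul] at e4
  simp only [e3, e4]
  rfl

/-- The unnormalized Fourier transform `∫ exp(i t u) f(u) du`. -/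
def ft (f : ℝ → ℂ) (t : ℝ) : ℂ := ∫ u, exp ((t * u : ℝ) * I) * f u

open scoped FourierTransform in
lemma ft_eq_fourier (f : ℝ → ℂ) (t : ℝ) : ft f t = 𝓕 f (-(2 * Real.pi)⁻¹ * t) := by
  rw [Real.fourier_eq', ft]
  refine integral_congr_ae (.of_forall fun u => ?_)
  simp only [smul_eq_mul]
  congr 3
  rw [show inner ℝ u (-(2 * Real.pi)⁻¹ * t) = -(2 * Real.pi)⁻¹ * t * u from rfl]
  have := Real.pi_pos.ne'
  congr 1
  field_simp

open scoped FourierTransform in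
/-- Plancherel's theorem for functions in `L¹ ∩ L²`. -/
lemma sqInt_ft {f : ℝ → ℂ} (h1 : Integrable f) (h2 : SqInt volume f) :
    Integrable (fun t => ‖ft f t‖ ^ 2) ∧
      ∫ t, ‖ft f t‖ ^ 2 = 2 * Real.pi * ∫ u, ‖f u‖ ^ 2 := by
  have hpi := Real.pi_pos
  have hae := fourier_ae_eq_L2 h1 h2.memLp
  have hint : Integrable (fun t => ‖𝓕 f t‖ ^ 2) := by
    have := (Lp.memLp (𝓕 (h2.memLp.toLp f) : Lp ℂ 2 (volume : Measure ℝ))).integrable_norm_pow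
      (by norm_num)
    exact this.congr (hae.mono fun t ht => by simp [ht])
  have hval : ∫ t, ‖𝓕 f t‖ ^ 2 = ∫ u, ‖f u‖ ^ 2 := by
    have key : ∀ g : Lp ℂ 2 (volume : Measure ℝ), ‖g‖ ^ 2 = ∫ t, ‖g t‖ ^ 2 := by
      intro g
      rw [← inner_self_eq_norm_sq (𝕜 := ℂ), L2.inner_def, ← integral_re
        (L2.integrable_inner g g)]
      refine integral_congr_ae (.of_forall fun t => ?_)
      exact inner_self_eq_norm_sq (𝕜 := ℂ) (g t)
    have e := congrArg (· ^ 2) (Lp.norm_fourier_eq (h2.memLp.toLp f))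
    simp only [key] at e
    exact (integral_congr_ae (hae.fun_comp fun z => ‖z‖ ^ 2)).symm.trans
      (e.trans (integral_congr_ae (h2.memLp.coeFn_toLp.fun_comp fun z => ‖z‖ ^ 2)))
  simp only [ft_eq_fourier]
  refine ⟨hint.comp_mul_left' (neg_ne_zero.2 (by positivity)), ?_⟩
  rw [Measure.integral_comp_mul_left (fun t => ‖𝓕 f t‖ ^ 2), hval]
  rw [inv_neg, inv_inv, abs_neg, abs_of_pos (by positivity), smul_eq_mul]

/-! ### Tensor products -/

section Tensor

variable {X Y U W : Type*} [MeasurableSpace X] [MeasurableSpace Y] [MeasurableSpace U]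
  [MeasurableSpace W] {μ : Measure X} {ν : Measure Y} {ρ : Measure U} {τ : Measure W}
  [SFinite μ] [SFinite ν] [SFinite ρ] [SFinite τ]

lemma measurePreserving_prodAssoc :
    MeasurePreserving (MeasurableEquiv.prodAssoc : (X × Y) × U ≃ᵐ X × Y × U)
      ((μ.prod ν).prod ρ) (μ.prod (ν.prod ρ)) :=
  ⟨MeasurableEquiv.measurable _, Measure.prodAssoc_prod⟩

variable (X Y U W) in
/-- The exchange of the two middle factors. -/
def prodComm4 : (U × X) × (W × Y) ≃ᵐ (U × W) × (X × Y) where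
  toEquiv := Equiv.prodProdProdComm U X W Y
  measurable_toFun := by simp only [Equiv.prodProdProdComm, Equiv.coe_fn_mk]; fun_prop
  measurable_invFun := by
    simp only [Equiv.prodProdProdComm, Equiv.coe_fn_symm_mk]; fun_prop

lemma measurePreserving_prodComm4 :
    MeasurePreserving (prodComm4 X Y U W) ((ρ.prod μ).prod (τ.prod ν))
      ((ρ.prod τ).prod (μ.prod ν)) := by
  have h1 : MeasurePreserving (MeasurableEquiv.prodAssoc : (U × X) × (W × Y) ≃ᵐ U × X × W × Y)
      ((ρ.prod μ).prod (τ.prod ν)) _ := measurePreserving_prodAssoc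
  have h2 : MeasurePreserving (MeasurableEquiv.prodAssoc.symm : X × W × Y ≃ᵐ (X × W) × Y)
      (μ.prod (τ.prod ν)) ((μ.prod τ).prod ν) := measurePreserving_prodAssoc.symm _
  have h3 : MeasurePreserving (Prod.map Prod.swap id : (X × W) × Y → (W × X) × Y)
      ((μ.prod τ).prod ν) ((τ.prod μ).prod ν) :=
    Measure.measurePreserving_swap.prod (MeasurePreserving.id _)
  have h4 : MeasurePreserving (MeasurableEquiv.prodAssoc : (W × X) × Y ≃ᵐ W × X × Y)
      ((τ.prod μ).prod ν) _ := measurePreserving_prodAssoc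
  have h5 : MeasurePreserving (MeasurableEquiv.prodAssoc.symm : U × W × X × Y ≃ᵐ (U × W) × X × Y)
      (ρ.prod (τ.prod (μ.prod ν))) ((ρ.prod τ).prod (μ.prod ν)) :=
    measurePreserving_prodAssoc.symm _
  exact h5.comp (((MeasurePreserving.id ρ).prod (h4.comp (h3.comp h2))).comp h1)

lemma SqInt.tensor4 {k : U → W → ℂ} {K : X → Y → ℂ}
    (hk : SqInt (ρ.prod τ) (fun z => k z.1 z.2)) (hK : SqInt (μ.prod ν) (fun z => K z.1 z.2)) :
    SqInt ((ρ.prod μ).prod (τ.prod ν)) (fun z => k z.1.1 z.2.1 * K z.1.2 z.2.2) :=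
  (hk.tensor hK).comp measurePreserving_prodComm4

lemma Integrable.formInt_comm4 {F : (U × W) × (X × Y) → ℂ} :
    Integrable (fun z : (U × X) × (W × Y) => F (prodComm4 X Y U W z))
      ((ρ.prod μ).prod (τ.prod ν)) ↔ Integrable F ((ρ.prod τ).prod (μ.prod ν)) :=
  measurePreserving_prodComm4.integrable_comp_emb (prodComm4 X Y U W).measurableEmbedding

lemma integral_comm4 (F : (U × W) × (X × Y) → ℂ) :
    ∫ z, F (prodComm4 X Y U W z) ∂((ρ.prod μ).prod (τ.prod ν)) =
      ∫ z, F z ∂((ρ.prod τ).prod (μ.prod ν)) :=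
  measurePreserving_prodComm4.integral_comp (prodComm4 X Y U W).measurableEmbedding F

lemma formInt_tensor {v : U → ℂ} {w : W → ℂ} {c : U → W → ℂ} {K : X → Y → ℂ}
    (hk : SqInt (ρ.prod τ) (fun z => c z.1 z.2 * (v z.1 * w z.2)))
    (hK : SqInt (μ.prod ν) (fun z => K z.1 z.2)) {ψ : U × X → ℂ} {χ : W × Y → ℂ}
    (hψ : SqInt (ρ.prod μ) ψ) (hχ : SqInt (τ.prod ν) χ) :
    formInt (ρ.prod μ) (τ.prod ν)
        (fun a b => c a.1 b.1 * (v a.1 * w b.1) * K a.2 b.2) ψ χ =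
      ∫ z, c z.1 z.2 * formInt μ ν K (fun x => v z.1 * ψ (z.1, x))
        (fun y => w z.2 * χ (z.2, y)) ∂(ρ.prod τ) := by
  have hi := formInt_integrable (K := fun (a : U × X) (b : W × Y) =>
    c a.1 b.1 * (v a.1 * w b.1) * K a.2 b.2) (SqInt.tensor4 (k := fun u y => c u y * (v u * w y)) hk hK) hψ hχ
  let F : (U × W) × (X × Y) → ℂ := fun z => ψ (z.1.1, z.2.1) *
    (c z.1.1 z.1.2 * (v z.1.1 * w z.1.2) * K z.2.1 z.2.2) * χ (z.1.2, z.2.2)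
  have h1 : formInt (ρ.prod μ) (τ.prod ν)
      (fun a b => c a.1 b.1 * (v a.1 * w b.1) * K a.2 b.2) ψ χ =
      ∫ z, F z ∂((ρ.prod τ).prod (μ.prod ν)) := integral_comm4 F
  have h2 : Integrable F ((ρ.prod τ).prod (μ.prod ν)) := Integrable.formInt_comm4.1 hi
  rw [h1, integral_prod _ h2]
  refine integral_congr_ae (.of_forall fun z => ?_)
  simp only [formInt, ← integral_const_mul]
  refine integral_congr_ae (.of_forall fun y => ?_)
  simp only [F]
  ring

lemma integrable_l2_weighted {v : U → ℂ} {ψ : U × X → ℂ} (hv : SqInt ρ v)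
    (hψ : SqInt (ρ.prod μ) ψ) :
    Integrable (fun u => l2 μ (fun x => v u * ψ (u, x))) ρ ∧
      ∫ u, l2 μ (fun x => v u * ψ (u, x)) ∂ρ ≤ l2 ρ v * l2 (ρ.prod μ) ψ := by
  simp only [l2_const_mul]
  refine ⟨hv.memLp.norm.integrable_mul hψ.memLp_l2_slice, ?_⟩
  refine (integral_mul_le_sqrt (fun _ => norm_nonneg _) (fun _ => l2_nonneg _) hv.memLp.norm
    hψ.memLp_l2_slice).trans_eq ?_
  rw [integral_l2_slice hψ, Real.sqrt_sq (l2_nonneg _)]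
  rfl

variable {Λ : Type*} {l : Filter Λ}

/-- The tensor product of a good family with bounded kernels between square-integrable weights. -/
lemma Good.tensor_bounded [l.IsCountablyGenerated] {K : Λ → X → Y → ℂ} {C : ℝ}
    (hK : Good l μ ν K C) {v : U → ℂ} {w : W → ℂ} (hv : SqInt ρ v) (hw : SqInt τ w)
    {c : Λ → U → W → ℂ} {R : ℝ} (hR0 : 0 ≤ R)
    (hcm : ∀ t, Measurable (fun z : U × W => c t z.1 z.2)) (hc : ∀ᶠ t in l, ∀ u y, ‖c t u y‖ ≤ R)
    (hlim : ∀ᵐ z ∂(ρ.prod τ), ∃ L, Tendsto (fun t => c t z.1 z.2) l (𝓝 L)) :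
    Good l (ρ.prod μ) (τ.prod ν)
      (fun t a b => c t a.1 b.1 * (v a.1 * w b.1) * K t a.2 b.2) (R * C * (l2 ρ v * l2 τ w)) := by
  have hk : ∀ᶠ t in l, SqInt (ρ.prod τ) (fun z => c t z.1 z.2 * (v z.1 * w z.2)) := by
    filter_upwards [hc] with t ht
    exact (hv.tensor hw).mul_bdd (hcm t) fun z => ht z.1 z.2
  have hsl : ∀ {ψ : U × X → ℂ}, SqInt (ρ.prod μ) ψ →
      ∀ᵐ z ∂(ρ.prod τ), SqInt μ (fun x => v z.1 * ψ (z.1, x)) := fun hψ => by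
    filter_upwards [Measure.quasiMeasurePreserving_fst.ae hψ.slice] with z hz
    exact hz.const_mul _
  have hsr : ∀ {χ : W × Y → ℂ}, SqInt (τ.prod ν) χ →
      ∀ᵐ z ∂(ρ.prod τ), SqInt ν (fun y => w z.2 * χ (z.2, y)) := fun hχ => by
    filter_upwards [Measure.quasiMeasurePreserving_snd.ae hχ.slice] with z hz
    exact hz.const_mul _
  have hint : ∀ {ψ : U × X → ℂ} {χ : W × Y → ℂ}, SqInt (ρ.prod μ) ψ → SqInt (τ.prod ν) χ →
      Integrable (fun z : U × W => l2 μ (fun x => v z.1 * ψ (z.1, x)) *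
        l2 ν (fun y => w z.2 * χ (z.2, y))) (ρ.prod τ) ∧
      ∫ z : U × W, l2 μ (fun x => v z.1 * ψ (z.1, x)) * l2 ν (fun y => w z.2 * χ (z.2, y))
        ∂(ρ.prod τ) ≤ (l2 ρ v * l2 τ w) * (l2 (ρ.prod μ) ψ * l2 (τ.prod ν) χ) := by
    intro ψ χ hψ hχ
    obtain ⟨a1, a2⟩ := integrable_l2_weighted hv hψ
    obtain ⟨b1, b2⟩ := integrable_l2_weighted hw hχ
    refine ⟨a1.mul_prod b1, ?_⟩
    rw [integral_prod_mul (fun u => l2 μ (fun x => v u * ψ (u, x)))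
      (fun y' => l2 ν (fun y => w y' * χ (y', y)))]
    calc _ ≤ (l2 ρ v * l2 (ρ.prod μ) ψ) * (l2 τ w * l2 (τ.prod ν) χ) :=
          mul_le_mul a2 b2 (integral_nonneg fun _ => l2_nonneg _)
            (mul_nonneg (l2_nonneg _) (l2_nonneg _))
      _ = _ := by ring
  refine ⟨?_, fun ψ χ hψ hχ => ?_⟩
  · filter_upwards [hK.bdd, hc, hk] with t h1 h2 h3
    refine ⟨SqInt.tensor4 (k := fun u y => c t u y * (v u * w y)) h3 h1.sq, mul_nonneg (mul_nonneg hR0 h1.nonneg)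
      (mul_nonneg (l2_nonneg _) (l2_nonneg _)), fun ψ χ hψ hχ => ?_⟩
    rw [formInt_tensor h3 h1.sq hψ hχ]
    refine (h1.superpose (hsl hψ) (hsr hχ) (hint hψ hχ).1 hR0 fun z => h2 z.1 z.2).trans ?_
    rw [mul_assoc (R * C)]
    exact mul_le_mul_of_nonneg_left (hint hψ hχ).2 (mul_nonneg hR0 h1.nonneg)
  · have hm1 : Measurable (fun p : (U × W) × X => v p.1.1 * ψ (p.1.1, p.2)) :=
      (hv.meas.comp (by fun_prop)).mul (hψ.meas.comp (by fun_prop))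
    have hm2 : Measurable (fun p : (U × W) × Y => w p.1.2 * χ (p.1.2, p.2)) :=
      (hw.meas.comp (by fun_prop)).mul (hχ.meas.comp (by fun_prop))
    obtain ⟨L, hL⟩ := hK.superpose (ρ := ρ.prod τ) (c := fun t z => c t z.1 z.2)
      hm1 hm2 (hsl hψ) (hsr hχ) (hint hψ hχ).1 hR0 hcm
      (hc.mono fun t ht z => ht z.1 z.2) hlim
    refine ⟨L, hL.congr' ?_⟩
    filter_upwards [hK.bdd, hk] with t h1 h3
    exact (formInt_tensor h3 h1.sq hψ hχ).symm

/-! ### The tensor product with a simple pole -/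

/-- The partial Fourier transform of a weighted function. -/
def partialFt (v : ℝ → ℂ) (ψ : ℝ × X → ℂ) (t : ℝ) (x : X) : ℂ := ft (fun u => v u * ψ (u, x)) t

lemma measurable_partialFt {v : ℝ → ℂ} (hv : Measurable v) {ψ : ℝ × X → ℂ} (hψ : Measurable ψ) :
    Measurable (fun p : ℝ × X => partialFt v ψ p.1 p.2) := by
  refine (StronglyMeasurable.integral_prod_right' (ν := (volume : Measure ℝ))
    (f := fun p : (ℝ × X) × ℝ => exp ((p.1.1 * p.2 : ℝ) * I) *
      (v p.2 * ψ (p.2, p.1.2))) (Measurable.stronglyMeasurable ?_)).measurable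
  exact (by fun_prop : Measurable fun p : (ℝ × X) × ℝ =>
    exp ((p.1.1 * p.2 : ℝ) * I)).mul
    ((hv.comp measurable_snd).mul (hψ.comp (by fun_prop)))

lemma sqInt_partialFt {v : ℝ → ℂ} (hv : SqInt volume v) (hv1 : ∀ u, ‖v u‖ ≤ 1) {ψ : ℝ × X → ℂ}
    (hψ : SqInt (volume.prod μ) ψ) :
    SqInt (volume.prod μ) (fun p => partialFt v ψ p.1 p.2) ∧
      l2 (volume.prod μ) (fun p => partialFt v ψ p.1 p.2) ≤
        √(2 * Real.pi) * l2 (volume.prod μ) ψ := by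
  have hm := measurable_partialFt hv.meas hψ.meas
  have hvψ : SqInt (volume.prod μ) (fun p : ℝ × X => v p.1 * ψ p) :=
    hψ.mul_bdd (hv.meas.comp measurable_fst) fun p => hv1 p.1
  have hsl : ∀ᵐ x ∂μ, SqInt volume (fun u => ψ (u, x)) := hψ.swap.slice
  have hpl : ∀ᵐ x ∂μ, Integrable (fun t => ‖partialFt v ψ t x‖ ^ 2) ∧
      ∫ t, ‖partialFt v ψ t x‖ ^ 2 = 2 * Real.pi * ∫ u, ‖v u * ψ (u, x)‖ ^ 2 := by
    filter_upwards [hsl] with x hx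
    exact sqInt_ft (hv.integrable_mul hx) (hx.mul_bdd hv.meas hv1)
  have hint : Integrable (fun p : ℝ × X => ‖partialFt v ψ p.1 p.2‖ ^ 2) (volume.prod μ) := by
    rw [integrable_prod_iff' (hm.norm.pow_const 2).aestronglyMeasurable]
    refine ⟨hpl.mono fun x hx => hx.1, ?_⟩
    simp only [norm_pow, norm_norm]
    refine (hvψ.int.integral_prod_right.const_mul (2 * Real.pi)).congr ?_
    filter_upwards [hpl] with x hx
    exact hx.2.symm
  refine ⟨⟨hm, hint⟩, ?_⟩
  have : l2 (volume.prod μ) (fun p => partialFt v ψ p.1 p.2) =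
      √(2 * Real.pi) * l2 (volume.prod μ) (fun p : ℝ × X => v p.1 * ψ p) := by
    unfold l2
    rw [← Real.sqrt_mul (by positivity), integral_prod_symm _ hint, integral_prod_symm _ hvψ.int,
      ← integral_const_mul]
    congr 1
    refine integral_congr_ae ?_
    filter_upwards [hpl] with x hx
    exact hx.2
  rw [this]
  gcongr
  exact l2_mono hψ.int (.of_forall fun p => by
    rw [norm_mul]; exact mul_le_of_le_one_left (norm_nonneg _) (hv1 _))

lemma integral_exp_pole {z : ℂ} (hz : 0 < z.im) :
    ∫ t in Set.Ioi (0 : ℝ), exp (t * (I * z)) = I / z := by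
  have hre : (I * z).re < 0 := by simpa using hz
  have h := integral_exp_mul_complex_Ioi hre 0
  simp only [mul_comm (I * z)] at h
  rw [h]
  have hz0 : z ≠ 0 := by rintro rfl; simp at hz
  simp
  field_simp
  simp

/-- The density of the simple pole `(x + i ε)⁻¹` as a superposition of exponentials. -/
def poleDensity (ε t : ℝ) : ℂ :=
  if 0 < t then -I * (Real.exp (-ε * t) : ℂ) else 0

lemma measurable_poleDensity (ε : ℝ) : Measurable (poleDensity ε) :=
  Measurable.ite measurableSet_Ioi (by fun_prop) measurable_const

lemma norm_poleDensity_le {ε : ℝ} (hε : 0 ≤ ε) (t : ℝ) : ‖poleDensity ε t‖ ≤ 1 := by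
  unfold poleDensity
  split_ifs with h
  · rw [norm_mul, norm_neg, Complex.norm_I, one_mul, Complex.norm_real,
      norm_of_nonneg (exp_pos _).le, Real.exp_le_one_iff]
    nlinarith
  · simp

lemma integrable_poleDensity {ε : ℝ} (hε : 0 < ε) : Integrable (poleDensity ε) := by
  have h : IntegrableOn (fun t : ℝ => -I * (Real.exp (-ε * t) : ℂ)) (Set.Ioi 0) :=
    ((integrableOn_exp_mul_Ioi (neg_neg_iff_pos.2 hε) 0).ofReal).const_mul _
  refine (h.integrable_indicator measurableSet_Ioi).congr (.of_forall fun t => ?_)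
  simp [Set.indicator, poleDensity]

lemma integral_poleDensity {ε : ℝ} (hε : 0 < ε) (x : ℝ) :
    ∫ t, poleDensity ε t * exp ((t * x : ℝ) * I) =
      ((x : ℂ) + ε * I)⁻¹ := by
  have h := integral_exp_pole (z := (x : ℂ) + ε * I) (by simpa using hε)
  rw [← integral_indicator measurableSet_Ioi] at h
  have h2 : ∀ t : ℝ, poleDensity ε t * exp ((t * x : ℝ) * I) =
      -I * (Set.Ioi (0 : ℝ)).indicator
        (fun t : ℝ => exp (t * (I * ((x : ℂ) + ε * I)))) t := by
    intro t
    by_cases ht : 0 < t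
    · simp only [poleDensity, if_pos ht, Set.indicator, Set.mem_Ioi, mul_assoc]
      rw [Complex.ofReal_exp, ← Complex.exp_add]
      congr 2
      push_cast
      linear_combination (-t * ε : ℂ) * Complex.I_sq
    · simp [poleDensity, ht]
  simp only [h2, integral_const_mul, h]
  rw [div_eq_mul_inv, ← mul_assoc]
  simp

lemma formInt_pole {v w : ℝ → ℂ} (hv : SqInt volume v) (hw : SqInt volume w) {K : X → Y → ℂ}
    (hK : SqInt (μ.prod ν) (fun z => K z.1 z.2)) {ψ : ℝ × X → ℂ} {χ : ℝ × Y → ℂ}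
    (hψ : SqInt (volume.prod μ) ψ) (hχ : SqInt (volume.prod ν) χ) {ε : ℝ} (hε : 0 < ε) :
    formInt (volume.prod μ) (volume.prod ν)
        (fun a b => (((a.1 - b.1 : ℝ) : ℂ) + ε * I)⁻¹ * (v a.1 * w b.1) * K a.2 b.2) ψ χ =
      ∫ t, poleDensity ε t * formInt μ ν K (partialFt v ψ t) (partialFt w χ (-t)) := by
  let G : (ℝ × X) × (ℝ × Y) → ℂ := fun z => ψ z.1 * ((v z.1.1 * w z.2.1) * K z.1.2 z.2.2) * χ z.2
  have hG : Integrable G ((volume.prod μ).prod (volume.prod ν)) :=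
    formInt_integrable (K := fun (a : ℝ × X) (b : ℝ × Y) => v a.1 * w b.1 * K a.2 b.2)
      (SqInt.tensor4 (k := fun u y => v u * w y) (hv.tensor hw) hK) hψ hχ
  have hph : ∀ t : ℝ, formInt μ ν K (partialFt v ψ t) (partialFt w χ (-t)) =
      ∫ z : (ℝ × X) × (ℝ × Y), exp ((t * (z.1.1 - z.2.1) : ℝ) * I) * G z
        ∂((volume.prod μ).prod (volume.prod ν)) := by
    intro t
    let F : (ℝ × ℝ) × (X × Y) → ℂ := fun z => exp ((t * (z.1.1 - z.1.2) : ℝ) * I) *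
      G (((z.1.1, z.2.1), (z.1.2, z.2.2)))
    have hF : Integrable F ((volume.prod volume).prod (μ.prod ν)) := by
      rw [← Integrable.formInt_comm4]
      refine hG.bdd_mul (c := 1) (by fun_prop) (.of_forall fun z => ?_)
      exact (Complex.norm_exp_ofReal_mul_I _).le
    have e := integral_comm4 (ρ := (volume : Measure ℝ)) (τ := (volume : Measure ℝ)) (μ := μ)
      (ν := ν) F
    refine Eq.trans ?_ e.symm
    rw [integral_prod_symm _ hF, formInt]
    refine integral_congr_ae (.of_forall fun z => ?_)
    simp only [partialFt, ft]
    rw [mul_right_comm, ← integral_prod_mul, ← integral_mul_const]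
    refine integral_congr_ae (.of_forall fun p => ?_)
    simp only [F, G]
    have : exp ((t * (p.1 - p.2) : ℝ) * I) =
        exp ((t * p.1 : ℝ) * I) * exp ((-t * p.2 : ℝ) * I) := by
      rw [← Complex.exp_add]
      congr 1
      push_cast
      ring
    rw [this]
    ring
  simp only [hph, ← integral_const_mul]
  rw [integral_integral_swap]
  · refine integral_congr_ae (.of_forall fun z => ?_)
    have h := integral_poleDensity hε (z.1.1 - z.2.1)
    simp only [← mul_assoc, integral_mul_const]
    simp only [h, G]
    ring
  · have h1 : Integrable (fun p : ℝ × ((ℝ × X) × (ℝ × Y)) => poleDensity ε p.1 * G p.2)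
        (volume.prod ((volume.prod μ).prod (volume.prod ν))) :=
      (integrable_poleDensity hε).mul_prod hG
    refine (h1.bdd_mul (c := 1) (f := fun p => exp ((p.1 * (p.2.1.1 - p.2.2.1) : ℝ) *
      I)) (by fun_prop) (.of_forall fun z =>
        (Complex.norm_exp_ofReal_mul_I _).le)).congr (.of_forall fun p => ?_)
    simp only [Function.uncurry]
    ring

lemma norm_inv_add_mul_I_le {ε : ℝ} (hε : 0 < ε) (x : ℝ) :
    ‖((x : ℂ) + ε * I)⁻¹‖ ≤ ε⁻¹ := by
  rw [norm_inv]
  refine inv_anti₀ hε ?_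
  have := Complex.abs_im_le_norm ((x : ℂ) + ε * I)
  simpa [abs_of_pos hε] using this

variable {Λ : Type*} {l : Filter Λ} in
/-- The tensor product of a good family with a regularized simple pole. -/
lemma Good.tensor_pole [l.IsCountablyGenerated] {K : Λ → X → Y → ℂ} {C : ℝ}
    (hK : Good l μ ν K C) {v w : ℝ → ℂ} (hv : SqInt volume v) (hw : SqInt volume w)
    (hv1 : ∀ u, ‖v u‖ ≤ 1) (hw1 : ∀ u, ‖w u‖ ≤ 1) {ε : Λ → ℝ} (hε : ∀ᶠ t in l, 0 < ε t)
    (hlim : Tendsto ε l (𝓝 0)) :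
    Good l (volume.prod μ) (volume.prod ν)
      (fun t a b => (((a.1 - b.1 : ℝ) : ℂ) + ε t * I)⁻¹ * (v a.1 * w b.1) * K t a.2 b.2)
      (2 * Real.pi * C) := by
  have hpi := Real.pi_pos
  have hneg : MeasurePreserving (Neg.neg : ℝ → ℝ) := Measure.measurePreserving_neg _
  have hχ' : ∀ {χ : ℝ × Y → ℂ}, SqInt (volume.prod ν) χ →
      SqInt (volume.prod ν) (fun p : ℝ × Y => partialFt w χ (-p.1) p.2) ∧
      l2 (volume.prod ν) (fun p : ℝ × Y => partialFt w χ (-p.1) p.2) ≤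
        √(2 * Real.pi) * l2 (volume.prod ν) χ := by
    intro χ hχ
    obtain ⟨h1, h2⟩ := sqInt_partialFt hw hw1 hχ
    have hmp := hneg.prod (MeasurePreserving.id ν)
    refine ⟨h1.comp hmp, ?_⟩
    rw [← MeasurePreserving.l2_comp hmp h1.meas] at h2
    exact h2
  have hint : ∀ {ψ : ℝ × X → ℂ} {χ : ℝ × Y → ℂ}, SqInt (volume.prod μ) ψ →
      SqInt (volume.prod ν) χ →
      Integrable (fun t : ℝ => l2 μ (partialFt v ψ t) * l2 ν (partialFt w χ (-t))) ∧
      ∫ t : ℝ, l2 μ (partialFt v ψ t) * l2 ν (partialFt w χ (-t)) ≤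
        2 * Real.pi * (l2 (volume.prod μ) ψ * l2 (volume.prod ν) χ) := by
    intro ψ χ hψ hχ
    obtain ⟨a1, a2⟩ := sqInt_partialFt hv hv1 hψ
    obtain ⟨b1, b2⟩ := hχ' hχ
    refine ⟨a1.memLp_l2_slice.integrable_mul b1.memLp_l2_slice, ?_⟩
    refine (integral_mul_le_sqrt (fun _ => l2_nonneg _) (fun _ => l2_nonneg _) a1.memLp_l2_slice
      b1.memLp_l2_slice).trans ?_
    rw [integral_l2_slice a1, integral_l2_slice b1, Real.sqrt_sq (l2_nonneg _),
      Real.sqrt_sq (l2_nonneg _)]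
    refine (mul_le_mul a2 b2 (l2_nonneg _) (mul_nonneg (Real.sqrt_nonneg _)
      (l2_nonneg _))).trans_eq ?_
    rw [mul_mul_mul_comm, Real.mul_self_sqrt (by positivity)]
  have hsq : ∀ t, 0 < ε t → SqInt ((volume : Measure ℝ).prod volume) (fun z : ℝ × ℝ =>
      (((z.1 - z.2 : ℝ) : ℂ) + ε t * I)⁻¹ * (v z.1 * w z.2)) := fun t ht =>
    (hv.tensor hw).mul_bdd (by fun_prop) fun z => norm_inv_add_mul_I_le ht _
  refine ⟨?_, fun ψ χ hψ hχ => ?_⟩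
  · filter_upwards [hK.bdd, hε] with t h1 h2
    refine ⟨SqInt.tensor4 (k := fun u y => (((u - y : ℝ) : ℂ) + ε t * I)⁻¹ * (v u * w y))
      (hsq t h2) h1.sq, mul_nonneg (by positivity) h1.nonneg, fun ψ χ hψ hχ => ?_⟩
    rw [formInt_pole hv hw h1.sq hψ hχ h2]
    refine (h1.superpose (sqInt_partialFt hv hv1 hψ).1.slice (hχ' hχ).1.slice (hint hψ hχ).1
      zero_le_one fun z => norm_poleDensity_le h2.le z).trans ?_
    refine (mul_le_mul_of_nonneg_left (hint hψ hχ).2 (by simpa using h1.nonneg)).trans_eq ?_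
    ring
  · have hl : ∀ s : ℝ, ∃ L, Tendsto (fun t => poleDensity (ε t) s) l (𝓝 L) := by
      intro s
      by_cases hs : 0 < s
      · refine ⟨-I * (Real.exp (-0 * s) : ℂ), ?_⟩
        simp only [poleDensity, if_pos hs]
        have : Continuous fun e : ℝ => -I * (Real.exp (-e * s) : ℂ) := by fun_prop
        exact (this.tendsto 0).comp hlim
      · exact ⟨0, by simpa [poleDensity, hs] using tendsto_const_nhds⟩
    obtain ⟨L, hL⟩ := hK.superpose (ρ := (volume : Measure ℝ)) (c := fun t => poleDensity (ε t))
      (sqInt_partialFt hv hv1 hψ).1.meas (hχ' hχ).1.meas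
      (sqInt_partialFt hv hv1 hψ).1.slice (hχ' hχ).1.slice (hint hψ hχ).1 zero_le_one
      (fun t => measurable_poleDensity _) (hε.mono fun t ht => norm_poleDensity_le ht.le)
      (.of_forall hl)
    refine ⟨L, hL.congr' ?_⟩
    filter_upwards [hK.bdd, hε] with t h1 h2
    exact (formInt_pole hv hw h1.sq hψ hχ h2).symm

end Tensor


/-! ### Partial fractions -/

open Polynomial in
lemma prod_div_eq_sum {ι : Type*} [Fintype ι] [DecidableEq ι] {z : ι → ℂ} {y : ℂ}
    (hz : Function.Injective z) (hy : ∀ j, y + z j ≠ 0) :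
    ∏ j, (y - z j) / (y + z j) = 1 + ∑ j, (∏ l ∈ Finset.univ.erase j, (z j + z l) / (z j - z l)) *
      ((y - z j) / (y + z j) - 1) := by
  have hinj : Set.InjOn (fun j => -z j) (univ : Finset ι) := fun a _ b _ h =>
    hz (neg_injective h)
  let Q : ℂ[X] := Lagrange.nodal univ z - Lagrange.nodal univ (fun j => -z j)
  have hdeg : Q.degree < (univ : Finset ι).card := by
    have := degree_sub_lt_left (Lagrange.degree_nodal (s := univ) (v := z)
      |>.trans (Lagrange.degree_nodal (s := univ) (v := fun j => -z j)).symm)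
      (Lagrange.nodal_ne_zero) (by
      rw [(Lagrange.nodal_monic (s := univ) (v := z)).leadingCoeff,
        (Lagrange.nodal_monic (s := univ) (v := fun j => -z j)).leadingCoeff])
    rwa [Lagrange.degree_nodal] at this
  have h1 := Lagrange.eq_interpolate hinj hdeg
  have h2 := congrArg (eval y) h1
  have hne : ∀ i ∈ (univ : Finset ι), y ≠ -z i := fun i _ h => hy i (by rw [h]; ring)
  rw [Lagrange.eval_interpolate_not_at_node _ hne] at h2
  simp only [Q, eval_sub, Lagrange.eval_nodal, sub_neg_eq_add] at h2
  have hP : ∏ j, (y + z j) ≠ 0 := Finset.prod_ne_zero_iff.2 fun j _ => hy j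
  have h3 : ∀ i, ∏ j, (-z i + z j) = 0 := fun i =>
    Finset.prod_eq_zero (mem_univ i) (by ring)
  rw [Finset.prod_div_distrib, div_eq_iff hP]
  have h4 : ∏ j, (y - z j) = (∏ j, (y + z j)) + (∏ j, (y + z j)) *
      ∑ i, Lagrange.nodalWeight univ (fun j => -z j) i * (y + z i)⁻¹ *
        ∏ j, (-z i - z j) := by
    simp only [h3, sub_zero] at h2
    linear_combination h2
  rw [h4, add_mul, one_mul, mul_comm (∑ j, _)]
  congr 2
  refine sum_congr rfl fun i _ => ?_
  rw [← Finset.mul_prod_erase _ _ (mem_univ i), Lagrange.nodalWeight]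
  have h5 : ∏ l ∈ Finset.univ.erase i, (z i + z l) / (z i - z l) =
      (∏ l ∈ Finset.univ.erase i, (-z i - -z l)⁻¹) * ∏ l ∈ Finset.univ.erase i, (-z i - z l) := by
    rw [← Finset.prod_mul_distrib]
    refine prod_congr rfl fun l _ => ?_
    rw [div_eq_mul_inv, show -z i - -z l = -(z i - z l) by ring, inv_neg]
    ring
  rw [h5]
  field_simp [hy i]
  ring

/-- The constant in the partial fraction expansion. -/
def parityConst (N : ℕ) : ℂ := (1 + (-1) ^ N) / 2

lemma norm_parityConst_le (N : ℕ) : ‖parityConst N‖ ≤ 1 := by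
  rcases neg_one_pow_eq_or ℂ N with h | h <;> simp [parityConst, h]

lemma prod_div_eq_parity_add_sum {ι : Type*} [Fintype ι] [DecidableEq ι] {z : ι → ℂ} {y : ℂ}
    (hz : Function.Injective z) (hy : ∀ j, y + z j ≠ 0) (h0 : ∀ j, z j ≠ 0) :
    ∏ j, (y - z j) / (y + z j) = parityConst (Fintype.card ι) +
      ∑ j, (∏ l ∈ Finset.univ.erase j, (z j + z l) / (z j - z l)) * ((y - z j) / (y + z j)) := by
  have e0 := prod_div_eq_sum (y := 0) hz (fun j => by simpa using h0 j)
  have h1 : ∀ j, (0 - z j) / (0 + z j) = -1 := fun j => by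
    have := h0 j; rw [zero_sub, zero_add, neg_div, div_self this]
  simp only [h1, Finset.prod_const, Finset.card_univ] at e0
  rw [← Finset.sum_mul] at e0
  rw [prod_div_eq_sum hz hy]
  simp only [mul_sub, mul_one, Finset.sum_sub_distrib, parityConst]
  linear_combination (-1 / 2) * e0

/-! ### The product of hyperbolic tangents in exponential variables -/

/-- `∏_{i<j} (x_i - x_j) / (x_i + x_j)`. -/
def tprod {n : ℕ} (x : Fin n → ℂ) : ℂ := ∏ i, ∏ j ∈ Finset.Ioi i, (x i - x j) / (x i + x j)

lemma tprod_succ {n : ℕ} (x : Fin (n + 1) → ℂ) :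
    tprod x = (∏ j : Fin n, (x 0 - x j.succ) / (x 0 + x j.succ)) * tprod (fun j => x j.succ) := by
  rw [tprod, Fin.prod_univ_succ, Fin.prod_Ioi_zero]
  simp only [Fin.prod_Ioi_succ]
  rfl

lemma tprod_succAbove {n : ℕ} (x : Fin (n + 1) → ℂ) (i : Fin (n + 1)) :
    tprod x = (-1) ^ (i : ℕ) * (∏ k : Fin n, (x i - x (i.succAbove k)) / (x i + x (i.succAbove k))) *
      tprod (fun k => x (i.succAbove k)) := by
  induction n with
  | zero =>
    obtain rfl : i = 0 := Fin.ext (by omega)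
    simp [tprod]
  | succ n ih =>
    refine Fin.cases ?_ (fun i => ?_) i
    · simp [tprod_succ x]
    · have e1 := Fin.prod_univ_succAbove
        (fun j : Fin (n + 1) => (x 0 - x j.succ) / (x 0 + x j.succ)) i
      have e2 := Fin.prod_univ_succ (fun k : Fin (n + 1) =>
        (x i.succ - x (i.succ.succAbove k)) / (x i.succ + x (i.succ.succAbove k)))
      rw [tprod_succ x, ih (fun j => x j.succ) i, tprod_succ (fun k => x (i.succ.succAbove k)),
        e1, e2]
      simp only [Fin.succ_succAbove_zero, Fin.succ_succAbove_succ, Fin.val_succ, pow_succ]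
      rw [show (x i.succ - x 0) / (x i.succ + x 0) = -((x 0 - x i.succ) / (x 0 + x i.succ)) by
        rw [← neg_div, neg_sub, add_comm (x i.succ)]]
      ring

/-- The odd form factor in exponential variables near a node: the variables `y` are shifted
by `i π`. -/
def crossProd {m n : ℕ} (x : Fin m → ℂ) (y : Fin n → ℂ) : ℂ :=
  tprod x * tprod y * ∏ i, ∏ j, (x i + y j) / (x i - y j)

lemma crossProd_succ {m n : ℕ} (x : Fin m → ℂ) (y : Fin (n + 1) → ℂ) :
    crossProd x y = ((∏ i, (x i + y 0) / (x i - y 0)) *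
      ∏ j : Fin n, (y 0 - y j.succ) / (y 0 + y j.succ)) * crossProd x (fun j => y j.succ) := by
  simp only [crossProd, tprod_succ y, Fin.prod_univ_succ, Finset.prod_mul_distrib]
  ring

lemma prod_mul_prod_cancel {ι : Type*} {s : Finset ι} {f g : ι → ℂ} (h : ∀ i ∈ s, f i * g i = 1) :
    (∏ i ∈ s, f i) * ∏ i ∈ s, g i = 1 := by
  rw [← Finset.prod_mul_distrib]
  exact Finset.prod_eq_one h

lemma crossProd_del_left {m n : ℕ} (x : Fin (m + 1) → ℂ) (y : Fin n → ℂ) (i : Fin (m + 1))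
    (h1 : ∀ k, x i - x (i.succAbove k) ≠ 0) (h2 : ∀ k, x i + x (i.succAbove k) ≠ 0)
    (h3 : ∀ j, x i - y j ≠ 0) (h4 : ∀ j, x i + y j ≠ 0) :
    (∏ k, (x i + x (i.succAbove k)) / (x i - x (i.succAbove k))) *
      (∏ j, (x i - y j) / (x i + y j)) * crossProd x y =
        (-1) ^ (i : ℕ) * crossProd (fun k => x (i.succAbove k)) y := by
  have e1 := prod_mul_prod_cancel (s := univ)
    (f := fun k => (x i + x (i.succAbove k)) / (x i - x (i.succAbove k)))
    (g := fun k => (x i - x (i.succAbove k)) / (x i + x (i.succAbove k)))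
    (fun k _ => by have := h1 k; have := h2 k; field_simp)
  have e2 := prod_mul_prod_cancel (s := univ) (f := fun j => (x i - y j) / (x i + y j))
    (g := fun j => (x i + y j) / (x i - y j))
    (fun k _ => by have := h3 k; have := h4 k; field_simp)
  simp only [crossProd]
  rw [tprod_succAbove x i, Fin.prod_univ_succAbove _ i]
  linear_combination ((-1) ^ (i : ℕ) * tprod (fun k => x (i.succAbove k)) * tprod y *
    ∏ k, ∏ j, (x (i.succAbove k) + y j) / (x (i.succAbove k) - y j)) *
      ((∏ j, (x i - y j) / (x i + y j)) * (∏ j, (x i + y j) / (x i - y j)) * e1 + e2)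

lemma crossProd_del_right {m n : ℕ} (x : Fin m → ℂ) (y : Fin (n + 1) → ℂ) (j : Fin (n + 1))
    (h1 : ∀ k, y j - y (j.succAbove k) ≠ 0) (h2 : ∀ k, y j + y (j.succAbove k) ≠ 0)
    (h3 : ∀ i, x i - y j ≠ 0) (h4 : ∀ i, x i + y j ≠ 0) :
    (∏ k, (y j + y (j.succAbove k)) / (y j - y (j.succAbove k))) *
      (∏ i, (x i - y j) / (x i + y j)) * crossProd x y =
        (-1) ^ (j : ℕ) * crossProd x (fun k => y (j.succAbove k)) := by
  have e1 := prod_mul_prod_cancel (s := univ)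
    (f := fun k => (y j + y (j.succAbove k)) / (y j - y (j.succAbove k)))
    (g := fun k => (y j - y (j.succAbove k)) / (y j + y (j.succAbove k)))
    (fun k _ => by have := h1 k; have := h2 k; field_simp)
  have e2 := prod_mul_prod_cancel (s := univ) (f := fun i => (x i - y j) / (x i + y j))
    (g := fun i => (x i + y j) / (x i - y j))
    (fun k _ => by have := h3 k; have := h4 k; field_simp)
  simp only [crossProd]
  rw [tprod_succAbove y j]
  simp only [Fin.prod_univ_succAbove _ j, Finset.prod_mul_distrib]
  linear_combination ((-1) ^ (j : ℕ) * tprod (fun k => y (j.succAbove k)) * tprod x *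
    ∏ i, ∏ k, (x i + y (j.succAbove k)) / (x i - y (j.succAbove k))) *
      ((∏ i, (x i - y j) / (x i + y j)) * (∏ i, (x i + y j) / (x i - y j)) * e1 + e2)

/-- Nondegeneracy of the variables in `crossProd`. -/
structure Nondeg {m n : ℕ} (x : Fin m → ℂ) (y : Fin n → ℂ) : Prop where
  x_ne_zero : ∀ i, x i ≠ 0
  y_ne_zero : ∀ j, y j ≠ 0
  x_sub : ∀ i k, i ≠ k → x i - x k ≠ 0
  x_add : ∀ i k, x i + x k ≠ 0
  y_sub : ∀ i k, i ≠ k → y i - y k ≠ 0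
  y_add : ∀ i k, y i + y k ≠ 0
  sub : ∀ i j, x i - y j ≠ 0
  add : ∀ i j, x i + y j ≠ 0

/-- The coefficient of the pole at `x i` in the expansion in a further variable. -/
def coeffLeft {m n : ℕ} (x : Fin m → ℂ) (y : Fin n → ℂ) (i : Fin m) : ℂ :=
  (∏ l ∈ Finset.univ.erase i, (x i + x l) / (x i - x l)) * ∏ j, (x i - y j) / (x i + y j)

/-- The coefficient of the pole at `-y j` in the expansion in a further variable. -/
def coeffRight {m n : ℕ} (x : Fin m → ℂ) (y : Fin n → ℂ) (j : Fin n) : ℂ :=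
  (∏ l ∈ Finset.univ.erase j, (y j + y l) / (y j - y l)) * ∏ i, (y j - x i) / (y j + x i)

lemma crossProd_expand {m n : ℕ} {x : Fin m → ℂ} {y : Fin (n + 1) → ℂ} (h : Nondeg x y) :
    crossProd x y = (-1) ^ m * (parityConst (m + n) * crossProd x (fun j => y j.succ) -
      ∑ i, (x i + y 0) / (x i - y 0) *
        (coeffLeft x (fun j => y j.succ) i * crossProd x (fun j => y j.succ)) +
      ∑ j : Fin n, (y 0 - y j.succ) / (y 0 + y j.succ) *
        (coeffRight x (fun j => y j.succ) j * crossProd x (fun j => y j.succ))) := by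
  let z : Fin m ⊕ Fin n → ℂ := Sum.elim (fun i => -x i) (fun j => y j.succ)
  have hinj : Function.Injective z := by
    rintro (i | i) (k | k) hik
    · by_contra hne
      exact h.x_sub i k (fun e => hne (by rw [e])) (by
        have : -x i = -x k := hik
        linear_combination -this)
    · exact absurd (show x i + y k.succ = 0 by
        have : -x i = y k.succ := hik
        linear_combination -this) (h.add i k.succ)
    · exact absurd (show x k + y i.succ = 0 by
        have : y i.succ = -x k := hik
        linear_combination this) (h.add k i.succ)
    · by_contra hne
      exact h.y_sub i.succ k.succ (fun e => hne (by rw [Fin.succ_injective _ e])) (by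
        have : y i.succ = y k.succ := hik
        linear_combination this)
  have key := prod_div_eq_parity_add_sum (z := z) (y := y 0) hinj
    (by
      rintro (i | j)
      · intro e; exact h.sub i 0 (by simp only [z, Sum.elim_inl] at e; linear_combination -e)
      · exact h.y_add 0 j.succ)
    (by rintro (i | j); exacts [neg_ne_zero.2 (h.x_ne_zero i), h.y_ne_zero _])
  simp only [Fintype.prod_sum_type, Fintype.sum_sum_type, Fintype.card_sum, Fintype.card_fin,
    z, Sum.elim_inl, Sum.elim_inr] at key
  have hl : ∀ i, ∏ l ∈ Finset.univ.erase (Sum.inl i : Fin m ⊕ Fin n),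
      (-x i + z l) / (-x i - z l) = coeffLeft x (fun j => y j.succ) i := by
    intro i
    have hs : Finset.univ.erase (Sum.inl i : Fin m ⊕ Fin n) =
        (Finset.univ.erase i).disjSum univ := by
      ext (a | a) <;> simp
    rw [hs, Finset.prod_disjSum, coeffLeft]
    congr 1
    · refine prod_congr rfl fun l _ => ?_
      simp only [z, Sum.elim_inl]
      rw [← neg_div_neg_eq]; congr 1 <;> ring
    · refine prod_congr rfl fun l _ => ?_
      simp only [z, Sum.elim_inr]
      rw [← neg_div_neg_eq]; congr 1 <;> ring
  have hr : ∀ j, ∏ l ∈ Finset.univ.erase (Sum.inr j : Fin m ⊕ Fin n),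
      (y j.succ + z l) / (y j.succ - z l) = coeffRight x (fun j => y j.succ) j := by
    intro j
    have hs : Finset.univ.erase (Sum.inr j : Fin m ⊕ Fin n) =
        Finset.univ.disjSum (Finset.univ.erase j) := by
      ext (a | a) <;> simp
    rw [hs, Finset.prod_disjSum, coeffRight, mul_comm]
    congr 1
    refine prod_congr rfl fun l _ => ?_
    simp only [z, Sum.elim_inl]
    congr 1; ring
  simp only [z] at hl hr
  simp only [hl, hr] at key
  have hm : ∏ i, (x i + y 0) / (x i - y 0) = (-1) ^ m * ∏ i, (y 0 - -x i) / (y 0 + -x i) := by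
    rw [show (-1 : ℂ) ^ m = ∏ _i : Fin m, (-1 : ℂ) by simp, ← Finset.prod_mul_distrib]
    refine prod_congr rfl fun i _ => ?_
    rw [neg_one_mul, ← div_neg]
    congr 1 <;> ring
  have hx : ∀ i, (y 0 - -x i) / (y 0 + -x i) = -((x i + y 0) / (x i - y 0)) := fun i => by
    rw [← div_neg]; congr 1 <;> ring
  rw [crossProd_succ, hm, mul_assoc ((-1) ^ m), key]
  simp only [hx, mul_neg, Finset.sum_neg_distrib]
  simp only [← mul_assoc, ← Finset.sum_mul]
  rw [mul_assoc ((-1) ^ m)]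
  congr 1
  simp only [mul_comm ((_ : ℂ) / _)]
  ring

lemma coeffLeft_mul_crossProd {m n : ℕ} {x : Fin (m + 1) → ℂ} {y : Fin n → ℂ} (h : Nondeg x y)
    (i : Fin (m + 1)) :
    coeffLeft x y i * crossProd x y = (-1) ^ (i : ℕ) * crossProd (fun k => x (i.succAbove k)) y := by
  rw [← crossProd_del_left x y i (fun k => h.x_sub _ _ (Fin.succAbove_ne i k).symm)
    (fun k => h.x_add _ _) (fun j => h.sub i j) (fun j => h.add i j), coeffLeft]
  congr 2
  rw [← Finset.compl_singleton, ← Fin.image_succAbove_univ, Finset.prod_image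
    (fun a _ b _ hab => Fin.succAbove_right_injective hab)]

lemma coeffRight_mul_crossProd {m n : ℕ} {x : Fin m → ℂ} {y : Fin (n + 1) → ℂ} (h : Nondeg x y)
    (j : Fin (n + 1)) :
    coeffRight x y j * crossProd x y =
      (-1) ^ m * (-1) ^ (j : ℕ) * crossProd x (fun k => y (j.succAbove k)) := by
  rw [mul_assoc, ← crossProd_del_right x y j (fun k => h.y_sub _ _ (Fin.succAbove_ne j k).symm)
    (fun k => h.y_add _ _) (fun i => h.sub i j) (fun i => h.add i j), coeffRight]
  have e1 : ∏ l ∈ Finset.univ.erase j, (y j + y l) / (y j - y l) =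
      ∏ k, (y j + y (j.succAbove k)) / (y j - y (j.succAbove k)) := by
    rw [← Finset.compl_singleton, ← Fin.image_succAbove_univ, Finset.prod_image
      (fun a _ b _ hab => Fin.succAbove_right_injective hab)]
  have e2 : ∏ i, (y j - x i) / (y j + x i) = (-1) ^ m * ∏ i, (x i - y j) / (x i + y j) := by
    rw [show (-1 : ℂ) ^ m = ∏ _i : Fin m, (-1 : ℂ) by simp, ← Finset.prod_mul_distrib]
    refine prod_congr rfl fun i _ => ?_
    rw [neg_one_mul, ← neg_div]
    congr 1 <;> ring
  rw [e1, e2]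
  ring


/-! ### Elementary bounds for the pole factor -/

lemma norm_sub_div_add_le {x y : ℂ} (h : 0 ≤ (x * starRingEnd ℂ y).re) : ‖(x - y) / (x + y)‖ ≤ 1 := by
  rw [norm_div]
  refine div_le_one_of_le₀ ?_ (norm_nonneg _)
  rw [← sq_le_sq₀ (norm_nonneg _) (norm_nonneg _), ← Complex.normSq_eq_norm_sq,
    ← Complex.normSq_eq_norm_sq, Complex.normSq_sub, Complex.normSq_add]
  linarith

lemma norm_exp_sub_div_add_le {z z' : ℂ} (h : |z.im - z'.im| ≤ 1) :
    ‖(exp z - exp z') / (exp z + exp z')‖ ≤ 1 := by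
  refine norm_sub_div_add_le ?_
  rw [← Complex.exp_conj, ← Complex.exp_add, Complex.exp_re]
  refine mul_nonneg (exp_pos _).le (Real.cos_nonneg_of_mem_Icc ?_)
  have := Real.pi_gt_three
  rw [abs_le] at h
  simp only [Complex.add_im, Complex.conj_im]
  constructor <;> linarith [h.1, h.2]

/-- The regular part of `coth (z / 2)`. -/
def cothRem (z : ℂ) : ℂ := (exp z + 1) / (exp z - 1) - 2 / z

lemma norm_exp_add_one_div_le {z : ℂ} {s : ℝ} (hs : 0 < s) (h : s ≤ |z.re|) :
    ‖(exp z + 1) / (exp z - 1)‖ ≤ 1 + 2 / s := by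
  have key : ∀ z : ℂ, s ≤ z.re → ‖(exp z + 1) / (exp z - 1)‖ ≤ 1 + 2 / s := by
    intro z hz
    have h1 : s ≤ ‖exp z - 1‖ := by
      have h2 := norm_sub_norm_le (exp z) 1
      rw [Complex.norm_exp, norm_one] at h2
      linarith [Real.add_one_le_exp z.re]
    have h0 : exp z - 1 ≠ 0 := norm_pos_iff.1 (hs.trans_le h1)
    rw [show (exp z + 1) / (exp z - 1) = 1 + 2 / (exp z - 1) by
      field_simp; ring]
    refine (norm_add_le _ _).trans ?_
    rw [norm_one, norm_div, Complex.norm_ofNat]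
    gcongr
  rcases le_abs.1 h with h | h
  · exact key z h
  · have := key (-z) (by simpa using h)
    rw [Complex.exp_neg] at this
    have h0 := Complex.exp_ne_zero z
    rw [show ((exp z)⁻¹ + 1) / ((exp z)⁻¹ - 1) =
      -((exp z + 1) / (exp z - 1)) by
        rw [← div_neg, ← mul_div_mul_left _ _ h0]
        congr 1 <;> field_simp <;> ring, norm_neg] at this
    exact this

lemma norm_cothRem_le {z : ℂ} (h0 : z ≠ 0) (hz : |z.im| ≤ 1 / 4) : ‖cothRem z‖ ≤ 11 := by
  rcases le_or_gt ‖z‖ (1 / 2) with h | h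
  · have hz0 : 0 < ‖z‖ := norm_pos_iff.2 h0
    have hq := Complex.norm_exp_sub_one_sub_id_le (h.trans (by norm_num))
    set q := exp z - 1 - z with hq_def
    have he : exp z = 1 + z + q := by rw [hq_def]; ring
    have hden : ‖z‖ / 2 ≤ ‖z + q‖ := by
      have h1 := norm_sub_norm_le z (-q)
      rw [sub_neg_eq_add, norm_neg] at h1
      nlinarith
    have hd0 : z + q ≠ 0 := norm_pos_iff.1 (by linarith)
    have e : cothRem z = (z ^ 2 + z * q - 2 * q) / (z * (z + q)) := by
      rw [cothRem, he, show (1 + z + q - 1 : ℂ) = z + q by ring, div_sub_div _ _ hd0 h0,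
        mul_comm (z + q) z]
      congr 1
      ring
    have hnum : ‖z ^ 2 + z * q - 2 * q‖ ≤ 4 * ‖z‖ ^ 2 := by
      refine (norm_sub_le _ _).trans ((add_le_add_left (norm_add_le _ _) _).trans ?_)
      rw [norm_mul, norm_mul, norm_pow, Complex.norm_ofNat]
      nlinarith [norm_nonneg q]
    rw [e, norm_div, norm_mul]
    rw [div_le_iff₀ (mul_pos hz0 (by linarith))]
    nlinarith
  · have hre : 1 / 3 ≤ |z.re| := by
      have h1 : ‖z‖ ^ 2 = z.re ^ 2 + z.im ^ 2 := by
        rw [← Complex.normSq_eq_norm_sq, Complex.normSq_apply]; ring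
      rw [← sq_abs z.re, ← sq_abs z.im] at h1
      nlinarith [abs_nonneg z.re, abs_nonneg z.im]
    refine (norm_sub_le _ _).trans ?_
    have h1 := norm_exp_add_one_div_le (by norm_num) hre
    have h2 : ‖2 / z‖ ≤ 4 := by
      rw [norm_div, Complex.norm_ofNat, div_le_iff₀ (by linarith)]
      linarith
    have h3 : (1 : ℝ) + 2 / (1 / 3) ≤ 7 := by norm_num
    linarith

/-! ### The shifted form factor kernels -/

/-- `exp (θ_i + i a_i)`. -/
def expShift {n : ℕ} (a θ : Fin n → ℝ) (i : Fin n) : ℂ := exp (θ i + a i * I)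

lemma expShift_ne_zero {n : ℕ} (a θ : Fin n → ℝ) (i : Fin n) : expShift a θ i ≠ 0 :=
  Complex.exp_ne_zero _

lemma measurable_expShift {n : ℕ} (a : Fin n → ℝ) (i : Fin n) :
    Measurable fun θ : Fin n → ℝ => expShift a θ i := by
  unfold expShift; fun_prop

/-- The form factor kernel near a node, with the poles displaced by small shifts `a`, `b`. -/
def shiftKer {m n : ℕ} (a : Fin m → ℝ) (b : Fin n → ℝ) (θ : Fin m → ℝ) (η : Fin n → ℝ) : ℂ :=
  crossProd (expShift a θ) (expShift (fun j => -b j) η)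

lemma measurable_tprod {α : Type*} [MeasurableSpace α] {n : ℕ} {f : Fin n → α → ℂ}
    (hf : ∀ i, Measurable (f i)) : Measurable fun x => tprod fun i => f i x := by
  unfold tprod
  fun_prop

/-- Small positive shifts in general position. -/
structure SmallShift {m n : ℕ} (a : Fin m → ℝ) (b : Fin n → ℝ) : Prop where
  a_pos : ∀ i, 0 < a i
  b_pos : ∀ j, 0 < b j
  a_lt : ∀ i, a i < 1 / 8
  b_lt : ∀ j, b j < 1 / 8
  a_inj : Function.Injective a
  b_inj : Function.Injective b

lemma SmallShift.comp {m n m' n' : ℕ} {a : Fin m → ℝ} {b : Fin n → ℝ} (h : SmallShift a b)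
    {f : Fin m' → Fin m} {g : Fin n' → Fin n} (hf : Function.Injective f)
    (hg : Function.Injective g) : SmallShift (fun i => a (f i)) (fun j => b (g j)) :=
  ⟨fun _ => h.a_pos _, fun _ => h.b_pos _, fun _ => h.a_lt _, fun _ => h.b_lt _,
    h.a_inj.comp hf, h.b_inj.comp hg⟩

lemma expShift_sub_ne_zero {n : ℕ} {a : Fin n → ℝ} (ha : ∀ i, |a i| < 1 / 8)
    (hinj : Function.Injective a) (θ : Fin n → ℝ) {i k : Fin n} (hik : i ≠ k) :
    expShift a θ i - expShift a θ k ≠ 0 := by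
  intro h
  rw [sub_eq_zero, expShift, expShift] at h
  have h1 := congrArg norm h
  rw [Complex.norm_exp, Complex.norm_exp, Real.exp_eq_exp] at h1
  have h2 := congrArg Complex.im h
  rw [Complex.exp_im, Complex.exp_im, h1] at h2
  have h3 := mul_left_cancel₀ (exp_pos _).ne' h2
  simp only [Complex.add_im, Complex.ofReal_im, Complex.mul_im, Complex.ofReal_re, Complex.I_im,
    Complex.I_re, mul_one, mul_zero, add_zero, zero_add] at h3
  have hp := Real.pi_gt_three
  have hmem : ∀ i, a i ∈ Set.Icc (-(Real.pi / 2)) (Real.pi / 2) := fun i => by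
    have := abs_lt.1 (ha i); constructor <;> linarith
  exact hik (hinj (Real.injOn_sin (hmem i) (hmem k) h3))

lemma expShift_re_pos {n : ℕ} {a : Fin n → ℝ} (ha : ∀ i, |a i| < 1 / 8) (θ : Fin n → ℝ)
    (i : Fin n) : 0 < (expShift a θ i).re := by
  have hp := Real.pi_gt_three
  have := abs_lt.1 (ha i)
  rw [expShift, Complex.exp_re]
  refine mul_pos (exp_pos _) (Real.cos_pos_of_mem_Ioo ?_)
  simp only [Complex.add_im, Complex.ofReal_im, Complex.mul_im, Complex.ofReal_re, Complex.I_im,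
    Complex.I_re, mul_one, mul_zero, add_zero, zero_add]
  constructor <;> linarith

lemma ne_zero_of_re_pos {z : ℂ} (h : 0 < z.re) : z ≠ 0 := by
  rintro rfl; simp at h

lemma expShift_im {n : ℕ} (a θ : Fin n → ℝ) (i : Fin n) :
    (expShift a θ i).im = Real.exp (θ i) * Real.sin (a i) := by
  rw [expShift, Complex.exp_im]
  simp

lemma SmallShift.abs_a {m n : ℕ} {a : Fin m → ℝ} {b : Fin n → ℝ} (h : SmallShift a b) (i : Fin m) :
    |a i| < 1 / 8 := by rw [abs_of_pos (h.a_pos i)]; exact h.a_lt i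

lemma SmallShift.abs_b {m n : ℕ} {a : Fin m → ℝ} {b : Fin n → ℝ} (h : SmallShift a b) (i : Fin n) :
    |-b i| < 1 / 8 := by rw [abs_neg, abs_of_pos (h.b_pos i)]; exact h.b_lt i

lemma SmallShift.nondeg {m n : ℕ} {a : Fin m → ℝ} {b : Fin n → ℝ} (h : SmallShift a b)
    (θ : Fin m → ℝ) (η : Fin n → ℝ) :
    Nondeg (expShift a θ) (expShift (fun j => -b j) η) where
  x_ne_zero := expShift_ne_zero _ _
  y_ne_zero := expShift_ne_zero _ _
  x_sub _ _ := expShift_sub_ne_zero h.abs_a h.a_inj θ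
  y_sub _ _ := expShift_sub_ne_zero h.abs_b (neg_injective.comp h.b_inj) η
  x_add i k := ne_zero_of_re_pos
    (add_pos (expShift_re_pos h.abs_a θ i) (expShift_re_pos h.abs_a θ k))
  y_add i k := ne_zero_of_re_pos
    (add_pos (expShift_re_pos h.abs_b η i) (expShift_re_pos h.abs_b η k))
  add i k := ne_zero_of_re_pos
    (add_pos (expShift_re_pos h.abs_a θ i) (expShift_re_pos h.abs_b η k))
  sub i k := by
    have hp := Real.pi_gt_three
    have h1 : 0 < (expShift a θ i).im := by
      rw [expShift_im]
      exact mul_pos (exp_pos _) (Real.sin_pos_of_pos_of_lt_pi (h.a_pos i)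
        (by linarith [h.a_lt i]))
    have h2 : (expShift (fun j => -b j) η k).im < 0 := by
      rw [expShift_im, Real.sin_neg]
      have := mul_pos (exp_pos (η k)) (Real.sin_pos_of_pos_of_lt_pi (h.b_pos k)
        (by linarith [h.b_lt k]))
      linarith
    intro e
    have := congrArg Complex.im e
    simp only [Complex.sub_im, Complex.zero_im] at this
    linarith

lemma norm_expShift_le {n : ℕ} {a : Fin n → ℝ} (ha : ∀ i, |a i| < 1 / 8) (θ : Fin n → ℝ)
    (i k : Fin n) :
    ‖(expShift a θ i - expShift a θ k) / (expShift a θ i + expShift a θ k)‖ ≤ 1 := by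
  refine norm_exp_sub_div_add_le ?_
  have h1 := abs_lt.1 (ha i)
  have h2 := abs_lt.1 (ha k)
  simp only [Complex.add_im, Complex.ofReal_im, Complex.mul_im, Complex.ofReal_re, Complex.I_im,
    Complex.I_re, mul_one, mul_zero, add_zero, zero_add]
  rw [abs_le]
  constructor <;> linarith

lemma norm_tprod_expShift_le {n : ℕ} {a : Fin n → ℝ} (ha : ∀ i, |a i| < 1 / 8) (θ : Fin n → ℝ) :
    ‖tprod (expShift a θ)‖ ≤ 1 := by
  unfold tprod
  rw [norm_prod]
  refine Finset.prod_le_one (fun _ _ => norm_nonneg _) fun i _ => ?_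
  rw [norm_prod]
  exact Finset.prod_le_one (fun _ _ => norm_nonneg _) fun j _ => norm_expShift_le ha θ i j

section Families

variable {Λ : Type*} {l : Filter Λ} {m n : ℕ}

/-- Families of small shifts that tend to zero. -/
structure ShiftFam (l : Filter Λ) (a : Λ → Fin m → ℝ) (b : Λ → Fin n → ℝ) : Prop where
  small : ∀ᶠ t in l, SmallShift (a t) (b t)
  lim_a : ∀ i, Tendsto (fun t => a t i) l (𝓝 0)
  lim_b : ∀ j, Tendsto (fun t => b t j) l (𝓝 0)

lemma ShiftFam.comp {a : Λ → Fin m → ℝ} {b : Λ → Fin n → ℝ} (h : ShiftFam l a b) {m' n' : ℕ}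
    {f : Fin m' → Fin m} {g : Fin n' → Fin n} (hf : Function.Injective f)
    (hg : Function.Injective g) :
    ShiftFam l (fun t i => a t (f i)) (fun t j => b t (g j)) :=
  ⟨h.small.mono fun _ ht => ht.comp hf hg, fun _ => h.lim_a _, fun _ => h.lim_b _⟩

lemma tendsto_expShift {a : Λ → Fin n → ℝ} {i : Fin n} (h : Tendsto (fun t => a t i) l (𝓝 0))
    (θ : Fin n → ℝ) : Tendsto (fun t => expShift (a t) θ i) l (𝓝 (Real.exp (θ i))) := by
  have hc : Continuous fun s : ℝ => exp (θ i + s * I) := by fun_prop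
  have := (hc.tendsto 0).comp h
  simpa [Function.comp_def, expShift] using this

lemma tendsto_expShift_ratio {a : Λ → Fin n → ℝ} (h : ∀ i, Tendsto (fun t => a t i) l (𝓝 0))
    (θ : Fin n → ℝ) (i k : Fin n) : ∃ L, Tendsto (fun t => (expShift (a t) θ i - expShift (a t) θ k) /
      (expShift (a t) θ i + expShift (a t) θ k)) l (𝓝 L) := by
  refine ⟨_, ((tendsto_expShift (h i) θ).sub (tendsto_expShift (h k) θ)).div
    ((tendsto_expShift (h i) θ).add (tendsto_expShift (h k) θ)) ?_⟩
  rw [← Complex.ofReal_add, Complex.ofReal_ne_zero]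
  exact (add_pos (exp_pos _) (exp_pos _)).ne'

lemma exists_tendsto_prod {ι : Type*} (s : Finset ι) {f : ι → Λ → ℂ}
    (h : ∀ i ∈ s, ∃ L, Tendsto (f i) l (𝓝 L)) : ∃ L, Tendsto (fun t => ∏ i ∈ s, f i t) l (𝓝 L) := by
  choose! L hL using h
  exact ⟨_, tendsto_finsetProd s hL⟩

lemma tendsto_tprod_expShift {a : Λ → Fin n → ℝ} (h : ∀ i, Tendsto (fun t => a t i) l (𝓝 0))
    (θ : Fin n → ℝ) : ∃ L, Tendsto (fun t => tprod (expShift (a t) θ)) l (𝓝 L) :=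
  exists_tendsto_prod _ fun i _ => exists_tendsto_prod _ fun j _ => tendsto_expShift_ratio h θ i j

end Families


section UnitTensor

variable {X Y W : Type*} [MeasurableSpace X] [MeasurableSpace Y] [MeasurableSpace W]
  {μ : Measure X} {ν : Measure Y} {τ : Measure W} [SFinite μ] [SFinite ν] [SFinite τ]
  {Λ : Type*} {l : Filter Λ}

lemma measurePreserving_punitProd :
    MeasurePreserving (MeasurableEquiv.punitProd.symm : X ≃ᵐ Unit × X) μ
      ((Measure.dirac ()).prod μ) := by
  refine ⟨MeasurableEquiv.measurable _, ?_⟩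
  rw [Measure.dirac_prod]
  rfl

lemma measurePreserving_prodPUnit :
    MeasurePreserving (MeasurableEquiv.prodPUnit.symm : X ≃ᵐ X × Unit) μ
      (μ.prod (Measure.dirac ())) := by
  refine ⟨MeasurableEquiv.measurable _, ?_⟩
  rw [Measure.prod_dirac]
  rfl

lemma sqInt_one_dirac : SqInt (Measure.dirac ()) (fun _ => 1) :=
  ⟨measurable_const, by simp⟩

lemma l2_one_dirac : l2 (Measure.dirac ()) (fun _ => 1) = 1 := by simp [l2]

/-- A good family multiplied with bounded functions of an additional variable on the right. -/
lemma Good.tensor_right [l.IsCountablyGenerated] {K : Λ → X → Y → ℂ} {C : ℝ}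
    (hK : Good l μ ν K C) {w : W → ℂ} (hw : SqInt τ w) {c : Λ → W → ℂ}
    (hcm : ∀ t, Measurable (c t)) (hc : ∀ᶠ t in l, ∀ y, ‖c t y‖ ≤ 1)
    (hlim : ∀ z, ∃ L, Tendsto (fun t => c t z) l (𝓝 L)) :
    Good l μ (τ.prod ν) (fun t a b => c t b.1 * w b.1 * K t a b.2) (C * l2 τ w) := by
  have h := hK.tensor_bounded sqInt_one_dirac hw (c := fun t _ y => c t y) zero_le_one
    (fun t => (hcm t).comp measurable_snd) (hc.mono fun t ht _ y => ht y)
    (.of_forall fun z => hlim z.2)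
  have h2 := h.comp MeasurableEquiv.punitProd.symm (MeasurableEquiv.refl _)
    measurePreserving_punitProd (MeasurePreserving.id _)
  rw [l2_one_dirac, one_mul, one_mul] at h2
  refine h2.congr (.of_forall fun t => ?_)
  funext x y
  change c t y.1 * (1 * w y.1) * K t x y.2 = _
  rw [one_mul]

/-- The one-dimensional identity kernel. -/
lemma Good.unit : Good l (Measure.dirac ()) (Measure.dirac ())
    (fun _ _ _ => 1) 1 := by
  have key : ∀ ψ χ : Unit → ℂ, formInt (Measure.dirac ()) (Measure.dirac ())
      (fun _ _ => 1) ψ χ = ψ () * χ () := by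
    intro ψ χ
    simp [formInt, Measure.dirac_prod_dirac]
  refine ⟨.of_forall fun _ => ⟨⟨measurable_const, by
    simp [Measure.dirac_prod_dirac]⟩, zero_le_one, fun ψ χ _ _ => ?_⟩, fun ψ χ _ _ => ⟨_, by
      simp only [key]; exact tendsto_const_nhds⟩⟩
  rw [key]
  simp [l2, Real.sqrt_sq]

/-- Bounded kernels between square-integrable weights. -/
lemma Good.of_bounded [l.IsCountablyGenerated] {v : X → ℂ} {w : Y → ℂ} (hv : SqInt μ v)
    (hw : SqInt ν w) {c : Λ → X → Y → ℂ} {R : ℝ} (hR : 0 ≤ R)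
    (hcm : ∀ t, Measurable (fun z : X × Y => c t z.1 z.2)) (hc : ∀ᶠ t in l, ∀ u y, ‖c t u y‖ ≤ R)
    (hlim : ∀ᵐ z ∂(μ.prod ν), ∃ L, Tendsto (fun t => c t z.1 z.2) l (𝓝 L)) :
    Good l μ ν (fun t x y => c t x y * (v x * w y)) (R * (l2 μ v * l2 ν w)) := by
  have h := (Good.unit (l := l)).tensor_bounded hv hw hR hcm hc hlim
  have h2 := h.comp MeasurableEquiv.prodPUnit.symm MeasurableEquiv.prodPUnit.symm
    measurePreserving_prodPUnit measurePreserving_prodPUnit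
  rw [mul_one] at h2
  refine h2.congr (.of_forall fun t => ?_)
  funext x y
  exact mul_one _

end UnitTensor

/-! ### Weighted form factor kernels -/

section Weighted

variable {Λ : Type*} {l : Filter Λ}

/-- `∏ v(θ_i)`. -/
def wprod {n : ℕ} (v : ℝ → ℂ) (θ : Fin n → ℝ) : ℂ := ∏ i, v (θ i)

lemma sqInt_wprod {v : ℝ → ℂ} (hv : SqInt volume v) (n : ℕ) :
    SqInt volume (wprod v : (Fin n → ℝ) → ℂ) := by
  refine ⟨?_, ?_⟩
  · have := hv.meas
    unfold wprod
    fun_prop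
  · simp only [wprod, norm_prod, ← Finset.prod_pow]
    exact Integrable.fintype_prod (f := fun _ : Fin n => fun x => ‖v x‖ ^ 2) fun _ => hv.int

lemma l2_wprod {v : ℝ → ℂ} (n : ℕ) :
    l2 volume (wprod v : (Fin n → ℝ) → ℂ) = l2 volume v ^ n := by
  simp only [l2, wprod, norm_prod, ← Finset.prod_pow]
  rw [integral_fintype_prod_volume_eq_pow (fun x => ‖v x‖ ^ 2), Fintype.card_fin,
    Real.sqrt_eq_rpow, Real.sqrt_eq_rpow, Real.rpow_pow_comm (integral_nonneg fun _ => by positivity)]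

/-- The form factor kernel with weights. -/
def wKer {m n : ℕ} (v w : ℝ → ℂ) (a : Fin m → ℝ) (b : Fin n → ℝ) (θ : Fin m → ℝ)
    (η : Fin n → ℝ) : ℂ :=
  wprod v θ * shiftKer a b θ η * wprod w η

lemma wprod_succAbove {n : ℕ} (v : ℝ → ℂ) (θ : Fin (n + 1) → ℝ) (i : Fin (n + 1)) :
    wprod v θ = v (θ i) * wprod v fun k => θ (i.succAbove k) :=
  Fin.prod_univ_succAbove _ i

/-- Splitting off one coordinate. -/
def delEquiv (n : ℕ) (i : Fin (n + 1)) : (Fin (n + 1) → ℝ) ≃ᵐ ℝ × (Fin n → ℝ) :=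
  MeasurableEquiv.piFinSuccAbove (fun _ => ℝ) i

lemma delEquiv_apply {n : ℕ} (i : Fin (n + 1)) (θ : Fin (n + 1) → ℝ) :
    delEquiv n i θ = (θ i, fun k => θ (i.succAbove k)) := rfl

lemma measurePreserving_delEquiv (n : ℕ) (i : Fin (n + 1)) :
    MeasurePreserving (delEquiv n i) volume (volume.prod volume) :=
  volume_preserving_piFinSuccAbove (fun _ => ℝ) i

/-- The pole factor in terms of the variables `θ_i + i a_i`. -/
lemma expShift_add_div_sub {m n : ℕ} (a : Fin m → ℝ) (b : Fin n → ℝ) (θ : Fin m → ℝ)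
    (η : Fin n → ℝ) (i : Fin m) (j : Fin n) :
    (expShift a θ i + expShift (fun j => -b j) η j) /
      (expShift a θ i - expShift (fun j => -b j) η j) =
    2 * (((θ i - η j : ℝ) : ℂ) + ((a i + b j : ℝ) : ℂ) * I)⁻¹ +
      cothRem (((θ i - η j : ℝ) : ℂ) + ((a i + b j : ℝ) : ℂ) * I) := by
  rw [cothRem, ← div_eq_mul_inv, add_sub_cancel]
  have e : expShift a θ i = expShift (fun j => -b j) η j * exp (((θ i - η j : ℝ) : ℂ) +
      ((a i + b j : ℝ) : ℂ) * I) := by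
    rw [expShift, expShift, ← Complex.exp_add]
    congr 1
    push_cast
    ring
  rw [e, ← mul_add_one, ← mul_sub_one, mul_div_mul_left _ _ (expShift_ne_zero _ _ _)]

lemma measurable_cothRem : Measurable cothRem := by unfold cothRem; fun_prop

lemma tendsto_cothRem {ε : Λ → ℝ} (hε : Tendsto ε l (𝓝 0)) {x : ℝ} (hx : x ≠ 0) :
    ∃ L, Tendsto (fun t => cothRem ((x : ℂ) + (ε t : ℂ) * I)) l (𝓝 L) := by
  have hc : Continuous fun s : ℝ => (x : ℂ) + (s : ℂ) * I := by fun_prop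
  have h1 : Tendsto (fun t => (x : ℂ) + (ε t : ℂ) * I) l (𝓝 (x : ℂ)) := by
    simpa [Function.comp_def] using (hc.tendsto 0).comp hε
  have h2 := (Complex.continuous_exp.tendsto _).comp h1
  refine ⟨_, ((h2.add_const 1).div (h2.sub_const 1) ?_).sub (tendsto_const_nhds.div h1 ?_)⟩
  · rw [sub_ne_zero]
    rw [← Complex.ofReal_exp, ← Complex.ofReal_one, Ne, Complex.ofReal_inj, Real.exp_eq_one_iff]
    exact hx
  · exact Complex.ofReal_ne_zero.2 hx

/-- The pole factor between weights is compatible with good families. -/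
lemma Good.tensor_coth [l.IsCountablyGenerated] {X Y : Type*} [MeasurableSpace X]
    [MeasurableSpace Y] {μ : Measure X} {ν : Measure Y} [SFinite μ] [SFinite ν]
    {K : Λ → X → Y → ℂ} {C : ℝ} (hK : Good l μ ν K C) {v w : ℝ → ℂ} (hv : SqInt volume v)
    (hw : SqInt volume w) (hv1 : ∀ u, ‖v u‖ ≤ 1) (hw1 : ∀ u, ‖w u‖ ≤ 1) {ε : Λ → ℝ}
    (hε : ∀ᶠ t in l, 0 < ε t ∧ ε t ≤ 1 / 4) (hlim : Tendsto ε l (𝓝 0)) :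
    Good l (volume.prod μ) (volume.prod ν)
      (fun t a b => (2 * (((a.1 - b.1 : ℝ) : ℂ) + (ε t : ℂ) * I)⁻¹ +
        cothRem (((a.1 - b.1 : ℝ) : ℂ) + (ε t : ℂ) * I)) * (v a.1 * w b.1) * K t a.2 b.2)
      (4 * Real.pi * C + 11 * C * (l2 volume v * l2 volume w)) := by
  have h1 := (hK.tensor_pole hv hw hv1 hw1 (hε.mono fun _ h => h.1) hlim).const_mul 2
  have h2 := hK.tensor_bounded hv hw (R := 11)
    (c := fun t u y => if 0 < ε t ∧ ε t ≤ 1 / 4 then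
      cothRem (((u - y : ℝ) : ℂ) + (ε t : ℂ) * I) else 0) (by norm_num)
    (fun t => by
      split_ifs
      · exact measurable_cothRem.comp (by fun_prop)
      · exact measurable_const)
    (.of_forall fun t u y => by
      split_ifs with h
      · refine norm_cothRem_le (fun e => ?_) ?_
        · have := congrArg Complex.im e
          simp at this
          linarith [h.1]
        · simpa [abs_of_pos h.1] using h.2
      · simp)
    (by
      have hd : ∀ᵐ z : ℝ × ℝ ∂((volume : Measure ℝ).prod volume), z.1 - z.2 ≠ 0 := by
        have hms : MeasurableSet {z : ℝ × ℝ | z.1 - z.2 ≠ 0} :=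
          (measurableSet_eq_fun (by fun_prop) measurable_const).compl
        rw [Measure.ae_prod_iff_ae_ae hms]
        refine .of_forall fun x => ?_
        have : ∀ᵐ y : ℝ, y ≠ x := by simp [ae_iff]
        filter_upwards [this] with y hy
        exact sub_ne_zero.2 hy.symm
      filter_upwards [hd] with z hz
      obtain ⟨L, hL⟩ := tendsto_cothRem hlim hz
      refine ⟨L, hL.congr' ?_⟩
      filter_upwards [hε] with t ht
      rw [if_pos ht])
  refine ((h1.add h2).congr ?_).mono ?_
  · filter_upwards [hε] with t ht
    funext x y
    simp only [if_pos ht]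
    ring
  · rw [Complex.norm_ofNat]
    exact le_of_eq (by ring)

end Weighted


section Weighted

variable {Λ : Type*} {l : Filter Λ}

/-- The bound for the weighted form factor kernels. -/
def kerBound (c c' : ℝ) (m n : ℕ) : ℝ :=
  c ^ m * ((4 * Real.pi + 12) * (m + n + 1) * c' ^ 2) ^ n

/-- The term in the expansion of the kernel given by the pole in `η_0` at `θ_i`. -/
lemma good_term_left [l.IsCountablyGenerated] {v w : ℝ → ℂ} (hv : SqInt volume v)
    (hw : SqInt volume w) (hv1 : ∀ u, ‖v u‖ ≤ 1) (hw1 : ∀ u, ‖w u‖ ≤ 1) {m n : ℕ}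
    {a : Λ → Fin (m + 1) → ℝ} {b : Λ → Fin (n + 1) → ℝ} (h : ShiftFam l a b) (i : Fin (m + 1))
    {C : ℝ} (hK : Good l volume volume (fun t => wKer v w (fun k => a t (i.succAbove k))
      (fun j => b t j.succ)) C) :
    Good l volume volume (fun t θ η => wprod v θ *
      ((expShift (a t) θ i + expShift (fun j => -b t j) η 0) /
        (expShift (a t) θ i - expShift (fun j => -b t j) η 0) *
      (coeffLeft (expShift (a t) θ) (fun j => expShift (fun j => -b t j) η j.succ) i *
        crossProd (expShift (a t) θ) (fun j => expShift (fun j => -b t j) η j.succ))) * wprod w η)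
      (4 * Real.pi * C + 11 * C * (l2 volume v * l2 volume w)) := by
  have h1 := hK.tensor_coth hv hw hv1 hw1 (ε := fun t => a t i + b t 0)
    (h.small.mono fun t ht => ⟨add_pos (ht.a_pos _) (ht.b_pos _),
      by linarith [ht.a_lt i, ht.b_lt 0]⟩) (by simpa using (h.lim_a i).add (h.lim_b 0))
  have h2 := h1.comp (delEquiv m i) (delEquiv n 0) (measurePreserving_delEquiv m i)
    (measurePreserving_delEquiv n 0)
  have h3 := h2.const_mul ((-1) ^ (i : ℕ))
  rw [norm_pow, norm_neg, norm_one, one_pow, one_mul] at h3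
  refine h3.congr ?_
  filter_upwards [h.small] with t ht
  funext θ η
  have hn := ht.nondeg θ η
  have hn' : Nondeg (expShift (a t) θ) (fun j : Fin n => expShift (fun j => -b t j) η j.succ) :=
    (ht.comp (f := id) (g := Fin.succ) Function.injective_id (Fin.succ_injective _)).nondeg θ
      (fun j => η j.succ)
  rw [coeffLeft_mul_crossProd hn' i, expShift_add_div_sub, wprod_succAbove v θ i,
    wprod_succAbove w η 0]
  simp only [delEquiv_apply, Fin.zero_succAbove, wKer, shiftKer]
  unfold expShift
  ring

lemma tendsto_exp_ratio {s s' : Λ → ℝ} (hs : Tendsto s l (𝓝 0)) (hs' : Tendsto s' l (𝓝 0))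
    (x y : ℝ) : ∃ L, Tendsto (fun t =>
      (exp (x + ((-s t : ℝ) : ℂ) * I) - exp (y + ((-s' t : ℝ) : ℂ) * I)) /
      (exp (x + ((-s t : ℝ) : ℂ) * I) + exp (y + ((-s' t : ℝ) : ℂ) * I)))
      l (𝓝 L) := by
  have := tendsto_expShift_ratio (l := l) (a := fun t => ![-s t, -s' t])
    (by intro i; fin_cases i
        · simpa using hs.neg
        · simpa using hs'.neg) ![x, y] 0 1
  simpa [expShift] using this

/-- Splitting off the first and a further coordinate. -/
def delEquiv2 (n : ℕ) (j : Fin (n + 1)) : (Fin (n + 1 + 1) → ℝ) ≃ᵐ (ℝ × ℝ) × (Fin n → ℝ) :=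
  ((delEquiv (n + 1) 0).trans ((MeasurableEquiv.refl ℝ).prodCongr (delEquiv n j))).trans
    MeasurableEquiv.prodAssoc.symm

lemma delEquiv2_apply {n : ℕ} (j : Fin (n + 1)) (η : Fin (n + 1 + 1) → ℝ) :
    delEquiv2 n j η = ((η 0, η j.succ), fun k => η (j.succAbove k).succ) := rfl

lemma measurePreserving_delEquiv2 (n : ℕ) (j : Fin (n + 1)) :
    MeasurePreserving (delEquiv2 n j) volume ((volume.prod volume).prod volume) :=
  (measurePreserving_prodAssoc.symm _).comp
    (((MeasurePreserving.id _).prod (measurePreserving_delEquiv n j)).comp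
      (measurePreserving_delEquiv (n + 1) 0))

/-- The term in the expansion of the kernel given by the pole in `η_0` at `η_{j+1} + i π`. -/
lemma good_term_right [l.IsCountablyGenerated] {v w : ℝ → ℂ}
    (hw : SqInt volume w) {m n : ℕ}
    {a : Λ → Fin m → ℝ} {b : Λ → Fin (n + 1 + 1) → ℝ} (h : ShiftFam l a b) (j : Fin (n + 1))
    {C : ℝ} (hK : Good l volume volume (fun t => wKer v w (a t)
      (fun k => b t (j.succAbove k).succ)) C) :
    Good l volume volume (fun t θ η => wprod v θ *
      ((expShift (fun j => -b t j) η 0 - expShift (fun j => -b t j) η j.succ) /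
        (expShift (fun j => -b t j) η 0 + expShift (fun j => -b t j) η j.succ) *
      (coeffRight (expShift (a t) θ) (fun j => expShift (fun j => -b t j) η j.succ) j *
        crossProd (expShift (a t) θ) (fun j => expShift (fun j => -b t j) η j.succ))) * wprod w η)
      (C * (l2 volume w * l2 volume w)) := by
  have h1 := hK.tensor_right (hw.tensor hw) (c := fun t z =>
      (exp (z.1 + ((-b t 0 : ℝ) : ℂ) * I) -
        exp (z.2 + ((-b t j.succ : ℝ) : ℂ) * I)) /
      (exp (z.1 + ((-b t 0 : ℝ) : ℂ) * I) +
        exp (z.2 + ((-b t j.succ : ℝ) : ℂ) * I)))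
    (fun t => by fun_prop)
    (h.small.mono fun t ht z => by
      refine norm_exp_sub_div_add_le ?_
      have h1 := abs_lt.1 (ht.abs_b 0)
      have h2 := abs_lt.1 (ht.abs_b j.succ)
      simp only [Complex.add_im, Complex.ofReal_im, Complex.mul_im, Complex.ofReal_re,
        Complex.I_im, Complex.I_re, mul_one, mul_zero, add_zero, zero_add]
      rw [abs_le]
      constructor <;> linarith)
    (fun z => tendsto_exp_ratio (h.lim_b 0) (h.lim_b j.succ) z.1 z.2)
  rw [l2_tensor] at h1
  have h2 := h1.comp (MeasurableEquiv.refl _) (delEquiv2 n j) (MeasurePreserving.id _)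
    (measurePreserving_delEquiv2 n j)
  have h3 := h2.const_mul ((-1) ^ m * (-1) ^ (j : ℕ))
  rw [norm_mul, norm_pow, norm_pow, norm_neg, norm_one, one_pow, one_pow, one_mul, one_mul] at h3
  refine h3.congr ?_
  filter_upwards [h.small] with t ht
  funext θ η
  have hn' : Nondeg (expShift (a t) θ) (fun j : Fin (n + 1) => expShift (fun j => -b t j) η j.succ) :=
    (ht.comp (f := id) (g := Fin.succ) Function.injective_id (Fin.succ_injective _)).nondeg θ
      (fun j => η j.succ)
  rw [coeffRight_mul_crossProd hn' j, wprod_succAbove w η 0,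
    wprod_succAbove w (fun k => η (Fin.succAbove 0 k)) j]
  simp only [delEquiv2_apply, Fin.zero_succAbove, wKer, shiftKer, MeasurableEquiv.refl_apply]
  unfold expShift
  ring

/-- The weighted form factor kernels are bounded and convergent near the nodes. -/
theorem good_wKer [l.IsCountablyGenerated] {v w : ℝ → ℂ} (hv : SqInt volume v)
    (hw : SqInt volume w) (hv1 : ∀ u, ‖v u‖ ≤ 1) (hw1 : ∀ u, ‖w u‖ ≤ 1) {c c' : ℝ}
    (hc : l2 volume v ≤ c) (hc1 : 1 ≤ c) (hc' : l2 volume w ≤ c') (hc1' : 1 ≤ c') (n : ℕ) :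
    ∀ (m : ℕ) (a : Λ → Fin m → ℝ) (b : Λ → Fin n → ℝ), ShiftFam l a b →
      Good l volume volume (fun t => wKer v w (a t) (b t)) (kerBound c c' m n) := by
  have hpi := Real.pi_pos
  have hv0 := l2_nonneg (μ := volume) v
  have hw0 := l2_nonneg (μ := volume) w
  induction n using Nat.strong_induction_on with
  | _ n ih =>
  intro m a b h
  rcases n with _ | n
  · have h1 := Good.of_bounded (l := l) (sqInt_wprod hv m) (sqInt_wprod hw 0) (R := 1)
      (c := fun t θ _ => tprod (expShift (a t) θ)) zero_le_one
      (fun t => measurable_tprod fun i => (measurable_expShift (a t) i).comp measurable_fst)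
      (h.small.mono fun t ht θ _ => norm_tprod_expShift_le ht.abs_a θ)
      (.of_forall fun z => tendsto_tprod_expShift h.lim_a z.1)
    rw [l2_wprod, l2_wprod, pow_zero, mul_one, one_mul] at h1
    refine (h1.congr (.of_forall fun t => ?_)).mono ?_
    · funext θ η
      simp [wKer, shiftKer, crossProd, tprod, wprod]
      ring
    · rw [kerBound, pow_zero, mul_one]
      gcongr
  · have ih' := ih n (Nat.lt_succ_self n)
    set S : ℝ := (4 * Real.pi + 12) * (m + (n + 1 : ℕ) + 1) * c' ^ 2 with hS
    have hc'2 : 1 ≤ c' ^ 2 := one_le_pow₀ hc1'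
    have hc'le : c' ≤ c' ^ 2 := le_self_pow₀ hc1' two_ne_zero
    have hS1 : 1 ≤ S := by
      have h1 : (1 : ℝ) ≤ m + (n + 1 : ℕ) + 1 := by
        have h2 : (0 : ℝ) ≤ m := Nat.cast_nonneg _
        have h3 : (0 : ℝ) ≤ (n + 1 : ℕ) := Nat.cast_nonneg _
        linarith
      have h2 : (1 : ℝ) ≤ 4 * Real.pi + 12 := by linarith
      exact one_le_mul_of_one_le_of_one_le (one_le_mul_of_one_le_of_one_le h2 h1) hc'2
    have hB : ∀ m' n' : ℕ, m' ≤ m → n' ≤ n → kerBound c c' m' n' ≤ c ^ m' * S ^ n' := by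
      intro m' n' h1 h2
      rw [kerBound, hS]
      have h1' : (m' : ℝ) ≤ m := Nat.cast_le.2 h1
      have h2' : (n' : ℝ) ≤ (n + 1 : ℕ) := Nat.cast_le.2 (by omega)
      have h3 : 0 ≤ 4 * Real.pi + 12 := by linarith
      gcongr
    have hb : ShiftFam l a (fun t (j : Fin n) => b t j.succ) :=
      h.comp (f := id) (g := Fin.succ) Function.injective_id (Fin.succ_injective _)
    -- the constant term
    have hE : Good l volume volume (fun t θ η => wprod v θ *
        crossProd (expShift (a t) θ) (fun j : Fin n => expShift (fun j => -b t j) η j.succ) *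
          wprod w η) (c ^ m * S ^ n * c' ^ 2) := by
      have h1 := (ih' m a _ hb).tensor_right hw (c := fun _ _ => 1) (fun _ => measurable_const)
        (.of_forall fun _ _ => by simp) (fun _ => ⟨1, tendsto_const_nhds⟩)
      have h2 := h1.comp (MeasurableEquiv.refl _) (delEquiv n 0) (MeasurePreserving.id _)
        (measurePreserving_delEquiv n 0)
      refine (h2.congr (.of_forall fun t => ?_)).mono ?_
      · funext θ η
        rw [wprod_succAbove w η 0]
        simp only [delEquiv_apply, Fin.zero_succAbove, wKer, shiftKer, MeasurableEquiv.refl_apply]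
        unfold expShift
        ring
      · exact mul_le_mul (hB m n le_rfl le_rfl) (hc'.trans hc'le) hw0 (by positivity)
    have hI : ∀ i : Fin m, Good l volume volume (fun t θ η => wprod v θ *
        ((expShift (a t) θ i + expShift (fun j => -b t j) η 0) /
          (expShift (a t) θ i - expShift (fun j => -b t j) η 0) *
        (coeffLeft (expShift (a t) θ) (fun j => expShift (fun j => -b t j) η j.succ) i *
          crossProd (expShift (a t) θ) (fun j => expShift (fun j => -b t j) η j.succ))) *
            wprod w η) ((4 * Real.pi + 11) * (c ^ m * S ^ n * c' ^ 2)) := by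
      rcases m with _ | m
      · exact fun i => i.elim0
      intro i
      refine (good_term_left hv hw hv1 hw1 h i (ih' m _ _ (h.comp
        (f := i.succAbove) (g := Fin.succ) Fin.succAbove_right_injective
        (Fin.succ_injective _)))).mono ?_
      have h1 := hB m n (Nat.le_succ m) le_rfl
      have hK0 : 0 ≤ kerBound c c' m n := by unfold kerBound; positivity
      have h2 : l2 volume v * l2 volume w ≤ c * c' ^ 2 :=
        mul_le_mul hc (hc'.trans hc'le) hw0 (by linarith)
      have h3 : (1 : ℝ) ≤ c * c' ^ 2 := one_le_mul_of_one_le_of_one_le hc1 hc'2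
      calc _ ≤ 4 * Real.pi * kerBound c c' m n * (c * c' ^ 2) +
            11 * kerBound c c' m n * (c * c' ^ 2) := by
            refine add_le_add (le_mul_of_one_le_right (by positivity) h3) ?_
            gcongr
        _ = (4 * Real.pi + 11) * (kerBound c c' m n * (c * c' ^ 2)) := by ring
        _ ≤ (4 * Real.pi + 11) * (c ^ m * S ^ n * (c * c' ^ 2)) := by gcongr
        _ = _ := by rw [pow_succ]; ring
    have hJ : ∀ j : Fin n, Good l volume volume (fun t θ η => wprod v θ *
        ((expShift (fun j => -b t j) η 0 - expShift (fun j => -b t j) η j.succ) /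
          (expShift (fun j => -b t j) η 0 + expShift (fun j => -b t j) η j.succ) *
        (coeffRight (expShift (a t) θ) (fun j => expShift (fun j => -b t j) η j.succ) j *
          crossProd (expShift (a t) θ) (fun j => expShift (fun j => -b t j) η j.succ))) *
            wprod w η) (c ^ m * S ^ n * c' ^ 2) := by
      rcases n with _ | n
      · exact fun j => j.elim0
      intro j
      refine (good_term_right hw h j (ih n (by omega) m _ _ (h.comp
        (f := id) (g := fun k => (j.succAbove k).succ) Function.injective_id
        ((Fin.succ_injective _).comp Fin.succAbove_right_injective)))).mono ?_
      have h1 := hB m n le_rfl (Nat.le_succ n)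
      refine mul_le_mul (h1.trans ?_) ?_ (mul_nonneg hw0 hw0) (by positivity)
      · gcongr
        exact Nat.le_succ n
      · rw [sq]; exact mul_le_mul hc' hc' hw0 (by linarith)
    have hsum := ((hE.const_mul (parityConst (m + n))).add
      (((Good.sum univ fun i _ => hI i).const_mul (-1)).add
        (Good.sum univ fun j _ => hJ j))).const_mul ((-1) ^ m)
    refine (hsum.congr ?_).mono ?_
    · filter_upwards [h.small] with t ht
      funext θ η
      rw [wKer, shiftKer, crossProd_expand (ht.nondeg θ η)]
      simp only [mul_add, mul_sub, add_mul, sub_mul, Finset.mul_sum, Finset.sum_mul, neg_mul,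
        one_mul, Finset.sum_neg_distrib]
      rw [sub_eq_add_neg]
      simp only [← Finset.sum_neg_distrib]
      rw [← add_assoc]
      congr 1
      · congr 1
        · ring
        · rw [Finset.mul_sum]
          refine sum_congr rfl fun i _ => ?_
          ring
      · refine sum_congr rfl fun i _ => ?_
        ring
    · simp only [norm_pow, norm_neg, norm_one, one_pow, one_mul, Finset.sum_const,
        Finset.card_univ, Fintype.card_fin, nsmul_eq_mul]
      have hT : 0 ≤ c ^ m * S ^ n * c' ^ 2 := by positivity
      calc _ ≤ 1 * (c ^ m * S ^ n * c' ^ 2) + (m * ((4 * Real.pi + 11) *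
            (c ^ m * S ^ n * c' ^ 2)) + n * (c ^ m * S ^ n * c' ^ 2)) := by
            gcongr
            exact norm_parityConst_le _
        _ = (1 + m * (4 * Real.pi + 11) + n) * (c ^ m * S ^ n * c' ^ 2) := by ring
        _ ≤ ((4 * Real.pi + 12) * (m + (n + 1 : ℕ) + 1)) * (c ^ m * S ^ n * c' ^ 2) := by
            gcongr
            push_cast
            nlinarith [Nat.cast_nonneg (α := ℝ) m, Nat.cast_nonneg (α := ℝ) n]
        _ = kerBound c c' m (n + 1) := by
            rw [kerBound, ← hS, pow_succ S n]
            have : S ^ n * S = S ^ n *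
              ((4 * Real.pi + 12) * (m + (n + 1 : ℕ) + 1) * c' ^ 2) := by rw [← hS]
            rw [this]
            ring

end Weighted


section Mult

variable {X Y : Type*} [MeasurableSpace X] [MeasurableSpace Y] {μ : Measure X} {ν : Measure Y}
  [SFinite μ] [SFinite ν] {Λ : Type*} {l : Filter Λ}

/-- Families of functions that are pointwise multipliers of good families of kernels. -/
structure Mult (l : Filter Λ) (μ : Measure X) (ν : Measure Y) (s : Λ → X → Y → ℂ) (C : ℝ) :
    Prop where
  nonneg : 0 ≤ C
  good : ∀ K C', Good l μ ν K C' → Good l μ ν (fun t x y => s t x y * K t x y) (C * C')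

lemma Mult.congr {s s' : Λ → X → Y → ℂ} {C : ℝ} (h : Mult l μ ν s C)
    (hs : ∀ᶠ t in l, ∀ x y, s t x y = s' t x y) : Mult l μ ν s' C :=
  ⟨h.nonneg, fun K D hK => (h.good K D hK).congr (hs.mono fun t ht => by
    funext x y; rw [ht])⟩

lemma Mult.mul {s s' : Λ → X → Y → ℂ} {C C' : ℝ} (h : Mult l μ ν s C) (h' : Mult l μ ν s' C') :
    Mult l μ ν (fun t x y => s t x y * s' t x y) (C * C') :=
  ⟨mul_nonneg h.nonneg h'.nonneg, fun K D hK => by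
    simpa only [mul_assoc] using h.good _ _ (h'.good K D hK)⟩

lemma Mult.add {s s' : Λ → X → Y → ℂ} {C C' : ℝ} (h : Mult l μ ν s C) (h' : Mult l μ ν s' C') :
    Mult l μ ν (fun t x y => s t x y + s' t x y) (C + C') :=
  ⟨add_nonneg h.nonneg h'.nonneg, fun K D hK => by
    simpa only [add_mul] using (h.good K D hK).add (h'.good K D hK)⟩

lemma Mult.zero : Mult l μ ν (fun _ _ _ => 0) 0 :=
  ⟨le_rfl, fun K D _ => by simpa using Good.zero⟩

lemma Mult.const (c : ℂ) : Mult l μ ν (fun _ _ _ => c) ‖c‖ :=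
  ⟨norm_nonneg _, fun _ _ hK => hK.const_mul c⟩

lemma Mult.sum {ι : Type*} (S : Finset ι) {s : ι → Λ → X → Y → ℂ} {C : ι → ℝ}
    (h : ∀ i ∈ S, Mult l μ ν (s i) (C i)) :
    Mult l μ ν (fun t x y => ∑ i ∈ S, s i t x y) (∑ i ∈ S, C i) := by
  classical
  induction S using Finset.induction_on with
  | empty => simpa using Mult.zero
  | insert a S ha ih =>
    simp only [Finset.sum_insert ha]
    exact (h a (Finset.mem_insert_self _ _)).add
      (ih fun i hi => h i (Finset.mem_insert_of_mem hi))

lemma Mult.swap {s : Λ → X → Y → ℂ} {C : ℝ} (h : Mult l μ ν s C) :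
    Mult l ν μ (fun t y x => s t x y) C :=
  ⟨h.nonneg, fun _ _ hK => (h.good _ _ hK.swap).swap⟩

lemma exists_measurable_lim [l.NeBot] [l.IsCountablyGenerated] {α : Λ → X → ℂ}
    (hm : ∀ t, Measurable (α t)) (hlim : ∀ x, ∃ L, Tendsto (fun t => α t x) l (𝓝 L)) :
    ∃ α0 : X → ℂ, Measurable α0 ∧ ∀ x, Tendsto (fun t => α t x) l (𝓝 (α0 x)) := by
  choose α0 h0 using hlim
  exact ⟨α0, measurable_of_tendsto_metrizable' l hm (tendsto_pi_nhds.2 h0), h0⟩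

lemma tendsto_l2_mul_sub [l.IsCountablyGenerated] {α : Λ → X → ℂ} {α0 : X → ℂ} {A : ℝ}
    (hm : ∀ t, Measurable (α t)) (hm0 : Measurable α0) (hA : ∀ᶠ t in l, ∀ x, ‖α t x‖ ≤ A)
    (hA0 : ∀ x, ‖α0 x‖ ≤ A) (hlim : ∀ x, Tendsto (fun t => α t x) l (𝓝 (α0 x))) {ψ : X → ℂ}
    (hψ : SqInt μ ψ) : Tendsto (fun t => l2 μ (fun x => (α t x - α0 x) * ψ x)) l (𝓝 0) := by
  unfold l2
  rw [← Real.sqrt_zero]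
  refine (Real.continuous_sqrt.tendsto 0).comp ?_
  have := tendsto_integral_filter_of_dominated_convergence (μ := μ) (l := l)
    (F := fun t x => ‖(α t x - α0 x) * ψ x‖ ^ 2) (f := fun _ => (0 : ℝ))
    (fun x => (2 * A) ^ 2 * ‖ψ x‖ ^ 2)
    (.of_forall fun t => ((((hm t).sub hm0).mul hψ.meas).norm.pow_const
      2).aestronglyMeasurable) ?_ (hψ.int.const_mul _) (.of_forall fun x => ?_)
  · simpa using this
  · filter_upwards [hA] with t ht
    refine .of_forall fun x => ?_
    rw [norm_of_nonneg (by positivity), norm_mul, mul_pow]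
    gcongr
    linarith [norm_sub_le (α t x) (α0 x), ht x, hA0 x]
  · have h1 : Tendsto (fun t => ‖(α t x - α0 x) * ψ x‖ ^ 2) l (𝓝 (‖(α0 x - α0 x) * ψ x‖ ^ 2)) :=
      ((((hlim x).sub_const _).mul_const _).norm).pow 2
    simpa using h1

/-- Convergence of the forms on convergent arguments. -/
lemma Good.tendsto_mul [l.IsCountablyGenerated] {K : Λ → X → Y → ℂ} {C : ℝ} (hK : Good l μ ν K C)
    {α : Λ → X → ℂ} {β : Λ → Y → ℂ} {A B : ℝ} (hαm : ∀ t, Measurable (α t))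
    (hβm : ∀ t, Measurable (β t)) (hA : ∀ᶠ t in l, ∀ x, ‖α t x‖ ≤ A)
    (hB : ∀ᶠ t in l, ∀ x, ‖β t x‖ ≤ B) (hα : ∀ x, ∃ L, Tendsto (fun t => α t x) l (𝓝 L))
    (hβ : ∀ x, ∃ L, Tendsto (fun t => β t x) l (𝓝 L)) {ψ : X → ℂ} {χ : Y → ℂ}
    (hψ : SqInt μ ψ) (hχ : SqInt ν χ) :
    ∃ L, Tendsto (fun t => formInt μ ν (K t) (fun x => α t x * ψ x) (fun y => β t y * χ y)) l
      (𝓝 L) := by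
  rcases l.eq_or_neBot with rfl | hne
  · exact ⟨0, tendsto_bot⟩
  obtain ⟨α0, hα0m, hα0⟩ := exists_measurable_lim hαm hα
  obtain ⟨β0, hβ0m, hβ0⟩ := exists_measurable_lim hβm hβ
  have hA0 : ∀ x, ‖α0 x‖ ≤ A := fun x => le_of_tendsto (hα0 x).norm (hA.mono fun t ht => ht x)
  have hB0 : ∀ x, ‖β0 x‖ ≤ B := fun x => le_of_tendsto (hβ0 x).norm (hB.mono fun t ht => ht x)
  obtain ⟨L, hL⟩ := hK.conv _ _ (hψ.mul_bdd hα0m hA0) (hχ.mul_bdd hβ0m hB0)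
  have hαl := tendsto_l2_mul_sub hαm hα0m hA hA0 hα0 hψ
  have hβl := tendsto_l2_mul_sub hβm hβ0m hB hB0 hβ0 hχ
  have hB' : ∀ᶠ t in l, l2 ν (fun y => β t y * χ y) ≤ |B| * l2 ν χ := hB.mono fun t ht =>
    l2_mul_le hχ (abs_nonneg _) fun y => (ht y).trans (le_abs_self _)
  refine ⟨L, ?_⟩
  rw [tendsto_iff_norm_sub_tendsto_zero] at hL ⊢
  have hsum : Tendsto (fun t => C * (l2 μ (fun x => (α t x - α0 x) * ψ x) * (|B| * l2 ν χ)) +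
      C * (l2 μ (fun x => α0 x * ψ x) * l2 ν (fun y => (β t y - β0 y) * χ y)) +
      ‖formInt μ ν (K t) (fun x => α0 x * ψ x) (fun y => β0 y * χ y) - L‖) l (𝓝 0) := by
    have := (((hαl.mul_const (|B| * l2 ν χ)).const_mul C).add
      ((hβl.const_mul (l2 μ (fun x => α0 x * ψ x))).const_mul C)).add hL
    simpa using this
  refine tendsto_of_tendsto_of_tendsto_of_le_of_le' tendsto_const_nhds hsum
    (.of_forall fun _ => norm_nonneg _) ?_
  filter_upwards [hK.bdd, hB', hA, hB] with t ht hBt hAt hBBt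
  have hψ0 := hψ.mul_bdd hα0m hA0
  have hψt := hψ.mul_bdd (hαm t) hAt
  have hχ0 := hχ.mul_bdd hβ0m hB0
  have hχt := hχ.mul_bdd (hβm t) hBBt
  have e1 : (fun x => (α t x - α0 x) * ψ x) = fun x => α t x * ψ x - α0 x * ψ x := by
    funext x; ring
  have e2 : (fun x => (β t x - β0 x) * χ x) = fun x => β t x * χ x - β0 x * χ x := by
    funext x; ring
  have b1 := ht.bound _ _ (hψt.sub hψ0) hχt
  have b2 := ht.bound _ _ hψ0 (hχt.sub hχ0)
  rw [← e1] at b1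
  rw [← e2] at b2
  have d1 := formInt_sub_left ht.sq hψt hψ0 hχt
  have d2 := formInt_sub_left (K := fun y x => K t x y) ht.sq.swap hχt hχ0 hψ0
  rw [← e1] at d1
  rw [← e2] at d2
  rw [formInt_swap (K t), formInt_swap (K t), formInt_swap (K t)] at d2
  rw [← d1] at b1
  rw [← d2] at b2
  have h0 := l2_nonneg (μ := μ) (fun x => (α t x - α0 x) * ψ x)
  have hC := ht.nonneg
  calc _ = ‖(formInt μ ν (K t) (fun x => α t x * ψ x) (fun y => β t y * χ y) -
          formInt μ ν (K t) (fun x => α0 x * ψ x) (fun y => β t y * χ y)) +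
        (formInt μ ν (K t) (fun x => α0 x * ψ x) (fun y => β t y * χ y) -
          formInt μ ν (K t) (fun x => α0 x * ψ x) (fun y => β0 y * χ y)) +
        (formInt μ ν (K t) (fun x => α0 x * ψ x) (fun y => β0 y * χ y) - L)‖ := by
        congr 1; ring
    _ ≤ _ := (norm_add₃_le).trans (by
        refine add_le_add (add_le_add (b1.trans ?_) b2) le_rfl
        gcongr)

/-- Superpositions of products of functions of the first and of the second variable are
multipliers. -/
lemma Mult.superpose [l.IsCountablyGenerated] {Z : Type*} [MeasurableSpace Z] {ρ : Measure Z}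
    [SFinite ρ] {γ : Z → ℂ} {α : Λ → Z → X → ℂ} {β : Λ → Z → Y → ℂ} {A B : Z → ℝ}
    (hγ : Measurable γ) (hαm : ∀ t, Measurable (fun p : Z × X => α t p.1 p.2))
    (hβm : ∀ t, Measurable (fun p : Z × Y => β t p.1 p.2))
    (hA0 : ∀ z, 0 ≤ A z) (hB0 : ∀ z, 0 ≤ B z)
    (hA : ∀ᶠ t in l, ∀ z x, ‖α t z x‖ ≤ A z) (hB : ∀ᶠ t in l, ∀ z x, ‖β t z x‖ ≤ B z)
    (hα : ∀ z x, ∃ L, Tendsto (fun t => α t z x) l (𝓝 L))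
    (hβ : ∀ z x, ∃ L, Tendsto (fun t => β t z x) l (𝓝 L))
    (hint : Integrable (fun z => ‖γ z‖ * (A z * B z)) ρ) :
    Mult l μ ν (fun t x y => ∫ z, γ z * (α t z x * β t z y) ∂ρ)
      (∫ z, ‖γ z‖ * (A z * B z) ∂ρ) := by
  set I : ℝ := ∫ z, ‖γ z‖ * (A z * B z) ∂ρ with hI
  have hI0 : 0 ≤ I := integral_nonneg fun z =>
    mul_nonneg (norm_nonneg _) (mul_nonneg (hA0 z) (hB0 z))
  refine ⟨hI0, fun K C hK => ?_⟩
  have hmeas3 : ∀ t, Measurable (fun p : (X × Y) × Z => γ p.2 * (α t p.2 p.1.1 * β t p.2 p.1.2)) := by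
    intro t
    have h1 : Measurable fun p : (X × Y) × Z => α t p.2 p.1.1 :=
      (hαm t).comp (measurable_snd.prodMk (measurable_fst.comp measurable_fst))
    have h2 : Measurable fun p : (X × Y) × Z => β t p.2 p.1.2 :=
      (hβm t).comp (measurable_snd.prodMk (measurable_snd.comp measurable_fst))
    exact (hγ.comp measurable_snd).mul (h1.mul h2)
  have hsm : ∀ t, Measurable (fun p : X × Y => ∫ z, γ z * (α t z p.1 * β t z p.2) ∂ρ) := fun t =>
    (StronglyMeasurable.integral_prod_right' (hmeas3 t).stronglyMeasurable).measurable
  have hsb : ∀ᶠ t in l, ∀ z x y, ‖γ z * (α t z x * β t z y)‖ ≤ ‖γ z‖ * (A z * B z) := by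
    filter_upwards [hA, hB] with t h1 h2 z x y
    rw [norm_mul, norm_mul]
    have := hA0 z
    gcongr
    exacts [h1 z x, h2 z y]
  have hform : ∀ᶠ t in l, ∀ ψ χ, SqInt μ ψ → SqInt ν χ →
      formInt μ ν (fun x y => (∫ z, γ z * (α t z x * β t z y) ∂ρ) * K t x y) ψ χ =
        ∫ z, γ z * formInt μ ν (K t) (fun x => α t z x * ψ x) (fun y => β t z y * χ y) ∂ρ := by
    filter_upwards [hsb, hK.bdd] with t hst hKt ψ χ hψ hχ
    have hint2 : Integrable (fun p : (X × Y) × Z => (γ p.2 * (α t p.2 p.1.1 * β t p.2 p.1.2)) *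
        (ψ p.1.1 * K t p.1.1 p.1.2 * χ p.1.2)) ((μ.prod ν).prod ρ) := by
      have h1 : Integrable (fun p : (X × Y) × Z => ‖ψ p.1.1 * K t p.1.1 p.1.2 * χ p.1.2‖ *
          (‖γ p.2‖ * (A p.2 * B p.2))) ((μ.prod ν).prod ρ) :=
        (formInt_integrable hKt.sq hψ hχ).norm.mul_prod hint
      refine h1.mono' ?_ (.of_forall fun p => ?_)
      · have h2 : Measurable fun p : (X × Y) × Z => ψ p.1.1 * K t p.1.1 p.1.2 * χ p.1.2 :=
          (((hψ.meas.comp measurable_fst).mul hKt.sq.meas).mul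
            (hχ.meas.comp measurable_snd)).comp measurable_fst
        exact ((hmeas3 t).mul h2).aestronglyMeasurable
      · rw [norm_mul, mul_comm]
        gcongr
        exact hst _ _ _
    unfold formInt
    calc _ = ∫ q : X × Y, ∫ z, (γ z * (α t z q.1 * β t z q.2)) *
          (ψ q.1 * K t q.1 q.2 * χ q.2) ∂ρ ∂(μ.prod ν) := by
          refine integral_congr_ae (.of_forall fun q => ?_)
          simp only
          rw [integral_mul_const]
          ring
      _ = ∫ z, ∫ q : X × Y, (γ z * (α t z q.1 * β t z q.2)) *
          (ψ q.1 * K t q.1 q.2 * χ q.2) ∂(μ.prod ν) ∂ρ := integral_integral_swap hint2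
      _ = _ := by
          refine integral_congr_ae (.of_forall fun z => ?_)
          simp only
          rw [← integral_const_mul]
          refine integral_congr_ae (.of_forall fun q => ?_)
          simp only
          ring
  have hbd : ∀ᶠ t in l, ∀ ψ χ, SqInt μ ψ → SqInt ν χ → ∀ z,
      ‖γ z * formInt μ ν (K t) (fun x => α t z x * ψ x) (fun y => β t z y * χ y)‖ ≤
        ‖γ z‖ * (A z * B z) * (C * (l2 μ ψ * l2 ν χ)) := by
    filter_upwards [hK.bdd, hA, hB] with t hKt hAt hBt ψ χ hψ hχ z
    have hz1 : Measurable (α t z) := (hαm t).comp measurable_prodMk_left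
    have hz2 : Measurable (β t z) := (hβm t).comp measurable_prodMk_left
    have h1 := hKt.bound _ _ (hψ.mul_bdd hz1 (hAt z)) (hχ.mul_bdd hz2 (hBt z))
    have h2 := mul_le_mul (l2_mul_le hψ (hA0 z) (hAt z)) (l2_mul_le hχ (hB0 z) (hBt z))
      (l2_nonneg _) (mul_nonneg (hA0 z) (l2_nonneg _))
    rw [norm_mul, mul_assoc]
    refine mul_le_mul_of_nonneg_left (h1.trans ?_) (norm_nonneg _)
    calc _ ≤ C * (A z * l2 μ ψ * (B z * l2 ν χ)) := mul_le_mul_of_nonneg_left h2 hKt.nonneg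
      _ = _ := by ring
  refine ⟨?_, fun ψ χ hψ hχ => ?_⟩
  · filter_upwards [hK.bdd, hsb, hform, hbd] with t hKt hst hft hbt
    refine ⟨?_, mul_nonneg hI0 hKt.nonneg, fun ψ χ hψ hχ => ?_⟩
    · refine hKt.sq.mul_bdd (hsm t) (c := I) fun p => ?_
      exact norm_integral_le_of_norm_le hint (.of_forall fun z => hst z _ _)
    · rw [hft ψ χ hψ hχ, mul_assoc, hI, ← integral_mul_const]
      exact norm_integral_le_of_norm_le (hint.mul_const _)
        (.of_forall fun z => hbt ψ χ hψ hχ z)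
  · rcases l.eq_or_neBot with rfl | hne
    · exact ⟨0, tendsto_bot⟩
    have hex : ∀ z, ∃ L, Tendsto (fun t => γ z *
        formInt μ ν (K t) (fun x => α t z x * ψ x) (fun y => β t z y * χ y)) l (𝓝 L) := by
      intro z
      obtain ⟨L, hL⟩ := hK.tendsto_mul (α := fun t => α t z) (β := fun t => β t z)
        (fun t => (hαm t).comp measurable_prodMk_left)
        (fun t => (hβm t).comp measurable_prodMk_left) (hA.mono fun t ht => ht z)
        (hB.mono fun t ht => ht z) (hα z) (hβ z) hψ hχ
      exact ⟨_, hL.const_mul (γ z)⟩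
    choose L hL using hex
    refine ⟨∫ z, L z ∂ρ, Tendsto.congr' (hform.mono fun t ht => (ht ψ χ hψ hχ).symm) ?_⟩
    refine tendsto_integral_filter_of_dominated_convergence
      (fun z => ‖γ z‖ * (A z * B z) * (C * (l2 μ ψ * l2 ν χ))) ?_ ?_ (hint.mul_const _)
      (.of_forall hL)
    · filter_upwards [hK.bdd] with t ht
      exact (hγ.mul (measurable_formInt ht.sq.meas ((hαm t).mul (hψ.meas.comp measurable_snd))
        ((hβm t).mul (hχ.meas.comp measurable_snd)))).aestronglyMeasurable
    · filter_upwards [hbd] with t ht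
      exact .of_forall fun z => ht ψ χ hψ hχ z

/-- Bounded convergent products of functions of one variable are multipliers. -/
lemma Mult.tensor [l.IsCountablyGenerated] {α : Λ → X → ℂ} {β : Λ → Y → ℂ} {A B : ℝ}
    (hA0 : 0 ≤ A) (hB0 : 0 ≤ B) (hαm : ∀ t, Measurable (α t)) (hβm : ∀ t, Measurable (β t))
    (hA : ∀ᶠ t in l, ∀ x, ‖α t x‖ ≤ A) (hB : ∀ᶠ t in l, ∀ x, ‖β t x‖ ≤ B)
    (hα : ∀ x, ∃ L, Tendsto (fun t => α t x) l (𝓝 L))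
    (hβ : ∀ x, ∃ L, Tendsto (fun t => β t x) l (𝓝 L)) :
    Mult l μ ν (fun t x y => α t x * β t y) (A * B) := by
  have := Mult.superpose (μ := μ) (ν := ν) (l := l) (ρ := Measure.dirac ()) (γ := fun _ => 1)
    (α := fun t _ => α t) (β := fun t _ => β t) (A := fun _ => A) (B := fun _ => B)
    measurable_const (fun t => (hαm t).comp measurable_snd) (fun t => (hβm t).comp measurable_snd)
    (fun _ => hA0) (fun _ => hB0) (hA.mono fun t ht _ => ht) (hB.mono fun t ht _ => ht)
    (fun _ => hα) (fun _ => hβ) (by simp)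
  simpa using this

lemma Mult.left [l.IsCountablyGenerated] {α : X → ℂ} {A : ℝ} (hA0 : 0 ≤ A) (hαm : Measurable α)
    (hA : ∀ x, ‖α x‖ ≤ A) : Mult l μ ν (fun _ x _ => α x) A := by
  simpa using Mult.tensor (μ := μ) (ν := ν) (l := l) (α := fun _ => α) (β := fun _ _ => 1) hA0
    zero_le_one (fun _ => hαm) (fun _ => measurable_const) (.of_forall fun _ => hA)
    (.of_forall fun _ _ => by simp) (fun x => ⟨_, tendsto_const_nhds⟩)
    (fun _ => ⟨_, tendsto_const_nhds⟩)

lemma Mult.right [l.IsCountablyGenerated] {β : Y → ℂ} {B : ℝ} (hB0 : 0 ≤ B) (hβm : Measurable β)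
    (hB : ∀ x, ‖β x‖ ≤ B) : Mult l μ ν (fun _ _ y => β y) B :=
  (Mult.left (μ := ν) (ν := μ) hB0 hβm hB).swap

end Mult


section Fourier

/-- The plane wave `exp(i p·x)`. -/
def planeWave (p : ℂ × ℂ) (x : ℝ × ℝ) : ℂ :=
  exp (I * (p.1 * (x.1 : ℂ) - p.2 * (x.2 : ℂ)))

lemma fourier_eq (g : ℝ × ℝ → ℂ) (p : ℂ × ℂ) :
    fourier g p = (2 * (Real.pi : ℂ))⁻¹ * ∫ x : ℝ × ℝ, planeWave p x * g x := rfl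

lemma continuous_planeWave (p : ℂ × ℂ) : Continuous (planeWave p) := by
  unfold planeWave; fun_prop

lemma integrable_planeWave_mul {g : ℝ × ℝ → ℂ} (hg : Continuous g) (hc : HasCompactSupport g)
    (p : ℂ × ℂ) : Integrable (fun x => planeWave p x * g x) :=
  ((continuous_planeWave p).mul hg).integrable_of_hasCompactSupport hc.mul_left

lemma contDiff_planeWave (p : ℂ × ℂ) : ContDiff ℝ ∞ (planeWave p) := by
  unfold planeWave
  have h1 : ContDiff ℝ ∞ fun x : ℝ × ℝ => (x.1 : ℂ) :=
    Complex.ofRealCLM.contDiff.comp contDiff_fst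
  have h2 : ContDiff ℝ ∞ fun x : ℝ × ℝ => (x.2 : ℂ) :=
    Complex.ofRealCLM.contDiff.comp contDiff_snd
  exact (contDiff_const.mul ((contDiff_const.mul h1).sub (contDiff_const.mul h2))).cexp

lemma fderiv_planeWave_time (p : ℂ × ℂ) (x : ℝ × ℝ) :
    fderiv ℝ (planeWave p) x (1, 0) = I * p.1 * planeWave p x := by
  have hd : DifferentiableAt ℝ (planeWave p) x :=
    (contDiff_planeWave p).differentiable (by simp) x
  have h0 : HasDerivAt (fun t : ℝ => x + t • ((1, 0) : ℝ × ℝ)) (1, 0) 0 := by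
    simpa using ((hasDerivAt_id (0 : ℝ)).smul_const ((1, 0) : ℝ × ℝ)).const_add x
  have h1 : HasDerivAt (fun t : ℝ => planeWave p (x + t • ((1, 0) : ℝ × ℝ)))
      (fderiv ℝ (planeWave p) x (1, 0)) 0 := by
    have := HasFDerivAt.comp_hasDerivAt (f := fun t : ℝ => x + t • ((1, 0) : ℝ × ℝ)) (0 : ℝ)
      (l := planeWave p) (l' := fderiv ℝ (planeWave p) x) (by simpa using hd.hasFDerivAt) h0
    exact this
  have h2 : HasDerivAt (fun t : ℝ => exp (I * (p.1 * ((x.1 + t : ℝ) : ℂ) -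
      p.2 * (x.2 : ℂ)))) (exp (I * (p.1 * ((x.1 + 0 : ℝ) : ℂ) - p.2 * (x.2 : ℂ))) *
        (I * (p.1 * ((1 : ℝ) : ℂ)))) 0 := by
    have h3 : HasDerivAt (fun t : ℝ => ((x.1 + t : ℝ) : ℂ)) ((1 : ℝ) : ℂ) 0 :=
      ((hasDerivAt_id (0 : ℝ)).const_add x.1).ofReal_comp
    exact (((h3.const_mul p.1).sub_const (p.2 * (x.2 : ℂ))).const_mul I).cexp
  have h4 := h1.unique (by simpa [planeWave] using h2)
  rw [h4]
  simp [planeWave]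
  ring

/-- The time derivative. -/
def timeDeriv (g : ℝ × ℝ → ℂ) (x : ℝ × ℝ) : ℂ := fderiv ℝ g x (1, 0)

lemma contDiff_timeDeriv {g : ℝ × ℝ → ℂ} (hg : ContDiff ℝ ∞ g) : ContDiff ℝ ∞ (timeDeriv g) :=
  (hg.fderiv_right (m := ∞) (by simp)).clm_apply contDiff_const

lemma hasCompactSupport_timeDeriv {g : ℝ × ℝ → ℂ} (hg : HasCompactSupport g) :
    HasCompactSupport (timeDeriv g) := hg.fderiv_apply (𝕜 := ℝ) (1, 0)

lemma fourier_timeDeriv {g : ℝ × ℝ → ℂ} (hg : ContDiff ℝ ∞ g) (hc : HasCompactSupport g)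
    (p : ℂ × ℂ) : p.1 * fourier g p = I * fourier (timeDeriv g) p := by
  have h := integral_mul_fderiv_eq_neg_fderiv_mul_of_integrable (μ := (volume : Measure (ℝ × ℝ)))
    (f := planeWave p) (g := g) (v := (1, 0))
    (by
      simp only [fderiv_planeWave_time, mul_assoc]
      exact ((integrable_planeWave_mul hg.continuous hc p).const_mul p.1).const_mul _)
    (integrable_planeWave_mul (contDiff_timeDeriv hg).continuous (hasCompactSupport_timeDeriv hc) p)
    (integrable_planeWave_mul hg.continuous hc p)
    (fun x _ => (contDiff_planeWave p).differentiable (by simp) x)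
    (fun x _ => hg.differentiable (by simp) x)
  simp only [fderiv_planeWave_time, mul_assoc] at h
  rw [fourier_eq, fourier_eq]
  change ∫ x, planeWave p x * timeDeriv g x = _ at h
  rw [h, integral_const_mul, integral_const_mul]
  linear_combination ((p.1 * ((2 * (Real.pi : ℂ))⁻¹ * ∫ x, planeWave p x * g x))) * Complex.I_sq

end Fourier

section Multipliers

/-- The real momentum. -/
def realMomentum (μ : ℝ) {n : ℕ} (θ : Fin n → ℝ) : ℝ × ℝ :=
  (μ * energy θ, μ * ∑ j, Real.sinh (θ j))

lemma measurable_energy {n : ℕ} : Measurable (energy : (Fin n → ℝ) → ℝ) := by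
  unfold energy; fun_prop

lemma continuous_energy {n : ℕ} : Continuous (energy : (Fin n → ℝ) → ℝ) := by
  unfold energy; fun_prop

lemma energy_nonneg {n : ℕ} (θ : Fin n → ℝ) : 0 ≤ energy θ :=
  Finset.sum_nonneg fun _ _ => (Real.cosh_pos _).le

lemma card_le_energy {n : ℕ} (θ : Fin n → ℝ) : n ≤ energy θ := by
  unfold energy
  calc (n : ℝ) = ∑ _j : Fin n, (1 : ℝ) := by simp
    _ ≤ _ := sum_le_sum fun _ _ => Real.one_le_cosh _

lemma cosh_le_energy {n : ℕ} (θ : Fin n → ℝ) (j : Fin n) : Real.cosh (θ j) ≤ energy θ :=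
  Finset.single_le_sum (f := fun j => Real.cosh (θ j)) (fun _ _ => (Real.cosh_pos _).le)
    (mem_univ j)

/-- The function `1 + E`. -/
def energy1 {n : ℕ} (θ : Fin n → ℝ) : ℝ := 1 + energy θ

lemma one_le_energy1 {n : ℕ} (θ : Fin n → ℝ) : 1 ≤ energy1 θ := by
  have := energy_nonneg θ; unfold energy1; linarith

lemma energy1_pos {n : ℕ} (θ : Fin n → ℝ) : 0 < energy1 θ := by
  have := one_le_energy1 θ; linarith

lemma energy1_ne_zero {n : ℕ} (θ : Fin n → ℝ) : (energy1 θ : ℂ) ≠ 0 :=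
  Complex.ofReal_ne_zero.2 (energy1_pos θ).ne'

lemma measurable_energy1 {n : ℕ} : Measurable (energy1 : (Fin n → ℝ) → ℝ) :=
  measurable_energy.const_add 1

/-- The momentum transfer `p(θ) - p(η)`. -/
def transfer (μ : ℝ) {m n : ℕ} (θ : Fin m → ℝ) (η : Fin n → ℝ) : ℂ × ℂ :=
  (((realMomentum μ θ).1 - (realMomentum μ η).1 : ℝ), ((realMomentum μ θ).2 - (realMomentum μ η).2 : ℝ))

lemma planeWave_transfer (μ : ℝ) {m n : ℕ} (θ : Fin m → ℝ) (η : Fin n → ℝ) (x : ℝ × ℝ) :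
    planeWave (transfer μ θ η) x =
      exp (((realMomentum μ θ).1 * x.1 - (realMomentum μ θ).2 * x.2 : ℝ) * I) *
      exp ((-((realMomentum μ η).1 * x.1 - (realMomentum μ η).2 * x.2) : ℝ) * I) := by
  rw [← Complex.exp_add, planeWave, transfer]
  congr 1
  push_cast
  ring

lemma measurable_realMomentum (μ : ℝ) {n : ℕ} :
    Measurable (realMomentum μ : (Fin n → ℝ) → ℝ × ℝ) := by
  unfold realMomentum energy; fun_prop

lemma measurable_phase {n : ℕ} (μ s : ℝ) :
    Measurable fun p : (ℝ × ℝ) × (Fin n → ℝ) =>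
      exp ((s * ((realMomentum μ p.2).1 * p.1.1 - (realMomentum μ p.2).2 * p.1.2) : ℝ) *
        I) := by
  have h := (measurable_realMomentum μ (n := n)).comp (measurable_snd : Measurable
    (Prod.snd : (ℝ × ℝ) × (Fin n → ℝ) → _))
  have h1 : Measurable fun p : (ℝ × ℝ) × (Fin n → ℝ) => (realMomentum μ p.2).1 := h.fst
  have h2 : Measurable fun p : (ℝ × ℝ) × (Fin n → ℝ) => (realMomentum μ p.2).2 := h.snd
  fun_prop

/-- The function `g̃(p(θ) - p(η))` is a multiplier. -/
lemma mult_fourier {g : ℝ × ℝ → ℂ} (hg : ContDiff ℝ ∞ g) (hc : HasCompactSupport g) (μ : ℝ)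
    (m n : ℕ) {Λ : Type*} (l : Filter Λ) [l.IsCountablyGenerated] :
    Mult l volume volume (fun _ (θ : Fin m → ℝ) (η : Fin n → ℝ) => fourier g (transfer μ θ η))
      (∫ x, ‖(2 * (Real.pi : ℂ))⁻¹ * g x‖) := by
  have h := Mult.superpose (l := l) (μ := (volume : Measure (Fin m → ℝ)))
    (ν := (volume : Measure (Fin n → ℝ))) (ρ := (volume : Measure (ℝ × ℝ)))
    (γ := fun x => (2 * (Real.pi : ℂ))⁻¹ * g x)
    (α := fun _ x θ => exp ((1 * ((realMomentum μ θ).1 * x.1 -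
      (realMomentum μ θ).2 * x.2) : ℝ) * I))
    (β := fun _ x θ => exp (((-1) * ((realMomentum μ θ).1 * x.1 -
      (realMomentum μ θ).2 * x.2) : ℝ) * I))
    (A := fun _ => 1) (B := fun _ => 1) (hg.continuous.measurable.const_mul _)
    (fun _ => measurable_phase μ 1) (fun _ => measurable_phase μ (-1)) (fun _ => zero_le_one)
    (fun _ => zero_le_one)
    (.of_forall fun _ _ _ => (Complex.norm_exp_ofReal_mul_I _).le)
    (.of_forall fun _ _ _ => (Complex.norm_exp_ofReal_mul_I _).le)
    (fun _ _ => ⟨_, tendsto_const_nhds⟩) (fun _ _ => ⟨_, tendsto_const_nhds⟩)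
    (by simpa using ((hg.continuous.integrable_of_hasCompactSupport hc).norm.const_mul _))
  simp only [mul_one] at h
  refine h.congr (.of_forall fun _ θ η => ?_)
  rw [fourier_eq, ← integral_const_mul]
  refine integral_congr_ae (.of_forall fun x => ?_)
  simp only [planeWave_transfer, one_mul, neg_one_mul]
  ring

lemma mult_inv_energy_left (m n : ℕ) (k : ℕ) {Λ : Type*} (l : Filter Λ) [l.IsCountablyGenerated] :
    Mult l volume volume (fun _ (θ : Fin m → ℝ) (_ : Fin n → ℝ) => ((energy1 θ : ℂ) ^ k)⁻¹) 1 := by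
  refine Mult.left zero_le_one ?_ fun θ => ?_
  · have := measurable_energy1 (n := m)
    fun_prop
  · rw [norm_inv, norm_pow, Complex.norm_real, norm_of_nonneg (energy1_pos θ).le]
    exact inv_le_one_of_one_le₀ (one_le_pow₀ (one_le_energy1 θ))

lemma mult_inv_energy_right (m n : ℕ) (k : ℕ) {Λ : Type*} (l : Filter Λ)
    [l.IsCountablyGenerated] :
    Mult l volume volume (fun _ (_ : Fin m → ℝ) (η : Fin n → ℝ) => ((energy1 η : ℂ) ^ k)⁻¹) 1 :=
  (mult_inv_energy_left n m k l).swap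

/-- The function `g̃(p(θ) - p(η))` maps energy-bounded vectors to energy-bounded vectors. -/
lemma mult_energy_fourier {μ : ℝ} (hμ : 0 < μ) (k : ℕ) :
    ∀ g : ℝ × ℝ → ℂ, ContDiff ℝ ∞ g → HasCompactSupport g → ∃ C : ℝ,
      ∀ (m n : ℕ) (Λ : Type) (l : Filter Λ) [l.IsCountablyGenerated],
      Mult l volume volume (fun _ (θ : Fin m → ℝ) (η : Fin n → ℝ) =>
        (energy1 θ : ℂ) ^ k * fourier g (transfer μ θ η) * ((energy1 η : ℂ) ^ k)⁻¹) C := by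
  induction k with
  | zero =>
    intro g hg hc
    refine ⟨_, fun m n Λ l _ => (mult_fourier hg hc μ m n l).congr
      (.of_forall fun _ θ η => by simp)⟩
  | succ k ih =>
    intro g hg hc
    obtain ⟨C, hC⟩ := ih g hg hc
    obtain ⟨D, hD⟩ := ih (timeDeriv g) (contDiff_timeDeriv hg) (hasCompactSupport_timeDeriv hc)
    refine ⟨C + ‖(μ : ℂ)⁻¹ * I‖ * (D * 1), fun m n Λ l _ =>
      ((hC m n Λ l).add ((Mult.const ((μ : ℂ)⁻¹ * I)).mul ((hD m n Λ l).mul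
        (mult_inv_energy_right m n 1 l)))).congr (.of_forall fun _ θ η => ?_)⟩
    have hμ' : (μ : ℂ) ≠ 0 := Complex.ofReal_ne_zero.2 hμ.ne'
    have h1 := fourier_timeDeriv hg hc (transfer μ θ η)
    have h2 : (energy1 θ : ℂ) = energy1 η + (μ : ℂ)⁻¹ * (transfer μ θ η).1 := by
      simp only [transfer, realMomentum, energy1]
      push_cast
      field_simp
      ring
    have h3 : I * fourier (timeDeriv g) (transfer μ θ η) =
        (transfer μ θ η).1 * fourier g (transfer μ θ η) := h1.symm
    have h4 := energy1_ne_zero η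
    calc _ = (energy1 θ : ℂ) ^ k * fourier g (transfer μ θ η) * ((energy1 η : ℂ) ^ k)⁻¹ +
          (energy1 θ : ℂ) ^ k * ((μ : ℂ)⁻¹ * (I * fourier (timeDeriv g) (transfer μ θ η))) *
            ((energy1 η : ℂ) ^ (k + 1))⁻¹ := by
          rw [pow_succ, mul_inv]
          ring
      _ = (energy1 θ : ℂ) ^ k * fourier g (transfer μ θ η) * ((energy1 η : ℂ) ^ (k + 1))⁻¹ *
            (energy1 η + (μ : ℂ)⁻¹ * (transfer μ θ η).1) := by
          rw [h3, pow_succ]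
          field_simp
      _ = _ := by rw [← h2]; ring

lemma fourier_neg (g : ℝ × ℝ → ℂ) (p : ℂ × ℂ) : fourier (fun x => g (-x)) (-p) = fourier g p := by
  rw [fourier_eq, fourier_eq, ← integral_neg_eq_self]
  congr 1
  refine integral_congr_ae (.of_forall fun x => ?_)
  simp only [planeWave, neg_neg, Prod.fst_neg, Prod.snd_neg]
  congr 2
  push_cast
  ring

lemma mult_energy_fourier' {μ : ℝ} (hμ : 0 < μ) (k : ℕ) (g : ℝ × ℝ → ℂ) (hg : ContDiff ℝ ∞ g)
    (hc : HasCompactSupport g) : ∃ C : ℝ,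
      ∀ (m n : ℕ) (Λ : Type) (l : Filter Λ) [l.IsCountablyGenerated],
      Mult l volume volume (fun _ (θ : Fin m → ℝ) (η : Fin n → ℝ) =>
        (energy1 η : ℂ) ^ k * fourier g (transfer μ θ η) * ((energy1 θ : ℂ) ^ k)⁻¹) C := by
  obtain ⟨C, hC⟩ := mult_energy_fourier hμ k (fun x => g (-x)) (hg.comp contDiff_neg)
    (hc.comp_homeomorph (Homeomorph.neg _))
  refine ⟨C, fun m n Λ l _ => ((hC n m Λ l).swap).congr (.of_forall fun _ θ η => ?_)⟩
  have : transfer μ η θ = -transfer μ θ η := by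
    ext <;> simp [transfer]
  rw [this, fourier_neg]

/-- The arguments `e^ζ` at the node. -/
def expNode {m n : ℕ} (θ : Fin m → ℝ) (η : Fin n → ℝ) : Fin (m + n) → ℂ :=
  Fin.append (fun i => exp (θ i)) (fun j => -exp (η j))

lemma norm_sum_exp_zpow_le {n : ℕ} (θ : Fin n → ℝ) (c : ℂ) (hc : ‖c‖ = 1) (k : ℤ) :
    ‖∑ j, (c * exp (θ j)) ^ k‖ ≤ 2 ^ k.natAbs * energy1 θ ^ (k.natAbs + 1) := by
  have hE := one_le_energy1 θ
  have hn : (n : ℝ) ≤ energy1 θ := by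
    have := card_le_energy θ
    unfold energy1; linarith
  have h1 : ∀ j, ‖(c * exp (θ j)) ^ k‖ ≤ (2 * energy1 θ) ^ k.natAbs := by
    intro j
    have hj : Real.exp |θ j| ≤ 2 * energy1 θ := by
      have h2 := cosh_le_energy θ j
      have h3 : Real.exp |θ j| ≤ 2 * Real.cosh (θ j) := by
        rw [← Real.cosh_abs, Real.cosh_eq]
        have := exp_pos (-|θ j|)
        linarith
      unfold energy1; linarith
    rw [norm_zpow, norm_mul, hc, one_mul, ← Complex.ofReal_exp, Complex.norm_real,
      norm_of_nonneg (exp_pos _).le, ← Real.rpow_intCast, ← Real.exp_mul,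
      mul_comm (θ j)]
    calc Real.exp (k * θ j) ≤ Real.exp (k.natAbs * |θ j|) := by
          rw [exp_le_exp]
          have : (k.natAbs : ℝ) = |(k : ℝ)| := by simp [Nat.cast_natAbs]
          rw [this, ← abs_mul]
          exact le_abs_self _
      _ = Real.exp |θ j| ^ k.natAbs := by rw [Real.exp_nat_mul]
      _ ≤ _ := by gcongr
  calc _ ≤ ∑ j, ‖(c * exp (θ j)) ^ k‖ := norm_sum_le _ _
    _ ≤ ∑ _j : Fin n, (2 * energy1 θ) ^ k.natAbs := sum_le_sum fun j _ => h1 j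
    _ = n * (2 * energy1 θ) ^ k.natAbs := by simp
    _ ≤ energy1 θ * (2 * energy1 θ) ^ k.natAbs := by gcongr
    _ = _ := by rw [mul_pow]; ring

lemma mult_power_left (m n : ℕ) (c : ℂ) (hc : ‖c‖ = 1) (k : ℤ) {Λ : Type*} (l : Filter Λ)
    [l.IsCountablyGenerated] :
    Mult l volume volume (fun _ (θ : Fin m → ℝ) (_ : Fin n → ℝ) =>
      ((energy1 θ : ℂ) ^ (k.natAbs + 1))⁻¹ * ∑ j, (c * exp (θ j)) ^ k) (2 ^ k.natAbs) := by
  have hm := measurable_energy1 (n := m)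
  refine Mult.left (by positivity) ?_ fun θ => ?_
  · refine (by fun_prop : Measurable fun θ : Fin m → ℝ =>
      ((energy1 θ : ℂ) ^ (k.natAbs + 1))⁻¹).mul (Finset.measurable_sum _ fun j _ => ?_)
    exact (by fun_prop : Measurable fun θ : Fin m → ℝ => c * exp (θ j)).pow_const k
  · rw [norm_mul, norm_inv, norm_pow, Complex.norm_real, norm_of_nonneg (energy1_pos θ).le,
      inv_mul_le_iff₀ (pow_pos (energy1_pos θ) _), mul_comm (energy1 θ ^ _)]
    exact norm_sum_exp_zpow_le θ c hc k

/-- Symmetric Laurent functions at the node are multipliers after division by a power of the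
energies. -/
lemma mult_evalLaurent (P : SymLaurent) : ∃ (d : ℕ) (C : ℝ),
    ∀ (m n : ℕ) (Λ : Type) (l : Filter Λ) [l.IsCountablyGenerated],
    Mult l volume volume (fun _ (θ : Fin m → ℝ) (η : Fin n → ℝ) =>
      ((energy1 θ : ℂ) ^ d)⁻¹ * ((energy1 η : ℂ) ^ d)⁻¹ * evalLaurent (expNode θ η) P) C := by
  induction P using MvPolynomial.induction_on with
  | C a =>
    exact ⟨0, ‖a‖, fun m n Λ l _ => (Mult.const a).congr (.of_forall fun _ θ η => by
      simp [evalLaurent])⟩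
  | add P Q hP hQ =>
    obtain ⟨d, C, hC⟩ := hP
    obtain ⟨e, D, hD⟩ := hQ
    refine ⟨d + e, _, fun m n Λ l _ => (((hC m n Λ l).mul ((mult_inv_energy_left m n e l).mul
      (mult_inv_energy_right m n e l))).add ((hD m n Λ l).mul ((mult_inv_energy_left m n d l).mul
      (mult_inv_energy_right m n d l)))).congr (.of_forall fun _ θ η => ?_)⟩
    simp only [evalLaurent, map_add, pow_add, mul_inv]
    ring
  | mul_X P k hP =>
    obtain ⟨d, C, hC⟩ := hP
    have hr : ∀ (m n : ℕ) (Λ : Type) (l : Filter Λ) [l.IsCountablyGenerated],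
        Mult l volume volume (fun _ (_ : Fin m → ℝ) (η : Fin n → ℝ) =>
          ((energy1 η : ℂ) ^ ((k : ℤ).natAbs + 1))⁻¹ * ∑ j, (-1 * exp (η j)) ^ (k : ℤ))
          (2 ^ (k : ℤ).natAbs) := fun m n Λ l _ =>
      (mult_power_left n m (-1) (by simp) (k : ℤ) l).swap
    refine ⟨d + ((k : ℤ).natAbs + 1), _, fun m n Λ l _ => ((hC m n Λ l).mul
      (((mult_power_left m n 1 (by simp) (k : ℤ) l).mul (mult_inv_energy_right m n ((k : ℤ).natAbs + 1) l)).add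
        ((hr m n Λ l).mul (mult_inv_energy_left m n ((k : ℤ).natAbs + 1) l)))).congr
        (.of_forall fun _ θ η => ?_)⟩
    have h1 : evalLaurent (expNode θ η) (P * MvPolynomial.X k) = evalLaurent (expNode θ η) P *
        (∑ j, (1 * exp (θ j)) ^ (k : ℤ) + ∑ j, (-1 * exp (η j)) ^ (k : ℤ)) := by
      simp [evalLaurent, expNode, Fin.sum_univ_add]
    rw [h1, pow_add, pow_add, mul_inv, mul_inv]
    ring

end Multipliers


section Weights

/-- The one-variable weight. -/
def expWeight (b u : ℝ) : ℂ := (Real.exp (-(b * |u|)) : ℂ)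

lemma measurable_expWeight (b : ℝ) : Measurable (expWeight b) := by
  unfold expWeight; fun_prop

lemma norm_expWeight (b u : ℝ) : ‖expWeight b u‖ = Real.exp (-(b * |u|)) := by
  rw [expWeight, Complex.norm_real, norm_of_nonneg (exp_pos _).le]

lemma norm_expWeight_le {b : ℝ} (hb : 0 ≤ b) (u : ℝ) : ‖expWeight b u‖ ≤ 1 := by
  rw [norm_expWeight, Real.exp_le_one_iff]
  have := mul_nonneg hb (abs_nonneg u)
  linarith

lemma sq_norm_expWeight (b u : ℝ) : ‖expWeight b u‖ ^ 2 = Real.exp (-(2 * b) * |u|) := by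
  rw [norm_expWeight, ← Real.exp_nat_mul]
  congr 1
  push_cast
  ring

lemma integral_sq_norm_expWeight {b : ℝ} (hb : 0 < b) : ∫ u, ‖expWeight b u‖ ^ 2 = b⁻¹ := by
  simp only [sq_norm_expWeight]
  rw [integral_comp_abs (f := fun u => Real.exp (-(2 * b) * u)),
    integral_exp_mul_Ioi (by linarith)]
  field_simp
  simp

lemma sqInt_expWeight {b : ℝ} (hb : 0 < b) : SqInt volume (expWeight b) :=
  ⟨measurable_expWeight b, .of_integral_ne_zero (by
    rw [integral_sq_norm_expWeight hb]; exact inv_ne_zero hb.ne')⟩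

lemma l2_expWeight {b : ℝ} (hb : 0 < b) : l2 volume (expWeight b) = √(b⁻¹) := by
  rw [l2, integral_sq_norm_expWeight hb]

/-- The width of the weight used for `m` variables. -/
def weightWidth (m : ℕ) : ℝ := max 1 (√m / 4)

lemma one_le_weightWidth (m : ℕ) : 1 ≤ weightWidth m := le_max_left _ _

lemma weightWidth_pos (m : ℕ) : 0 < weightWidth m := zero_lt_one.trans_le (one_le_weightWidth m)

/-- The weight used for `m` variables. -/
def cardWeight (m : ℕ) : ℝ → ℂ := expWeight ((weightWidth m ^ 2)⁻¹)

lemma sqInt_cardWeight (m : ℕ) : SqInt volume (cardWeight m) :=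
  sqInt_expWeight (inv_pos.2 (pow_pos (weightWidth_pos m) 2))

lemma l2_cardWeight (m : ℕ) : l2 volume (cardWeight m) = weightWidth m := by
  rw [cardWeight, l2_expWeight (inv_pos.2 (pow_pos (weightWidth_pos m) 2)), inv_inv,
    Real.sqrt_sq (weightWidth_pos m).le]

lemma norm_cardWeight_le (m : ℕ) (u : ℝ) : ‖cardWeight m u‖ ≤ 1 :=
  norm_expWeight_le (inv_nonneg.2 (sq_nonneg _)) u

lemma cardWeight_ne_zero (m : ℕ) (u : ℝ) : cardWeight m u ≠ 0 := by
  simp [cardWeight, expWeight]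

lemma wprod_ne_zero {n m : ℕ} (θ : Fin n → ℝ) : wprod (cardWeight m) θ ≠ 0 :=
  Finset.prod_ne_zero_iff.2 fun _ _ => cardWeight_ne_zero _ _

lemma inv_sq_weightWidth_le {m : ℕ} : (weightWidth m ^ 2)⁻¹ * m ≤ 16 := by
  have h : (m : ℝ) / 16 ≤ weightWidth m ^ 2 := by
    calc (m : ℝ) / 16 = (√m / 4) ^ 2 := by
          rw [div_pow, Real.sq_sqrt (Nat.cast_nonneg m)]; norm_num
      _ ≤ _ := pow_le_pow_left₀ (by positivity) (le_max_right _ _) 2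
  rw [inv_mul_le_iff₀ (pow_pos (weightWidth_pos m) 2)]
  linarith

lemma exp_sum_abs_le {m : ℕ} (θ : Fin m → ℝ) :
    Real.exp ((weightWidth m ^ 2)⁻¹ * ∑ j, |θ j|) ≤ 2 ^ 16 * energy1 θ ^ 16 := by
  rcases Nat.eq_zero_or_pos m with rfl | hm
  · simp [energy1, energy]
    norm_num
  have hm' : (0 : ℝ) < m := Nat.cast_pos.2 hm
  have h1 : Real.exp ((∑ j, |θ j|) / m) ≤ 2 * energy1 θ := by
    have hj := (convexOn_exp).map_sum_le (t := (univ : Finset (Fin m)))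
      (w := fun _ => (m : ℝ)⁻¹) (p := fun j => |θ j|) (fun _ _ => by positivity)
      (by simp [hm'.ne']) (fun _ _ => Set.mem_univ _)
    simp only [smul_eq_mul, ← Finset.mul_sum] at hj
    rw [inv_mul_eq_div] at hj
    refine hj.trans ?_
    have h2 : ∑ j, Real.exp |θ j| ≤ 2 * energy θ := by
      rw [energy, Finset.mul_sum]
      refine sum_le_sum fun j _ => ?_
      rw [← Real.cosh_abs, Real.cosh_eq]
      have := exp_pos (-|θ j|)
      linarith
    have h3 : (m : ℝ)⁻¹ ≤ 1 := inv_le_one_of_one_le₀ (by exact_mod_cast hm)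
    have h4 : 0 ≤ ∑ j, Real.exp |θ j| := Finset.sum_nonneg fun _ _ => (exp_pos _).le
    have h5 := mul_le_mul h3 h2 h4 zero_le_one
    unfold energy1
    linarith
  have h0 : 0 ≤ ∑ j, |θ j| := Finset.sum_nonneg fun _ _ => abs_nonneg _
  calc _ ≤ Real.exp ((16 : ℕ) * ((∑ j, |θ j|) / m)) := by
        rw [exp_le_exp]
        have := mul_le_mul_of_nonneg_right (inv_sq_weightWidth_le (m := m))
          (div_nonneg h0 hm'.le)
        calc _ = (weightWidth m ^ 2)⁻¹ * m * ((∑ j, |θ j|) / m) := by field_simp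
          _ ≤ _ := by simpa using this
    _ = Real.exp ((∑ j, |θ j|) / m) ^ 16 := Real.exp_nat_mul _ _
    _ ≤ (2 * energy1 θ) ^ 16 := by gcongr
    _ = _ := mul_pow _ _ _

lemma norm_wprod_cardWeight {m : ℕ} (θ : Fin m → ℝ) :
    ‖wprod (cardWeight m) θ‖ = (Real.exp ((weightWidth m ^ 2)⁻¹ * ∑ j, |θ j|))⁻¹ := by
  rw [wprod, norm_prod, ← Real.exp_neg, Finset.mul_sum, ← Finset.sum_neg_distrib, Real.exp_sum]
  exact prod_congr rfl fun j _ => norm_expWeight _ _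

lemma measurable_wprod {v : ℝ → ℂ} (hv : Measurable v) (m : ℕ) :
    Measurable (wprod v : (Fin m → ℝ) → ℂ) := by
  unfold wprod; fun_prop

lemma inv_energy_le_wprod {m : ℕ} (θ : Fin m → ℝ) :
    (energy1 θ ^ 16)⁻¹ ≤ 2 ^ 16 * ‖wprod (cardWeight m) θ‖ := by
  rw [norm_wprod_cardWeight, ← div_eq_mul_inv, inv_eq_one_div,
    div_le_div_iff₀ (pow_pos (energy1_pos θ) _) (exp_pos _), one_mul]
  exact exp_sum_abs_le θ

lemma mult_weight_left (m n : ℕ) {Λ : Type*} (l : Filter Λ) [l.IsCountablyGenerated] :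
    Mult l volume volume (fun _ (θ : Fin m → ℝ) (_ : Fin n → ℝ) =>
      ((energy1 θ : ℂ) ^ 16)⁻¹ * (wprod (cardWeight m) θ)⁻¹) (2 ^ 16) := by
  refine Mult.left (by positivity) ?_ fun θ => ?_
  · have h1 := measurable_energy1 (n := m)
    have h2 := measurable_wprod (measurable_expWeight (weightWidth m ^ 2)⁻¹) m
    unfold cardWeight
    fun_prop
  · rw [norm_mul, norm_inv, norm_inv, norm_pow, Complex.norm_real,
      norm_of_nonneg (energy1_pos θ).le, ← div_eq_mul_inv,
      div_le_iff₀ (norm_pos_iff.2 (wprod_ne_zero θ))]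
    exact inv_energy_le_wprod θ

lemma energy_pow_le_exp {α : ℝ} (hα : 0 < α) (q : ℕ) : ∃ C : ℝ, 0 ≤ C ∧
    ∀ (n : ℕ) (θ : Fin n → ℝ), energy1 θ ^ q ≤ C * Real.exp (omega α (energy θ)) := by
  set N : ℕ := ⌈q / α⌉₊ with hN
  have hN' : q / α ≤ N := Nat.le_ceil _
  refine ⟨2 ^ q * N.factorial, by positivity, fun n θ => ?_⟩
  have hE := energy_nonneg θ
  rw [energy1, omega]
  have hf : (1 : ℝ) ≤ N.factorial := by exact_mod_cast N.factorial_pos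
  rcases le_total (energy θ) 1 with h | h
  · calc (1 + energy θ) ^ q ≤ 2 ^ q := by gcongr; linarith
      _ = 2 ^ q * 1 * 1 := by ring
      _ ≤ _ := by
        gcongr
        exact Real.one_le_exp (Real.rpow_nonneg hE _)
  · have h1 : energy θ ^ q ≤ (energy θ ^ α) ^ N := by
      rw [← Real.rpow_natCast, ← Real.rpow_natCast (energy θ ^ α), ← Real.rpow_mul hE]
      refine Real.rpow_le_rpow_of_exponent_le h ?_
      rwa [div_le_iff₀' hα] at hN'
    have h2 := Real.pow_div_factorial_le_exp (energy θ ^ α) (Real.rpow_nonneg hE _) N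
    rw [div_le_iff₀ (by positivity)] at h2
    calc (1 + energy θ) ^ q ≤ (2 * energy θ) ^ q := by gcongr; linarith
      _ = 2 ^ q * energy θ ^ q := mul_pow _ _ _
      _ ≤ 2 ^ q * (N.factorial * Real.exp (energy θ ^ α)) := by
        gcongr
        linarith
      _ = _ := by ring

/-- Multiplication with `exp(-ω(E))`. -/
def expOmegaInv (α : ℝ) {n : ℕ} (θ : Fin n → ℝ) : ℂ := ((Real.exp (omega α (energy θ)))⁻¹ : ℝ)

lemma measurable_omega_energy (α : ℝ) (n : ℕ) :
    Measurable fun θ : Fin n → ℝ => Real.exp (omega α (energy θ)) := by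
  have := measurable_energy (n := n)
  unfold omega
  fun_prop

lemma measurable_expOmegaInv (α : ℝ) (n : ℕ) :
    Measurable (expOmegaInv α : (Fin n → ℝ) → ℂ) := by
  have := measurable_omega_energy α n
  unfold expOmegaInv
  fun_prop

lemma mult_omega_right {α : ℝ} (hα : 0 < α) (q : ℕ) : ∃ C : ℝ, ∀ (m n : ℕ) (Λ : Type)
    (l : Filter Λ) [l.IsCountablyGenerated], Mult l volume volume
      (fun _ (_ : Fin m → ℝ) (η : Fin n → ℝ) => (energy1 η : ℂ) ^ q * expOmegaInv α η) C := by
  obtain ⟨C, hC0, hC⟩ := energy_pow_le_exp hα q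
  refine ⟨C, fun m n Λ l _ => Mult.right hC0 ?_ fun η => ?_⟩
  · have h1 := measurable_energy1 (n := n)
    have h2 := measurable_expOmegaInv α n
    fun_prop
  · rw [norm_mul, norm_pow, expOmegaInv, Complex.norm_real, Complex.norm_real, norm_inv,
      norm_of_nonneg (energy1_pos η).le, norm_of_nonneg (exp_pos _).le,
      ← div_eq_mul_inv, div_le_iff₀ (exp_pos _)]
    exact hC n η

end Weights

section FormFactorKernel

/-- The form factor kernel with the momenta taken at the node. -/
def ffKer (μ : ℝ) (P : SymLaurent) (g : ℝ × ℝ → ℂ) {m n : ℕ} (a : Fin m → ℝ) (b : Fin n → ℝ)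
    (θ : Fin m → ℝ) (η : Fin n → ℝ) : ℂ :=
  fourier g (transfer μ θ η) * evalLaurent (expNode θ η) P * shiftKer a b θ η

lemma ShiftFam.symm {Λ : Type*} {l : Filter Λ} {m n : ℕ} {a : Λ → Fin m → ℝ} {b : Λ → Fin n → ℝ}
    (h : ShiftFam l a b) : ShiftFam l b a :=
  ⟨h.small.mono fun _ ht => ⟨ht.b_pos, ht.a_pos, ht.b_lt, ht.a_lt, ht.b_inj, ht.a_inj⟩,
    h.lim_b, h.lim_a⟩

lemma conj_tprod {n : ℕ} (x : Fin n → ℂ) :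
    starRingEnd ℂ (tprod x) = tprod fun i => starRingEnd ℂ (x i) := by
  simp [tprod, map_prod]

lemma conj_crossProd {m n : ℕ} (x : Fin m → ℂ) (y : Fin n → ℂ) :
    starRingEnd ℂ (crossProd x y) =
      crossProd (fun i => starRingEnd ℂ (x i)) fun j => starRingEnd ℂ (y j) := by
  simp [crossProd, conj_tprod, map_prod]

lemma crossProd_comm {m n : ℕ} (x : Fin m → ℂ) (y : Fin n → ℂ) :
    crossProd x y = (-1) ^ (m * n) * crossProd y x := by
  have h : ∏ i, ∏ j, (x i + y j) / (x i - y j) =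
      (-1) ^ (m * n) * ∏ j, ∏ i, (y j + x i) / (y j - x i) := by
    rw [Finset.prod_comm]
    have : ((-1 : ℂ)) ^ (m * n) = ∏ _j : Fin n, ∏ _i : Fin m, (-1 : ℂ) := by
      simp [pow_mul]
    rw [this, ← Finset.prod_mul_distrib]
    refine prod_congr rfl fun j _ => ?_
    rw [← Finset.prod_mul_distrib]
    refine prod_congr rfl fun i _ => ?_
    rw [neg_one_mul, ← div_neg, neg_sub, add_comm]
  rw [crossProd, crossProd, h]
  ring

lemma conj_expShift {n : ℕ} (a θ : Fin n → ℝ) (i : Fin n) :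
    starRingEnd ℂ (expShift a θ i) = expShift (fun j => -a j) θ i := by
  rw [expShift, ← Complex.exp_conj, expShift]
  simp

lemma conj_shiftKer {m n : ℕ} (a : Fin m → ℝ) (b : Fin n → ℝ) (θ : Fin m → ℝ) (η : Fin n → ℝ) :
    starRingEnd ℂ (shiftKer a b θ η) = (-1) ^ (m * n) * shiftKer b a η θ := by
  rw [shiftKer, conj_crossProd, crossProd_comm, shiftKer]
  simp [conj_expShift]

lemma conj_wprod_cardWeight {n m : ℕ} (θ : Fin n → ℝ) :
    starRingEnd ℂ (wprod (cardWeight m) θ) = wprod (cardWeight m) θ := by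
  simp [wprod, cardWeight, expWeight, map_prod, Complex.conj_ofReal,
    -Complex.ofReal_exp]

lemma good_cardKer {Λ : Type*} {l : Filter Λ} [l.IsCountablyGenerated] {m n : ℕ}
    {a : Λ → Fin m → ℝ} {b : Λ → Fin n → ℝ} (h : ShiftFam l a b) :
    Good l volume volume (fun t => wKer (cardWeight m) (cardWeight n) (a t) (b t))
      (kerBound (weightWidth m) (weightWidth n) m n) :=
  good_wKer (sqInt_cardWeight m) (sqInt_cardWeight n) (norm_cardWeight_le m)
    (norm_cardWeight_le n) (l2_cardWeight m).le (one_le_weightWidth m) (l2_cardWeight n).le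
    (one_le_weightWidth n) n m a b h

lemma good_cardKer' {Λ : Type*} {l : Filter Λ} [l.IsCountablyGenerated] {m n : ℕ}
    {a : Λ → Fin m → ℝ} {b : Λ → Fin n → ℝ} (h : ShiftFam l a b) :
    Good l volume volume (fun t => wKer (cardWeight m) (cardWeight n) (a t) (b t))
      (kerBound (weightWidth n) (weightWidth m) n m) := by
  have h1 := ((good_cardKer h.symm).swap.star).const_mul ((-1) ^ (m * n))
  rw [norm_pow, norm_neg, norm_one, one_pow, one_mul] at h1
  refine h1.congr (.of_forall fun t => ?_)
  funext θ η
  rw [wKer, map_mul, map_mul, conj_shiftKer, conj_wprod_cardWeight, conj_wprod_cardWeight, wKer]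
  have : ((-1 : ℂ)) ^ (m * n) * (-1) ^ (n * m) = 1 := by
    rw [mul_comm n m, ← mul_pow]; simp
  linear_combination (wprod (cardWeight m) θ * shiftKer (a t) (b t) θ η *
    wprod (cardWeight n) η) * this

variable {μ α : ℝ}

/-- The form factor kernels, damped in the second variable. -/
theorem good_ffKer_right (hμ : 0 < μ) (hα : 0 < α) (P : SymLaurent) {g : ℝ × ℝ → ℂ}
    (hg : ContDiff ℝ ∞ g) (hc : HasCompactSupport g) : ∃ C : ℝ, 0 ≤ C ∧
    ∀ (m n : ℕ) (Λ : Type) (l : Filter Λ) [l.IsCountablyGenerated] (a : Λ → Fin m → ℝ)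
      (b : Λ → Fin n → ℝ), ShiftFam l a b → Good l volume volume
        (fun t θ η => ffKer μ P g (a t) (b t) θ η * expOmegaInv α η)
        (C * kerBound (weightWidth m) (weightWidth n) m n) := by
  obtain ⟨d, CP, hP⟩ := mult_evalLaurent P
  obtain ⟨Cg, hG⟩ := mult_energy_fourier hμ (16 + d) g hg hc
  obtain ⟨Co, hO⟩ := mult_omega_right hα (16 + d + d + 16)
  have hM := fun (m n : ℕ) (Λ : Type) (l : Filter Λ) (_ : l.IsCountablyGenerated) =>
    (((hP m n Λ l).mul (hG m n Λ l)).mul (hO m n Λ l)).mul ((mult_weight_left m n l).mul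
      (mult_weight_left n m l).swap)
  refine ⟨_, (hM 0 0 Unit ⊤ inferInstance).nonneg, fun m n Λ l _ a b h => ?_⟩
  refine ((hM m n Λ l inferInstance).good _ _ (good_cardKer h)).congr
    (.of_forall fun t => ?_)
  funext θ η
  have h1 := energy1_ne_zero θ
  have h2 := energy1_ne_zero η
  have h3 := wprod_ne_zero (m := m) θ
  have h4 := wprod_ne_zero (m := n) η
  rw [ffKer, wKer]
  simp only [pow_add]
  field_simp

/-- The form factor kernels, damped in the first variable. -/
theorem good_ffKer_left (hμ : 0 < μ) (hα : 0 < α) (P : SymLaurent) {g : ℝ × ℝ → ℂ}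
    (hg : ContDiff ℝ ∞ g) (hc : HasCompactSupport g) : ∃ C : ℝ, 0 ≤ C ∧
    ∀ (m n : ℕ) (Λ : Type) (l : Filter Λ) [l.IsCountablyGenerated] (a : Λ → Fin m → ℝ)
      (b : Λ → Fin n → ℝ), ShiftFam l a b → Good l volume volume
        (fun t θ η => expOmegaInv α θ * ffKer μ P g (a t) (b t) θ η)
        (C * kerBound (weightWidth n) (weightWidth m) n m) := by
  obtain ⟨d, CP, hP⟩ := mult_evalLaurent P
  obtain ⟨Cg, hG⟩ := mult_energy_fourier' hμ (16 + d) g hg hc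
  obtain ⟨Co, hO⟩ := mult_omega_right hα (16 + d + d + 16)
  have hM := fun (m n : ℕ) (Λ : Type) (l : Filter Λ) (_ : l.IsCountablyGenerated) =>
    (((hP m n Λ l).mul (hG m n Λ l)).mul (hO n m Λ l).swap).mul ((mult_weight_left m n l).mul
      (mult_weight_left n m l).swap)
  refine ⟨_, (hM 0 0 Unit ⊤ inferInstance).nonneg, fun m n Λ l _ a b h => ?_⟩
  refine ((hM m n Λ l inferInstance).good _ _ (good_cardKer' h)).congr
    (.of_forall fun t => ?_)
  funext θ η
  have h1 := energy1_ne_zero θ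
  have h2 := energy1_ne_zero η
  have h3 := wprod_ne_zero (m := m) θ
  have h4 := wprod_ne_zero (m := n) η
  rw [ffKer, wKer]
  simp only [pow_add]
  field_simp

end FormFactorKernel


section Split

/-- Splitting the first `m` from the last `n` variables. -/
def splitEquiv (m n : ℕ) : (Fin (m + n) → ℝ) ≃ᵐ (Fin m → ℝ) × (Fin n → ℝ) where
  toFun x := (fun i => x (Fin.castAdd n i), fun j => x (Fin.natAdd m j))
  invFun z := Fin.append z.1 z.2
  left_inv x := by
    funext i
    refine Fin.addCases (fun i => ?_) (fun j => ?_) i <;> simp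
  right_inv z := by simp
  measurable_toFun := by
    refine Measurable.prodMk ?_ ?_ <;> exact measurable_pi_iff.2 fun i => measurable_pi_apply _
  measurable_invFun := by
    refine measurable_pi_iff.2 fun i => ?_
    refine Fin.addCases (fun i => ?_) (fun j => ?_) i
    · simp only [Equiv.coe_fn_symm_mk, Fin.append_left]
      exact (measurable_pi_apply i).comp measurable_fst
    · simp only [Equiv.coe_fn_symm_mk, Fin.append_right]
      exact (measurable_pi_apply j).comp measurable_snd

lemma splitEquiv_apply {m n : ℕ} (x : Fin (m + n) → ℝ) :
    splitEquiv m n x = (fun i => x (Fin.castAdd n i), fun j => x (Fin.natAdd m j)) := rfl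

lemma splitEquiv_symm_apply {m n : ℕ} (z : (Fin m → ℝ) × (Fin n → ℝ)) :
    (splitEquiv m n).symm z = Fin.append z.1 z.2 := rfl

lemma measurePreserving_splitEquiv (m n : ℕ) : MeasurePreserving (splitEquiv m n) volume volume := by
  have h1 := (volume_measurePreserving_piCongrLeft (fun _ : Fin (m + n) => ℝ)
    (finSumFinEquiv (m := m) (n := n))).symm
  have h2 := volume_measurePreserving_sumPiEquivProdPi (fun _ : Fin m ⊕ Fin n => ℝ)
  have h3 := h2.comp h1
  convert h3 using 1
  funext x
  ext i
  · simp [splitEquiv_apply, MeasurableEquiv.sumPiEquivProdPi, MeasurableEquiv.piCongrLeft]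
  · simp [splitEquiv_apply, MeasurableEquiv.sumPiEquivProdPi, MeasurableEquiv.piCongrLeft]

lemma integral_append {m n : ℕ} (f : (Fin (m + n) → ℝ) → ℂ) :
    ∫ z : (Fin m → ℝ) × (Fin n → ℝ), f (Fin.append z.1 z.2) = ∫ x, f x := by
  rw [← (measurePreserving_splitEquiv m n).symm.integral_comp
    (splitEquiv m n).symm.measurableEmbedding]
  rfl

end Split

section Node

variable {m n : ℕ}

/-- The filter of the region at the node. -/
abbrev nodeFilter (m n : ℕ) : Filter (Fin (m + n) → ℝ) := 𝓝[regionPlus (m + n)] node m n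

/-- The imaginary parts of the first variables. -/
def shiftA (l : Fin (m + n) → ℝ) (i : Fin m) : ℝ := l (Fin.castAdd n i)

/-- The distance of the imaginary parts of the last variables to `π`. -/
def shiftB (l : Fin (m + n) → ℝ) (j : Fin n) : ℝ := Real.pi - l (Fin.natAdd m j)

lemma node_castAdd (i : Fin m) : node m n (Fin.castAdd n i) = 0 := by simp [node]

lemma node_natAdd (j : Fin n) : node m n (Fin.natAdd m j) = Real.pi := by simp [node]

lemma tendsto_nodeFilter (i : Fin (m + n)) :
    Tendsto (fun l : Fin (m + n) → ℝ => l i) (nodeFilter m n) (𝓝 (node m n i)) :=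
  ((continuous_apply i).tendsto _).mono_left nhdsWithin_le_nhds

lemma shiftFam_node (m n : ℕ) : ShiftFam (nodeFilter m n) shiftA shiftB := by
  have hA : ∀ i : Fin m, Tendsto (fun l : Fin (m + n) → ℝ => shiftA l i) (nodeFilter m n)
      (𝓝 0) := fun i => by
    simpa [node_castAdd, shiftA] using tendsto_nodeFilter (Fin.castAdd n i)
  have hB : ∀ j : Fin n, Tendsto (fun l : Fin (m + n) → ℝ => shiftB l j) (nodeFilter m n)
      (𝓝 0) := fun j => by
    simpa [node_natAdd, shiftB] using (tendsto_nodeFilter (m := m) (Fin.natAdd m j)).const_sub Real.pi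
  refine ⟨?_, hA, hB⟩
  have hA' : ∀ᶠ l in nodeFilter m n, ∀ i : Fin m, shiftA l i < 1 / 8 :=
    eventually_all.2 fun i => (hA i).eventually_lt_const (by norm_num)
  have hB' : ∀ᶠ l in nodeFilter m n, ∀ j : Fin n, shiftB l j < 1 / 8 :=
    eventually_all.2 fun j => (hB j).eventually_lt_const (by norm_num)
  filter_upwards [hA', hB', self_mem_nhdsWithin] with l h1 h2 h3
  refine ⟨fun i => (h3.1 _).1, fun j => sub_pos.2 (h3.1 _).2, h1, h2, fun i i' h => ?_,
    fun j j' h => ?_⟩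
  · exact Fin.castAdd_injective m n (h3.2.injective h)
  · exact Fin.natAdd_injective n m (h3.2.injective (by simpa [shiftB] using h))

instance nodeFilter_neBot (m n : ℕ) : (nodeFilter m n).NeBot := by
  rw [← mem_closure_iff_nhdsWithin_neBot]
  let c : Fin (m + n) → ℝ := Fin.append (fun i => (i : ℝ) + 1) (fun j => (j : ℝ) - n)
  have hpath : Tendsto (fun ε : ℝ => node m n + ε • c) (𝓝[>] 0) (𝓝 (node m n)) := by
    have : Continuous fun ε : ℝ => node m n + ε • c := by fun_prop
    simpa using (this.tendsto 0).mono_left nhdsWithin_le_nhds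
  refine mem_closure_of_tendsto hpath ?_
  have hs : ∀ᶠ ε : ℝ in 𝓝[>] 0, ε * (m + n + 1) < 1 := by
    have : Tendsto (fun ε : ℝ => ε * (m + n + 1)) (𝓝[>] 0) (𝓝 0) := by
      have : Continuous fun ε : ℝ => ε * ((m : ℝ) + n + 1) := by fun_prop
      simpa using (this.tendsto 0).mono_left nhdsWithin_le_nhds
    exact this.eventually_lt_const one_pos
  filter_upwards [hs, self_mem_nhdsWithin] with ε h1 h2
  have h2' : 0 < ε := h2
  have hpi := Real.pi_gt_three
  have hl : ∀ i : Fin m, (node m n + ε • c) (Fin.castAdd n i) = ε * (i + 1) := by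
    intro i; simp [node_castAdd, c]
  have hr : ∀ j : Fin n, (node m n + ε • c) (Fin.natAdd m j) = Real.pi + ε * (j - n) := by
    intro j; simp [node_natAdd, c]
  have bi : ∀ i : Fin m, ε * ((i : ℝ) + 1) < 1 := fun i => by
    have : (i : ℝ) ≤ m := by exact_mod_cast i.2.le
    refine lt_of_le_of_lt (mul_le_mul_of_nonneg_left ?_ h2'.le) h1
    have : (0 : ℝ) ≤ n := Nat.cast_nonneg n
    linarith
  have bj : ∀ j : Fin n, -1 < ε * ((j : ℝ) - n) := fun j => by
    have : ε * ((n : ℝ) - j) < 1 := by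
      refine lt_of_le_of_lt (mul_le_mul_of_nonneg_left ?_ h2'.le) h1
      have : (0 : ℝ) ≤ m := Nat.cast_nonneg m
      have : (0 : ℝ) ≤ j := Nat.cast_nonneg _
      linarith
    linarith
  have bi' : ∀ i : Fin m, 0 < ε * ((i : ℝ) + 1) := fun i => by positivity
  have bj' : ∀ j : Fin n, ε * ((j : ℝ) - n) < 0 := fun j => by
    refine mul_neg_of_pos_of_neg h2' (sub_neg.2 ?_)
    exact_mod_cast j.2
  refine ⟨fun p => ?_, fun p q => ?_⟩
  · refine Fin.addCases (fun i => ?_) (fun j => ?_) p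
    · rw [hl]; exact ⟨bi' i, (bi i).trans (by linarith)⟩
    · rw [hr]; exact ⟨by linarith [bj j], by linarith [bj' j]⟩
  · refine Fin.addCases (fun i => ?_) (fun j => ?_) p <;>
      refine Fin.addCases (fun i' => ?_) (fun j' => ?_) q <;> intro hpq
    · rw [hl, hl]
      have h3 : (i : ℕ) < i' := hpq
      have : (i : ℝ) < i' := by exact_mod_cast h3
      exact mul_lt_mul_of_pos_left (by linarith) h2'
    · rw [hl, hr]
      linarith [bi i, bj j']
    · exfalso
      have h3 : m + (j : ℕ) < i' := hpq
      have := i'.2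
      omega
    · rw [hr, hr]
      have h3 : (j : ℕ) < j' := Nat.lt_of_add_lt_add_left hpq
      have : (j : ℝ) < j' := by exact_mod_cast h3
      have := mul_lt_mul_of_pos_left (show (j : ℝ) - n < j' - n by linarith) h2'
      linarith

lemma tanh_half (u v : ℂ) : Complex.tanh ((u - v) / 2) =
    (exp u - exp v) / (exp u + exp v) := by
  have h1 : 2 * exp ((u + v) / 2) * Complex.sinh ((u - v) / 2) =
      exp u - exp v := by
    rw [mul_right_comm, Complex.two_sinh, sub_mul, ← Complex.exp_add, ← Complex.exp_add]
    ring_nf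
  have h2 : 2 * exp ((u + v) / 2) * Complex.cosh ((u - v) / 2) =
      exp u + exp v := by
    rw [mul_right_comm, Complex.two_cosh, add_mul, ← Complex.exp_add, ← Complex.exp_add]
    ring_nf
  rw [← h1, ← h2, mul_div_mul_left _ _ (mul_ne_zero two_ne_zero (Complex.exp_ne_zero _)),
    Complex.tanh_eq_sinh_div_cosh]

lemma Modd_eq_tprod {k : ℕ} (ζ : Fin k → ℂ) : Modd ζ = tprod fun i => exp (ζ i) := by
  simp only [Modd, tprod, tanh_half]

lemma tprod_neg {k : ℕ} (y : Fin k → ℂ) : (tprod fun i => -y i) = tprod y := by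
  simp only [tprod]
  refine prod_congr rfl fun i _ => prod_congr rfl fun j _ => ?_
  rw [← neg_add, neg_sub_neg, ← neg_sub (y i), neg_div_neg_eq]

lemma tprod_append (x : Fin m → ℂ) (y : Fin n → ℂ) :
    tprod (Fin.append x (fun j => -y j)) = crossProd x y := by
  rw [crossProd, ← tprod_neg y]
  have key : ∀ {k : ℕ} (z : Fin k → ℂ), tprod z =
      ∏ i, ∏ j, if i < j then (z i - z j) / (z i + z j) else 1 := by
    intro k z
    refine prod_congr rfl fun i _ => ?_
    rw [← Finset.prod_filter]
    exact prod_congr (by ext; simp) fun _ _ => rfl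
  simp only [key, Fin.prod_univ_add, Fin.append_left, Fin.append_right, Finset.prod_mul_distrib]
  have e1 : ∀ (i i' : Fin m), (Fin.castAdd n i < Fin.castAdd n i') ↔ i < i' := by
    intro i i'; exact Iff.rfl
  have e2 : ∀ (j j' : Fin n), (Fin.natAdd m j < Fin.natAdd m j') ↔ j < j' := by
    intro i i'; exact Nat.add_lt_add_iff_left
  have e3 : ∀ (i : Fin m) (j : Fin n), Fin.castAdd n i < Fin.natAdd m j := by
    intro i j; simp only [Fin.lt_def, Fin.val_castAdd, Fin.val_natAdd]; omega
  have e4 : ∀ (i : Fin m) (j : Fin n), ¬ (Fin.natAdd m j < Fin.castAdd n i) := by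
    intro i j; exact (e3 i j).le.not_gt
  simp only [e1, e2, e3, e4, if_true, if_false, Finset.prod_const_one, sub_neg_eq_add,
    ← sub_eq_add_neg]
  ring

/-- The complex arguments with imaginary parts `l`. -/
def shiftArg (θ : Fin m → ℝ) (η : Fin n → ℝ) (l : Fin (m + n) → ℝ) (i : Fin (m + n)) : ℂ :=
  (Fin.append θ η i : ℝ) + (l i : ℂ) * I

lemma shiftArg_castAdd (θ : Fin m → ℝ) (η : Fin n → ℝ) (l : Fin (m + n) → ℝ) (i : Fin m) :
    shiftArg θ η l (Fin.castAdd n i) = θ i + (l (Fin.castAdd n i) : ℂ) * I := by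
  simp [shiftArg]

lemma shiftArg_natAdd (θ : Fin m → ℝ) (η : Fin n → ℝ) (l : Fin (m + n) → ℝ) (j : Fin n) :
    shiftArg θ η l (Fin.natAdd m j) = η j + (l (Fin.natAdd m j) : ℂ) * I := by
  simp [shiftArg]

lemma Modd_shiftArg (θ : Fin m → ℝ) (η : Fin n → ℝ) (l : Fin (m + n) → ℝ) :
    Modd (shiftArg θ η l) = shiftKer (shiftA l) (shiftB l) θ η := by
  rw [Modd_eq_tprod, shiftKer, ← tprod_append]
  congr 1
  funext p
  refine Fin.addCases (fun i => ?_) (fun j => ?_) p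
  · rw [shiftArg_castAdd, Fin.append_left]; rfl
  · rw [shiftArg_natAdd, Fin.append_right, expShift]
    have : (η j : ℂ) + (l (Fin.natAdd m j) : ℂ) * I =
        (η j + ((-shiftB l j : ℝ) : ℂ) * I) + Real.pi * I := by
      simp only [shiftB]
      push_cast
      ring
    rw [this, Complex.exp_add, Complex.exp_pi_mul_I, mul_neg_one]

lemma momentum_node (μ : ℝ) (θ : Fin m → ℝ) (η : Fin n → ℝ) :
    momentum μ (shiftArg θ η (node m n)) = transfer μ θ η := by
  simp only [momentum, Fin.sum_univ_add, shiftArg_castAdd, shiftArg_natAdd, node_castAdd,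
    node_natAdd, transfer, realMomentum, energy, Complex.ofReal_zero, zero_mul, add_zero,
    Complex.cosh_add, Complex.sinh_add, Complex.cosh_mul_I, Complex.sinh_mul_I, Complex.cos_pi,
    Complex.sin_pi, mul_neg_one, mul_zero, add_zero, Finset.sum_neg_distrib]
  push_cast
  simp only [mul_add, mul_neg, sub_eq_add_neg]

lemma exp_shiftArg_node (θ : Fin m → ℝ) (η : Fin n → ℝ) :
    (fun i => exp (shiftArg θ η (node m n) i)) = expNode θ η := by
  funext p
  refine Fin.addCases (fun i => ?_) (fun j => ?_) p
  · rw [shiftArg_castAdd, node_castAdd, expNode, Fin.append_left]; simp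
  · rw [shiftArg_natAdd, node_natAdd, expNode, Fin.append_right, Complex.exp_add,
      Complex.exp_pi_mul_I, mul_neg_one]

end Node


section Cut

/-- The indicator function of a ball. -/
def cut (R : ℝ) {n : ℕ} (θ : Fin n → ℝ) : ℂ :=
  (Metric.closedBall (0 : Fin n → ℝ) R).indicator (fun _ => 1) θ

lemma measurable_cut (R : ℝ) (n : ℕ) : Measurable (cut R : (Fin n → ℝ) → ℂ) :=
  measurable_const.indicator Metric.isClosed_closedBall.measurableSet

lemma cut_cases (R : ℝ) {n : ℕ} (θ : Fin n → ℝ) :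
    cut R θ = 0 ∨ cut R θ = 1 ∧ ∀ i, |θ i| ≤ R := by
  by_cases h : θ ∈ Metric.closedBall (0 : Fin n → ℝ) R
  · refine Or.inr ⟨Set.indicator_of_mem h _, fun i => ?_⟩
    rw [mem_closedBall_zero_iff] at h
    exact (norm_le_pi_norm θ i).trans h
  · exact Or.inl (Set.indicator_of_notMem h _)

lemma cut_eq_one {R : ℝ} {n : ℕ} {θ : Fin n → ℝ} (h : ‖θ‖ ≤ R) : cut R θ = 1 :=
  Set.indicator_of_mem (mem_closedBall_zero_iff.2 h) _

lemma cut_mul_self (R : ℝ) {n : ℕ} (θ : Fin n → ℝ) : cut R θ * cut R θ = cut R θ := by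
  rcases cut_cases R θ with h | ⟨h, -⟩ <;> simp [h]

lemma norm_cut_le (R : ℝ) {n : ℕ} (θ : Fin n → ℝ) : ‖cut R θ‖ ≤ 1 := by
  rcases cut_cases R θ with h | ⟨h, -⟩ <;> simp [h]

lemma norm_cut_mul_le {R : ℝ} {n : ℕ} {θ : Fin n → ℝ} {z : ℂ} {C : ℝ} (hC : 0 ≤ C)
    (h : (∀ i, |θ i| ≤ R) → ‖z‖ ≤ C) : ‖cut R θ * z‖ ≤ C := by
  rcases cut_cases R θ with h1 | ⟨h1, h2⟩
  · simpa [h1] using hC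
  · simpa [h1] using h h2

lemma sqInt_cut (R : ℝ) (n : ℕ) : SqInt volume (cut R : (Fin n → ℝ) → ℂ) := by
  refine .of_memLp (measurable_cut R n) (memLp_indicator_const 2
    Metric.isClosed_closedBall.measurableSet 1 (Or.inr ?_))
  exact (isCompact_closedBall (0 : Fin n → ℝ) R).measure_lt_top.ne

variable {Λ : Type*} {l : Filter Λ} [l.IsCountablyGenerated] {m n : ℕ}

lemma mult_cut_left {R : ℝ} {α : Λ → (Fin m → ℝ) → ℂ} {A : ℝ} (hA0 : 0 ≤ A)
    (hm : ∀ t, Measurable (α t)) (hA : ∀ t θ, (∀ i, |θ i| ≤ R) → ‖α t θ‖ ≤ A)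
    (hl : ∀ θ, ∃ L, Tendsto (fun t => α t θ) l (𝓝 L)) :
    Mult l volume volume (fun t θ (η : Fin n → ℝ) => cut R θ * cut R η * α t θ) A := by
  have h := Mult.tensor (l := l) (μ := (volume : Measure (Fin m → ℝ)))
    (ν := (volume : Measure (Fin n → ℝ))) (α := fun t θ => cut R θ * α t θ)
    (β := fun _ η => cut R η) hA0 zero_le_one (fun t => (measurable_cut R m).mul (hm t))
    (fun _ => measurable_cut R n)
    (.of_forall fun t θ => norm_cut_mul_le hA0 (hA t θ))
    (.of_forall fun _ η => norm_cut_le R η)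
    (fun θ => let ⟨_, hL⟩ := hl θ; ⟨_, hL.const_mul (cut R θ)⟩) (fun η => ⟨_, tendsto_const_nhds⟩)
  rw [mul_one] at h
  exact h.congr (.of_forall fun t θ η => by ring)

/-- The part of the plane wave depending on some of the variables. -/
def partWave (μ : ℝ) (x : ℝ × ℝ) {k : ℕ} (θ s : Fin k → ℝ) : ℂ :=
  exp (I * (μ * (∑ i, Complex.cosh (θ i + s i * I)) * x.1 -
    μ * (∑ i, Complex.sinh (θ i + s i * I)) * x.2))

lemma planeWave_shiftArg (μ : ℝ) (x : ℝ × ℝ) (θ : Fin m → ℝ) (η : Fin n → ℝ)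
    (s : Fin (m + n) → ℝ) : planeWave (momentum μ (shiftArg θ η s)) x =
      partWave μ x θ (fun i => s (Fin.castAdd n i)) * partWave μ x η (fun j => s (Fin.natAdd m j)) := by
  simp only [planeWave, momentum, Fin.sum_univ_add, shiftArg_castAdd, shiftArg_natAdd, partWave,
    ← Complex.exp_add]
  congr 1
  ring

lemma norm_cosh_le {z : ℂ} {R : ℝ} (h : |z.re| ≤ R) : ‖Complex.cosh z‖ ≤ Real.exp R := by
  have h1 : ‖exp z‖ ≤ Real.exp R := by
    rw [Complex.norm_exp, exp_le_exp]; exact (abs_le.1 h).2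
  have h2 : ‖exp (-z)‖ ≤ Real.exp R := by
    rw [Complex.norm_exp, exp_le_exp, Complex.neg_re]; linarith [(abs_le.1 h).1]
  rw [Complex.cosh, norm_div, Complex.norm_ofNat]
  linarith [norm_add_le (exp z) (exp (-z))]

lemma norm_sinh_le {z : ℂ} {R : ℝ} (h : |z.re| ≤ R) : ‖Complex.sinh z‖ ≤ Real.exp R := by
  have h1 : ‖exp z‖ ≤ Real.exp R := by
    rw [Complex.norm_exp, exp_le_exp]; exact (abs_le.1 h).2
  have h2 : ‖exp (-z)‖ ≤ Real.exp R := by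
    rw [Complex.norm_exp, exp_le_exp, Complex.neg_re]; linarith [(abs_le.1 h).1]
  rw [Complex.sinh, norm_div, Complex.norm_ofNat]
  linarith [norm_sub_le (exp z) (exp (-z))]

lemma norm_partWave_le {μ R : ℝ} (x : ℝ × ℝ) {k : ℕ} (θ s : Fin k → ℝ) (h : ∀ i, |θ i| ≤ R) :
    ‖partWave μ x θ s‖ ≤ Real.exp (|μ| * (k * Real.exp R) * (|x.1| + |x.2|)) := by
  have h1 : ‖∑ i, Complex.cosh (θ i + s i * I)‖ ≤ k * Real.exp R := by
    refine (norm_sum_le _ _).trans ((sum_le_sum fun i _ => norm_cosh_le (R := R) ?_).trans ?_)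
    · simpa using h i
    · simp
  have h2 : ‖∑ i, Complex.sinh (θ i + s i * I)‖ ≤ k * Real.exp R := by
    refine (norm_sum_le _ _).trans ((sum_le_sum fun i _ => norm_sinh_le (R := R) ?_).trans ?_)
    · simpa using h i
    · simp
  rw [partWave]
  refine (Complex.norm_exp_le_exp_norm _).trans (Real.exp_le_exp.2 ?_)
  rw [norm_mul, Complex.norm_I, one_mul]
  refine (norm_sub_le _ _).trans ?_
  rw [norm_mul, norm_mul, norm_mul, norm_mul, Complex.norm_real, Complex.norm_real,
    Complex.norm_real, Real.norm_eq_abs, Real.norm_eq_abs, Real.norm_eq_abs, mul_add]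
  gcongr

lemma measurable_cut_mul_partWave (R μ : ℝ) {k : ℕ} (u : Fin k → ℝ) :
    Measurable fun p : (ℝ × ℝ) × (Fin k → ℝ) => cut R p.2 * partWave μ p.1 p.2 u := by
  have h1 : Measurable fun p : (ℝ × ℝ) × (Fin k → ℝ) => cut R p.2 :=
    (measurable_cut R k).comp measurable_snd
  have h2 : Continuous fun p : (ℝ × ℝ) × (Fin k → ℝ) => partWave μ p.1 p.2 u := by
    unfold partWave; fun_prop
  exact h1.mul h2.measurable

lemma tendsto_partWave (μ : ℝ) (x : ℝ × ℝ) {k : ℕ} (θ : Fin k → ℝ) {s : Λ → Fin k → ℝ}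
    {s0 : Fin k → ℝ} (hs : ∀ i, Tendsto (fun t => s t i) l (𝓝 (s0 i))) :
    Tendsto (fun t => partWave μ x θ (s t)) l (𝓝 (partWave μ x θ s0)) := by
  have h : Continuous fun s : Fin k → ℝ => partWave μ x θ s := by unfold partWave; fun_prop
  exact (h.tendsto s0).comp (tendsto_pi_nhds.2 hs)

lemma mult_cut_fourier {g : ℝ × ℝ → ℂ} (hg : Continuous g) (hc : HasCompactSupport g) (μ R : ℝ)
    {s : Λ → Fin (m + n) → ℝ} {s0 : Fin (m + n) → ℝ}
    (hs : ∀ i, Tendsto (fun t => s t i) l (𝓝 (s0 i))) :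
    ∃ C, Mult l volume volume (fun t (θ : Fin m → ℝ) (η : Fin n → ℝ) =>
      cut R θ * cut R η * fourier g (momentum μ (shiftArg θ η (s t)))) C := by
  have hint : Integrable (fun x : ℝ × ℝ => ‖(2 * (Real.pi : ℂ))⁻¹ * g x‖ *
      (Real.exp (|μ| * (m * Real.exp R) * (|x.1| + |x.2|)) *
        Real.exp (|μ| * (n * Real.exp R) * (|x.1| + |x.2|)))) := by
    have h0 : HasCompactSupport fun x : ℝ × ℝ => ‖(2 * (Real.pi : ℂ))⁻¹ * g x‖ :=
      (hc.mul_left (f := fun _ => (2 * (Real.pi : ℂ))⁻¹)).norm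
    have h1 : Continuous fun x : ℝ × ℝ => Real.exp (|μ| * (m * Real.exp R) * (|x.1| + |x.2|)) *
        Real.exp (|μ| * (n * Real.exp R) * (|x.1| + |x.2|)) := by fun_prop
    exact Continuous.integrable_of_hasCompactSupport
      ((continuous_const.mul hg).norm.mul h1) h0.mul_right
  have hb : ∀ {k : ℕ} (x : ℝ × ℝ) (θ u : Fin k → ℝ), ‖cut R θ * partWave μ x θ u‖ ≤
      Real.exp (|μ| * (k * Real.exp R) * (|x.1| + |x.2|)) := fun x θ u =>
    norm_cut_mul_le (exp_pos _).le (norm_partWave_le x θ u)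
  have hl1 : ∀ (x : ℝ × ℝ) (θ : Fin m → ℝ), ∃ L, Tendsto (fun t => cut R θ *
      partWave μ x θ (fun i => s t (Fin.castAdd n i))) l (𝓝 L) := fun x θ =>
    ⟨_, (tendsto_partWave μ x θ (s := fun t i => s t (Fin.castAdd n i))
      (s0 := fun i => s0 (Fin.castAdd n i)) fun i => hs _).const_mul _⟩
  have hl2 : ∀ (x : ℝ × ℝ) (η : Fin n → ℝ), ∃ L, Tendsto (fun t => cut R η *
      partWave μ x η (fun j => s t (Fin.natAdd m j))) l (𝓝 L) := fun x η =>
    ⟨_, (tendsto_partWave μ x η (s := fun t j => s t (Fin.natAdd m j))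
      (s0 := fun j => s0 (Fin.natAdd m j)) fun j => hs _).const_mul _⟩
  have h := Mult.superpose (l := l) (μ := (volume : Measure (Fin m → ℝ)))
    (ν := (volume : Measure (Fin n → ℝ))) (ρ := (volume : Measure (ℝ × ℝ)))
    (γ := fun x => (2 * (Real.pi : ℂ))⁻¹ * g x)
    (α := fun t x θ => cut R θ * partWave μ x θ (fun i => s t (Fin.castAdd n i)))
    (β := fun t x η => cut R η * partWave μ x η (fun j => s t (Fin.natAdd m j)))
    (A := fun x => Real.exp (|μ| * (m * Real.exp R) * (|x.1| + |x.2|)))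
    (B := fun x => Real.exp (|μ| * (n * Real.exp R) * (|x.1| + |x.2|)))
    (hg.measurable.const_mul _) (fun t => measurable_cut_mul_partWave R μ _)
    (fun t => measurable_cut_mul_partWave R μ _)
    (fun _ => (exp_pos _).le) (fun _ => (exp_pos _).le)
    (.of_forall fun t x θ => hb x θ _) (.of_forall fun t x θ => hb x θ _)
    hl1 hl2 hint
  refine ⟨_, h.congr (.of_forall fun t θ η => ?_)⟩
  rw [fourier_eq, ← integral_const_mul, ← integral_const_mul]
  refine integral_congr_ae (.of_forall fun x => ?_)
  simp only [planeWave_shiftArg]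
  ring

lemma mult_cut_exp (R : ℝ) (k : ℤ) {s : Λ → Fin m → ℝ} {s0 : Fin m → ℝ}
    (hs : ∀ i, Tendsto (fun t => s t i) l (𝓝 (s0 i))) (i : Fin m) :
    Mult l volume volume (fun t (θ : Fin m → ℝ) (η : Fin n → ℝ) =>
      cut R θ * cut R η * exp (θ i + s t i * I) ^ k) (Real.exp (|k| * R)) := by
  refine mult_cut_left (α := fun t θ => exp (θ i + s t i * I) ^ k)
    (exp_pos _).le (fun t => ?_) (fun t θ h => ?_) fun θ => ?_
  · exact (by fun_prop : Measurable fun θ : Fin m → ℝ =>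
      exp (θ i + s t i * I)).pow_const k
  · rw [← Complex.exp_int_mul, Complex.norm_exp, exp_le_exp]
    have : ((k : ℂ) * (θ i + s t i * I)).re = k * θ i := by simp
    rw [this, Int.cast_abs]
    calc (k : ℝ) * θ i ≤ |(k : ℝ) * θ i| := le_abs_self _
      _ = |(k : ℝ)| * |θ i| := abs_mul _ _
      _ ≤ _ := by gcongr; exact h i
  · refine ⟨exp (θ i + s0 i * I) ^ k, ?_⟩
    simp only [← Complex.exp_int_mul]
    have : Continuous fun u : ℝ => exp (k * (θ i + u * I)) := by fun_prop
    exact (this.tendsto _).comp (hs i)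

lemma mult_cut_evalLaurent (P : SymLaurent) (R : ℝ) {s : Λ → Fin (m + n) → ℝ}
    {s0 : Fin (m + n) → ℝ} (hs : ∀ i, Tendsto (fun t => s t i) l (𝓝 (s0 i))) :
    ∃ C, Mult l volume volume (fun t (θ : Fin m → ℝ) (η : Fin n → ℝ) =>
      cut R θ * cut R η * evalLaurent (fun i => exp (shiftArg θ η (s t) i)) P) C := by
  induction P using MvPolynomial.induction_on with
  | C a =>
    refine ⟨_, (mult_cut_left (m := m) (n := n) (l := l) (R := R) (α := fun _ _ => a)
      (norm_nonneg a) (fun _ => measurable_const) (fun _ _ _ => le_rfl)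
      fun _ => ⟨_, tendsto_const_nhds⟩).congr (.of_forall fun t θ η => by
        simp [evalLaurent])⟩
  | add P Q hP hQ =>
    obtain ⟨C, hC⟩ := hP
    obtain ⟨D, hD⟩ := hQ
    refine ⟨_, (hC.add hD).congr (.of_forall fun t θ η => ?_)⟩
    simp only [evalLaurent, map_add]
    ring
  | mul_X P k hP =>
    obtain ⟨C, hC⟩ := hP
    have h1 := Mult.sum (univ : Finset (Fin m)) fun i _ =>
      mult_cut_exp (m := m) (n := n) (l := l) R (k : ℤ) (s := fun t i => s t (Fin.castAdd n i))
        (fun i => hs (Fin.castAdd n i)) i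
    have h2 := Mult.sum (univ : Finset (Fin n)) fun j _ =>
      (mult_cut_exp (m := n) (n := m) (l := l) R (k : ℤ) (s := fun t j => s t (Fin.natAdd m j))
        (fun j => hs (Fin.natAdd m j)) j).swap
    refine ⟨_, (hC.mul (h1.add h2)).congr (.of_forall fun t θ η => ?_)⟩
    have h3 : evalLaurent (fun i => exp (shiftArg θ η (s t) i)) (P * MvPolynomial.X k) =
        evalLaurent (fun i => exp (shiftArg θ η (s t) i)) P *
        (∑ i, exp (θ i + s t (Fin.castAdd n i) * I) ^ (k : ℤ) +
          ∑ j, exp (η j + s t (Fin.natAdd m j) * I) ^ (k : ℤ)) := by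
      simp [evalLaurent, Fin.sum_univ_add, shiftArg_castAdd, shiftArg_natAdd]
    rw [h3, ← Finset.mul_sum, ← Finset.mul_sum]
    linear_combination (evalLaurent (fun i => exp (shiftArg θ η (s t) i)) P *
      (∑ i, exp (θ i + s t (Fin.castAdd n i) * I) ^ (k : ℤ) +
          ∑ j, exp (η j + s t (Fin.natAdd m j) * I) ^ (k : ℤ))) *
      ((cut R η * cut R η) * cut_mul_self R θ + cut R θ * cut_mul_self R η)

lemma mult_cut_inv_wprod (R : ℝ) (m n : ℕ) :
    ∃ C, Mult l volume volume (fun _ (θ : Fin m → ℝ) (η : Fin n → ℝ) =>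
      cut R θ * cut R η * (wprod (cardWeight m) θ)⁻¹) C := by
  refine ⟨_, mult_cut_left (α := fun _ θ => (wprod (cardWeight m) θ)⁻¹)
    (A := 2 ^ 16 * (1 + m * Real.cosh R) ^ 16) (by have := Real.cosh_pos R; positivity)
    (fun _ => (measurable_wprod (measurable_expWeight _) m).inv) (fun _ θ h => ?_)
    fun θ => ⟨_, tendsto_const_nhds⟩⟩
  have h1 := inv_energy_le_wprod θ
  have h2 : energy1 θ ≤ 1 + m * Real.cosh R := by
    unfold energy1 energy
    have : ∑ j, Real.cosh (θ j) ≤ ∑ _j : Fin m, Real.cosh R :=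
      sum_le_sum fun j _ => Real.cosh_le_cosh.2 ((h j).trans (le_abs_self R))
    simpa using this
  have h3 : 0 < ‖wprod (cardWeight m) θ‖ := norm_pos_iff.2 (wprod_ne_zero θ)
  have h4 := pow_pos (energy1_pos θ) 16
  rw [norm_inv, inv_le_iff_one_le_mul₀ h3]
  rw [inv_le_iff_one_le_mul₀ h4] at h1
  calc (1 : ℝ) ≤ 2 ^ 16 * ‖wprod (cardWeight m) θ‖ * energy1 θ ^ 16 := h1
    _ ≤ 2 ^ 16 * ‖wprod (cardWeight m) θ‖ * (1 + m * Real.cosh R) ^ 16 := by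
      have := (energy1_pos θ).le
      gcongr
    _ = _ := by ring

open FourierTransform in
lemma mult_testFunction {φ : (Fin (m + n) → ℝ) → ℂ} (hφ : ContDiff ℝ ∞ φ)
    (hc : HasCompactSupport φ) : ∃ C, Mult l volume volume
      (fun _ (θ : Fin m → ℝ) (η : Fin n → ℝ) => φ (Fin.append θ η)) C := by
  let e : EuclideanSpace ℝ (Fin (m + n)) ≃L[ℝ] (Fin (m + n) → ℝ) := EuclideanSpace.equiv (Fin (m + n)) ℝ
  have h1 : ContDiff ℝ ∞ (fun x : EuclideanSpace ℝ (Fin (m + n)) => φ (e x)) := hφ.comp e.contDiff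
  have h2 : HasCompactSupport (fun x : EuclideanSpace ℝ (Fin (m + n)) => φ (e x)) := hc.comp_homeomorph e.toHomeomorph
  let f : SchwartzMap (EuclideanSpace ℝ (Fin (m + n))) ℂ := h2.toSchwartzMap h1
  have hf : ∀ x, f x = φ (e x) := fun x => rfl
  have hinv : ∀ x : EuclideanSpace ℝ (Fin (m + n)), f x = ∫ k : EuclideanSpace ℝ (Fin (m + n)), exp (((2 * Real.pi * inner ℝ k x : ℝ) : ℂ) *
      I) * (𝓕 f) k := by
    intro x
    have h3 : 𝓕⁻ (𝓕 f) = f := FourierTransform.fourierInv_fourier_eq f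
    have h4 : (𝓕⁻ (𝓕 f)) x = (𝓕⁻ ((𝓕 f : SchwartzMap (EuclideanSpace ℝ (Fin (m + n))) ℂ) : EuclideanSpace ℝ (Fin (m + n)) → ℂ)) x := by
      rw [SchwartzMap.fourierInv_coe]
    rw [← h3, h4, Real.fourierInv_eq']
    rw [h3]
    simp only [smul_eq_mul]
  have hcont : Continuous (fun p : EuclideanSpace ℝ (Fin (m + n)) × (Fin m → ℝ) => exp (((2 * Real.pi *
      ∑ i, p.1 (Fin.castAdd n i) * p.2 i : ℝ) : ℂ) * I)) := by
    fun_prop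
  have hcont' : Continuous (fun p : EuclideanSpace ℝ (Fin (m + n)) × (Fin n → ℝ) => exp (((2 * Real.pi *
      ∑ j, p.1 (Fin.natAdd m j) * p.2 j : ℝ) : ℂ) * I)) := by
    fun_prop
  have h := Mult.superpose (l := l) (μ := (volume : Measure (Fin m → ℝ)))
    (ν := (volume : Measure (Fin n → ℝ))) (ρ := (volume : Measure (EuclideanSpace ℝ (Fin (m + n)))))
    (γ := (𝓕 f : SchwartzMap (EuclideanSpace ℝ (Fin (m + n))) ℂ))
    (α := fun _ k θ => exp (((2 * Real.pi *
      ∑ i, k (Fin.castAdd n i) * θ i : ℝ) : ℂ) * I))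
    (β := fun _ k η => exp (((2 * Real.pi *
      ∑ j, k (Fin.natAdd m j) * η j : ℝ) : ℂ) * I))
    (A := fun _ => 1) (B := fun _ => 1)
    (𝓕 f).continuous.measurable (fun _ => hcont.measurable) (fun _ => hcont'.measurable)
    (fun _ => zero_le_one) (fun _ => zero_le_one)
    (.of_forall fun _ _ _ => (Complex.norm_exp_ofReal_mul_I _).le)
    (.of_forall fun _ _ _ => (Complex.norm_exp_ofReal_mul_I _).le)
    (fun _ _ => ⟨_, tendsto_const_nhds⟩) (fun _ _ => ⟨_, tendsto_const_nhds⟩)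
    (by simpa using (𝓕 f).integrable.norm)
  refine ⟨_, h.congr (.of_forall fun _ θ η => ?_)⟩
  have h5 : φ (Fin.append θ η) = f (WithLp.toLp 2 (Fin.append θ η)) := rfl
  rw [h5, hinv]
  refine integral_congr_ae (.of_forall fun k => ?_)
  simp only
  rw [← Complex.exp_add, mul_comm]
  congr 2
  rw [← add_mul, ← Complex.ofReal_add, ← mul_add]
  congr 3
  rw [PiLp.inner_apply, Fin.sum_univ_add]
  simp [mul_comm]

end Cut


section BoundaryValue

/-- The constant prefactor of the form factors. -/
def oddConst (k : ℕ) : ℂ :=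
  if Odd k then ((2 * (Real.pi : ℂ) * I) ^ ((k - 1) / 2))⁻¹ else 0

lemma norm_oddConst_le (k : ℕ) : ‖oddConst k‖ ≤ 1 := by
  unfold oddConst
  split_ifs
  · rw [norm_inv, norm_pow, norm_mul, norm_mul, Complex.norm_I, Complex.norm_real,
      Complex.norm_ofNat, mul_one, norm_of_nonneg Real.pi_pos.le]
    exact inv_le_one_of_one_le₀ (one_le_pow₀ (by linarith [Real.pi_gt_three]))
  · simp

lemma Fodd_eq (μ : ℝ) (P : SymLaurent) (g : ℝ × ℝ → ℂ) (k : ℕ) (ζ : Fin k → ℂ) :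
    Fodd μ P g k ζ = oddConst k * (fourier g (momentum μ ζ) *
      evalLaurent (fun i => exp (ζ i)) P * Modd ζ) := by
  unfold Fodd oddConst
  split_ifs <;> ring

variable {Λ : Type*} {l : Filter Λ} [l.IsCountablyGenerated] {m n : ℕ}

lemma exists_cut {φ : (Fin (m + n) → ℝ) → ℂ} (hc : HasCompactSupport φ) : ∃ R : ℝ,
    ∀ (θ : Fin m → ℝ) (η : Fin n → ℝ), φ (Fin.append θ η) =
      cut R θ * cut R η * φ (Fin.append θ η) := by
  obtain ⟨R, hR⟩ := hc.isCompact.isBounded.subset_closedBall 0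
  refine ⟨|R|, fun θ η => ?_⟩
  by_cases h : φ (Fin.append θ η) = 0
  · simp [h]
  · have h1 := hR (subset_tsupport φ h)
    rw [mem_closedBall_zero_iff] at h1
    have h2 : ‖θ‖ ≤ |R| := (pi_norm_le_iff_of_nonneg (abs_nonneg R)).2 fun i => by
      have := (norm_le_pi_norm (Fin.append θ η) (Fin.castAdd n i)).trans h1
      rw [Fin.append_left] at this
      exact this.trans (le_abs_self R)
    have h3 : ‖η‖ ≤ |R| := (pi_norm_le_iff_of_nonneg (abs_nonneg R)).2 fun i => by
      have := (norm_le_pi_norm (Fin.append θ η) (Fin.natAdd m i)).trans h1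
      rw [Fin.append_right] at this
      exact this.trans (le_abs_self R)
    rw [cut_eq_one h2, cut_eq_one h3, one_mul, one_mul]

/-- The form factors multiplied with a test function. -/
lemma good_testFunction (μ : ℝ) (P : SymLaurent) {g : ℝ × ℝ → ℂ} (hg : Continuous g)
    (hgc : HasCompactSupport g) {φ : (Fin (m + n) → ℝ) → ℂ} (hφ : ContDiff ℝ ∞ φ)
    (hc : HasCompactSupport φ) {a : Λ → Fin m → ℝ} {b : Λ → Fin n → ℝ} (h : ShiftFam l a b)
    {s : Λ → Fin (m + n) → ℝ} {s0 : Fin (m + n) → ℝ}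
    (hs : ∀ i, Tendsto (fun t => s t i) l (𝓝 (s0 i))) :
    ∃ C, Good l volume volume (fun t θ η => fourier g (momentum μ (shiftArg θ η (s t))) *
      evalLaurent (fun i => exp (shiftArg θ η (s t) i)) P * shiftKer (a t) (b t) θ η *
        φ (Fin.append θ η)) C := by
  obtain ⟨R, hR⟩ := exists_cut (m := m) (n := n) hc
  obtain ⟨C1, h1⟩ := mult_cut_fourier hg hgc μ R hs
  obtain ⟨C2, h2⟩ := mult_cut_evalLaurent P R hs
  obtain ⟨C3, h3⟩ := mult_cut_inv_wprod (l := l) R m n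
  obtain ⟨C4, h4⟩ := mult_cut_inv_wprod (l := l) R n m
  obtain ⟨C5, h5⟩ := mult_testFunction (l := l) hφ hc
  refine ⟨_, ((((h1.mul h2).mul (h3.mul h4.swap)).mul h5).good _ _ (good_cardKer h)).congr
    (.of_forall fun t => ?_)⟩
  funext θ η
  have e1 := wprod_ne_zero (m := m) θ
  have e2 := wprod_ne_zero (m := n) η
  have e3 := hR θ η
  rw [wKer]
  rcases cut_cases R θ with e4 | ⟨e4, -⟩
  · rw [e3]; simp [e4]
  rcases cut_cases R η with e5 | ⟨e5, -⟩
  · rw [e3]; simp [e5]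
  rw [e4, e5]
  field_simp

/-- Existence of the boundary values of the form factors, which can be computed with the momenta
taken at the node. -/
theorem exists_boundaryValue (μ : ℝ) (P : SymLaurent) {g : ℝ × ℝ → ℂ} (hg : Continuous g)
    (hgc : HasCompactSupport g) {φ : (Fin (m + n) → ℝ) → ℂ} (hφ : ContDiff ℝ ∞ φ)
    (hc : HasCompactSupport φ) :
    ∃ L : ℂ, Tendsto (fun l : Fin (m + n) → ℝ => ∫ x : Fin (m + n) → ℝ,
        Fodd μ P g (m + n) (fun j => (x j : ℂ) + (l j : ℂ) * I) * φ x)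
        (nodeFilter m n) (𝓝 L) ∧
      Tendsto (fun l : Fin (m + n) → ℝ => oddConst (m + n) *
        ∫ z : (Fin m → ℝ) × (Fin n → ℝ), ffKer μ P g (shiftA l) (shiftB l) z.1 z.2 *
          φ (Fin.append z.1 z.2)) (nodeFilter m n) (𝓝 L) := by
  have hfam : ShiftFam (nodeFilter m n ×ˢ (⊤ : Filter Bool)) (fun t => shiftA t.1)
      (fun t => shiftB t.1) :=
    ⟨tendsto_fst.eventually (shiftFam_node m n).small,
      fun i => ((shiftFam_node m n).lim_a i).comp tendsto_fst,
      fun j => ((shiftFam_node m n).lim_b j).comp tendsto_fst⟩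
  have hs : ∀ i, Tendsto (fun t : (Fin (m + n) → ℝ) × Bool => (if t.2 then t.1 else node m n) i)
      (nodeFilter m n ×ˢ (⊤ : Filter Bool)) (𝓝 (node m n i)) := by
    intro i
    have h1 := (tendsto_nodeFilter (m := m) (n := n) i).comp
      (tendsto_fst (g := (⊤ : Filter Bool)))
    rw [tendsto_def] at h1 ⊢
    intro S hS
    filter_upwards [h1 S hS] with t ht
    rcases t with ⟨t, _ | _⟩
    · exact mem_of_mem_nhds (x := node m n i) hS
    · exact ht
  obtain ⟨R, hR⟩ := exists_cut (m := m) (n := n) hc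
  obtain ⟨C, hC⟩ := good_testFunction (m := m) (n := n) μ P hg hgc hφ hc hfam hs
  obtain ⟨L, hL⟩ := hC.conv _ _ (sqInt_cut R m) (sqInt_cut R n)
  have hform : ∀ t : (Fin (m + n) → ℝ) × Bool, formInt volume volume (fun θ η =>
      fourier g (momentum μ (shiftArg θ η (if t.2 then t.1 else node m n))) *
      evalLaurent (fun i => exp (shiftArg θ η (if t.2 then t.1 else node m n) i)) P *
      shiftKer (shiftA t.1) (shiftB t.1) θ η * φ (Fin.append θ η)) (cut R) (cut R) =
      ∫ z : (Fin m → ℝ) × (Fin n → ℝ),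
        fourier g (momentum μ (shiftArg z.1 z.2 (if t.2 then t.1 else node m n))) *
      evalLaurent (fun i => exp (shiftArg z.1 z.2 (if t.2 then t.1 else node m n) i)) P *
      shiftKer (shiftA t.1) (shiftB t.1) z.1 z.2 * φ (Fin.append z.1 z.2) := by
    intro t
    refine integral_congr_ae (.of_forall fun z => ?_)
    simp only
    conv_rhs => rw [hR z.1 z.2]
    ring
  simp only [hform] at hL
  have hpt : ∀ c : Bool, Tendsto (fun l : Fin (m + n) → ℝ => (l, c)) (nodeFilter m n)
      (nodeFilter m n ×ˢ (⊤ : Filter Bool)) := fun c => tendsto_id.prodMk tendsto_top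
  refine ⟨oddConst (m + n) * L, ?_, ?_⟩
  · refine ((hL.comp (hpt true)).const_mul (oddConst (m + n))).congr fun l => ?_
    simp only [Function.comp, if_true]
    rw [← integral_append, ← integral_const_mul]
    refine integral_congr_ae (.of_forall fun z => ?_)
    simp only [Fodd_eq]
    rw [← Modd_shiftArg, show (fun j => ((Fin.append z.1 z.2 j : ℝ) : ℂ) + (l j : ℂ) * I) =
      shiftArg z.1 z.2 l from rfl]
    simp only [show ∀ j, ((Fin.append z.1 z.2 j : ℝ) : ℂ) + (l j : ℂ) * I =
      shiftArg z.1 z.2 l j from fun _ => rfl]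
    ring
  · refine ((hL.comp (hpt false)).const_mul (oddConst (m + n))).congr fun l => ?_
    simp only [Function.comp, Bool.false_eq_true, if_false, momentum_node, exp_shiftArg_node, ffKer]

end BoundaryValue


section Summability

/-- The factor `√((m + k)! / k!)` from the action of `m` annihilators. -/
def annihFactor (m k : ℕ) : ℝ := √((m + k).factorial / k.factorial)

lemma annihFactor_nonneg (m k : ℕ) : 0 ≤ annihFactor m k := Real.sqrt_nonneg _

lemma annihFactor_zero (k : ℕ) : annihFactor 0 k = 1 := by
  rw [annihFactor, zero_add, div_self (by positivity), Real.sqrt_one]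

lemma annihFactor_succ (m k : ℕ) :
    annihFactor (m + 1) k = √(m + k + 1) * annihFactor m k := by
  rw [annihFactor, annihFactor, ← Real.sqrt_mul (by positivity)]
  congr 1
  rw [show m + 1 + k = (m + k) + 1 by ring, Nat.factorial_succ]
  push_cast
  ring

lemma annihFactor_succ' (m k : ℕ) :
    annihFactor (m + 1) k = √(k + 1) * annihFactor m (k + 1) := by
  rw [annihFactor, annihFactor, ← Real.sqrt_mul (by positivity)]
  congr 1
  rw [show m + 1 + k = m + (k + 1) by ring, Nat.factorial_succ k]
  push_cast
  field_simp

lemma annihFactor_le (m k : ℕ) : annihFactor m k ≤ √(m.factorial) * (m + k + 1) ^ k := by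
  have h1 : ((m + k).factorial : ℝ) / k.factorial ≤ m.factorial * (m + k + 1) ^ k := by
    rw [div_le_iff₀ (by positivity)]
    have h2 : ((m + k).factorial : ℝ) ≤ m.factorial * (m + k) ^ k := by
      rw [← Nat.factorial_mul_ascFactorial]
      have := Nat.ascFactorial_le_pow_add m k
      exact_mod_cast Nat.mul_le_mul_left m.factorial this
    have h3 : (1 : ℝ) ≤ k.factorial := by exact_mod_cast k.factorial_pos
    calc _ ≤ (m.factorial : ℝ) * (m + k) ^ k := h2
      _ ≤ m.factorial * (m + k + 1) ^ k :=
        mul_le_mul_of_nonneg_left (pow_le_pow_left₀ (by positivity) (by linarith) k) (by positivity)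
      _ ≤ _ := le_mul_of_one_le_right (by positivity) h3
  have h4 : (1 : ℝ) ≤ (m + k + 1) ^ k := one_le_pow₀ (by
    have : (0 : ℝ) ≤ m := Nat.cast_nonneg m
    have : (0 : ℝ) ≤ k := Nat.cast_nonneg k
    linarith)
  calc annihFactor m k ≤ √(m.factorial * (m + k + 1) ^ k) := Real.sqrt_le_sqrt h1
    _ = √(m.factorial) * √((m + k + 1) ^ k) := Real.sqrt_mul (by positivity) _
    _ ≤ _ := by
      gcongr
      rw [Real.sqrt_le_left (by positivity)]
      exact le_self_pow₀ h4 two_ne_zero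

lemma weightWidth_pow_le (m : ℕ) :
    weightWidth m ^ m ≤ √(m.factorial) * ((Real.exp 2 + 1) * (1 / 2) ^ m) := by
  have hf : (0 : ℝ) < m.factorial := by exact_mod_cast m.factorial_pos
  have h1 : (1 : ℝ) ≤ √(m.factorial) * (Real.exp 2 * (1 / 2) ^ m) := by
    have h2 := Real.pow_div_factorial_le_exp 4 (by norm_num) m
    rw [div_le_iff₀ hf] at h2
    have h3 : (2 : ℝ) ^ m ≤ Real.exp 2 * √(m.factorial) := by
      refine le_of_sq_le_sq ?_ (by positivity)
      rw [mul_pow, Real.sq_sqrt hf.le, ← Real.exp_nat_mul, ← pow_mul, mul_comm m, pow_mul]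
      norm_num at h2 ⊢
      exact h2
    have h4 : (1 / 2 : ℝ) ^ m * 2 ^ m = 1 := by rw [← mul_pow]; norm_num
    calc (1 : ℝ) = (1 / 2 : ℝ) ^ m * 2 ^ m := h4.symm
      _ ≤ (1 / 2 : ℝ) ^ m * (Real.exp 2 * √(m.factorial)) := by gcongr
      _ = _ := by ring
  have h5 : (√m / 4) ^ m ≤ √(m.factorial) * (1 / 2) ^ m := by
    have h2 := Real.pow_div_factorial_le_exp m (Nat.cast_nonneg m) m
    rw [div_le_iff₀ hf] at h2
    have he : Real.exp m ≤ (2 ^ m) ^ 2 := by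
      have : Real.exp 1 ≤ 4 := by linarith [Real.exp_one_lt_d9]
      calc Real.exp m = Real.exp 1 ^ m := by rw [← Real.exp_nat_mul, mul_one]
        _ ≤ 4 ^ m := by gcongr
        _ = _ := by rw [← pow_mul, mul_comm m, pow_mul]; norm_num
    have h3 : √m ^ m ≤ 2 ^ m * √(m.factorial) := by
      refine le_of_sq_le_sq ?_ (by positivity)
      rw [mul_pow, Real.sq_sqrt hf.le, ← pow_mul, mul_comm m, pow_mul,
        Real.sq_sqrt (Nat.cast_nonneg m)]
      exact h2.trans (by gcongr)
    rw [div_pow]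
    calc √m ^ m / 4 ^ m ≤ 2 ^ m * √(m.factorial) / 4 ^ m := by gcongr
      _ = √(m.factorial) * (2 / 4) ^ m := by rw [div_pow]; ring
      _ = _ := by norm_num
  rw [weightWidth]
  have h0 : (0 : ℝ) ≤ √m / 4 := by positivity
  rcases max_choice 1 (√m / 4) with h | h <;> rw [h]
  · rw [one_pow]
    calc (1 : ℝ) ≤ √(m.factorial) * (Real.exp 2 * (1 / 2) ^ m) := h1
      _ ≤ _ := by gcongr; linarith
  · refine h5.trans ?_
    gcongr
    have := exp_pos 2
    exact le_mul_of_one_le_left (by positivity) (by linarith)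

/-- Summability of the bounds in the number of creators. -/
lemma summable_kerBound (n k : ℕ) : Summable fun m : ℕ =>
    (m.factorial : ℝ)⁻¹ * annihFactor m k * kerBound (weightWidth m) (weightWidth n) m n := by
  set D : ℝ := (Real.exp 2 + 1) * ((4 * Real.pi + 12) * weightWidth n ^ 2) ^ n with hD
  have hpi := Real.pi_pos
  have hsum : Summable fun m : ℕ =>
      D * 2 ^ (n + k + 1) * (((m + (n + k + 1) : ℕ) : ℝ) ^ (n + k) * (1 / 2) ^ (m + (n + k + 1))) := by
    have h := summable_pow_mul_geometric_of_norm_lt_one (n + k) (r := (1 / 2 : ℝ)) (by norm_num)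
    exact ((summable_nat_add_iff (f := fun j : ℕ => (j : ℝ) ^ (n + k) * (1 / 2 : ℝ) ^ j)
      (n + k + 1)).2 h).mul_left _
  refine Summable.of_nonneg_of_le (fun m => ?_) (fun m => ?_) hsum
  · have := annihFactor_nonneg m k
    have := weightWidth_pos m
    have := weightWidth_pos n
    unfold kerBound
    positivity
  · have hf : (0 : ℝ) < m.factorial := by exact_mod_cast m.factorial_pos
    have hw := weightWidth_pos n
    have hm0 : (0 : ℝ) ≤ m := Nat.cast_nonneg m
    have hn0 : (0 : ℝ) ≤ n := Nat.cast_nonneg n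
    have hk0 : (0 : ℝ) ≤ k := Nat.cast_nonneg k
    have hwm := weightWidth_pos m
    have hfs : √(m.factorial : ℝ) * √(m.factorial) = m.factorial := Real.mul_self_sqrt hf.le
    calc _ ≤ (m.factorial : ℝ)⁻¹ * (√(m.factorial) * (m + k + 1) ^ k) *
          (√(m.factorial) * ((Real.exp 2 + 1) * (1 / 2) ^ m) *
            ((4 * Real.pi + 12) * (m + n + 1) * weightWidth n ^ 2) ^ n) := by
          unfold kerBound
          gcongr
          · exact annihFactor_le m k
          · exact weightWidth_pow_le m
      _ = ((m.factorial : ℝ)⁻¹ * (√(m.factorial : ℝ) * √(m.factorial))) * (D * (1 / 2) ^ m *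
            ((m + k + 1) ^ k * (m + n + 1) ^ n)) := by
          rw [hD, mul_right_comm (4 * Real.pi + 12), mul_pow _ ((m : ℝ) + n + 1)]
          ring
      _ = D * (1 / 2) ^ m * ((m + k + 1) ^ k * (m + n + 1) ^ n) := by
          rw [hfs, inv_mul_cancel₀ hf.ne', one_mul]
      _ ≤ D * (1 / 2) ^ m * ((m + (n + k + 1)) ^ k * (m + (n + k + 1)) ^ n) := by
          have : 0 ≤ D := by positivity
          exact mul_le_mul_of_nonneg_left (mul_le_mul (pow_le_pow_left₀ (by positivity)
            (by linarith) k) (pow_le_pow_left₀ (by positivity) (by linarith) n) (by positivity)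
            (by positivity)) (by positivity)
      _ = _ := by
          push_cast
          rw [pow_add (1 / 2 : ℝ) m, pow_add ((m : ℝ) + (n + k + 1)) n k]
          have : (2 : ℝ) ^ (n + k + 1) * (1 / 2) ^ (n + k + 1) = 1 := by
            rw [← mul_pow]; norm_num
          linear_combination (-(D * (1 / 2) ^ m * ((m + (n + k + 1)) ^ k * (m + (n + k + 1)) ^ n))) *
            this

end Summability

section Annihilators

lemma waveSeq_congr (ψ : WaveSeq) {a b : ℕ} (h : a = b) {x : Fin a → ℝ} {y : Fin b → ℝ}
    (hxy : ∀ i, x i = y (Fin.cast h i)) : ψ a x = ψ b y := by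
  subst h
  congr 1
  funext i
  exact hxy i

lemma append_cases {m k : ℕ} (θ : Fin m → ℝ) (ξ : Fin k → ℝ) (i : Fin (m + k)) :
    Fin.append θ ξ i = if h : (i : ℕ) < m then θ ⟨i, h⟩ else ξ ⟨i - m, by omega⟩ := by
  refine Fin.addCases (fun i => ?_) (fun j => ?_) i
  · simp
  · simp

lemma annihProdRev_apply {m : ℕ} (θ : Fin m → ℝ) (ψ : WaveSeq) (k : ℕ) (ξ : Fin k → ℝ) :
    annihProdRev θ ψ k ξ = annihFactor m k * ψ (m + k) (Fin.append θ ξ) := by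
  induction m generalizing ψ with
  | zero =>
    rw [annihFactor_zero, Complex.ofReal_one, one_mul]
    simp only [annihProdRev, List.ofFn_zero, List.foldl_nil]
    exact waveSeq_congr ψ (zero_add k).symm fun i => by simp [append_cases]
  | succ m ih =>
    have h1 : annihProdRev θ ψ = annihProdRev (fun i => θ i.succ) (annih (θ 0) ψ) := by
      simp [annihProdRev, List.ofFn_succ]
    rw [h1, ih, annih, annihFactor_succ]
    have h2 : ψ (m + k + 1) (Fin.cons (θ 0) (Fin.append (fun i => θ i.succ) ξ)) =
        ψ (m + 1 + k) (Fin.append θ ξ) := waveSeq_congr ψ (by ring) fun i => by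
      refine Fin.cases ?_ (fun i => ?_) i
      · simp [append_cases]
      · simp [append_cases]
    rw [h2]
    push_cast
    ring

lemma annihProd_apply {n : ℕ} (η : Fin n → ℝ) (χ : WaveSeq) (k : ℕ) (ξ : Fin k → ℝ) :
    annihProd η χ k ξ = annihFactor n k * χ (n + k) (Fin.append (fun j => η j.rev) ξ) := by
  induction n generalizing k with
  | zero =>
    rw [annihFactor_zero, Complex.ofReal_one, one_mul]
    simp only [annihProd, List.ofFn_zero, List.foldr_nil]
    exact waveSeq_congr χ (zero_add k).symm fun i => by simp [append_cases]
  | succ n ih =>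
    have h1 : annihProd η χ = annih (η 0) (annihProd (fun i => η i.succ) χ) := by
      simp [annihProd, List.ofFn_succ]
    rw [h1, annih, ih, annihFactor_succ']
    have h2 : χ (n + (k + 1)) (Fin.append (fun j => η (Fin.succ (Fin.rev j))) (Fin.cons (η 0) ξ)) =
        χ (n + 1 + k) (Fin.append (fun j => η j.rev) ξ) := waveSeq_congr χ (by ring) fun i => by
      rw [append_cases, append_cases]
      rcases lt_trichotomy (i : ℕ) n with h | h | h
      · rw [dif_pos h, dif_pos (by simpa using by omega)]
        congr 1
        ext
        simp [Fin.val_rev]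
        omega
      · rw [dif_neg (by omega), dif_pos (by simpa using by omega)]
        have h3 : (⟨(i : ℕ) - n, by omega⟩ : Fin (k + 1)) = 0 := by ext; simp [h]
        rw [h3, Fin.cons_zero]
        congr 1
        ext
        simp [Fin.val_rev]
        omega
      · rw [dif_neg (by omega), dif_neg (by simpa using by omega)]
        have h3 : (⟨(i : ℕ) - n, by omega⟩ : Fin (k + 1)) =
            Fin.succ ⟨(i : ℕ) - (n + 1), by omega⟩ := by ext; simp; omega
        rw [h3, Fin.cons_succ]
        rfl
    rw [h2]
    push_cast
    ring

end Annihilators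


section SliceForm

variable {Z X Y : Type*} [MeasurableSpace Z] [MeasurableSpace X] [MeasurableSpace Y]
  {ρ : Measure Z} {μ : Measure X} {ν : Measure Y} [SFinite ρ] [SFinite μ] [SFinite ν]

/-- The form with kernel `K` tensored with the identity of a further variable. -/
def sliceForm (ρ : Measure Z) (μ : Measure X) (ν : Measure Y) (K : X → Y → ℂ) (Ψ : Z × X → ℂ)
    (χ : Z × Y → ℂ) : ℂ :=
  ∫ z, formInt μ ν K (fun x => Ψ (z, x)) (fun y => χ (z, y)) ∂ρ

variable {K : X → Y → ℂ} {C : ℝ} {Ψ Ψ' : Z × X → ℂ} {χ χ' : Z × Y → ℂ}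

lemma integrable_l2_mul (hΨ : SqInt (ρ.prod μ) Ψ) (hχ : SqInt (ρ.prod ν) χ) :
    Integrable (fun z => l2 μ (fun x => Ψ (z, x)) * l2 ν (fun y => χ (z, y))) ρ :=
  hΨ.memLp_l2_slice.integrable_mul hχ.memLp_l2_slice

lemma integral_l2_mul_le (hΨ : SqInt (ρ.prod μ) Ψ) (hχ : SqInt (ρ.prod ν) χ) :
    ∫ z, l2 μ (fun x => Ψ (z, x)) * l2 ν (fun y => χ (z, y)) ∂ρ ≤
      l2 (ρ.prod μ) Ψ * l2 (ρ.prod ν) χ := by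
  refine (integral_mul_le_sqrt (fun _ => l2_nonneg _) (fun _ => l2_nonneg _)
    hΨ.memLp_l2_slice hχ.memLp_l2_slice).trans_eq ?_
  rw [integral_l2_slice hΨ, integral_l2_slice hχ, Real.sqrt_sq (l2_nonneg _),
    Real.sqrt_sq (l2_nonneg _)]

lemma FormBdd.integrable_slice (hK : FormBdd μ ν K C) (hΨ : SqInt (ρ.prod μ) Ψ)
    (hχ : SqInt (ρ.prod ν) χ) :
    Integrable (fun z => formInt μ ν K (fun x => Ψ (z, x)) (fun y => χ (z, y))) ρ := by
  refine ((integrable_l2_mul hΨ hχ).const_mul C).mono'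
    (measurable_formInt hK.sq.meas (ψ := fun z x => Ψ (z, x)) (χ := fun z y => χ (z, y))
      hΨ.meas hχ.meas).aestronglyMeasurable ?_
  filter_upwards [hΨ.slice, hχ.slice] with z h1 h2
  exact hK.bound _ _ h1 h2

lemma FormBdd.norm_sliceForm_le (hK : FormBdd μ ν K C) (hΨ : SqInt (ρ.prod μ) Ψ)
    (hχ : SqInt (ρ.prod ν) χ) :
    ‖sliceForm ρ μ ν K Ψ χ‖ ≤ C * (l2 (ρ.prod μ) Ψ * l2 (ρ.prod ν) χ) := by
  have h := hK.superpose (ψ := fun z x => Ψ (z, x)) (χ := fun z y => χ (z, y)) hΨ.slice hχ.slice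
    (integrable_l2_mul hΨ hχ) (c := fun _ => 1) zero_le_one (fun _ => by simp)
  simp only [one_mul] at h
  exact h.trans (mul_le_mul_of_nonneg_left (integral_l2_mul_le hΨ hχ) hK.nonneg)

lemma Good.tendsto_sliceForm {Λ : Type*} {l : Filter Λ} [l.IsCountablyGenerated]
    {K : Λ → X → Y → ℂ} (hK : Good l μ ν K C) (hΨ : SqInt (ρ.prod μ) Ψ)
    (hχ : SqInt (ρ.prod ν) χ) : ∃ L, Tendsto (fun t => sliceForm ρ μ ν (K t) Ψ χ) l (𝓝 L) := by
  have h := hK.superpose (ψ := fun z x => Ψ (z, x)) (χ := fun z y => χ (z, y)) hΨ.meas hχ.meas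
    hΨ.slice hχ.slice (integrable_l2_mul hΨ hχ) (c := fun _ _ => 1) zero_le_one
    (fun _ => measurable_const) (.of_forall fun _ _ => by simp)
    (.of_forall fun _ => ⟨1, tendsto_const_nhds⟩)
  simp only [one_mul] at h
  exact h

lemma FormBdd.sliceForm_add_left (hK : FormBdd μ ν K C) (hΨ : SqInt (ρ.prod μ) Ψ)
    (hΨ' : SqInt (ρ.prod μ) Ψ') (hχ : SqInt (ρ.prod ν) χ) :
    sliceForm ρ μ ν K (fun p => Ψ p + Ψ' p) χ =
      sliceForm ρ μ ν K Ψ χ + sliceForm ρ μ ν K Ψ' χ := by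
  unfold sliceForm
  rw [← integral_add (hK.integrable_slice hΨ hχ) (hK.integrable_slice hΨ' hχ)]
  refine integral_congr_ae ?_
  filter_upwards [hΨ.slice, hΨ'.slice, hχ.slice] with z h1 h2 h3
  unfold formInt
  rw [← integral_add (formInt_integrable hK.sq h1 h3) (formInt_integrable hK.sq h2 h3)]
  simp only [add_mul]

lemma FormBdd.sliceForm_add_right (hK : FormBdd μ ν K C) (hΨ : SqInt (ρ.prod μ) Ψ)
    (hχ : SqInt (ρ.prod ν) χ) (hχ' : SqInt (ρ.prod ν) χ') :
    sliceForm ρ μ ν K Ψ (fun p => χ p + χ' p) =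
      sliceForm ρ μ ν K Ψ χ + sliceForm ρ μ ν K Ψ χ' := by
  unfold sliceForm
  rw [← integral_add (hK.integrable_slice hΨ hχ) (hK.integrable_slice hΨ hχ')]
  refine integral_congr_ae ?_
  filter_upwards [hΨ.slice, hχ'.slice, hχ.slice] with z h1 h2 h3
  unfold formInt
  rw [← integral_add (formInt_integrable hK.sq h1 h3) (formInt_integrable hK.sq h1 h2)]
  simp only [mul_add]

lemma sliceForm_const_mul_left (c : ℂ) :
    sliceForm ρ μ ν K (fun p => c * Ψ p) χ = c * sliceForm ρ μ ν K Ψ χ := by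
  unfold sliceForm formInt
  simp only [mul_assoc, integral_const_mul]

lemma sliceForm_const_mul_right (c : ℂ) :
    sliceForm ρ μ ν K Ψ (fun p => c * χ p) = c * sliceForm ρ μ ν K Ψ χ := by
  unfold sliceForm formInt
  simp only [mul_left_comm _ c, integral_const_mul]

lemma sliceForm_congr (h : Ψ =ᵐ[ρ.prod μ] Ψ') (h' : χ =ᵐ[ρ.prod ν] χ') :
    sliceForm ρ μ ν K Ψ χ = sliceForm ρ μ ν K Ψ' χ' := by
  refine integral_congr_ae ?_
  filter_upwards [Measure.ae_ae_of_ae_prod h, Measure.ae_ae_of_ae_prod h'] with z h1 h2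
  refine integral_congr_ae ?_
  have h3 : ∀ᵐ p ∂(μ.prod ν), Ψ (z, p.1) = Ψ' (z, p.1) :=
    Measure.quasiMeasurePreserving_fst.ae h1
  have h4 : ∀ᵐ p ∂(μ.prod ν), χ (z, p.2) = χ' (z, p.2) :=
    Measure.quasiMeasurePreserving_snd.ae h2
  filter_upwards [h3, h4] with p h5 h6
  rw [h5, h6]

end SliceForm

section Block

variable {α μ : ℝ} {P : SymLaurent} {g : ℝ × ℝ → ℂ}

/-- The real number `exp(ω(E(θ)))` as a complex number. -/
def expOmega (α : ℝ) {n : ℕ} (θ : Fin n → ℝ) : ℂ := (Real.exp (omega α (energy θ)) : ℝ)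

lemma expOmegaInv_mul_expOmega (α : ℝ) {n : ℕ} (θ : Fin n → ℝ) :
    expOmegaInv α θ * expOmega α θ = 1 := by
  rw [expOmegaInv, expOmega, ← Complex.ofReal_mul, inv_mul_cancel₀ (exp_pos _).ne',
    Complex.ofReal_one]

/-- Square-integrable functions in the domain of `exp(ω(E))`. -/
structure OmSq (α : ℝ) {n : ℕ} (ψ : (Fin n → ℝ) → ℂ) : Prop where
  sq : SqInt volume ψ
  exp : SqInt volume fun θ => expOmega α θ * ψ θ

lemma measurable_expOmega (α : ℝ) (n : ℕ) : Measurable (expOmega α : (Fin n → ℝ) → ℂ) :=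
  Complex.measurable_ofReal.comp (measurable_omega_energy α n)

lemma measurePreserving_joinLeft (m k : ℕ) : MeasurePreserving
    (fun z : (Fin k → ℝ) × (Fin m → ℝ) => (Fin.append z.2 z.1 : Fin (m + k) → ℝ))
    (volume.prod volume) volume :=
  (measurePreserving_splitEquiv m k).symm.comp Measure.measurePreserving_swap

lemma measurePreserving_rev (n : ℕ) :
    MeasurePreserving (fun η : Fin n → ℝ => fun j => η (Fin.rev j)) volume volume :=
  measurePreserving_perm (Fin.revPerm)

lemma measurePreserving_joinRight (n k : ℕ) : MeasurePreserving
    (fun z : (Fin k → ℝ) × (Fin n → ℝ) => (Fin.append (fun j => z.2 (Fin.rev j)) z.1 :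
      Fin (n + k) → ℝ)) (volume.prod volume) volume :=
  (measurePreserving_joinLeft n k).comp ((MeasurePreserving.id volume).prod (measurePreserving_rev n))

/-- The left argument of a block, as a function of the integrated and the created variables. -/
def leftArg {m k : ℕ} (ψ : (Fin (m + k) → ℝ) → ℂ) (z : (Fin k → ℝ) × (Fin m → ℝ)) : ℂ :=
  starRingEnd ℂ (ψ (Fin.append z.2 z.1))

/-- The right argument of a block, as a function of the integrated and the annihilated
variables. -/
def rightArg {n k : ℕ} (χ : (Fin (n + k) → ℝ) → ℂ) (z : (Fin k → ℝ) × (Fin n → ℝ)) : ℂ :=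
  χ (Fin.append (fun j => z.2 (Fin.rev j)) z.1)

variable {m n k : ℕ}

lemma sqInt_leftArg {ψ : (Fin (m + k) → ℝ) → ℂ} (h : SqInt volume ψ) :
    SqInt (volume.prod volume) (leftArg ψ) :=
  (h.comp (measurePreserving_joinLeft m k)).star

lemma l2_leftArg {ψ : (Fin (m + k) → ℝ) → ℂ} (h : SqInt volume ψ) :
    l2 (volume.prod volume) (leftArg ψ) = l2 volume ψ :=
  (l2_star _).trans (MeasurePreserving.l2_comp (measurePreserving_joinLeft m k) h.meas)

lemma sqInt_rightArg {χ : (Fin (n + k) → ℝ) → ℂ} (h : SqInt volume χ) :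
    SqInt (volume.prod volume) (rightArg χ) :=
  h.comp (measurePreserving_joinRight n k)

lemma l2_rightArg {χ : (Fin (n + k) → ℝ) → ℂ} (h : SqInt volume χ) :
    l2 (volume.prod volume) (rightArg χ) = l2 volume χ :=
  MeasurePreserving.l2_comp (measurePreserving_joinRight n k) h.meas

lemma energy_append (θ : Fin m → ℝ) (ξ : Fin k → ℝ) :
    energy (Fin.append θ ξ) = energy θ + energy ξ := by
  simp [energy, Fin.sum_univ_add]

lemma energy_rev (θ : Fin m → ℝ) : energy (fun j => θ (Fin.rev j)) = energy θ :=
  Equiv.sum_comp Fin.revPerm fun j => Real.cosh (θ j)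

/-- The ratio of the exponential weights is bounded. -/
lemma exists_ratio (hα : 0 < α) {e : (Fin k → ℝ) × (Fin m → ℝ) → Fin (m + k) → ℝ}
    (he : Measurable e) (hE : ∀ z, energy z.2 ≤ energy (e z)) :
    ∃ r : (Fin k → ℝ) × (Fin m → ℝ) → ℂ, Measurable r ∧ (∀ z, ‖r z‖ ≤ 1) ∧
      ∀ z, expOmega α z.2 = r z * expOmega α (e z) := by
  refine ⟨fun z => expOmega α z.2 * expOmegaInv α (e z), ?_, fun z => ?_, fun z => ?_⟩
  · exact ((measurable_expOmega α m).comp measurable_snd).mul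
      ((measurable_expOmegaInv α _).comp he)
  · rw [norm_mul, expOmega, expOmegaInv, Complex.norm_real, Complex.norm_real, norm_inv,
      norm_of_nonneg (exp_pos _).le, norm_of_nonneg (exp_pos _).le,
      ← div_eq_mul_inv, div_le_one (exp_pos _), exp_le_exp]
    exact Real.rpow_le_rpow (energy_nonneg _) (hE z) hα.le
  · rw [mul_assoc, expOmegaInv_mul_expOmega, mul_one]

lemma conj_expOmega {j : ℕ} (θ : Fin j → ℝ) : starRingEnd ℂ (expOmega α θ) = expOmega α θ :=
  Complex.conj_ofReal _

lemma OmSq.leftArg (hα : 0 < α) {ψ : (Fin (m + k) → ℝ) → ℂ} (h : OmSq α ψ) :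
    SqInt (volume.prod volume) (fun z => expOmega α z.2 * leftArg ψ z) ∧
      l2 (volume.prod volume) (fun z => expOmega α z.2 * IsingModel.leftArg ψ z) ≤
        l2 volume (fun θ => expOmega α θ * ψ θ) := by
  obtain ⟨r, hr, hr1, hr2⟩ := exists_ratio hα (measurePreserving_joinLeft m k).measurable
    (fun z => by rw [energy_append]; linarith [energy_nonneg z.1])
  have e : (fun z : (Fin k → ℝ) × (Fin m → ℝ) => expOmega α z.2 * IsingModel.leftArg ψ z) =
      fun z => r z * IsingModel.leftArg (fun θ => expOmega α θ * ψ θ) z := by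
    funext z
    rw [hr2, IsingModel.leftArg, IsingModel.leftArg, map_mul, conj_expOmega, mul_assoc]
  rw [e, ← l2_leftArg h.exp]
  exact ⟨(sqInt_leftArg h.exp).mul_bdd hr hr1,
    by simpa using l2_mul_le (sqInt_leftArg h.exp) zero_le_one hr1⟩

lemma OmSq.rightArg (hα : 0 < α) {χ : (Fin (n + k) → ℝ) → ℂ} (h : OmSq α χ) :
    SqInt (volume.prod volume) (fun z => expOmega α z.2 * rightArg χ z) ∧
      l2 (volume.prod volume) (fun z => expOmega α z.2 * IsingModel.rightArg χ z) ≤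
        l2 volume (fun θ => expOmega α θ * χ θ) := by
  obtain ⟨r, hr, hr1, hr2⟩ := exists_ratio hα (measurePreserving_joinRight n k).measurable
    (fun z => by rw [energy_append, energy_rev]; linarith [energy_nonneg z.1])
  have e : (fun z : (Fin k → ℝ) × (Fin n → ℝ) => expOmega α z.2 * IsingModel.rightArg χ z) =
      fun z => r z * IsingModel.rightArg (fun θ => expOmega α θ * χ θ) z := by
    funext z
    rw [hr2, IsingModel.rightArg, IsingModel.rightArg, mul_assoc]
  rw [e, ← l2_rightArg h.exp]
  exact ⟨(sqInt_rightArg h.exp).mul_bdd hr hr1,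
    by simpa using l2_mul_le (sqInt_rightArg h.exp) zero_le_one hr1⟩

/-- The form factor kernel near the node. -/
abbrev nodeKer (μ : ℝ) (P : SymLaurent) (g : ℝ × ℝ → ℂ) (m n : ℕ) (l : Fin (m + n) → ℝ) :
    (Fin m → ℝ) → (Fin n → ℝ) → ℂ := ffKer μ P g (shiftA l) (shiftB l)

lemma formInt_damp_right {K : (Fin m → ℝ) → (Fin n → ℝ) → ℂ} (ψ : (Fin m → ℝ) → ℂ)
    (χ : (Fin n → ℝ) → ℂ) :
    formInt volume volume (fun θ η => K θ η * expOmegaInv α η) ψ (fun η => expOmega α η * χ η) =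
      formInt volume volume K ψ χ := by
  refine integral_congr_ae (.of_forall fun z => ?_)
  simp only
  linear_combination (ψ z.1 * K z.1 z.2 * χ z.2) * expOmegaInv_mul_expOmega α z.2

lemma formInt_damp_left {K : (Fin m → ℝ) → (Fin n → ℝ) → ℂ} (ψ : (Fin m → ℝ) → ℂ)
    (χ : (Fin n → ℝ) → ℂ) :
    formInt volume volume (fun θ η => expOmegaInv α θ * K θ η) (fun θ => expOmega α θ * ψ θ) χ =
      formInt volume volume K ψ χ := by
  refine integral_congr_ae (.of_forall fun z => ?_)
  simp only
  linear_combination (ψ z.1 * K z.1 z.2 * χ z.2) * expOmegaInv_mul_expOmega α z.1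

/-- The contribution of `m` creators and `n` annihilators between vectors with `m + k` and `n + k`
particles, up to a factor. -/
def blockForm (μ : ℝ) (P : SymLaurent) (g : ℝ × ℝ → ℂ) (m n k : ℕ) (ψ : (Fin (m + k) → ℝ) → ℂ)
    (χ : (Fin (n + k) → ℝ) → ℂ) : ℂ :=
  limUnder (nodeFilter m n) fun l =>
    sliceForm volume volume volume (nodeKer μ P g m n l) (leftArg ψ) (rightArg χ)

/-- The damped kernels are good. -/
def DampRight (α μ : ℝ) (P : SymLaurent) (g : ℝ × ℝ → ℂ) (m n : ℕ) (C : ℝ) : Prop :=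
  Good (nodeFilter m n) volume volume (fun l θ η => nodeKer μ P g m n l θ η * expOmegaInv α η) C

/-- The damped kernels are good. -/
def DampLeft (α μ : ℝ) (P : SymLaurent) (g : ℝ × ℝ → ℂ) (m n : ℕ) (C : ℝ) : Prop :=
  Good (nodeFilter m n) volume volume (fun l θ η => expOmegaInv α θ * nodeKer μ P g m n l θ η) C

lemma sliceForm_damp_right {K : (Fin m → ℝ) → (Fin n → ℝ) → ℂ}
    (Ψ : (Fin k → ℝ) × (Fin m → ℝ) → ℂ) (χ : (Fin k → ℝ) × (Fin n → ℝ) → ℂ) :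
    sliceForm volume volume volume (fun θ η => K θ η * expOmegaInv α η) Ψ
      (fun z => expOmega α z.2 * χ z) = sliceForm volume volume volume K Ψ χ :=
  integral_congr_ae (.of_forall fun _ => formInt_damp_right _ _)

lemma sliceForm_damp_left {K : (Fin m → ℝ) → (Fin n → ℝ) → ℂ}
    (Ψ : (Fin k → ℝ) × (Fin m → ℝ) → ℂ) (χ : (Fin k → ℝ) × (Fin n → ℝ) → ℂ) :
    sliceForm volume volume volume (fun θ η => expOmegaInv α θ * K θ η)
      (fun z => expOmega α z.2 * Ψ z) χ = sliceForm volume volume volume K Ψ χ :=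
  integral_congr_ae (.of_forall fun _ => formInt_damp_left _ _)

variable {C : ℝ}

lemma tendsto_blockForm (hα : 0 < α) (h : DampRight α μ P g m n C) {ψ : (Fin (m + k) → ℝ) → ℂ}
    {χ : (Fin (n + k) → ℝ) → ℂ} (hψ : SqInt volume ψ) (hχ : OmSq α χ) :
    Tendsto (fun l => sliceForm volume volume volume (nodeKer μ P g m n l) (leftArg ψ)
      (rightArg χ)) (nodeFilter m n) (𝓝 (blockForm μ P g m n k ψ χ)) := by
  refine tendsto_nhds_limUnder ?_
  obtain ⟨L, hL⟩ := h.tendsto_sliceForm (sqInt_leftArg hψ) (hχ.rightArg hα).1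
  exact ⟨L, by simpa only [sliceForm_damp_right] using hL⟩

lemma norm_blockForm_le_right (hα : 0 < α) (h : DampRight α μ P g m n C)
    {ψ : (Fin (m + k) → ℝ) → ℂ} {χ : (Fin (n + k) → ℝ) → ℂ} (hψ : SqInt volume ψ)
    (hχ : OmSq α χ) : ‖blockForm μ P g m n k ψ χ‖ ≤
      C * (l2 volume ψ * l2 volume fun θ => expOmega α θ * χ θ) := by
  refine le_of_tendsto (tendsto_blockForm hα h hψ hχ).norm ?_
  filter_upwards [h.bdd] with l hl
  have h1 := hl.norm_sliceForm_le (sqInt_leftArg hψ) (hχ.rightArg hα).1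
  rw [sliceForm_damp_right, l2_leftArg hψ] at h1
  refine h1.trans (mul_le_mul_of_nonneg_left (mul_le_mul_of_nonneg_left (hχ.rightArg hα).2
    (l2_nonneg _)) hl.nonneg)

lemma norm_blockForm_le_left {D : ℝ} (hα : 0 < α) (h : DampRight α μ P g m n C)
    (h' : DampLeft α μ P g m n D) {ψ : (Fin (m + k) → ℝ) → ℂ} {χ : (Fin (n + k) → ℝ) → ℂ}
    (hψ : OmSq α ψ) (hχ : OmSq α χ) : ‖blockForm μ P g m n k ψ χ‖ ≤
      D * ((l2 volume fun θ => expOmega α θ * ψ θ) * l2 volume χ) := by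
  refine le_of_tendsto (tendsto_blockForm hα h hψ.sq hχ).norm ?_
  filter_upwards [h'.bdd] with l hl
  have h1 := hl.norm_sliceForm_le (hψ.leftArg hα).1 (sqInt_rightArg hχ.sq)
  rw [sliceForm_damp_left, l2_rightArg hχ.sq] at h1
  exact h1.trans (mul_le_mul_of_nonneg_left (mul_le_mul_of_nonneg_right (hψ.leftArg hα).2
    (l2_nonneg _)) hl.nonneg)

lemma OmSq.add {ψ ψ' : (Fin m → ℝ) → ℂ} (h : OmSq α ψ) (h' : OmSq α ψ') :
    OmSq α (fun θ => ψ θ + ψ' θ) :=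
  ⟨h.sq.add h'.sq, by simpa only [mul_add] using h.exp.add h'.exp⟩

lemma blockForm_add_left (hα : 0 < α) (h : DampRight α μ P g m n C)
    {ψ ψ' : (Fin (m + k) → ℝ) → ℂ} {χ : (Fin (n + k) → ℝ) → ℂ} (hψ : SqInt volume ψ)
    (hψ' : SqInt volume ψ') (hχ : OmSq α χ) :
    blockForm μ P g m n k (fun θ => ψ θ + ψ' θ) χ =
      blockForm μ P g m n k ψ χ + blockForm μ P g m n k ψ' χ := by
  refine tendsto_nhds_unique (tendsto_blockForm hα h (hψ.add hψ') hχ)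
    (((tendsto_blockForm hα h hψ hχ).add (tendsto_blockForm hα h hψ' hχ)).congr' ?_)
  filter_upwards [h.bdd] with l hl
  have h1 := hl.sliceForm_add_left (sqInt_leftArg hψ) (sqInt_leftArg hψ') (hχ.rightArg hα).1
  simp only [sliceForm_damp_right] at h1
  rw [← h1]
  congr 1
  funext z
  simp [leftArg]

lemma blockForm_add_right (hα : 0 < α) (h : DampRight α μ P g m n C)
    {ψ : (Fin (m + k) → ℝ) → ℂ} {χ χ' : (Fin (n + k) → ℝ) → ℂ} (hψ : SqInt volume ψ)
    (hχ : OmSq α χ) (hχ' : OmSq α χ') :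
    blockForm μ P g m n k ψ (fun θ => χ θ + χ' θ) =
      blockForm μ P g m n k ψ χ + blockForm μ P g m n k ψ χ' := by
  refine tendsto_nhds_unique (tendsto_blockForm hα h hψ (hχ.add hχ'))
    (((tendsto_blockForm hα h hψ hχ).add (tendsto_blockForm hα h hψ hχ')).congr' ?_)
  filter_upwards [h.bdd] with l hl
  have h1 := hl.sliceForm_add_right (sqInt_leftArg hψ) (hχ.rightArg hα).1 (hχ'.rightArg hα).1
  simp only [← mul_add, sliceForm_damp_right] at h1
  rw [← h1]
  rfl

lemma OmSq.const_mul {ψ : (Fin m → ℝ) → ℂ} (h : OmSq α ψ) (c : ℂ) : OmSq α (fun θ => c * ψ θ) :=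
  ⟨h.sq.const_mul c, by simpa only [mul_left_comm c] using h.exp.const_mul c⟩

lemma blockForm_const_mul_left (hα : 0 < α) (h : DampRight α μ P g m n C)
    {ψ : (Fin (m + k) → ℝ) → ℂ} {χ : (Fin (n + k) → ℝ) → ℂ} (hψ : SqInt volume ψ)
    (hχ : OmSq α χ) (c : ℂ) : blockForm μ P g m n k (fun θ => c * ψ θ) χ =
      starRingEnd ℂ c * blockForm μ P g m n k ψ χ := by
  refine tendsto_nhds_unique (tendsto_blockForm hα h (hψ.const_mul c) hχ)
    (((tendsto_blockForm hα h hψ hχ).const_mul _).congr fun l => ?_)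
  rw [← sliceForm_const_mul_left]
  congr 1
  funext z
  simp [leftArg]

lemma blockForm_const_mul_right (hα : 0 < α) (h : DampRight α μ P g m n C)
    {ψ : (Fin (m + k) → ℝ) → ℂ} {χ : (Fin (n + k) → ℝ) → ℂ} (hψ : SqInt volume ψ)
    (hχ : OmSq α χ) (c : ℂ) : blockForm μ P g m n k ψ (fun θ => c * χ θ) =
      c * blockForm μ P g m n k ψ χ := by
  refine tendsto_nhds_unique (tendsto_blockForm hα h hψ (hχ.const_mul c))
    (((tendsto_blockForm hα h hψ hχ).const_mul c).congr fun l => ?_)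
  rw [← sliceForm_const_mul_right]
  rfl

lemma blockForm_congr {ψ ψ' : (Fin (m + k) → ℝ) → ℂ} {χ χ' : (Fin (n + k) → ℝ) → ℂ}
    (h : ψ =ᵐ[volume] ψ') (h' : χ =ᵐ[volume] χ') :
    blockForm μ P g m n k ψ χ = blockForm μ P g m n k ψ' χ' := by
  unfold blockForm
  congr 1
  funext l
  refine sliceForm_congr ?_ ?_
  · filter_upwards [(measurePreserving_joinLeft m k).quasiMeasurePreserving.ae h] with z hz
    rw [leftArg, leftArg, hz]
  · exact (measurePreserving_joinRight n k).quasiMeasurePreserving.ae h'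

end Block


section Wave

variable {α : ℝ}

lemma sqInt_wave (Ψ : Fock) (n : ℕ) : SqInt volume (wave Ψ n) :=
  .of_memLp (Lp.stronglyMeasurable _).measurable (Lp.memLp _)

lemma l2_eq_norm {X : Type*} [MeasurableSpace X] {μ : Measure X} (f : Lp ℂ 2 μ) :
    l2 μ f = ‖f‖ := by
  have h : ∫ x, ‖f x‖ ^ 2 ∂μ = ‖f‖ ^ 2 := by
    have h1 : (inner ℂ f f : ℂ) = ((‖f‖ ^ 2 : ℝ) : ℂ) := by
      rw [inner_self_eq_norm_sq_to_K]; norm_cast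
    rw [L2.inner_def] at h1
    have h2 : (∫ x, (inner ℂ (f x) (f x) : ℂ) ∂μ) = ((∫ x, ‖f x‖ ^ 2 ∂μ : ℝ) : ℂ) := by
      rw [← integral_complex_ofReal]
      refine integral_congr_ae (.of_forall fun x => ?_)
      simp only
      rw [inner_self_eq_norm_sq_to_K]
      norm_cast
    rw [h2] at h1
    exact_mod_cast h1
  rw [l2, h, Real.sqrt_sq (norm_nonneg f)]

lemma l2_wave (Ψ : Fock) (n : ℕ) : l2 volume (wave Ψ n) = ‖Ψ n‖ := l2_eq_norm _

lemma l2_wave_le (Ψ : Fock) (n : ℕ) : l2 volume (wave Ψ n) ≤ ‖Ψ‖ := by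
  rw [l2_wave]
  exact lp.norm_apply_le_norm (by norm_num) Ψ n

lemma wave_eq_zero {Ψ : Fock} {n : ℕ} (h : Ψ n = 0) : wave Ψ n =ᵐ[volume] fun _ => 0 := by
  have : wave Ψ n = ((0 : Lp ℂ 2 (volume : Measure (Fin n → ℝ))) : (Fin n → ℝ) → ℂ) := by
    rw [wave, h]; rfl
  rw [this]
  exact Lp.coeFn_zero _ _ _

lemma l2_congr {X : Type*} [MeasurableSpace X] {μ : Measure X} {ψ φ : X → ℂ} (h : ψ =ᵐ[μ] φ) :
    l2 μ ψ = l2 μ φ := by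
  unfold l2
  congr 1
  refine integral_congr_ae ?_
  filter_upwards [h] with x hx
  rw [hx]

lemma IsExpOmega.sqInt {Ψ φ : Fock} (h : IsExpOmega α Ψ φ) (n : ℕ) :
    SqInt volume fun θ => expOmega α θ * wave Ψ n θ := by
  refine ⟨(measurable_expOmega α n).mul (sqInt_wave Ψ n).meas, (sqInt_wave φ n).int.congr ?_⟩
  filter_upwards [h n] with θ hθ
  rw [hθ]
  rfl

lemma IsExpOmega.omSq {Ψ φ : Fock} (h : IsExpOmega α Ψ φ) (n : ℕ) : OmSq α (wave Ψ n) :=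
  ⟨sqInt_wave Ψ n, h.sqInt n⟩

lemma IsExpOmega.l2_le {Ψ φ : Fock} (h : IsExpOmega α Ψ φ) (n : ℕ) :
    (l2 volume fun θ => expOmega α θ * wave Ψ n θ) ≤ ‖φ‖ := by
  exact (l2_congr (h n)).symm.trans_le (l2_wave_le φ n)

lemma omSq_wave (Ψ : finiteOmega α) (n : ℕ) : OmSq α (wave Ψ n) := by
  obtain ⟨-, φ, hφ⟩ := Ψ.2
  exact hφ.omSq n

end Wave

section FormA

variable {α μ : ℝ} {P : SymLaurent} {g : ℝ × ℝ → ℂ}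

/-- The numerical coefficient of a block. -/
def blockCoeff (m n k : ℕ) : ℝ :=
  (m.factorial : ℝ)⁻¹ * (n.factorial : ℝ)⁻¹ * annihFactor m k * annihFactor n k

lemma blockCoeff_nonneg (m n k : ℕ) : 0 ≤ blockCoeff m n k := by
  have := annihFactor_nonneg m k
  have := annihFactor_nonneg n k
  unfold blockCoeff
  positivity

/-- The contribution of `m` creators and `n` annihilators with `k` spectators. -/
def blockTerm (μ : ℝ) (P : SymLaurent) (g : ℝ × ℝ → ℂ) (p : ℕ × ℕ × ℕ) (Ψ X : Fock) : ℂ :=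
  blockCoeff p.1 p.2.1 p.2.2 * oddConst (p.1 + p.2.1) *
    blockForm μ P g p.1 p.2.1 p.2.2 (wave Ψ (p.1 + p.2.2)) (wave X (p.2.1 + p.2.2))

lemma blockForm_zero_left {m n k : ℕ} (χ : (Fin (n + k) → ℝ) → ℂ) :
    blockForm μ P g m n k (fun _ => 0) χ = 0 := by
  have : (fun l : Fin (m + n) → ℝ => sliceForm volume volume volume (nodeKer μ P g m n l)
      (leftArg fun _ : Fin (m + k) → ℝ => 0) (rightArg χ)) = fun _ => 0 := by
    funext l; simp [sliceForm, leftArg, formInt]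
  rw [blockForm, this]
  exact tendsto_const_nhds.limUnder_eq

lemma blockForm_zero_right {m n k : ℕ} (ψ : (Fin (m + k) → ℝ) → ℂ) :
    blockForm μ P g m n k ψ (fun _ => 0) = 0 := by
  have : (fun l : Fin (m + n) → ℝ => sliceForm volume volume volume (nodeKer μ P g m n l)
      (leftArg ψ) (rightArg fun _ : Fin (n + k) → ℝ => 0)) = fun _ => 0 := by
    funext l; simp [sliceForm, rightArg, formInt]
  rw [blockForm, this]
  exact tendsto_const_nhds.limUnder_eq

lemma blockTerm_eq_zero_left {p : ℕ × ℕ × ℕ} {Ψ X : Fock} (h : Ψ (p.1 + p.2.2) = 0) :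
    blockTerm μ P g p Ψ X = 0 := by
  rw [blockTerm, blockForm_congr (wave_eq_zero h) EventuallyEq.rfl, blockForm_zero_left, mul_zero]

lemma blockTerm_eq_zero_right {p : ℕ × ℕ × ℕ} {Ψ X : Fock} (h : X (p.2.1 + p.2.2) = 0) :
    blockTerm μ P g p Ψ X = 0 := by
  rw [blockTerm, blockForm_congr EventuallyEq.rfl (wave_eq_zero h), blockForm_zero_right, mul_zero]

lemma blockTerm_eq_zero {p : ℕ × ℕ × ℕ} {M N : ℕ} {Ψ X : Fock} (hΨ : AtMost M Ψ)
    (hX : AtMost N X) (hp : p ∉ range (M + 1) ×ˢ range (N + 1) ×ˢ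
      range (N + 1)) : blockTerm μ P g p Ψ X = 0 := by
  simp only [Finset.mem_product, Finset.mem_range, not_and_or, not_lt] at hp
  rcases hp with h | h | h
  · exact blockTerm_eq_zero_left (hΨ _ (by omega))
  · exact blockTerm_eq_zero_right (hX _ (by omega))
  · exact blockTerm_eq_zero_right (hX _ (by omega))

lemma summable_blockTerm (Ψ X : finiteOmega α) :
    Summable fun p : ℕ × ℕ × ℕ => blockTerm μ P g p Ψ X := by
  obtain ⟨⟨M, hM⟩, -⟩ := Ψ.2
  obtain ⟨⟨N, hN⟩, -⟩ := X.2
  exact summable_of_ne_finset_zero fun p hp => blockTerm_eq_zero hM hN hp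

/-- The form with the given form factors. -/
def formA (hα : 0 < α) (h : ∀ m n, ∃ C, DampRight α μ P g m n C) : SForm α :=
  LinearMap.mk₂'ₛₗ (starRingEnd ℂ) (RingHom.id ℂ)
    (fun Ψ X => ∑' p : ℕ × ℕ × ℕ, blockTerm μ P g p (Ψ : Fock) (X : Fock))
    (fun Ψ Ψ' X => by
      rw [← (summable_blockTerm Ψ X).tsum_add (summable_blockTerm Ψ' X)]
      refine tsum_congr fun p => ?_
      obtain ⟨C, hC⟩ := h p.1 p.2.1
      rw [blockTerm, Submodule.coe_add, blockForm_congr (wave_add _ _ _) EventuallyEq.rfl, blockTerm, blockTerm,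
        ← mul_add, ← blockForm_add_left hα hC (sqInt_wave _ _) (sqInt_wave _ _) (omSq_wave X _)]
      rfl)
    (fun c Ψ X => by
      rw [smul_eq_mul, ← tsum_mul_left]
      refine tsum_congr fun p => ?_
      obtain ⟨C, hC⟩ := h p.1 p.2.1
      rw [blockTerm, Submodule.coe_smul, blockForm_congr (wave_smul _ _ _) EventuallyEq.rfl, blockTerm,
        mul_left_comm, ← blockForm_const_mul_left hα hC (sqInt_wave _ _) (omSq_wave X _)]
      rfl)
    (fun Ψ X X' => by
      rw [← (summable_blockTerm Ψ X).tsum_add (summable_blockTerm Ψ X')]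
      refine tsum_congr fun p => ?_
      obtain ⟨C, hC⟩ := h p.1 p.2.1
      rw [blockTerm, Submodule.coe_add, blockForm_congr EventuallyEq.rfl (wave_add _ _ _), blockTerm, blockTerm,
        ← mul_add, ← blockForm_add_right hα hC (sqInt_wave _ _) (omSq_wave X _) (omSq_wave X' _)]
      rfl)
    (fun c Ψ X => by
      rw [smul_eq_mul, ← tsum_mul_left]
      refine tsum_congr fun p => ?_
      obtain ⟨C, hC⟩ := h p.1 p.2.1
      rw [blockTerm, Submodule.coe_smul, blockForm_congr EventuallyEq.rfl (wave_smul _ _ _), blockTerm,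
        RingHom.id_apply, mul_left_comm, ← blockForm_const_mul_right hα hC (sqInt_wave _ _)
          (omSq_wave X _)]
      rfl)

variable (hα : 0 < α) (h : ∀ m n, ∃ C, DampRight α μ P g m n C)

lemma formA_apply (Ψ X : finiteOmega α) :
    formA hα h Ψ X = ∑' p : ℕ × ℕ × ℕ, blockTerm μ P g p (Ψ : Fock) (X : Fock) := rfl

lemma formA_eq_sum {M N : ℕ} {Ψ X : finiteOmega α} (hΨ : AtMost M (Ψ : Fock))
    (hX : AtMost N (X : Fock)) : formA hα h Ψ X = ∑ m ∈ range (M + 1),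
      ∑ n ∈ range (N + 1), ∑ k ∈ range (N + 1),
        blockTerm μ P g (m, n, k) (Ψ : Fock) (X : Fock) := by
  rw [formA_apply, tsum_eq_sum fun p hp => blockTerm_eq_zero hΨ hX hp, Finset.sum_product]
  refine sum_congr rfl fun m _ => ?_
  rw [Finset.sum_product]

/-- Forms that are bounded by `C ‖ψ‖ ‖exp(ω) χ‖` and by `C ‖exp(ω) ψ‖ ‖χ‖`, where `C` depends only
on the number of particles of the vector that is damped. -/
def OmegaBounded (α : ℝ) : Submodule ℂ (SForm α) where
  carrier := {A | ∀ N : ℕ, ∃ C : ℝ, ∀ (ψ χ : finiteOmega α) (φ : Fock),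
    (AtMost N (χ : Fock) → IsExpOmega α χ φ → ‖A ψ χ‖ ≤ C * ‖(ψ : Fock)‖ * ‖φ‖) ∧
    (AtMost N (ψ : Fock) → IsExpOmega α ψ φ → ‖A ψ χ‖ ≤ C * ‖φ‖ * ‖(χ : Fock)‖)}
  add_mem' := by
    intro A B hA hB N
    obtain ⟨C, hC⟩ := hA N
    obtain ⟨D, hD⟩ := hB N
    refine ⟨C + D, fun ψ χ φ => ⟨fun h1 h2 => ?_, fun h1 h2 => ?_⟩⟩
    · have e1 := (hC ψ χ φ).1 h1 h2
      have e2 := (hD ψ χ φ).1 h1 h2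
      have e3 := norm_add_le (A ψ χ) (B ψ χ)
      simp only [LinearMap.add_apply]
      linarith
    · have e1 := (hC ψ χ φ).2 h1 h2
      have e2 := (hD ψ χ φ).2 h1 h2
      have e3 := norm_add_le (A ψ χ) (B ψ χ)
      simp only [LinearMap.add_apply]
      linarith
  zero_mem' := fun N => ⟨0, fun ψ χ φ => by simp⟩
  smul_mem' := by
    intro c A hA N
    obtain ⟨C, hC⟩ := hA N
    refine ⟨‖c‖ * C, fun ψ χ φ => ⟨fun h1 h2 => ?_, fun h1 h2 => ?_⟩⟩
    · have e1 := mul_le_mul_of_nonneg_left ((hC ψ χ φ).1 h1 h2) (norm_nonneg c)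
      simp only [LinearMap.smul_apply, norm_smul]
      linarith
    · have e1 := mul_le_mul_of_nonneg_left ((hC ψ χ φ).2 h1 h2) (norm_nonneg c)
      simp only [LinearMap.smul_apply, norm_smul]
      linarith

lemma norm_blockTerm_le {p : ℕ × ℕ × ℕ} {Ψ X : Fock} {B : ℝ}
    (hB : ‖blockForm μ P g p.1 p.2.1 p.2.2 (wave Ψ (p.1 + p.2.2)) (wave X (p.2.1 + p.2.2))‖ ≤ B) :
    ‖blockTerm μ P g p Ψ X‖ ≤ blockCoeff p.1 p.2.1 p.2.2 * B := by
  rw [blockTerm, norm_mul, norm_mul, Complex.norm_real, norm_of_nonneg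
    (blockCoeff_nonneg _ _ _)]
  refine mul_le_mul (mul_le_of_le_one_right (blockCoeff_nonneg _ _ _) (norm_oddConst_le _)) hB
    (norm_nonneg _) (blockCoeff_nonneg _ _ _)

lemma summable_blockCoeff (C : ℝ) (n k : ℕ) : Summable fun m : ℕ =>
    blockCoeff m n k * (C * kerBound (weightWidth m) (weightWidth n) m n) := by
  refine ((summable_kerBound n k).mul_left ((n.factorial : ℝ)⁻¹ * annihFactor n k * C)).congr
    fun m => ?_
  rw [blockCoeff]
  ring

lemma blockCoeff_comm (m n k : ℕ) : blockCoeff m n k = blockCoeff n m k := by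
  unfold blockCoeff; ring

/-- A finite sum of blocks is bounded by the sum of the series of bounds. -/
lemma norm_sum_blocks_le {M N : ℕ} {T : ℕ → ℕ → ℕ → ℂ} {b : ℕ → ℕ → ℕ → ℝ} {r : ℝ} (hr : 0 ≤ r)
    (hb0 : ∀ m n k, 0 ≤ b m n k) (hb : ∀ n k, Summable fun m => b m n k)
    (hT : ∀ m n k, ‖T m n k‖ ≤ b m n k * r) :
    ‖∑ m ∈ range (M + 1), ∑ n ∈ range (N + 1), ∑ k ∈ range (N + 1), T m n k‖ ≤
      (∑ n ∈ range (N + 1), ∑ k ∈ range (N + 1), ∑' m, b m n k) * r := by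
  calc _ ≤ ∑ m ∈ range (M + 1), ∑ n ∈ range (N + 1), ∑ k ∈ range (N + 1),
        b m n k * r := by
        refine (norm_sum_le _ _).trans (sum_le_sum fun m _ => (norm_sum_le _ _).trans
          (sum_le_sum fun n _ => (norm_sum_le _ _).trans
            (sum_le_sum fun k _ => hT m n k)))
    _ = ∑ n ∈ range (N + 1), ∑ k ∈ range (N + 1),
        ∑ m ∈ range (M + 1), b m n k * r := by
        rw [Finset.sum_comm]
        exact sum_congr rfl fun n _ => Finset.sum_comm
    _ ≤ ∑ n ∈ range (N + 1), ∑ k ∈ range (N + 1), (∑' m, b m n k) * r := by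
        refine sum_le_sum fun n _ => sum_le_sum fun k _ => ?_
        rw [← Finset.sum_mul]
        exact mul_le_mul_of_nonneg_right ((hb n k).sum_le_tsum _ fun m _ => hb0 m n k) hr
    _ = _ := by simp only [Finset.sum_mul]

lemma formA_mem_omegaBounded {CR CL : ℝ} (hCR : 0 ≤ CR) (hCL : 0 ≤ CL)
    (hR : ∀ m n, DampRight α μ P g m n (CR * kerBound (weightWidth m) (weightWidth n) m n))
    (hL : ∀ m n, DampLeft α μ P g m n (CL * kerBound (weightWidth n) (weightWidth m) n m)) :
    formA hα h ∈ OmegaBounded α := by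
  have hk : ∀ m n, 0 ≤ kerBound (weightWidth m) (weightWidth n) m n := fun m n => by
    have := weightWidth_pos m
    have := weightWidth_pos n
    have := Real.pi_pos
    unfold kerBound; positivity
  intro N
  let b : ℝ → ℕ → ℕ → ℕ → ℝ := fun C m n k =>
    blockCoeff m n k * (C * kerBound (weightWidth m) (weightWidth n) m n)
  let S : ℝ → ℝ := fun C => ∑ n ∈ range (N + 1), ∑ k ∈ range (N + 1), ∑' m, b C m n k
  have hb0 : ∀ C, 0 ≤ C → ∀ m n k, 0 ≤ b C m n k := fun C hC m n k =>
    mul_nonneg (blockCoeff_nonneg _ _ _) (mul_nonneg hC (hk m n))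
  have hS : ∀ C, 0 ≤ C → 0 ≤ S C := fun C hC => Finset.sum_nonneg fun n _ =>
    Finset.sum_nonneg fun k _ => tsum_nonneg fun m => hb0 C hC m n k
  refine ⟨S CR + S CL, fun Ψ X φ => ⟨fun hX hφ => ?_, fun hΨ hφ => ?_⟩⟩
  · obtain ⟨⟨M, hM⟩, -⟩ := Ψ.2
    rw [formA_eq_sum hα h hM hX, mul_assoc]
    refine (norm_sum_blocks_le (r := ‖(Ψ : Fock)‖ * ‖φ‖) (by positivity) (hb0 CR hCR)
      (fun n k => summable_blockCoeff CR n k) fun m n k => ?_).trans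
      (mul_le_mul_of_nonneg_right (le_add_of_nonneg_right (hS CL hCL)) (by positivity))
    have h1 := norm_blockForm_le_right hα (hR m n) (sqInt_wave (Ψ : Fock) (m + k)) (hφ.omSq (n + k))
    refine (norm_blockTerm_le (p := (m, n, k)) h1).trans ?_
    simp only [b]
    rw [mul_assoc (blockCoeff m n k)]
    have h2 := mul_nonneg hCR (hk m n)
    have h3 := l2_wave_le (Ψ : Fock) (m + k)
    have h4 := hφ.l2_le (n + k)
    have h5 := l2_nonneg (μ := volume) fun θ => expOmega α θ * wave (X : Fock) (n + k) θ
    exact mul_le_mul_of_nonneg_left (mul_le_mul_of_nonneg_left (mul_le_mul h3 h4 h5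
      (norm_nonneg _)) h2) (blockCoeff_nonneg m n k)
  · obtain ⟨⟨M, hM⟩, -⟩ := X.2
    have hsum : formA hα h Ψ X = ∑ n ∈ range (M + 1), ∑ m ∈ range (N + 1),
        ∑ k ∈ range (N + 1), blockTerm μ P g (m, n, k) (Ψ : Fock) (X : Fock) := by
      have hz : ∀ p ∉ range (N + 1) ×ˢ range (M + 1) ×ˢ range (N + 1),
          blockTerm μ P g p (Ψ : Fock) (X : Fock) = 0 := by
        intro p hp
        simp only [Finset.mem_product, Finset.mem_range, not_and_or, not_lt] at hp
        rcases hp with h' | h' | h'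
        · exact blockTerm_eq_zero_left (hΨ _ (by omega))
        · exact blockTerm_eq_zero_right (hM _ (by omega))
        · exact blockTerm_eq_zero_left (hΨ _ (by omega))
      rw [formA_apply, tsum_eq_sum hz, Finset.sum_product, Finset.sum_comm' (t' := range (N + 1))
        (s' := fun _ => range (M + 1)) (by intro x y; exact Iff.rfl)]
      refine sum_congr rfl fun m _ => ?_
      rw [Finset.sum_product]
    rw [hsum, mul_assoc]
    refine (norm_sum_blocks_le (r := ‖φ‖ * ‖(X : Fock)‖) (by positivity) (hb0 CL hCL)
      (fun n k => summable_blockCoeff CL n k) fun n m k => ?_).trans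
      (mul_le_mul_of_nonneg_right (le_add_of_nonneg_left (hS CR hCR)) (by positivity))
    have h1 := norm_blockForm_le_left hα (hR m n) (hL m n) (hφ.omSq (m + k)) (omSq_wave X (n + k))
    refine (norm_blockTerm_le (p := (m, n, k)) h1).trans ?_
    simp only [b]
    rw [blockCoeff_comm m n k, mul_assoc (blockCoeff n m k)]
    have h2 := mul_nonneg hCL (hk n m)
    have h3 := l2_wave_le (X : Fock) (n + k)
    have h4 := hφ.l2_le (m + k)
    have h5 := l2_nonneg (μ := volume) (wave (X : Fock) (n + k))
    exact mul_le_mul_of_nonneg_left (mul_le_mul_of_nonneg_left (mul_le_mul h4 h3 h5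
      (norm_nonneg _)) h2) (blockCoeff_nonneg n m k)

lemma OmegaBounded.le_Qomega : OmegaBounded α ≤ Qomega α := by
  intro A hA N
  obtain ⟨C, hC⟩ := hA N
  exact ⟨C, fun ψ χ hψ hχ => ⟨fun φ hφ => (hC ψ χ φ).1 hχ hφ, fun φ hφ => (hC ψ χ φ).2 hψ hφ⟩⟩

end FormA


section SliceFubini

variable {Z X Y : Type*} [MeasurableSpace Z] [MeasurableSpace X] [MeasurableSpace Y]
  {ρ : Measure Z} {μ : Measure X} {ν : Measure Y} [SFinite ρ] [SFinite μ] [SFinite ν]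
  {K : X → Y → ℂ} {Ψ : Z × X → ℂ} {χ : Z × Y → ℂ}

lemma SqInt.slice_left {Ψ : Z × X → ℂ} (h : SqInt (ρ.prod μ) Ψ) :
    ∀ᵐ x ∂μ, SqInt ρ (fun z => Ψ (z, x)) := h.swap.slice

lemma integrable_slice_kernel (hK : SqInt (μ.prod ν) fun z => K z.1 z.2)
    (hΨ : SqInt (ρ.prod μ) Ψ) (hχ : SqInt (ρ.prod ν) χ) :
    Integrable (fun q : Z × X × Y => Ψ (q.1, q.2.1) * K q.2.1 q.2.2 * χ (q.1, q.2.2))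
      (ρ.prod (μ.prod ν)) := by
  have hm : Measurable fun q : Z × X × Y => Ψ (q.1, q.2.1) * K q.2.1 q.2.2 * χ (q.1, q.2.2) :=
    ((hΨ.meas.comp (measurable_fst.prodMk (measurable_fst.comp measurable_snd))).mul
      (hK.meas.comp measurable_snd)).mul
      (hχ.meas.comp (measurable_fst.prodMk (measurable_snd.comp measurable_snd)))
  have hs1 : ∀ᵐ p ∂(μ.prod ν), SqInt ρ (fun z => Ψ (z, p.1)) :=
    Measure.quasiMeasurePreserving_fst.ae hΨ.slice_left
  have hs2 : ∀ᵐ p ∂(μ.prod ν), SqInt ρ (fun z => χ (z, p.2)) :=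
    Measure.quasiMeasurePreserving_snd.ae hχ.slice_left
  rw [integrable_prod_iff' hm.aestronglyMeasurable]
  constructor
  · filter_upwards [hs1, hs2] with p h1 h2
    exact ((h1.integrable_mul h2).const_mul (K p.1 p.2)).congr
      (.of_forall fun z => by simp only; ring)
  · have ha := hΨ.swap.memLp_l2_slice
    have hb := hχ.swap.memLp_l2_slice
    have hA : SqInt μ (fun x => ((l2 ρ fun z => Ψ (z, x) : ℝ) : ℂ)) :=
      ⟨Complex.measurable_ofReal.comp (measurable_l2_slice hΨ.swap.meas), by
        simpa [sq_abs] using hΨ.swap.integrable_l2_slice⟩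
    have hB : SqInt ν (fun y => ((l2 ρ fun z => χ (z, y) : ℝ) : ℂ)) :=
      ⟨Complex.measurable_ofReal.comp (measurable_l2_slice hχ.swap.meas), by
        simpa [sq_abs] using hχ.swap.integrable_l2_slice⟩
    refine (formInt_integrable hK hA hB).norm.mono' ?_ ?_
    · exact (hm.norm.comp measurable_swap).stronglyMeasurable.integral_prod_right'.aestronglyMeasurable
    · filter_upwards [hs1, hs2] with p h1 h2
      rw [norm_of_nonneg (integral_nonneg fun _ => norm_nonneg _)]
      have h3 : ∫ z, ‖Ψ (z, p.1)‖ * ‖χ (z, p.2)‖ ∂ρ ≤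
          (l2 ρ fun z => Ψ (z, p.1)) * l2 ρ fun z => χ (z, p.2) :=
        integral_mul_le_sqrt (fun _ => norm_nonneg _) (fun _ => norm_nonneg _) h1.memLp.norm
          h2.memLp.norm
      calc ∫ z, ‖Ψ (z, p.1) * K p.1 p.2 * χ (z, p.2)‖ ∂ρ
          = ‖K p.1 p.2‖ * ∫ z, ‖Ψ (z, p.1)‖ * ‖χ (z, p.2)‖ ∂ρ := by
            rw [← integral_const_mul]
            congr 1; funext z; rw [norm_mul, norm_mul]; ring
        _ ≤ ‖K p.1 p.2‖ * ((l2 ρ fun z => Ψ (z, p.1)) * l2 ρ fun z => χ (z, p.2)) := by gcongr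
        _ = _ := by
            simp only [norm_mul, Complex.norm_real, norm_of_nonneg (l2_nonneg _)]
            ring

lemma sliceForm_eq_integral (hK : SqInt (μ.prod ν) fun z => K z.1 z.2)
    (hΨ : SqInt (ρ.prod μ) Ψ) (hχ : SqInt (ρ.prod ν) χ) :
    sliceForm ρ μ ν K Ψ χ =
      ∫ p, K p.1 p.2 * ∫ z, Ψ (z, p.1) * χ (z, p.2) ∂ρ ∂(μ.prod ν) := by
  unfold sliceForm formInt
  rw [integral_integral_swap (f := fun z (p : X × Y) => Ψ (z, p.1) * K p.1 p.2 * χ (z, p.2))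
    (integrable_slice_kernel hK hΨ hχ)]
  congr 1
  funext p
  rw [← integral_const_mul]
  congr 1
  funext z
  ring

lemma integrable_kernel_mul (hK : SqInt (μ.prod ν) fun z => K z.1 z.2)
    (hΨ : SqInt (ρ.prod μ) Ψ) (hχ : SqInt (ρ.prod ν) χ) :
    Integrable (fun p => K p.1 p.2 * ∫ z, Ψ (z, p.1) * χ (z, p.2) ∂ρ) (μ.prod ν) := by
  refine (integrable_slice_kernel hK hΨ hχ).integral_prod_right.congr
    (.of_forall fun p => ?_)
  simp only
  rw [← integral_const_mul]
  congr 1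
  funext z
  ring

end SliceFubini

section Param

variable {E F : Type*} [NormedAddCommGroup E] [NormedSpace ℝ E] [NormedAddCommGroup F]
  [NormedSpace ℝ F] [MeasurableSpace F] [BorelSpace F] [FiniteDimensional ℝ F]
  {ν : Measure F} [ν.IsAddHaarMeasure]

lemma contDiff_integral_param {Φ : E × F → ℂ} (hΦ : ContDiff ℝ ∞ Φ) (hc : HasCompactSupport Φ) :
    ContDiff ℝ ∞ (fun x => ∫ y, Φ (x, y) ∂ν) := by
  have hk : IsCompact ((fun p : E × F => -p.2) '' tsupport Φ) := hc.image (by fun_prop)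
  have h := contDiffOn_convolution_right_with_param (μ := ν) (n := ⊤) (ContinuousLinearMap.mul ℝ ℂ)
    (g := fun (x : E) (y : F) => Φ (x, -y)) (f := fun _ : F => (1 : ℂ)) (s := Set.univ)
    isOpen_univ hk (fun p y _ hy => by
      by_contra hne
      exact hy ⟨(p, -y), subset_tsupport _ hne, by simp⟩) (locallyIntegrable_const _)
    ((hΦ.comp (contDiff_fst.prodMk contDiff_snd.neg)).contDiffOn)
  rw [Set.univ_prod_univ, contDiffOn_univ] at h
  have h2 := h.comp (contDiff_id.prodMk (contDiff_const (c := (0 : F))))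
  convert h2 using 1
  funext x
  simp [convolution]

lemma hasCompactSupport_integral_param {Φ : E × F → ℂ} (hc : HasCompactSupport Φ) :
    HasCompactSupport (fun x => ∫ y, Φ (x, y) ∂ν) := by
  refine HasCompactSupport.intro (hc.image continuous_fst) fun x hx => ?_
  have : ∀ y, Φ (x, y) = 0 := fun y => by
    by_contra hne
    exact hx ⟨(x, y), subset_tsupport _ hne, rfl⟩
  simp [this]

end Param

section TestKernel

variable {m n k : ℕ}

/-- The product whose integral is the kernel of a block, on pairs of an outer and an inner
variable. -/
def blockProd (ψ : (Fin (m + k) → ℝ) → ℂ) (χ : (Fin (n + k) → ℝ) → ℂ)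
    (p : (Fin (m + n) → ℝ) × (Fin k → ℝ)) : ℂ :=
  starRingEnd ℂ (ψ (Fin.append (fun i => p.1 (Fin.castAdd n i)) p.2)) *
    χ (Fin.append (fun j : Fin n => p.1 (Fin.natAdd m j.rev)) p.2)

lemma contDiff_append {E : Type*} [NormedAddCommGroup E] [NormedSpace ℝ E]
    {f : E → Fin m → ℝ} {h : E → Fin n → ℝ} (hf : ContDiff ℝ ∞ f) (hh : ContDiff ℝ ∞ h) :
    ContDiff ℝ ∞ (fun x => (Fin.append (f x) (h x) : Fin (m + n) → ℝ)) := by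
  rw [contDiff_pi]
  refine Fin.addCases (fun i => ?_) (fun j => ?_)
  · simpa using contDiff_pi.1 hf i
  · simpa using contDiff_pi.1 hh j

lemma contDiff_blockProd {ψ : (Fin (m + k) → ℝ) → ℂ} {χ : (Fin (n + k) → ℝ) → ℂ}
    (hψ : ContDiff ℝ ∞ ψ) (hχ : ContDiff ℝ ∞ χ) : ContDiff ℝ ∞ (blockProd (n := n) ψ χ) := by
  have h1 : ContDiff ℝ ∞ fun p : (Fin (m + n) → ℝ) × (Fin k → ℝ) =>
      (Fin.append (fun i => p.1 (Fin.castAdd n i)) p.2 : Fin (m + k) → ℝ) :=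
    contDiff_append (contDiff_pi.2 fun i => contDiff_pi.1 contDiff_fst _) contDiff_snd
  have h2 : ContDiff ℝ ∞ fun p : (Fin (m + n) → ℝ) × (Fin k → ℝ) =>
      (Fin.append (fun j : Fin n => p.1 (Fin.natAdd m j.rev)) p.2 : Fin (n + k) → ℝ) :=
    contDiff_append (contDiff_pi.2 fun i => contDiff_pi.1 contDiff_fst _) contDiff_snd
  exact ((Complex.conjCLE.contDiff.comp (hψ.comp h1)).mul (hχ.comp h2))

lemma exists_norm_le_of_ne_zero {E : Type*} [NormedAddCommGroup E] {f : E → ℂ}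
    (h : HasCompactSupport f) : ∃ R, ∀ x, f x ≠ 0 → ‖x‖ ≤ R := by
  obtain ⟨R, hR⟩ := h.isBounded.subset_closedBall 0
  exact ⟨R, fun x hx => by simpa using hR (subset_tsupport _ hx)⟩

lemma hasCompactSupport_blockProd {ψ : (Fin (m + k) → ℝ) → ℂ} {χ : (Fin (n + k) → ℝ) → ℂ}
    (hψ : HasCompactSupport ψ) (hχ : HasCompactSupport χ) :
    HasCompactSupport (blockProd (n := n) ψ χ) := by
  obtain ⟨R, hR⟩ := exists_norm_le_of_ne_zero hψ
  obtain ⟨S, hS⟩ := exists_norm_le_of_ne_zero hχ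
  refine HasCompactSupport.intro (isCompact_closedBall 0 (max (max R S) 0)) fun p hp => ?_
  by_contra hne
  apply hp
  obtain ⟨h1, h2⟩ := mul_ne_zero_iff.1 hne
  have h3 := hR _ (fun h => h1 (by rw [h, map_zero]))
  have h4 := hS _ h2
  rw [mem_closedBall_zero_iff, Prod.norm_def, max_le_iff, pi_norm_le_iff_of_nonneg (le_max_right _ _),
    pi_norm_le_iff_of_nonneg (le_max_right _ _)]
  have h5 := fun i => (norm_le_pi_norm (Fin.append (fun i => p.1 (Fin.castAdd n i)) p.2) i).trans h3
  have h6 := fun i => (norm_le_pi_norm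
    (Fin.append (fun j : Fin n => p.1 (Fin.natAdd m j.rev)) p.2) i).trans h4
  refine ⟨fun i => ?_, fun i => ?_⟩
  · induction i using Fin.addCases with
    | left i =>
    have := h5 (Fin.castAdd k i)
    rw [Fin.append_left] at this
    exact this.trans ((le_max_left _ _).trans (le_max_left _ _))
    | right j =>
    have := h6 (Fin.castAdd k j.rev)
    rw [Fin.append_left, Fin.rev_rev] at this
    exact this.trans ((le_max_right _ _).trans (le_max_left _ _))
  · have := h5 (Fin.natAdd m i)
    rw [Fin.append_right] at this
    exact this.trans ((le_max_left _ _).trans (le_max_left _ _))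

lemma monomialKernel_eq (N m n : ℕ) (ψ χ : WaveSeq) : monomialKernel N m n ψ χ = fun x =>
    ∑ k ∈ range (N + 1), ((annihFactor m k * annihFactor n k : ℝ) : ℂ) *
      ∫ ξ, blockProd (k := k) (ψ (m + k)) (χ (n + k)) (x, ξ) := by
  funext x
  simp only [monomialKernel, pairing, annihProdRev_apply, annihProd_apply]
  refine sum_congr rfl fun k _ => ?_
  rw [← integral_const_mul]
  congr 1
  funext ξ
  rw [map_mul, Complex.conj_ofReal, blockProd]
  push_cast
  ring

lemma contDiff_monomialKernel {N m n : ℕ} {ψ χ : WaveSeq} (hψ : IsTestSeq N ψ)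
    (hχ : IsTestSeq N χ) : ContDiff ℝ ∞ (monomialKernel N m n ψ χ) := by
  rw [monomialKernel_eq]
  exact ContDiff.sum fun k _ => contDiff_const.mul (contDiff_integral_param
    (contDiff_blockProd (hψ.smooth _) (hχ.smooth _))
    (hasCompactSupport_blockProd (hψ.compact _) (hχ.compact _)))

lemma hasCompactSupport_monomialKernel {N m n : ℕ} {ψ χ : WaveSeq} (hψ : IsTestSeq N ψ)
    (hχ : IsTestSeq N χ) : HasCompactSupport (monomialKernel N m n ψ χ) := by
  rw [monomialKernel_eq]
  have h : ∀ k, HasCompactSupport fun x : Fin (m + n) → ℝ =>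
      ((annihFactor m k * annihFactor n k : ℝ) : ℂ) *
        ∫ ξ, blockProd (k := k) (ψ (m + k)) (χ (n + k)) (x, ξ) := fun k =>
    HasCompactSupport.mul_left (hasCompactSupport_integral_param
      (hasCompactSupport_blockProd (hψ.compact _) (hχ.compact _)))
  induction range (N + 1) using Finset.induction_on with
  | empty => exact HasCompactSupport.zero
  | insert a s ha ih =>
    simp only [Finset.sum_insert ha]
    exact (h a).add ih

lemma integral_leftArg_rightArg {m n k : ℕ} (ψ : (Fin (m + k) → ℝ) → ℂ) (χ : (Fin (n + k) → ℝ) → ℂ)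
    (θ : Fin m → ℝ) (η : Fin n → ℝ) : ∫ ξ, leftArg ψ (ξ, θ) * rightArg χ (ξ, η) =
      ∫ ξ, blockProd ψ χ (Fin.append θ η, ξ) := by
  simp [leftArg, rightArg, blockProd]

end TestKernel

section Associated

variable {α μ : ℝ} {P : SymLaurent} {g : ℝ × ℝ → ℂ}

lemma IsTestSeq.sqInt {N : ℕ} {ψ : WaveSeq} (h : IsTestSeq N ψ) (n : ℕ) : SqInt volume (ψ n) :=
  .of_memLp (h.smooth n).continuous.measurable
    ((h.smooth n).continuous.memLp_of_hasCompactSupport (h.compact n))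

lemma continuous_expOmega (hα : 0 < α) (n : ℕ) : Continuous (expOmega α : (Fin n → ℝ) → ℂ) := by
  have h1 : Continuous fun θ : Fin n → ℝ => energy θ := continuous_energy
  exact Complex.continuous_ofReal.comp (Real.continuous_exp.comp
    (h1.rpow_const fun _ => Or.inr hα.le))

lemma IsTestSeq.omSq (hα : 0 < α) {N : ℕ} {ψ : WaveSeq} (h : IsTestSeq N ψ) (n : ℕ) :
    OmSq α (ψ n) :=
  ⟨h.sqInt n, .of_memLp ((continuous_expOmega hα n).mul (h.smooth n).continuous).measurable
    (((continuous_expOmega hα n).mul (h.smooth n).continuous).memLp_of_hasCompactSupport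
      (h.compact n).mul_left)⟩

lemma eq_zero_of_wave {Ψ : Fock} {n : ℕ} (h : wave Ψ n =ᵐ[volume] 0) : Ψ n = 0 :=
  Subtype.ext (Lp.ext (h.trans (Lp.coeFn_zero _ _ _).symm))

lemma Represents.atMost {N : ℕ} {ψ : WaveSeq} {Ψ : Fock} (h : Represents ψ Ψ)
    (hψ : IsTestSeq N ψ) : AtMost N Ψ := fun n hn =>
  eq_zero_of_wave ((h n).trans (by rw [hψ.vanish n hn]))

lemma tendsto_integral_monomialKernel (hα : 0 < α) {m n : ℕ} {C : ℝ} (hC : DampRight α μ P g m n C)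
    {N : ℕ} {ψ χ : WaveSeq} (hψ : IsTestSeq N ψ) (hχ : IsTestSeq N χ) :
    Tendsto (fun l : Fin (m + n) → ℝ => ∫ z : (Fin m → ℝ) × (Fin n → ℝ),
      ffKer μ P g (shiftA l) (shiftB l) z.1 z.2 * monomialKernel N m n ψ χ (Fin.append z.1 z.2))
      (nodeFilter m n) (𝓝 (∑ k ∈ range (N + 1),
        ((annihFactor m k * annihFactor n k : ℝ) : ℂ) *
          blockForm μ P g m n k (ψ (m + k)) (χ (n + k)))) := by
  refine (tendsto_finsetSum _ fun k _ => (tendsto_blockForm hα hC (hψ.sqInt (m + k))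
    (hχ.omSq hα (n + k))).const_mul _).congr' ?_
  filter_upwards [hC.bdd] with l hl
  have hE : ∀ k, (fun p : (Fin m → ℝ) × (Fin n → ℝ) => (nodeKer μ P g m n l p.1 p.2 *
      expOmegaInv α p.2) * ∫ z, leftArg (ψ (m + k)) (z, p.1) *
        (expOmega α p.2 * rightArg (χ (n + k)) (z, p.2))) = fun p => nodeKer μ P g m n l p.1 p.2 *
      ∫ ξ, blockProd (k := k) (ψ (m + k)) (χ (n + k)) (Fin.append p.1 p.2, ξ) := by
    intro k
    funext p
    rw [← integral_leftArg_rightArg]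
    have : ∀ z : Fin k → ℝ, leftArg (ψ (m + k)) (z, p.1) *
        (expOmega α p.2 * rightArg (χ (n + k)) (z, p.2)) = expOmega α p.2 *
          (leftArg (ψ (m + k)) (z, p.1) * rightArg (χ (n + k)) (z, p.2)) := fun z => by ring
    simp only [this, integral_const_mul]
    linear_combination (nodeKer μ P g m n l p.1 p.2 * ∫ z, leftArg (ψ (m + k)) (z, p.1) *
      rightArg (χ (n + k)) (z, p.2)) * expOmegaInv_mul_expOmega α p.2
  have h1 : ∀ k, sliceForm volume volume volume (nodeKer μ P g m n l) (leftArg (ψ (m + k)))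
      (rightArg (χ (n + k))) = ∫ p : (Fin m → ℝ) × (Fin n → ℝ), nodeKer μ P g m n l p.1 p.2 *
        ∫ ξ, blockProd (k := k) (ψ (m + k)) (χ (n + k)) (Fin.append p.1 p.2, ξ) := fun k => by
    rw [← sliceForm_damp_right (α := α), sliceForm_eq_integral hl.sq
      (sqInt_leftArg (hψ.sqInt _)) ((hχ.omSq hα _).rightArg hα).1, hE k]
    rfl
  have h2 : ∀ k, Integrable fun p : (Fin m → ℝ) × (Fin n → ℝ) => nodeKer μ P g m n l p.1 p.2 *
        ∫ ξ, blockProd (k := k) (ψ (m + k)) (χ (n + k)) (Fin.append p.1 p.2, ξ) := fun k => by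
    have := integrable_kernel_mul (K := fun θ η => nodeKer μ P g m n l θ η * expOmegaInv α η) hl.sq (sqInt_leftArg (k := k) (hψ.sqInt (m + k)))
      ((hχ.omSq hα (n + k)).rightArg hα).1
    rw [hE k] at this
    exact this
  have h3 : ∀ k, ((annihFactor m k * annihFactor n k : ℝ) : ℂ) * sliceForm volume volume volume
      (nodeKer μ P g m n l) (leftArg (ψ (m + k))) (rightArg (χ (n + k))) =
      ∫ p : (Fin m → ℝ) × (Fin n → ℝ), ((annihFactor m k * annihFactor n k : ℝ) : ℂ) *
        (nodeKer μ P g m n l p.1 p.2 *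
        ∫ ξ, blockProd (k := k) (ψ (m + k)) (χ (n + k)) (Fin.append p.1 p.2, ξ)) := fun k => by
    rw [h1 k, integral_const_mul]
  simp only [h3]
  rw [← integral_finsetSum _ fun k _ => (h2 k).const_mul _]
  congr 1
  funext p
  rw [monomialKernel_eq, Finset.mul_sum]
  exact sum_congr rfl fun k _ => by ring

lemma blockTerm_congr {p : ℕ × ℕ × ℕ} {ψ χ : WaveSeq} {Ψ X : Fock} (hΨ : Represents ψ Ψ)
    (hX : Represents χ X) : blockTerm μ P g p Ψ X = blockCoeff p.1 p.2.1 p.2.2 *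
      oddConst (p.1 + p.2.1) * blockForm μ P g p.1 p.2.1 p.2.2 (ψ (p.1 + p.2.2))
        (χ (p.2.1 + p.2.2)) := by
  rw [blockTerm, blockForm_congr (hΨ _) (hX _)]

theorem isAssociatedForm_formA (hα : 0 < α) (hg : Continuous g) (hgc : HasCompactSupport g)
    (h : ∀ m n, ∃ C, DampRight α μ P g m n C) (hA : formA hα h ∈ Qomega α) :
    IsAssociatedForm α (Fodd μ P g) (formA hα h) := by
  refine ⟨hA, fun m n φ => limUnder (nodeFilter m n) fun l => ∫ x : Fin (m + n) → ℝ,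
        Fodd μ P g (m + n) (fun j => (x j : ℂ) + (l j : ℂ) * I) * φ x, ?_, ?_⟩
  · intro m n φ hφ hc
    obtain ⟨L, hL, -⟩ := exists_boundaryValue μ P hg hgc hφ hc
    simp only [hL.limUnder_eq]
    exact hL
  · intro N ψ χ hψ hχ Ψ X hΨ hX
    rw [formA_eq_sum hα h (hΨ.atMost hψ) (hX.atMost hχ)]
    refine sum_congr rfl fun m _ => sum_congr rfl fun n _ => ?_
    obtain ⟨L, hL, hL'⟩ := exists_boundaryValue μ P hg hgc
      (contDiff_monomialKernel (m := m) (n := n) hψ hχ) (hasCompactSupport_monomialKernel hψ hχ)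
    obtain ⟨C, hC⟩ := h m n
    have h1 := tendsto_nhds_unique hL'
      ((tendsto_integral_monomialKernel hα hC hψ hχ).const_mul (oddConst (m + n)))
    have h2 := hL.limUnder_eq
    simp only [h2, h1]
    rw [Finset.mul_sum, Finset.mul_sum]
    refine sum_congr rfl fun k _ => ?_
    rw [blockTerm_congr hΨ hX, blockCoeff]
    push_cast
    rw [mul_inv]
    ring

end Associated


section Norm

variable {X : Type*} [MeasurableSpace X] {μ : Measure X} {ψ φ : X → ℂ}

lemma l2_eq_norm_toLp (h : SqInt μ ψ) : l2 μ ψ = ‖h.memLp.toLp ψ‖ := by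
  rw [← l2_eq_norm]
  exact l2_congr h.memLp.coeFn_toLp.symm

lemma l2_eq_toReal (h : SqInt μ ψ) : l2 μ ψ = (eLpNorm ψ 2 μ).toReal := by
  rw [l2_eq_norm_toLp h, Lp.norm_toLp]

lemma l2_add_le (h : SqInt μ ψ) (h' : SqInt μ φ) :
    l2 μ (fun x => ψ x + φ x) ≤ l2 μ ψ + l2 μ φ := by
  rw [l2_eq_norm_toLp h, l2_eq_norm_toLp h', l2_eq_norm_toLp (h.add h')]
  exact norm_add_le (h.memLp.toLp ψ) (h'.memLp.toLp φ)

end Norm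

section Antisymmetric

lemma wave_comp_perm {n : ℕ} (ψ : nParticle n) (σ : Equiv.Perm (Fin n)) :
    ∀ᵐ θ : Fin n → ℝ, (ψ : Lp ℂ 2 (volume : Measure (Fin n → ℝ))) (θ ∘ σ) =
      ((Equiv.Perm.sign σ : ℤ) : ℂ) * (ψ : Lp ℂ 2 (volume : Measure (Fin n → ℝ))) θ := by
  induction σ using Equiv.Perm.swap_induction_on' with
  | one => exact .of_forall fun θ => by simp
  | mul_swap σ i j hij ih =>
    have h1 := (mem_nParticle_iff _).1 ψ.2 i j hij
    have h2 := (measurePreserving_perm σ).quasiMeasurePreserving.ae h1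
    filter_upwards [ih, h2] with θ a b
    rw [Equiv.Perm.coe_mul, ← Function.comp_assoc, b, a]
    simp [hij]

/-- The antisymmetrization of a function. -/
def asym {n : ℕ} (f : (Fin n → ℝ) → ℂ) (θ : Fin n → ℝ) : ℂ :=
  (n.factorial : ℂ)⁻¹ * ∑ σ : Equiv.Perm (Fin n), ((Equiv.Perm.sign σ : ℤ) : ℂ) * f (θ ∘ σ)

lemma asym_swap {n : ℕ} (f : (Fin n → ℝ) → ℂ) {i j : Fin n} (hij : i ≠ j) (θ : Fin n → ℝ) :
    asym f (θ ∘ Equiv.swap i j) = - asym f θ := by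
  rw [asym, asym, ← mul_neg, ← Finset.sum_neg_distrib]
  congr 1
  refine Fintype.sum_equiv (Equiv.mulLeft (Equiv.swap i j)) _ _ fun σ => ?_
  simp [Equiv.Perm.sign_mul, hij, Equiv.Perm.coe_mul, Function.comp_assoc]

lemma contDiff_comp_perm {n : ℕ} {f : (Fin n → ℝ) → ℂ} (hf : ContDiff ℝ ∞ f)
    (σ : Equiv.Perm (Fin n)) : ContDiff ℝ ∞ fun θ => f (θ ∘ σ) :=
  hf.comp (contDiff_pi.2 fun i => contDiff_apply ℝ ℝ (σ i))

lemma hasCompactSupport_comp_perm {n : ℕ} {f : (Fin n → ℝ) → ℂ} (hf : HasCompactSupport f)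
    (σ : Equiv.Perm (Fin n)) : HasCompactSupport fun θ => f (θ ∘ σ) :=
  hf.comp_homeomorph (Homeomorph.piCongrLeft (Y := fun _ : Fin n => ℝ) σ.symm) |> fun h => by
    convert h using 1
    funext θ
    simp only [Function.comp_apply]
    congr 1
    funext i
    have := MeasurableEquiv.piCongrLeft_apply_apply (β := fun _ : Fin n => ℝ) σ.symm θ (σ i)
    rw [Equiv.symm_apply_apply] at this
    exact this.symm

lemma contDiff_asym {n : ℕ} {f : (Fin n → ℝ) → ℂ} (hf : ContDiff ℝ ∞ f) :
    ContDiff ℝ ∞ (asym f) :=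
  contDiff_const.mul (ContDiff.sum fun σ _ => contDiff_const.mul (contDiff_comp_perm hf σ))

lemma hasCompactSupport_asym {n : ℕ} {f : (Fin n → ℝ) → ℂ} (hf : HasCompactSupport f) :
    HasCompactSupport (asym f) := by
  refine HasCompactSupport.mul_left (f := fun _ => (n.factorial : ℂ)⁻¹) ?_
  induction (univ : Finset (Equiv.Perm (Fin n))) using Finset.induction_on with
  | empty => exact HasCompactSupport.zero
  | insert a s ha ih =>
    simp only [Finset.sum_insert ha]
    exact (HasCompactSupport.mul_left (hasCompactSupport_comp_perm hf a)).add ih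

lemma norm_sub_asym_le {n : ℕ} (ψ : nParticle n) {f : (Fin n → ℝ) → ℂ}
    (hf : SqInt volume f) (hψ : SqInt volume ((ψ : Lp ℂ 2 (volume : Measure (Fin n → ℝ))))) :
    l2 volume (fun θ => (ψ : Lp ℂ 2 (volume : Measure (Fin n → ℝ))) θ - asym f θ) ≤
      l2 volume (fun θ => (ψ : Lp ℂ 2 (volume : Measure (Fin n → ℝ))) θ - f θ) := by
  set u : (Fin n → ℝ) → ℂ := ⇑(ψ : Lp ℂ 2 (volume : Measure (Fin n → ℝ))) with hu
  have hd := hψ.sub hf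
  have h1 : (fun θ => u θ - asym f θ) =ᵐ[volume] fun θ => (n.factorial : ℂ)⁻¹ *
      ∑ σ : Equiv.Perm (Fin n), ((Equiv.Perm.sign σ : ℤ) : ℂ) * (u (θ ∘ σ) - f (θ ∘ σ)) := by
    have h2 : ∀ᵐ θ : Fin n → ℝ, ∀ σ : Equiv.Perm (Fin n),
      u (θ ∘ σ) = ((Equiv.Perm.sign σ : ℤ) : ℂ) * u θ := ae_all_iff.2 fun σ => wave_comp_perm ψ σ
    filter_upwards [h2] with θ hθ
    have hs : ∀ σ : Equiv.Perm (Fin n), ((Equiv.Perm.sign σ : ℤ) : ℂ) *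
        ((Equiv.Perm.sign σ : ℤ) : ℂ) = 1 := fun σ => by
      rw [← Int.cast_mul, ← Units.val_mul, Int.units_mul_self]; simp
    have hn : (n.factorial : ℂ) ≠ 0 := by exact_mod_cast n.factorial_ne_zero
    simp only [hθ, mul_sub, ← mul_assoc, hs, one_mul, Finset.sum_sub_distrib, Finset.sum_const,
      Finset.card_univ, Fintype.card_perm, Fintype.card_fin, nsmul_eq_mul, asym]
    rw [inv_mul_cancel₀ hn, one_mul]
  have hcomp : ∀ σ : Equiv.Perm (Fin n), SqInt volume fun θ : Fin n → ℝ => u (θ ∘ σ) - f (θ ∘ σ) :=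
    fun σ => hd.comp (measurePreserving_perm σ)
  have hnorm : ∀ σ : Equiv.Perm (Fin n), l2 volume (fun θ : Fin n → ℝ =>
      ((Equiv.Perm.sign σ : ℤ) : ℂ) * (u (θ ∘ σ) - f (θ ∘ σ))) = l2 volume fun θ => u θ - f θ := by
    intro σ
    rw [l2_const_mul]
    have : ‖((Equiv.Perm.sign σ : ℤ) : ℂ)‖ = 1 := by
      rcases Int.units_eq_one_or (Equiv.Perm.sign σ) with h | h <;> simp [h]
    rw [this, one_mul]
    exact MeasurePreserving.l2_comp (measurePreserving_perm σ) hd.meas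
  have hsum : ∀ s : Finset (Equiv.Perm (Fin n)), SqInt volume (fun θ : Fin n → ℝ => ∑ σ ∈ s,
      ((Equiv.Perm.sign σ : ℤ) : ℂ) * (u (θ ∘ σ) - f (θ ∘ σ))) ∧ l2 volume (fun θ : Fin n → ℝ =>
      ∑ σ ∈ s, ((Equiv.Perm.sign σ : ℤ) : ℂ) * (u (θ ∘ σ) - f (θ ∘ σ))) ≤
        s.card * l2 volume fun θ => u θ - f θ := by
    intro s
    induction s using Finset.induction_on with
    | empty => simp [l2, SqInt.of_le measurable_const (integrable_zero _ _ _)]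
    | insert a s ha ih =>
      simp only [Finset.sum_insert ha, Finset.card_insert_of_notMem ha]
      refine ⟨((hcomp a).const_mul _).add ih.1, (l2_add_le ((hcomp a).const_mul _) ih.1).trans ?_⟩
      rw [hnorm a]
      push_cast
      linarith [ih.2]
  rw [l2_congr h1, l2_const_mul, norm_inv, Complex.norm_natCast]
  have h3 := (hsum univ).2
  rw [Finset.card_univ, Fintype.card_perm, Fintype.card_fin] at h3
  rw [inv_mul_le_iff₀ (by exact_mod_cast n.factorial_pos)]
  exact h3

end Antisymmetric

section Build

lemma norm_le_sum {N : ℕ} {Ψ : Fock} (h : AtMost N Ψ) :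
    ‖Ψ‖ ≤ ∑ n ∈ range (N + 1), ‖Ψ n‖ := by
  have h1 : Ψ = ∑ n ∈ range (N + 1), (lp.single 2 n (Ψ n) : Fock) := by
    ext1
    funext j
    rw [lp.coeFn_sum, Finset.sum_apply]
    by_cases hj : j ∈ range (N + 1)
    · rw [Finset.sum_eq_single_of_mem j hj fun i _ hi => by rw [lp.single_apply_ne _ _ _ hi.symm],
        lp.single_apply_self]
    · rw [h j (by simpa using hj), Finset.sum_eq_zero fun i hi => ?_]
      exact lp.single_apply_ne _ _ _ fun hij => hj (hij ▸ hi)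
  conv_lhs => rw [h1]
  refine (norm_sum_le _ _).trans (sum_le_sum fun n _ => ?_)
  rw [lp.norm_single (by norm_num)]

/-- An antisymmetric sequence of square-integrable functions gives a vector. -/
lemma exists_represents {N : ℕ} {ψ : WaveSeq} (hs : ∀ n, SqInt volume (ψ n))
    (ha : ∀ n (i j : Fin n), i ≠ j → ∀ θ, ψ n (θ ∘ Equiv.swap i j) = - ψ n θ)
    (hN : ∀ n, N < n → ψ n = 0) : ∃ Ψ : Fock, Represents ψ Ψ ∧ AtMost N Ψ := by
  have hmem : ∀ n, (hs n).memLp.toLp (ψ n) ∈ nParticle n := by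
    intro n
    rw [mem_nParticle_iff]
    intro i j hij
    have h1 := (hs n).memLp.coeFn_toLp
    filter_upwards [h1, (measurePreserving_perm (Equiv.swap i j)).quasiMeasurePreserving.ae h1]
      with θ a b
    rw [a, b, ha n i j hij]
  let v : ∀ n, nParticle n := fun n => ⟨(hs n).memLp.toLp (ψ n), hmem n⟩
  have hv0 : ∀ n, N < n → v n = 0 := fun n hn => by
    refine Subtype.ext (Lp.ext ?_)
    refine ((hs n).memLp.coeFn_toLp).trans ?_
    rw [hN n hn]
    exact (Lp.coeFn_zero _ _ _).symm
  have hv : Memℓp v 2 := by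
    refine memℓp_gen (summable_of_ne_finset_zero (s := range (N + 1)) fun n hn => ?_)
    rw [hv0 n (by simpa using hn)]
    simp
  exact ⟨⟨v, hv⟩, fun n => (hs n).memLp.coeFn_toLp, hv0⟩

lemma energy_comp_perm {n : ℕ} (θ : Fin n → ℝ) (σ : Equiv.Perm (Fin n)) :
    energy (θ ∘ σ) = energy θ :=
  Equiv.sum_comp σ fun j => Real.cosh (θ j)

variable {α : ℝ}

lemma exists_finiteOmega {N : ℕ} {ψ : WaveSeq} (hs : ∀ n, OmSq α (ψ n))
    (ha : ∀ n (i j : Fin n), i ≠ j → ∀ θ, ψ n (θ ∘ Equiv.swap i j) = - ψ n θ)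
    (hN : ∀ n, N < n → ψ n = 0) : ∃ Ψ : finiteOmega α, Represents ψ (Ψ : Fock) ∧
      AtMost N (Ψ : Fock) := by
  obtain ⟨Ψ, h1, h2⟩ := exists_represents (fun n => (hs n).sq) ha hN
  obtain ⟨φ, h3, -⟩ := exists_represents (N := N) (fun n => (hs n).exp) (fun n i j hij θ => by
    rw [ha n i j hij, expOmega, expOmega, energy_comp_perm, mul_neg])
    (fun n hn => by funext θ; simp [hN n hn])
  refine ⟨⟨Ψ, ⟨N, h2⟩, φ, fun n => ?_⟩, h1, h2⟩
  filter_upwards [h1 n, h3 n] with θ a b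
  rw [b, a]
  rfl

lemma exists_smooth_approx {n : ℕ} (ψ : nParticle n) {ε : ℝ} (hε : 0 < ε) :
    ∃ f : (Fin n → ℝ) → ℂ, ContDiff ℝ ∞ f ∧ HasCompactSupport f ∧
      (∀ i j : Fin n, i ≠ j → ∀ θ, f (θ ∘ Equiv.swap i j) = - f θ) ∧
      l2 volume (fun θ => (ψ : Lp ℂ 2 (volume : Measure (Fin n → ℝ))) θ - f θ) ≤ ε := by
  obtain ⟨f, hc, hf, h⟩ := (Lp.memLp (ψ : Lp ℂ 2 (volume : Measure (Fin n → ℝ)))).exist_eLpNorm_sub_le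
    (by norm_num) (by norm_num) hε
  have hψ : SqInt volume (ψ : Lp ℂ 2 (volume : Measure (Fin n → ℝ))) :=
    .of_memLp (Lp.stronglyMeasurable _).measurable (Lp.memLp _)
  have hfs : SqInt volume f := .of_memLp hf.continuous.measurable
    (hf.continuous.memLp_of_hasCompactSupport hc)
  refine ⟨asym f, contDiff_asym hf, hasCompactSupport_asym hc, fun i j hij θ => asym_swap f hij θ,
    (norm_sub_asym_le ψ hfs hψ).trans ?_⟩
  rw [l2_eq_toReal (hψ.sub hfs)]
  exact ENNReal.toReal_le_of_le_ofReal hε.le h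

/-- Test vectors are dense among the vectors with at most `N` particles. -/
lemma exists_test_approx (hα : 0 < α) {N : ℕ} {Ψ : Fock} (hΨ : AtMost N Ψ) {ε : ℝ} (hε : 0 < ε) :
    ∃ (ψ : WaveSeq) (Ψ' : finiteOmega α), IsTestSeq N ψ ∧ Represents ψ (Ψ' : Fock) ∧
      AtMost N (Ψ' : Fock) ∧ ‖Ψ - Ψ'‖ ≤ ε := by
  have hδ : 0 < ε / (N + 1) := by positivity
  choose f hf hc ha hl using fun n => exists_smooth_approx (Ψ n) hδ
  let ψ : WaveSeq := fun n => if n ≤ N then f n else 0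
  have hψ : IsTestSeq N ψ := by
    refine ⟨fun n => ?_, fun n => ?_, fun n hn => if_neg (by omega)⟩
    · by_cases h : n ≤ N
      · simpa [ψ, h] using hf n
      · rw [show ψ n = fun _ => 0 from if_neg h]
        exact contDiff_const
    · by_cases h : n ≤ N
      · simpa [ψ, h] using hc n
      · simpa [ψ, h] using HasCompactSupport.zero
  obtain ⟨Ψ', h1, h2⟩ := exists_finiteOmega (α := α) (fun n => hψ.omSq hα n) (fun n i j hij θ => by
    by_cases h : n ≤ N
    · simpa [ψ, h] using ha n i j hij θ
    · simp [ψ, h]) hψ.vanish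
  refine ⟨ψ, Ψ', hψ, h1, h2, ?_⟩
  have h3 : AtMost N (Ψ - Ψ') := fun n hn => by
    rw [lp.coeFn_sub, Pi.sub_apply, hΨ n hn, h2 n hn, sub_zero]
  refine (norm_le_sum h3).trans ?_
  have h4 : ∀ n ∈ range (N + 1), ‖(Ψ - (Ψ' : Fock) : Fock) n‖ ≤ ε / (N + 1) := by
    intro n hn
    have hn' : n ≤ N := by simpa [Nat.lt_succ_iff] using hn
    rw [← l2_wave]
    refine (l2_congr ?_).trans_le (hl n)
    have h5 : wave (Ψ - (Ψ' : Fock)) n =ᵐ[volume] wave Ψ n - wave (Ψ' : Fock) n := Lp.coeFn_sub _ _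
    filter_upwards [h5, h1 n] with θ a b
    rw [a, Pi.sub_apply, b]
    simp [ψ, hn', wave]
  refine (sum_le_sum h4).trans_eq ?_
  rw [Finset.sum_const, Finset.card_range, nsmul_eq_mul]
  push_cast
  field_simp

lemma eq_zero_of_forall_le {z : ℂ} {C : ℝ} (h : ∀ ε > 0, ‖z‖ ≤ C * ε) : z = 0 := by
  by_contra hz
  have hz' := norm_pos_iff.2 hz
  rcases le_or_gt C 0 with hC | hC
  · have := h 1 one_pos; linarith
  · have := h (‖z‖ / (2 * C)) (by positivity)
    have h2 : C * (‖z‖ / (2 * C)) = ‖z‖ / 2 := by field_simp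
    linarith

/-- A form in `Q^ω` is determined by its values on test vectors. -/
lemma Qomega_eq_zero (hα : 0 < α) {D : SForm α} (hD : D ∈ Qomega α)
    (h : ∀ N ψ χ, IsTestSeq N ψ → IsTestSeq N χ → ∀ Ψ X : finiteOmega α,
      Represents ψ (Ψ : Fock) → Represents χ (X : Fock) → D Ψ X = 0) : D = 0 := by
  have hsub : ∀ {N : ℕ} {a b : Fock}, AtMost N a → AtMost N b → AtMost N (a - b) :=
    fun {N a b} ha hb n hn => by
    rw [lp.coeFn_sub, Pi.sub_apply, ha n hn, hb n hn, sub_zero]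
  have step : ∀ N χ, IsTestSeq N χ → ∀ Ψ X : finiteOmega α, AtMost N (Ψ : Fock) →
      Represents χ (X : Fock) → D Ψ X = 0 := by
    intro N χ hχ Ψ X hΨ hX
    obtain ⟨C, hC⟩ := hD N
    obtain ⟨-, φ, hφ⟩ := X.2
    refine eq_zero_of_forall_le (C := |C| * ‖φ‖) fun ε hε => ?_
    obtain ⟨ψ, Ψ', h1, h2, h3, h4⟩ := exists_test_approx hα hΨ hε
    have h5 : D Ψ X = D (Ψ - Ψ') X := by
      rw [map_sub, LinearMap.sub_apply, h N ψ χ h1 hχ Ψ' X h2 hX, sub_zero]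
    rw [h5]
    calc _ ≤ C * ‖((Ψ - Ψ' : finiteOmega α) : Fock)‖ * ‖φ‖ :=
          (hC _ _ (hsub hΨ h3) (hX.atMost hχ)).1 φ hφ
      _ ≤ |C| * ε * ‖φ‖ := by
          gcongr
          · exact le_abs_self C
          · exact h4
      _ = _ := by ring
  ext Ψ X
  obtain ⟨⟨N₁, hN₁⟩, φ, hφ⟩ := Ψ.2
  obtain ⟨⟨N₂, hN₂⟩, -⟩ := X.2
  have hΨ : AtMost (max N₁ N₂) (Ψ : Fock) := fun n hn => hN₁ n ((le_max_left _ _).trans_lt hn)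
  have hX : AtMost (max N₁ N₂) (X : Fock) := fun n hn => hN₂ n ((le_max_right _ _).trans_lt hn)
  obtain ⟨C, hC⟩ := hD (max N₁ N₂)
  refine eq_zero_of_forall_le (C := |C| * ‖φ‖) fun ε hε => ?_
  obtain ⟨χ, X', h1, h2, h3, h4⟩ := exists_test_approx hα hX hε
  have h5 : D Ψ X = D Ψ (X - X') := by
    rw [map_sub, step _ χ h1 Ψ X' hΨ h2, sub_zero]
  rw [h5]
  calc _ ≤ C * ‖φ‖ * ‖((X - X' : finiteOmega α) : Fock)‖ := (hC _ _ hΨ (hsub hX h3)).2 φ hφ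
    _ ≤ |C| * ‖φ‖ * ε := by
        gcongr
        · exact le_abs_self C
        · exact h4

lemma IsAssociatedForm.unique (hα : 0 < α) {F : (k : ℕ) → (Fin k → ℂ) → ℂ} {A B : SForm α}
    (hA : IsAssociatedForm α F A) (hB : IsAssociatedForm α F B) : A = B := by
  obtain ⟨hA, f, hf, hA'⟩ := hA
  obtain ⟨hB, f', hf', hB'⟩ := hB
  refine sub_eq_zero.1 (Qomega_eq_zero hα ((Qomega α).sub_mem hA hB) ?_)
  intro N ψ χ hψ hχ Ψ X hΨ hX
  rw [LinearMap.sub_apply, LinearMap.sub_apply, hA' N ψ χ hψ hχ Ψ X hΨ hX,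
    hB' N ψ χ hψ hχ Ψ X hΨ hX, sub_eq_zero]
  refine sum_congr rfl fun m _ => sum_congr rfl fun n _ => ?_
  rw [tendsto_nhds_unique
    (hf m n _ (contDiff_monomialKernel hψ hχ) (hasCompactSupport_monomialKernel hψ hχ))
    (hf' m n _ (contDiff_monomialKernel hψ hχ) (hasCompactSupport_monomialKernel hψ hχ))]

end Build


section Abstract

variable {E : Type*} [NormedAddCommGroup E] [InnerProductSpace ℂ E] [CompleteSpace E]
  {D : Submodule ℂ E}

lemma eq_of_forall_inner (hD : Dense (D : Set E)) {v w : E}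
    (h : ∀ x : D, inner ℂ (x : E) v = inner ℂ (x : E) w) : v = w :=
  hD.eq_of_inner_right (𝕜 := ℂ) fun x hx => h ⟨x, hx⟩

/-- A densely defined form that is bounded in its first argument is given by an operator. -/
lemma exists_operator (hD : Dense (D : Set E)) (B : D →ₗ⋆[ℂ] D →ₗ[ℂ] ℂ)
    (hB : ∀ y, ∃ K, ∀ x : D, ‖B x y‖ ≤ K * ‖(x : E)‖) :
    ∃ T : D →ₗ[ℂ] E, ∀ x y : D, inner ℂ (x : E) (T y) = B x y := by
  have hex : ∀ y, ∃ v : E, ∀ x : D, inner ℂ (x : E) v = B x y := by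
    intro y
    obtain ⟨K, hK⟩ := hB y
    let ℓ : D →ₗ[ℂ] ℂ :=
      { toFun := fun x => starRingEnd ℂ (B x y)
        map_add' := fun x x' => by rw [map_add, LinearMap.add_apply, map_add]
        map_smul' := fun c x => by
          rw [LinearMap.map_smulₛₗ, LinearMap.smul_apply, smul_eq_mul, map_mul, Complex.conj_conj]
          rfl }
    have hℓ : ∀ x, ‖ℓ x‖ ≤ K * ‖x‖ := fun x => by
      change ‖starRingEnd ℂ (B x y)‖ ≤ _
      rw [RCLike.norm_conj]
      exact hK x
    obtain ⟨G, hG, -⟩ := exists_extension_norm_eq D (ℓ.mkContinuous K hℓ)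
    refine ⟨(InnerProductSpace.toDual ℂ E).symm G, fun x => ?_⟩
    rw [← inner_conj_symm, InnerProductSpace.toDual_symm_apply, hG x]
    change starRingEnd ℂ (starRingEnd ℂ (B x y)) = _
    rw [Complex.conj_conj]
  choose T hT using hex
  refine ⟨{ toFun := T, map_add' := fun y y' => ?_, map_smul' := fun c y => ?_ }, fun x y => hT y x⟩
  · refine eq_of_forall_inner hD fun x => ?_
    rw [inner_add_right, hT, hT, hT, map_add]
  · refine eq_of_forall_inner hD fun x => ?_
    rw [inner_smul_right, hT, RingHom.id_apply, hT, map_smul, smul_eq_mul]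

/-- A densely defined operator with a densely defined formal adjoint has a closure. -/
lemma exists_closed_extension (hD : Dense (D : Set E)) {T S : D →ₗ[ℂ] E}
    (h : ∀ x y : D, inner ℂ (S x) (y : E) = inner ℂ (x : E) (T y)) :
    ∃ (C : E →ₗ.[ℂ] E) (hle : D ≤ C.domain), C.IsClosed ∧ D ≤ C.adjoint.domain ∧ C.HasCore D ∧
      ∀ x : D, C ⟨(x : E), hle x.2⟩ = T x := by
  let f : E →ₗ.[ℂ] E := ⟨D, T⟩
  let s : E →ₗ.[ℂ] E := ⟨D, S⟩
  have hfs : s.IsFormalAdjoint f := h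
  have hle : f ≤ s.adjoint := hfs.le_adjoint hD
  have hcs : s.adjoint.IsClosed := LinearPMap.adjoint_isClosed hD
  have hcl : f.IsClosable := hcs.isClosable.leIsClosable hle
  have hcle : f.closure ≤ s.adjoint := by
    refine LinearPMap.le_of_le_graph ?_
    rw [← hcl.graph_closure_eq_closure_graph]
    exact Submodule.topologicalClosure_minimal _ (LinearPMap.le_graph_of_le hle) hcs
  refine ⟨f.closure, f.le_closure.1, hcl.closure_isClosed, fun z hz => ?_, f.closureHasCore,
    fun x => (f.le_closure.2 (x := x) rfl).symm⟩
  refine LinearPMap.mem_adjoint_domain_of_exists _ ⟨S ⟨z, hz⟩, fun x => ?_⟩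
  have h1 : f.closure x = s.adjoint ⟨x, hcle.1 x.2⟩ := hcle.2 rfl
  rw [h1]
  exact ((LinearPMap.adjoint_isFormalAdjoint (T := s) hD).symm ⟨z, hz⟩ ⟨x, hcle.1 x.2⟩)

lemma hasCore_unique (hD : Dense (D : Set E)) {C C' : E →ₗ.[ℂ] E} (hC : C.HasCore D)
    (hC' : C'.HasCore D) (h : ∀ x y : D, inner ℂ (x : E) (C ⟨y, hC.le_domain y.2⟩) =
      inner ℂ (x : E) (C' ⟨y, hC'.le_domain y.2⟩)) : C = C' := by
  rw [← hC.closure_eq, ← hC'.closure_eq]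
  congr 1
  refine LinearPMap.ext (le_antisymm (le_inf inf_le_left (inf_le_left.trans hC'.le_domain))
    (le_inf inf_le_left (inf_le_left.trans hC.le_domain))) ?_
  intro x hx hx'
  have e1 : C.domRestrict D ⟨x, hx⟩ = C ⟨x, hC.le_domain hx.1⟩ := LinearPMap.domRestrict_apply rfl
  have e2 : C'.domRestrict D ⟨x, hx'⟩ = C' ⟨x, hC'.le_domain hx.1⟩ :=
    LinearPMap.domRestrict_apply rfl
  rw [e1, e2]
  exact eq_of_forall_inner hD fun z => h z ⟨x, hx.1⟩

end Abstract

section Closable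

variable {α : ℝ}

lemma dense_finiteOmega (hα : 0 < α) : Dense (finiteOmega α : Set Fock) := by
  intro Ψ
  rw [Metric.mem_closure_iff]
  intro ε hε
  have h1 := lp.hasSum_single (p := 2) (by norm_num) Ψ
  obtain ⟨s, hs⟩ := (Metric.tendsto_nhds.1 h1 (ε / 2) (half_pos hε)).exists
  have h2 : AtMost (s.sup id) (∑ n ∈ s, (lp.single 2 n (Ψ n) : Fock)) := by
    intro j hj
    rw [lp.coeFn_sum, Finset.sum_apply]
    refine Finset.sum_eq_zero fun i hi => lp.single_apply_ne _ _ _ fun hij => ?_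
    exact absurd (Finset.le_sup (f := id) hi) (by rw [← hij]; simpa using hj)
  obtain ⟨-, Ψ', -, -, -, h3⟩ := exists_test_approx hα h2 (show 0 < ε / 4 by positivity)
  refine ⟨Ψ', Ψ'.2, ?_⟩
  rw [dist_comm] at hs
  refine (dist_triangle _ _ _).trans_lt (add_lt_add_of_lt_of_le hs ?_ |>.trans_eq (by ring : ε / 2 + ε / 4 = 3 * ε / 4) |>.trans (by linarith))
  rwa [dist_eq_norm]

/-- The adjoint of a form. -/
def adjointForm (A : SForm α) : SForm α :=
  LinearMap.mk₂'ₛₗ (starRingEnd ℂ) (RingHom.id ℂ) (fun X Ψ => starRingEnd ℂ (A Ψ X))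
    (fun X X' Ψ => by rw [map_add, map_add])
    (fun c X Ψ => by rw [map_smul, smul_eq_mul, map_mul]; rfl)
    (fun X Ψ Ψ' => by rw [map_add, LinearMap.add_apply, map_add])
    (fun c X Ψ => by
      rw [LinearMap.map_smulₛₗ, LinearMap.smul_apply, smul_eq_mul, map_mul, Complex.conj_conj]
      rfl)

lemma adjointForm_apply (A : SForm α) (X Ψ : finiteOmega α) :
    adjointForm A X Ψ = starRingEnd ℂ (A Ψ X) := rfl

theorem OmegaBounded.existsUnique_closure (hα : 0 < α) {A : SForm α} (hA : A ∈ OmegaBounded α) :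
    ∃! T : Fock →ₗ.[ℂ] Fock, IsOmegaClosure α A T := by
  have hdense := dense_finiteOmega hα
  obtain ⟨T₀, hT₀⟩ := exists_operator hdense A fun X => by
    obtain ⟨⟨N, hN⟩, φ, hφ⟩ := X.2
    obtain ⟨C, hC⟩ := hA N
    exact ⟨C * ‖φ‖, fun Ψ => ((hC Ψ X φ).1 hN hφ).trans_eq (by ring)⟩
  obtain ⟨S₀, hS₀⟩ := exists_operator hdense (adjointForm A) fun Ψ => by
    obtain ⟨⟨N, hN⟩, φ, hφ⟩ := Ψ.2
    obtain ⟨C, hC⟩ := hA N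
    refine ⟨C * ‖φ‖, fun X => ?_⟩
    rw [adjointForm_apply, RCLike.norm_conj]
    exact ((hC Ψ X φ).2 hN hφ)
  obtain ⟨C, hle, h1, h2, h3, h4⟩ := exists_closed_extension hdense (T := T₀) (S := S₀)
    fun Ψ X => by rw [← inner_conj_symm, hS₀, adjointForm_apply, hT₀, Complex.conj_conj]
  refine ⟨C, ⟨h1, hle, h2, h3, fun Ψ X => by rw [h4, hT₀]⟩, fun T' hT' => ?_⟩
  refine hasCore_unique hdense hT'.core h3 fun Ψ X => ?_
  rw [h4, hT₀]
  exact hT'.agrees Ψ X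

end Closable


section Existence

variable {α μ : ℝ} {P : SymLaurent} {g : ℝ × ℝ → ℂ}

theorem exists_formA (hμ : 0 < μ) (hα : 0 < α) (P : SymLaurent) (hg : ContDiff ℝ ∞ g)
    (hc : HasCompactSupport g) : ∃ h : ∀ m n, ∃ C, DampRight α μ P g m n C,
      formA hα h ∈ OmegaBounded α ∧ IsAssociatedForm α (Fodd μ P g) (formA hα h) := by
  obtain ⟨CR, hCR, hR⟩ := good_ffKer_right hμ hα P hg hc
  obtain ⟨CL, hCL, hL⟩ := good_ffKer_left hμ hα P hg hc
  have hR' : ∀ m n, DampRight α μ P g m n (CR * kerBound (weightWidth m) (weightWidth n) m n) :=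
    fun m n => hR m n _ (nodeFilter m n) _ _ (shiftFam_node m n)
  have hL' : ∀ m n, DampLeft α μ P g m n (CL * kerBound (weightWidth n) (weightWidth m) n m) :=
    fun m n => hL m n _ (nodeFilter m n) _ _ (shiftFam_node m n)
  have h : ∀ m n, ∃ C, DampRight α μ P g m n C := fun m n => ⟨_, hR' m n⟩
  have hA := formA_mem_omegaBounded hα h hCR hCL hR' hL'
  exact ⟨h, hA, isAssociatedForm_formA hα hg.continuous hc h (OmegaBounded.le_Qomega hA)⟩

lemma Qodd_le_omegaBounded (hμ : 0 < μ) (hα : 0 < α) (O : Set (ℝ × ℝ)) :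
    Qodd μ α O ≤ OmegaBounded α := by
  refine Submodule.span_le.2 ?_
  rintro A ⟨P, -, g, hg, hA⟩
  obtain ⟨h, h1, h2⟩ := exists_formA hμ hα P hg.1 hg.2.1
  rw [hA.unique hα h2]
  exact h1

end Existence

section Vacuum

variable {α μ : ℝ} {P : SymLaurent} {g : ℝ × ℝ → ℂ} {m : ℕ}

/-- The real momentum as a point of `ℂ × ℂ`. -/
def cMomentum (μ : ℝ) (θ : Fin m → ℝ) : ℂ × ℂ :=
  (((realMomentum μ θ).1 : ℝ), ((realMomentum μ θ).2 : ℝ))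

/-- The form factor at real arguments, without its numerical constant. -/
def ffVac (μ : ℝ) (P : SymLaurent) (g : ℝ × ℝ → ℂ) (θ : Fin m → ℝ) : ℂ :=
  fourier g (cMomentum μ θ) * evalLaurent (fun i => exp (θ i)) P *
    tprod fun i => exp (θ i)

lemma transfer_empty (θ : Fin m → ℝ) (η : Fin 0 → ℝ) : transfer μ θ η = cMomentum μ θ := by
  simp [transfer, cMomentum, realMomentum, energy]

lemma evalLaurent_expNode_empty (θ : Fin m → ℝ) (η : Fin 0 → ℝ) :
    evalLaurent (expNode θ η) P = evalLaurent (fun i => exp (θ i)) P := by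
  unfold evalLaurent
  congr 2
  funext k
  rw [Fin.sum_univ_add]
  simp only [expNode, Fin.append_left, Finset.univ_eq_empty, Finset.sum_empty, add_zero]

lemma shiftKer_empty (a θ : Fin m → ℝ) (b η : Fin 0 → ℝ) :
    shiftKer a b θ η = tprod (expShift a θ) := by
  simp [shiftKer, crossProd, tprod]

lemma tendsto_tprod_zero {Λ : Type*} {l : Filter Λ} {a : Λ → Fin m → ℝ}
    (h : ∀ i, Tendsto (fun t => a t i) l (𝓝 0)) (θ : Fin m → ℝ) :
    Tendsto (fun t => tprod (expShift (a t) θ)) l (𝓝 (tprod fun i => exp (θ i))) := by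
  have h1 : ∀ i, Tendsto (fun t => expShift (a t) θ i) l (𝓝 (exp (θ i))) := by
    intro i
    have : Continuous fun s : ℝ => exp (θ i + s * I) := by fun_prop
    have h2 := (this.tendsto 0).comp (h i)
    simp only [Complex.ofReal_zero, zero_mul, add_zero] at h2
    exact h2
  refine tendsto_finsetProd _ fun i _ => tendsto_finsetProd _ fun j _ => ?_
  refine ((h1 i).sub (h1 j)).div ((h1 i).add (h1 j)) ?_
  simp only
  rw [← Complex.ofReal_exp, ← Complex.ofReal_exp, ← Complex.ofReal_add, Complex.ofReal_ne_zero]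
  positivity

lemma norm_fourier_le (g : ℝ × ℝ → ℂ) (a b : ℝ) :
    ‖fourier g (a, b)‖ ≤ ‖(2 * (Real.pi : ℂ))⁻¹‖ * ∫ x, ‖g x‖ := by
  rw [fourier, norm_mul]
  refine mul_le_mul_of_nonneg_left ((norm_integral_le_integral_norm _).trans_eq ?_) (norm_nonneg _)
  congr 1
  funext x
  rw [norm_mul, show I * ((a : ℂ) * (x.1 : ℂ) - (b : ℂ) * (x.2 : ℂ)) =
    ((a * x.1 - b * x.2 : ℝ) : ℂ) * I by push_cast; ring, Complex.norm_exp_ofReal_mul_I,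
    one_mul]

lemma energy_pow_mul_fourier_le (hμ : 0 < μ) (k : ℕ) : ∀ g : ℝ × ℝ → ℂ, ContDiff ℝ ∞ g →
    HasCompactSupport g → ∃ C : ℝ, ∀ (m : ℕ) (θ : Fin m → ℝ),
      energy1 θ ^ k * ‖fourier g (cMomentum μ θ)‖ ≤ C := by
  induction k with
  | zero => exact fun g _ _ => ⟨_, fun m θ => by
    rw [pow_zero, one_mul]
    exact norm_fourier_le g _ _⟩
  | succ k ih =>
    intro g hg hc
    obtain ⟨C₁, h1⟩ := ih g hg hc
    obtain ⟨C₂, h2⟩ := ih (timeDeriv g) (contDiff_timeDeriv hg) (hasCompactSupport_timeDeriv hc)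
    refine ⟨C₁ + μ⁻¹ * C₂, fun m θ => ?_⟩
    have h3 : energy θ * ‖fourier g (cMomentum μ θ)‖ =
        μ⁻¹ * ‖fourier (timeDeriv g) (cMomentum μ θ)‖ := by
      have h4 := congrArg norm (fourier_timeDeriv hg hc (cMomentum μ θ))
      rw [norm_mul, norm_mul, Complex.norm_I, one_mul] at h4
      rw [← h4]
      simp only [cMomentum, realMomentum, Complex.norm_real, norm_mul, norm_of_nonneg hμ.le,
        norm_of_nonneg (energy_nonneg θ)]
      field_simp
    calc energy1 θ ^ (k + 1) * ‖fourier g (cMomentum μ θ)‖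
        = energy1 θ ^ k * ‖fourier g (cMomentum μ θ)‖ +
          energy1 θ ^ k * (energy θ * ‖fourier g (cMomentum μ θ)‖) := by
          rw [pow_succ]; nth_rewrite 2 [energy1]; ring
      _ ≤ C₁ + μ⁻¹ * C₂ := by
          rw [h3]
          refine add_le_add (h1 m θ) ?_
          calc _ = μ⁻¹ * (energy1 θ ^ k * ‖fourier (timeDeriv g) (cMomentum μ θ)‖) := by ring
            _ ≤ _ := mul_le_mul_of_nonneg_left (h2 m θ) (inv_nonneg.2 hμ.le)

lemma norm_evalLaurent_le (P : SymLaurent) : ∃ (d : ℕ) (C : ℝ), ∀ (m : ℕ) (θ : Fin m → ℝ),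
    ‖evalLaurent (fun i => exp (θ i)) P‖ ≤ C * energy1 θ ^ d := by
  induction P using MvPolynomial.induction_on with
  | C a => exact ⟨0, ‖a‖, fun m θ => by simp [evalLaurent]⟩
  | add P Q hP hQ =>
    obtain ⟨d, C, h⟩ := hP
    obtain ⟨d', C', h'⟩ := hQ
    refine ⟨max d d', |C| + |C'|, fun m θ => ?_⟩
    rw [evalLaurent, map_add]
    have hE := one_le_energy1 θ
    refine (norm_add_le _ _).trans ?_
    rw [add_mul]
    refine add_le_add ((h m θ).trans ?_) ((h' m θ).trans ?_)
    · exact mul_le_mul (le_abs_self _) (pow_le_pow_right₀ hE (le_max_left _ _)) (by positivity)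
        (abs_nonneg _)
    · exact mul_le_mul (le_abs_self _) (pow_le_pow_right₀ hE (le_max_right _ _)) (by positivity)
        (abs_nonneg _)
  | mul_X P k hP =>
    obtain ⟨d, C, h⟩ := hP
    refine ⟨d + ((k : ℤ).natAbs + 1), C * 2 ^ (k : ℤ).natAbs, fun m θ => ?_⟩
    rw [evalLaurent, map_mul, MvPolynomial.aeval_X, norm_mul]
    have h1 := norm_sum_exp_zpow_le θ 1 norm_one (k : ℤ)
    simp only [one_mul] at h1
    have h2 := h m θ
    have hE := energy1_pos θ
    calc _ ≤ (C * energy1 θ ^ d) * (2 ^ (k : ℤ).natAbs * energy1 θ ^ ((k : ℤ).natAbs + 1)) :=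
          mul_le_mul h2 h1 (norm_nonneg _) ((norm_nonneg _).trans h2)
      _ = _ := by rw [pow_add]; ring

lemma continuous_fourier (hg : Continuous g) (hc : HasCompactSupport g) :
    Continuous fun p : ℝ × ℝ => fourier g (p.1, p.2) := by
  refine continuous_const.mul (continuous_of_dominated (bound := fun x => ‖g x‖) ?_ ?_ ?_ ?_)
  · intro p
    exact (integrable_planeWave_mul hg hc (p.1, p.2)).aestronglyMeasurable
  · intro p
    refine .of_forall fun x => ?_
    rw [norm_mul, show I * ((p.1 : ℂ) * (x.1 : ℂ) - (p.2 : ℂ) * (x.2 : ℂ)) =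
      ((p.1 * x.1 - p.2 * x.2 : ℝ) : ℂ) * I by push_cast; ring,
      Complex.norm_exp_ofReal_mul_I, one_mul]
  · exact (hg.integrable_of_hasCompactSupport hc).norm
  · exact .of_forall fun x => by fun_prop

lemma measurable_evalLaurent_exp (P : SymLaurent) : Measurable fun θ : Fin m → ℝ =>
    evalLaurent (fun i => exp (θ i)) P := by
  unfold evalLaurent
  induction P using MvPolynomial.induction_on with
  | C a => simp
  | add P Q hP hQ => simp only [map_add]; exact hP.add hQ
  | mul_X P k hP =>
    simp only [map_mul, MvPolynomial.aeval_X]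
    refine hP.mul (Finset.measurable_sum _ fun j _ => ?_)
    have : Measurable fun θ : Fin m → ℝ => exp (θ j) := by fun_prop
    exact this.pow_const (k : ℤ)

lemma measurable_fourier_evalLaurent (hg : Continuous g) (hc : HasCompactSupport g)
    (P : SymLaurent) : Measurable fun θ : Fin m → ℝ =>
      fourier g (cMomentum μ θ) * evalLaurent (fun i => exp (θ i)) P := by
  exact ((continuous_fourier hg hc).measurable.comp (measurable_realMomentum μ)).mul
    (measurable_evalLaurent_exp P)

lemma sqInt_fourier_evalLaurent (hμ : 0 < μ) (hg : ContDiff ℝ ∞ g) (hc : HasCompactSupport g)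
    (P : SymLaurent) (m : ℕ) : SqInt volume fun θ : Fin m → ℝ =>
      fourier g (cMomentum μ θ) * evalLaurent (fun i => exp (θ i)) P := by
  obtain ⟨d, C, hC⟩ := norm_evalLaurent_le P
  obtain ⟨D, hD⟩ := energy_pow_mul_fourier_le hμ (d + 16) g hg hc
  have hw := sqInt_wprod (sqInt_cardWeight m) m
  refine .of_le (measurable_fourier_evalLaurent hg.continuous hc P)
    (hw.int.const_mul ((|C| * |D| * 2 ^ 16) ^ 2)) fun θ => ?_
  rw [← mul_pow]
  refine pow_le_pow_left₀ (norm_nonneg _) ?_ 2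
  have hE := energy1_pos θ
  have h1 : ‖fourier g (cMomentum μ θ)‖ * energy1 θ ^ d ≤ |D| * (energy1 θ ^ 16)⁻¹ := by
    rw [← div_eq_mul_inv, le_div_iff₀ (by positivity)]
    refine le_trans (le_of_eq ?_) ((hD m θ).trans (le_abs_self D))
    rw [pow_add]; ring
  calc _ ≤ ‖fourier g (cMomentum μ θ)‖ * (|C| * energy1 θ ^ d) := by
        rw [norm_mul]
        refine mul_le_mul_of_nonneg_left ((hC m θ).trans ?_) (norm_nonneg _)
        exact mul_le_mul_of_nonneg_right (le_abs_self C) (by positivity)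
    _ = |C| * (‖fourier g (cMomentum μ θ)‖ * energy1 θ ^ d) := by ring
    _ ≤ |C| * (|D| * (2 ^ 16 * ‖wprod (cardWeight m) θ‖)) := by
        have := inv_energy_le_wprod θ
        refine mul_le_mul_of_nonneg_left (h1.trans ?_) (abs_nonneg C)
        exact mul_le_mul_of_nonneg_left this (abs_nonneg D)
    _ = _ := by ring

lemma norm_tprod_exp_le (θ : Fin m → ℝ) : ‖tprod fun i => exp (θ i)‖ ≤ 1 := by
  have := norm_tprod_expShift_le (a := fun _ : Fin m => (0 : ℝ)) (by simp) θ
  have h : expShift (fun _ : Fin m => (0 : ℝ)) θ = fun i => exp (θ i) := by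
    funext i; simp [expShift]
  rwa [h] at this

lemma sqInt_ffVac (hμ : 0 < μ) (hg : ContDiff ℝ ∞ g) (hc : HasCompactSupport g)
    (P : SymLaurent) (m : ℕ) : SqInt volume (ffVac μ P g : (Fin m → ℝ) → ℂ) := by
  have h := (sqInt_fourier_evalLaurent hμ hg hc P m).mul_bdd (a := fun θ : Fin m → ℝ =>
    tprod fun i => exp (θ i)) (measurable_tprod fun i => by fun_prop) norm_tprod_exp_le
  have h2 : (ffVac μ P g : (Fin m → ℝ) → ℂ) = fun θ => (tprod fun i => exp (θ i)) *
      (fourier g (cMomentum μ θ) * evalLaurent (fun i => exp (θ i)) P) := by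
    funext θ
    rw [ffVac, mul_comm]
  rwa [h2]

lemma evalLaurent_comp_perm {x : Fin m → ℂ} (σ : Equiv.Perm (Fin m)) (P : SymLaurent) :
    evalLaurent (fun i => x (σ i)) P = evalLaurent x P := by
  unfold evalLaurent
  congr 2
  funext k
  exact Equiv.sum_comp σ fun i => x i ^ (k : ℤ)

lemma cMomentum_comp_perm (θ : Fin m → ℝ) (σ : Equiv.Perm (Fin m)) :
    cMomentum μ (θ ∘ σ) = cMomentum μ θ := by
  have h : ∑ j, Real.sinh ((θ ∘ σ) j) = ∑ j, Real.sinh (θ j) :=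
    Equiv.sum_comp σ fun j => Real.sinh (θ j)
  simp only [cMomentum, realMomentum, energy_comp_perm, h]

lemma tprod_comp_perm (x : Fin m → ℂ) (σ : Equiv.Perm (Fin m)) :
    tprod (fun i => x (σ i)) = ((Equiv.Perm.sign σ : ℤ) : ℂ) * tprod x :=
  σ.prod_Ioi_comp_eq_sign_mul_prod (f := fun i j => (x i - x j) / (x i + x j)) fun i j => by
    rw [← neg_sub (x j), neg_div, add_comm]

lemma ffVac_comp_perm (θ : Fin m → ℝ) (σ : Equiv.Perm (Fin m)) :
    ffVac μ P g (θ ∘ σ) = ((Equiv.Perm.sign σ : ℤ) : ℂ) * ffVac μ P g θ := by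
  unfold ffVac
  rw [cMomentum_comp_perm]
  have h1 := evalLaurent_comp_perm (x := fun i => exp (θ i)) σ P
  have h2 := tprod_comp_perm (fun i => exp (θ i)) σ
  simp only [Function.comp_apply] at h1 h2 ⊢
  rw [h1, h2]
  ring

lemma ffVac_swap (θ : Fin m → ℝ) {i j : Fin m} (hij : i ≠ j) :
    ffVac μ P g (θ ∘ Equiv.swap i j) = - ffVac μ P g θ := by
  rw [ffVac_comp_perm]
  simp [hij]

lemma sliceForm_empty {K : (Fin m → ℝ) → (Fin 0 → ℝ) → ℂ} (ψ : (Fin m → ℝ) → ℂ) :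
    sliceForm volume volume volume K (leftArg (k := 0) ψ) (rightArg (n := 0) (k := 0) fun _ => 1) =
      ∫ θ, starRingEnd ℂ (ψ θ) * K θ 0 := by
  unfold sliceForm formInt
  rw [Measure.volume_pi_eq_dirac (0 : Fin 0 → ℝ), integral_dirac, Measure.prod_dirac,
    (measurableEmbedding_prod_mk_right (0 : Fin 0 → ℝ)).integral_map]
  congr 1
  funext θ
  simp only [leftArg, rightArg, mul_one]
  congr 3
  funext i
  rw [append_cases, dif_pos (show (i : ℕ) < m from i.2)]
  rfl

lemma blockForm_vacuum (hμ : 0 < μ) (hg : ContDiff ℝ ∞ g) (hc : HasCompactSupport g)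
    {ψ : (Fin m → ℝ) → ℂ} (hψ : SqInt volume ψ) :
    blockForm μ P g m 0 0 ψ (fun _ => 1) = ∫ θ, starRingEnd ℂ (ψ θ) * ffVac μ P g θ := by
  refine Tendsto.limUnder_eq ?_
  have hF := sqInt_fourier_evalLaurent hμ hg hc P m
  have hK : ∀ (l : Fin (m + 0) → ℝ) (θ : Fin m → ℝ), nodeKer μ P g m 0 l θ 0 =
      fourier g (cMomentum μ θ) * evalLaurent (fun i => exp (θ i)) P *
        tprod (expShift (shiftA l) θ) := fun l θ => by
    rw [nodeKer, ffKer, transfer_empty, evalLaurent_expNode_empty, shiftKer_empty]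
  simp only [sliceForm_empty, hK]
  refine tendsto_integral_filter_of_dominated_convergence (fun θ => ‖starRingEnd ℂ (ψ θ) *
    (fourier g (cMomentum μ θ) * evalLaurent (fun i => exp (θ i)) P)‖) ?_ ?_
    (hψ.star.integrable_mul hF).norm ?_
  · refine .of_forall fun l => (hψ.star.meas.mul (hF.meas.mul ?_)).aestronglyMeasurable
    exact measurable_tprod fun i => measurable_expShift _ i
  · filter_upwards [(shiftFam_node m 0).small] with l hl
    refine .of_forall fun θ => ?_
    rw [← mul_assoc, norm_mul]
    refine mul_le_of_le_one_right (norm_nonneg _) (norm_tprod_expShift_le (fun i => ?_) θ)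
    rw [abs_of_pos (hl.a_pos i)]
    exact hl.a_lt i
  · refine .of_forall fun θ => ?_
    exact ((tendsto_tprod_zero (shiftFam_node m 0).lim_a θ).const_mul _).const_mul _

lemma wave_vacuum : wave vacuum 0 =ᵐ[volume] fun _ => 1 := by
  have : wave vacuum 0 = (indicatorConstLp 2 MeasurableSet.univ (by simp [volume_pi]) (1 : ℂ) :
      Lp ℂ 2 (volume : Measure (Fin 0 → ℝ))) := by
    rw [wave, vacuum, lp.single_apply_self]
  rw [this]
  filter_upwards [indicatorConstLp_coeFn (p := 2) (s := Set.univ) (c := (1 : ℂ))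
    (hs := MeasurableSet.univ) (hμs := by simp [volume_pi])] with θ h
  rw [h, Set.indicator_univ]

lemma vacuum_atMost : AtMost 0 vacuum := fun _ hn => lp.single_apply_ne _ _ _ hn.ne'

lemma vacuum_mem (hα : 0 < α) : vacuum ∈ finiteOmega α := by
  refine ⟨⟨0, vacuum_atMost⟩, vacuum, fun n => ?_⟩
  rcases Nat.eq_zero_or_pos n with rfl | hn
  · refine .of_forall fun θ => ?_
    simp [energy, omega, Real.zero_rpow hα.ne']
  · filter_upwards [wave_eq_zero (vacuum_atMost n hn)] with θ h
    rw [h, mul_zero]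

theorem formA_vacuum (hμ : 0 < μ) (hα : 0 < α) (hg : ContDiff ℝ ∞ g) (hc : HasCompactSupport g)
    (h : ∀ m n, ∃ C, DampRight α μ P g m n C) {M : ℕ} (Ψ : finiteOmega α)
    (hΨ : AtMost M (Ψ : Fock)) : formA hα h Ψ ⟨vacuum, vacuum_mem hα⟩ =
      ∑ m ∈ range (M + 1), blockCoeff m 0 0 * oddConst m *
        ∫ θ, starRingEnd ℂ (wave (Ψ : Fock) m θ) * ffVac μ P g θ := by
  rw [formA_eq_sum hα h hΨ vacuum_atMost]
  refine sum_congr rfl fun m _ => ?_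
  rw [zero_add, Finset.sum_range_one, Finset.sum_range_one, blockTerm,
    blockForm_congr EventuallyEq.rfl wave_vacuum]
  exact congrArg _ (blockForm_vacuum hμ hg hc (sqInt_wave _ m))

end Vacuum


section HalfPlane

/-- A bounded holomorphic function on the upper half plane that vanishes on an interval of the real
line vanishes. -/
lemma eq_zero_of_boundary_zero {f : ℂ → ℂ} (hc : ContinuousOn f {z | 0 ≤ z.im})
    (hd : DifferentiableOn ℂ f {z | 0 < z.im}) {B : ℝ} (hB : ∀ z : ℂ, 0 ≤ z.im → ‖f z‖ ≤ B)
    {ε : ℝ} (hε : 0 < ε) (h0 : ∀ t : ℝ, |t| < ε → f t = 0) : ∀ z : ℂ, 0 < z.im → f z = 0 := by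
  intro z hz
  let ζ : ℂ → ℂ := fun w => exp (w * I)
  let φ : ℂ → ℂ := fun w => ε * (ζ w / (ζ w + 1))
  have hζ : ∀ w : ℂ, ζ w = Real.exp (-w.im) * (Real.cos w.re + Real.sin w.re * I) := by
    intro w
    simp only [ζ]
    rw [show w * I = ((-w.im : ℝ) : ℂ) + (w.re : ℝ) * I by
      apply Complex.ext <;> simp, Complex.exp_add, Complex.exp_mul_I, ← Complex.ofReal_exp,
      ← Complex.ofReal_cos, ← Complex.ofReal_sin]
  have him : ∀ w, (ζ w).im = Real.exp (-w.im) * Real.sin w.re := fun w => by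
    rw [hζ, Complex.im_ofReal_mul]; simp [-Complex.ofReal_cos, -Complex.ofReal_sin]
  have hne : ∀ w : ℂ, w.re ∈ Set.Ico 0 Real.pi → ζ w + 1 ≠ 0 := by
    intro w hw h
    have h1 := congrArg Complex.im h
    rw [Complex.add_im, him, Complex.one_im, add_zero, Complex.zero_im] at h1
    rcases hw.1.eq_or_lt with h2 | h2
    · have h3 := congrArg Complex.re h
      rw [hζ, ← h2] at h3
      simp [-Complex.ofReal_exp] at h3
      linarith [exp_pos (-w.im)]
    · exact (mul_pos (exp_pos _) (Real.sin_pos_of_pos_of_lt_pi h2 hw.2)).ne' h1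
  have hφim : ∀ w, (φ w).im = ε * (ζ w).im / Complex.normSq (ζ w + 1) := by
    intro w
    simp only [φ]
    rw [Complex.im_ofReal_mul, Complex.div_im]
    simp
    ring
  have hsin : ∀ w : ℂ, w.re ∈ Set.Ico 0 Real.pi → 0 ≤ (φ w).im := by
    intro w hw
    rw [hφim, him]
    have := Real.sin_nonneg_of_nonneg_of_le_pi hw.1 hw.2.le
    have := Complex.normSq_nonneg (ζ w + 1)
    positivity
  have hsin' : ∀ w : ℂ, w.re ∈ Set.Ioo 0 Real.pi → 0 < (φ w).im := by
    intro w hw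
    rw [hφim, him]
    have := Real.sin_pos_of_pos_of_lt_pi hw.1 hw.2
    have := Complex.normSq_pos.2 (hne w (Set.Ioo_subset_Ico_self hw))
    positivity
  have hφd : ∀ w : ℂ, w.re ∈ Set.Ico 0 Real.pi → DifferentiableAt ℂ φ w := by
    intro w hw
    have : DifferentiableAt ℂ ζ w := by fun_prop
    exact (this.div (this.add_const 1) (hne w hw)).const_mul _
  have hne1 : (ε : ℂ) - z ≠ 0 := fun h => by
    have := congrArg Complex.im h
    simp at this
    linarith
  set q : ℂ := z / (ε - z) with hq
  have hqim : 0 < q.im := by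
    have hn := Complex.normSq_pos.2 hne1
    have : q.im = ε * z.im / Complex.normSq ((ε : ℂ) - z) := by
      rw [hq, Complex.div_im]; simp; ring
    rw [this]; positivity
  have hq0 : q ≠ 0 := fun h => by simp [h] at hqim
  have h1 : 0 < q.arg := lt_of_le_of_ne (Complex.arg_nonneg_iff.2 hqim.le) fun h =>
    hqim.ne' (Complex.arg_eq_zero_iff.1 h.symm).2
  have h2 : q.arg < Real.pi := lt_of_le_of_ne (Complex.arg_le_pi q) fun h =>
    hqim.ne' (Complex.arg_eq_pi_iff.1 h).2
  set w : ℂ := -I * Complex.log q with hw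
  have hwre : w.re = q.arg := by simp [hw, Complex.log_im]
  have hφw : φ w = z := by
    have h3 : ζ w = q := by
      simp only [ζ, hw]
      rw [show -I * Complex.log q * I = Complex.log q by
        linear_combination (-Complex.log q) * Complex.I_mul_I, Complex.exp_log hq0]
    have hq1 : q + 1 = ε / (ε - z) := by rw [hq]; field_simp; ring
    have hε' : (ε : ℂ) ≠ 0 := Complex.ofReal_ne_zero.2 hε.ne'
    simp only [φ]
    rw [h3, hq1, hq]
    field_simp
  obtain ⟨l, hl1, hl2⟩ := exists_between h2
  have hIco : Set.Icc 0 l ⊆ Set.Ico 0 Real.pi := fun t ht => ⟨ht.1, ht.2.trans_lt hl2⟩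
  have h := Complex.HadamardThreeLines.norm_le_interp_of_mem_verticalClosedStrip'
    (f := fun w => f (φ w)) (z := w) (a := 0) (b := B) (l := 0) (u := l) (h1.trans hl1)
    ⟨hwre ▸ h1.le, hwre ▸ hl1.le⟩ ⟨?_, ?_⟩ ?_ ?_ ?_
  · rw [Real.zero_rpow, zero_mul] at h
    · simp only [hφw] at h
      exact norm_le_zero_iff.1 h
    · rw [sub_zero, sub_zero, hwre]
      exact (sub_pos.2 ((div_lt_one (h1.trans hl1)).2 hl1)).ne'
  · intro v hv
    have hv' : v.re ∈ Set.Ioo 0 Real.pi := ⟨hv.1, hv.2.trans hl2⟩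
    exact ((hd.differentiableAt ((isOpen_lt continuous_const Complex.continuous_im).mem_nhds
      (hsin' v hv'))).comp v (hφd v (Set.Ioo_subset_Ico_self hv'))).differentiableWithinAt
  · have hcl : closure (Complex.HadamardThreeLines.verticalStrip 0 l) ⊆
        Complex.re ⁻¹' Set.Icc 0 l :=
      closure_minimal (Set.preimage_mono Set.Ioo_subset_Icc_self)
        (isClosed_Icc.preimage Complex.continuous_re)
    exact (hc.comp (fun v hv => (hφd v (hIco hv)).continuousAt.continuousWithinAt)
      fun v hv => hsin v (hIco hv)).mono hcl
  · refine ⟨B, ?_⟩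
    rintro _ ⟨v, hv, rfl⟩
    exact hB _ (hsin v (hIco hv))
  · intro v hv
    have hv0 : v.re = 0 := hv
    have he := exp_pos (-v.im)
    have hφv : φ v = ((ε * (Real.exp (-v.im) / (Real.exp (-v.im) + 1)) : ℝ) : ℂ) := by
      simp only [φ]
      rw [hζ, hv0]
      simp
    rw [hφv, h0, norm_zero]
    rw [abs_of_pos (by positivity)]
    exact mul_lt_of_lt_one_right hε ((div_lt_one (by linarith)).2 (by linarith))
  · intro v hv
    have hv0 : v.re = l := hv
    exact hB _ (hsin v (hIco ⟨hv0 ▸ (h1.trans hl1).le, hv0.le⟩))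

variable {X : Type*} [MeasurableSpace X] {ν : Measure X} {H : X → ℂ} {E : X → ℝ}

lemma norm_exp_I_mul_le {z : ℂ} (hz : 0 ≤ z.im) {e : ℝ} (he : 0 ≤ e) :
    ‖exp (I * z * e)‖ ≤ 1 := by
  rw [Complex.norm_exp]
  simp only [Complex.mul_re, Complex.I_re, Complex.I_im, Complex.ofReal_re, Complex.ofReal_im,
    Complex.mul_im, zero_mul, one_mul, zero_sub, mul_zero, sub_zero]
  exact Real.exp_le_one_iff.2 (by nlinarith)

lemma integral_exp_eq_zero (hH : Integrable H ν) (hE : Measurable E) (hE0 : ∀ x, 0 ≤ E x)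
    {ε : ℝ} (hε : 0 < ε) (h0 : ∀ t : ℝ, |t| < ε → ∫ x, H x * exp (I * t * E x) ∂ν = 0)
    (n : ℕ) : ∫ x, H x * (Real.exp (-E x) : ℂ) ^ n ∂ν = 0 := by
  have hmeas : ∀ z : ℂ, AEStronglyMeasurable (fun x => H x * exp (I * z * E x)) ν :=
    fun z => hH.aestronglyMeasurable.mul (by fun_prop)
  rcases Nat.eq_zero_or_pos n with rfl | hn
  · simpa using h0 0 (by simpa using hε)
  have h := eq_zero_of_boundary_zero (f := fun z => ∫ x, H x * exp (I * z * E x) ∂ν)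
    ?_ ?_ (B := ∫ x, ‖H x‖ ∂ν) ?_ hε h0 (n * I) (by simpa using hn)
  · rw [← h]
    congr 1
    funext x
    rw [← Complex.ofReal_pow, ← Real.exp_nat_mul, Complex.ofReal_exp]
    congr 2
    push_cast
    linear_combination (-(n : ℂ) * E x) * Complex.I_mul_I
  · refine continuousOn_of_dominated (bound := fun x => ‖H x‖) (fun z _ => hmeas z) ?_ hH.norm ?_
    · intro z hz
      refine .of_forall fun x => ?_
      rw [norm_mul]
      exact mul_le_of_le_one_right (norm_nonneg _) (norm_exp_I_mul_le hz (hE0 x))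
    · exact .of_forall fun x => by fun_prop
  · intro z hz
    have hz' : 0 < z.im := hz
    have hball : ∀ w ∈ Metric.ball z (z.im / 2), z.im / 2 < w.im := by
      intro w hw
      have h1 : |w.im - z.im| < z.im / 2 := by
        have := (Complex.abs_im_le_norm (w - z)).trans_lt (mem_ball_iff_norm.1 hw)
        simpa using this
      linarith [(abs_lt.1 h1).1]
    refine (hasDerivAt_integral_of_dominated_loc_of_deriv_le (μ := ν)
      (F := fun z x => H x * exp (I * z * E x))
      (F' := fun z x => H x * (exp (I * z * E x) * (I * E x)))
      (bound := fun x => ‖H x‖ * (2 / z.im)) (x₀ := z) (s := Metric.ball z (z.im / 2))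
      (Metric.ball_mem_nhds z (by positivity)) (.of_forall hmeas) ?_ ?_ ?_ ?_
      ?_).2.differentiableAt.differentiableWithinAt
    · refine hH.norm.mono' (hmeas z) (.of_forall fun x => ?_)
      rw [norm_mul]
      exact mul_le_of_le_one_right (norm_nonneg _) (norm_exp_I_mul_le hz'.le (hE0 x))
    · exact hH.aestronglyMeasurable.mul (by fun_prop)
    · refine .of_forall fun x w hw => ?_
      rw [norm_mul]
      refine mul_le_mul_of_nonneg_left ?_ (norm_nonneg _)
      rw [norm_mul, norm_mul, Complex.norm_I, one_mul, Complex.norm_real,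
        norm_of_nonneg (hE0 x), Complex.norm_exp]
      simp only [Complex.mul_re, Complex.I_re, Complex.I_im, Complex.ofReal_re, Complex.ofReal_im,
        Complex.mul_im, zero_mul, one_mul, zero_sub, mul_zero, sub_zero]
      have h1 := hball w hw
      have h2 : z.im / 2 * E x ≤ Real.exp (w.im * E x) :=
        (mul_le_mul_of_nonneg_right h1.le (hE0 x)).trans
          (by linarith [Real.add_one_le_exp (w.im * E x)])
      rw [neg_mul, Real.exp_neg, inv_mul_le_iff₀ (exp_pos _), mul_div_assoc',
        le_div_iff₀ hz']
      linarith
    · exact hH.norm.mul_const _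
    · refine .of_forall fun x w _ => ?_
      have h1 : HasDerivAt (fun w : ℂ => I * w * E x) (I * E x) w := by
        simpa using ((hasDerivAt_id w).const_mul I).mul_const (E x : ℂ)
      exact h1.cexp.const_mul (H x)
  · intro z hz
    refine (norm_integral_le_integral_norm _).trans (integral_mono_of_nonneg
      (.of_forall fun _ => norm_nonneg _) hH.norm (.of_forall fun x => ?_))
    simp only [norm_mul]
    exact mul_le_of_le_one_right (norm_nonneg _) (norm_exp_I_mul_le hz (hE0 x))

/-- If `∫ H exp(i t E)` vanishes for small `t` then `H` is orthogonal to all continuous functions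
of `exp(-E)`. -/
lemma integral_mul_comp_eq_zero (hH : Integrable H ν) (hE : Measurable E) (hE0 : ∀ x, 0 ≤ E x)
    {ε : ℝ} (hε : 0 < ε) (h0 : ∀ t : ℝ, |t| < ε → ∫ x, H x * exp (I * t * E x) ∂ν = 0)
    {ψ : ℝ → ℝ} (hψ : Continuous ψ) : ∫ x, H x * (ψ (Real.exp (-E x)) : ℂ) ∂ν = 0 := by
  have hpoly : ∀ p : Polynomial ℝ, ∫ x, H x * ((p.eval (Real.exp (-E x)) : ℝ) : ℂ) ∂ν = 0 := by
    intro p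
    simp only [Polynomial.eval_eq_sum_range, Complex.ofReal_sum, Finset.mul_sum]
    rw [integral_finsetSum]
    · refine Finset.sum_eq_zero fun n _ => ?_
      have := integral_exp_eq_zero hH hE hE0 hε h0 n
      calc _ = ∫ x, (p.coeff n : ℂ) * (H x * (Real.exp (-E x) : ℂ) ^ n) ∂ν := by
            congr 1; funext x; push_cast; ring
        _ = 0 := by rw [integral_const_mul, this, mul_zero]
    · intro n _
      refine (hH.norm.const_mul ‖(p.coeff n : ℂ)‖).mono' (hH.aestronglyMeasurable.mul (by fun_prop))
        (.of_forall fun x => ?_)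
      push_cast
      rw [norm_mul, norm_mul, norm_pow, mul_comm]
      refine mul_le_mul_of_nonneg_right (mul_le_of_le_one_right (norm_nonneg _)
        (pow_le_one₀ (norm_nonneg _) ?_)) (norm_nonneg _)
      rw [← Complex.ofReal_neg, ← Complex.ofReal_exp, Complex.norm_real,
        norm_of_nonneg (exp_pos _).le]
      exact Real.exp_le_one_iff.2 (neg_nonpos.2 (hE0 x))
  refine eq_zero_of_forall_le (C := ∫ x, ‖H x‖ ∂ν) fun ε' hε' => ?_
  obtain ⟨p, hp⟩ := exists_polynomial_near_of_continuousOn 0 1 ψ hψ.continuousOn ε' hε'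
  have hx : ∀ x, Real.exp (-E x) ∈ Set.Icc (0 : ℝ) 1 := fun x =>
    ⟨(exp_pos _).le, Real.exp_le_one_iff.2 (neg_nonpos.2 (hE0 x))⟩
  have hbd : ∀ x, ‖((ψ (Real.exp (-E x)) - p.eval (Real.exp (-E x)) : ℝ) : ℂ)‖ ≤ ε' := fun x => by
    rw [Complex.norm_real, ← norm_neg, neg_sub]
    exact (hp _ (hx x)).le
  have hi : Integrable (fun x => H x * ((ψ (Real.exp (-E x)) - p.eval (Real.exp (-E x)) : ℝ) : ℂ)) ν := by
    refine (hH.norm.mul_const ε').mono' (hH.aestronglyMeasurable.mul ?_)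
      (.of_forall fun x => ?_)
    · have : Measurable fun x => Real.exp (-E x) := by fun_prop
      exact (Complex.measurable_ofReal.comp ((hψ.measurable.comp this).sub
        (p.continuous.measurable.comp this))).aestronglyMeasurable
    · rw [norm_mul]
      exact mul_le_mul_of_nonneg_left (hbd x) (norm_nonneg _)
  have hi2 : Integrable (fun x => H x * ((p.eval (Real.exp (-E x)) : ℝ) : ℂ)) ν := by
    obtain ⟨K, hK⟩ := isCompact_Icc.exists_bound_of_continuousOn (s := Set.Icc (0 : ℝ) 1)
      p.continuous.continuousOn
    refine (hH.norm.mul_const K).mono' (hH.aestronglyMeasurable.mul ?_)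
      (.of_forall fun x => ?_)
    · have : Measurable fun x => Real.exp (-E x) := by fun_prop
      exact (Complex.measurable_ofReal.comp
        (p.continuous.measurable.comp this)).aestronglyMeasurable
    · rw [norm_mul, Complex.norm_real]
      exact mul_le_mul_of_nonneg_left (hK _ (hx x)) (norm_nonneg _)
  have hsplit : ∫ x, H x * (ψ (Real.exp (-E x)) : ℂ) ∂ν =
      ∫ x, H x * ((ψ (Real.exp (-E x)) - p.eval (Real.exp (-E x)) : ℝ) : ℂ) ∂ν := by
    have := integral_add hi hi2
    rw [hpoly p, add_zero] at this
    rw [← this]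
    congr 1
    funext x
    push_cast
    ring
  rw [hsplit, ← integral_mul_const]
  refine (norm_integral_le_integral_norm _).trans (integral_mono_of_nonneg
    (.of_forall fun _ => norm_nonneg _) (hH.norm.mul_const ε')
      (.of_forall fun x => ?_))
  simp only [norm_mul]
  exact mul_le_mul_of_nonneg_left (hbd x) (norm_nonneg _)

end HalfPlane



section SymmetricApprox

lemma exists_equiv_of_oddPowerSums {ι κ : Type*} [Fintype ι] [Fintype κ] {x : ι → ℝ} {y : κ → ℝ}
    (hx : ∀ i, 0 < x i) (hy : ∀ j, 0 < y j)
    (h : ∀ k : ℕ, ∑ i, x i ^ (2 * k + 1) = ∑ j, y j ^ (2 * k + 1)) :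
    ∃ e : ι ≃ κ, ∀ i, y (e i) = x i := by
  classical
  have hpoly : ∀ q : Polynomial ℝ, ∑ i, x i * q.eval (x i ^ 2) = ∑ j, y j * q.eval (y j ^ 2) := by
    intro q
    simp only [Polynomial.eval_eq_sum_range, Finset.mul_sum]
    rw [Finset.sum_comm, Finset.sum_comm (s := (univ : Finset κ))]
    refine sum_congr rfl fun k _ => ?_
    have := congrArg (q.coeff k * ·) (h k)
    simp only [Finset.mul_sum] at this
    convert this using 2 <;> ring
  have hcard : ∀ a : ℝ, Fintype.card {i // x i = a} = Fintype.card {j // y j = a} := by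
    intro a
    rcases le_or_gt a 0 with ha | ha
    · have : IsEmpty {i // x i = a} := ⟨fun i => by linarith [hx i.1, i.2]⟩
      have : IsEmpty {j // y j = a} := ⟨fun i => by linarith [hy i.1, i.2]⟩
      simp
    set V := (Finset.univ.image x ∪ Finset.univ.image y).erase a with hV
    set q : Polynomial ℝ := ∏ b ∈ V, (Polynomial.X - Polynomial.C (b ^ 2)) with hq
    have hev : ∀ t, q.eval t = ∏ b ∈ V, (t - b ^ 2) := fun t => by
      rw [hq, Polynomial.eval_prod]; simp
    have hpos : ∀ b ∈ V, 0 < b := by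
      intro b hb
      rcases Finset.mem_union.1 (Finset.mem_of_mem_erase hb) with h | h
      · obtain ⟨i, -, rfl⟩ := Finset.mem_image.1 h; exact hx i
      · obtain ⟨i, -, rfl⟩ := Finset.mem_image.1 h; exact hy i
    have ha0 : q.eval (a ^ 2) ≠ 0 := by
      rw [hev, Finset.prod_ne_zero_iff]
      intro b hb h0
      have h1 := hpos b hb
      have h2 : (a - b) * (a + b) = 0 := by linarith [h0]
      rcases mul_eq_zero.1 h2 with h3 | h3
      · exact Finset.ne_of_mem_erase hb (by linarith)
      · linarith
    have hx0 : ∀ i, x i * q.eval (x i ^ 2) = if x i = a then a * q.eval (a ^ 2) else 0 := by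
      intro i
      split_ifs with hi
      · rw [hi]
      · rw [hev, Finset.prod_eq_zero (i := x i), mul_zero]
        · exact Finset.mem_erase.2 ⟨hi, Finset.mem_union_left _
            (Finset.mem_image_of_mem _ (mem_univ _))⟩
        · ring
    have hy0 : ∀ i, y i * q.eval (y i ^ 2) = if y i = a then a * q.eval (a ^ 2) else 0 := by
      intro i
      split_ifs with hi
      · rw [hi]
      · rw [hev, Finset.prod_eq_zero (i := y i), mul_zero]
        · exact Finset.mem_erase.2 ⟨hi, Finset.mem_union_right _
            (Finset.mem_image_of_mem _ (mem_univ _))⟩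
        · ring
    have h1 := hpoly q
    simp only [hx0, hy0, Finset.sum_ite, Finset.sum_const_zero, add_zero, Finset.sum_const,
      nsmul_eq_mul] at h1
    rw [Fintype.card_subtype, Fintype.card_subtype]
    exact_mod_cast mul_right_cancel₀ (mul_ne_zero ha.ne' ha0) h1
  refine ⟨Equiv.ofFiberEquiv (f := x) (g := y) fun a => Fintype.equivOfCardEq (hcard a), fun i => ?_⟩
  exact Equiv.ofFiberEquiv_map _ i

/-- The power sum `p_{2k+1}` as an element of the symmetric Laurent functions. -/
def oddPowerSum (k : ℕ) : SymLaurent := MvPolynomial.X ⟨(2 * k + 1 : ℕ), by simp; omega⟩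

lemma oddPowerSum_mem (k : ℕ) : oddPowerSum k ∈ LaurentI := by
  rw [mem_LaurentI_iff]
  intro y _
  rw [oddPowerSum, substPair, MvPolynomial.aeval_X]
  simp only [zpow_natCast]
  rw [Odd.neg_pow ⟨k, rfl⟩, add_neg_cancel, map_zero, add_zero]

lemma evalLaurent_oddPowerSum {m : ℕ} (x : Fin m → ℂ) (k : ℕ) :
    evalLaurent x (oddPowerSum k) = ∑ j, x j ^ (2 * k + 1) := by
  rw [oddPowerSum, evalLaurent, MvPolynomial.aeval_X]
  simp only [zpow_natCast]

/-- The points of all the spaces `ℝᵐ` with bounded energy. -/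
def energyBall (R : ℝ) : Set (Σ m, Fin m → ℝ) := {x | energy x.2 ≤ R}

lemma abs_le_energy {m : ℕ} (θ : Fin m → ℝ) (j : Fin m) : |θ j| ≤ energy θ := by
  have h1 : Real.cosh (θ j) ≤ energy θ :=
    Finset.single_le_sum (f := fun j => Real.cosh (θ j)) (fun i _ => (Real.cosh_pos _).le)
      (mem_univ j)
  rw [← Real.cosh_abs, Real.cosh_eq] at h1
  have h2 := Real.quadratic_le_exp_of_nonneg (abs_nonneg (θ j))
  have h3 := Real.add_one_le_exp (-|θ j|)
  nlinarith [sq_nonneg (|θ j| - 2)]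

lemma isCompact_energyBall (R : ℝ) : IsCompact (energyBall R) := by
  have h : energyBall R = ⋃ m ∈ range (⌊R⌋₊ + 1),
      Sigma.mk m '' {θ : Fin m → ℝ | energy θ ≤ R} := by
    ext ⟨m, θ⟩
    simp only [energyBall, Set.mem_ofPred_eq, Set.mem_iUnion, Finset.mem_range, Set.mem_image,
      exists_prop]
    constructor
    · intro h
      exact ⟨m, Nat.lt_succ_of_le (Nat.le_floor ((card_le_energy θ).trans h)), θ, h, rfl⟩
    · rintro ⟨m', -, θ', h', h⟩
      cases h
      exact h'
  rw [h]
  refine (range _).isCompact_biUnion fun m _ => IsCompact.image ?_ continuous_sigmaMk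
  refine Metric.isCompact_of_isClosed_isBounded (isClosed_le ?_ continuous_const) ?_
  · unfold energy; fun_prop
  · refine (Metric.isBounded_closedBall (x := (0 : Fin m → ℝ)) (r := |R|)).subset fun θ hθ => ?_
    rw [mem_closedBall_zero_iff, pi_norm_le_iff_of_nonneg (abs_nonneg _)]
    exact fun j => (abs_le_energy θ j).trans (le_trans hθ (le_abs_self R))

/-- On sets of bounded energy, symmetric continuous functions are uniformly approximated by elements
of the algebra `LaurentI`. -/
theorem exists_laurentI_near {f : (m : ℕ) → (Fin m → ℝ) → ℝ} (hf : ∀ m, Continuous (f m))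
    (hs : ∀ m θ (σ : Equiv.Perm (Fin m)), f m (θ ∘ σ) = f m θ) (R : ℝ) {ε : ℝ} (hε : 0 < ε) :
    ∃ P ∈ LaurentI, ∀ m (θ : Fin m → ℝ), energy θ ≤ R →
      ‖evalLaurent (fun j => exp (θ j)) P - f m θ‖ ≤ ε := by
  have : CompactSpace (energyBall R) := isCompact_iff_compactSpace.1 (isCompact_energyBall R)
  let T : energyBall R → ℕ → ℝ := fun x k => ∑ j, Real.exp (x.1.2 j) ^ (2 * k + 1)
  have hT : Continuous T := by
    refine continuous_pi fun k => ?_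
    have : Continuous fun x : (Σ m, Fin m → ℝ) => ∑ j, Real.exp (x.2 j) ^ (2 * k + 1) := by
      refine continuous_sigma_iff.2 fun m => ?_
      change Continuous fun a : Fin m → ℝ => ∑ j, Real.exp (a j) ^ (2 * k + 1)
      fun_prop
    exact this.comp continuous_subtype_val
  have hfc : Continuous fun x : energyBall R => f x.1.1 x.1.2 :=
    (show Continuous fun x : (Σ m, Fin m → ℝ) => f x.1 x.2 from continuous_sigma_iff.2 hf).comp
      continuous_subtype_val
  have hfib : ∀ a b : energyBall R, T a = T b → f a.1.1 a.1.2 = f b.1.1 b.1.2 := by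
    rintro ⟨⟨m, θ⟩, ha⟩ ⟨⟨n, η⟩, hb⟩ h
    obtain ⟨e, he⟩ := exists_equiv_of_oddPowerSums (fun j => exp_pos (θ j))
      (fun j => exp_pos (η j)) fun k => congrFun h k
    obtain rfl : m = n := by simpa using Fintype.card_congr e
    have : θ = η ∘ e := funext fun i => (Real.exp_injective (he i)).symm
    simp only
    rw [this, hs]
  let T' : C(energyBall R, Set.range T) :=
    ⟨Set.rangeFactorization T, hT.subtype_mk fun x => ⟨x, rfl⟩⟩
  have hT' : IsQuotientMap T' := IsQuotientMap.of_surjective_continuous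
    Set.rangeFactorization_surjective T'.continuous
  have : CompactSpace (Set.range T) := isCompact_iff_compactSpace.1 (isCompact_range hT)
  let F : C(energyBall R, ℝ) := ⟨fun x => f x.1.1 x.1.2, hfc⟩
  have hF : Function.FactorsThrough F T' := fun a b hab =>
    hfib a b (congrArg (fun z : Set.range T => z.1) (show T' a = T' b from hab))
  let u : C(Set.range T, ℝ) := hT'.lift F hF
  have hu : ∀ x, u (T' x) = f x.1.1 x.1.2 := fun x => DFunLike.congr_fun (hT'.lift_comp F hF) x
  let S : Subalgebra ℝ C(Set.range T, ℝ) :=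
    { carrier := {v | ∃ P ∈ LaurentI, ∀ x : energyBall R,
        evalLaurent (fun j => exp (x.1.2 j)) P = (v (T' x) : ℂ)}
      mul_mem' := by
        rintro v w ⟨P, hP, hv⟩ ⟨Q, hQ, hw⟩
        refine ⟨P * Q, mul_mem hP hQ, fun x => ?_⟩
        have : evalLaurent (fun j => exp (x.1.2 j)) (P * Q) = _ * _ := map_mul _ P Q
        rw [this, ContinuousMap.mul_apply, Complex.ofReal_mul, ← hv, ← hw]
        rfl
      add_mem' := by
        rintro v w ⟨P, hP, hv⟩ ⟨Q, hQ, hw⟩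
        refine ⟨P + Q, add_mem hP hQ, fun x => ?_⟩
        have : evalLaurent (fun j => exp (x.1.2 j)) (P + Q) = _ + _ := map_add _ P Q
        rw [this, ContinuousMap.add_apply, Complex.ofReal_add, ← hv, ← hw]
        rfl
      algebraMap_mem' := by
        intro r
        refine ⟨algebraMap ℂ _ r, Subalgebra.algebraMap_mem _ _, fun x => ?_⟩
        rw [evalLaurent, AlgHom.commutes]
        rfl }
  have hS : S.SeparatesPoints := by
    intro a b hab
    obtain ⟨k, hk⟩ : ∃ k, a.1 k ≠ b.1 k := by
      by_contra! h
      exact hab (Subtype.ext (funext h))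
    let v : C(Set.range T, ℝ) := ⟨fun z => z.1 k, (continuous_apply k).comp continuous_subtype_val⟩
    refine ⟨v, ⟨v, ⟨oddPowerSum k, oddPowerSum_mem k, fun x => ?_⟩, rfl⟩, hk⟩
    rw [evalLaurent_oddPowerSum]
    have : v (T' x) = ∑ j, Real.exp (x.1.2 j) ^ (2 * k + 1) := rfl
    rw [this]
    push_cast
    rfl
  obtain ⟨⟨v, P, hP, hv⟩, hvu⟩ :=
    ContinuousMap.exists_mem_subalgebra_near_continuousMap_of_separatesPoints S hS u ε hε
  refine ⟨P, hP, fun m θ hθ => ?_⟩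
  have h1 := hv ⟨⟨m, θ⟩, hθ⟩
  have h2 := (ContinuousMap.norm_coe_le_norm (v - u) (T' ⟨⟨m, θ⟩, hθ⟩)).trans hvu.le
  rw [ContinuousMap.sub_apply, hu] at h2
  rw [h1, ← Complex.ofReal_sub, Complex.norm_real]
  exact h2

end SymmetricApprox



section Moments

lemma measurable_sigma {Y : Type*} [MeasurableSpace Y] {f : (Σ m, Fin m → ℝ) → Y}
    (hf : ∀ m, Measurable fun θ => f ⟨m, θ⟩) : Measurable f := by
  intro s hs
  rw [MeasurableSpace.measurableSet_iInf]
  exact fun m => hf m hs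

lemma measurableEmbedding_sigmaMk (m : ℕ) :
    MeasurableEmbedding (Sigma.mk (β := fun m => Fin m → ℝ) m) where
  injective := sigma_mk_injective
  measurable := fun s hs => by
    rw [MeasurableSpace.measurableSet_iInf] at hs
    exact hs m
  measurableSet_image' := fun s hs => by
    rw [MeasurableSpace.measurableSet_iInf]
    intro n
    change MeasurableSet (Sigma.mk n ⁻¹' (Sigma.mk (β := fun m => Fin m → ℝ) m '' s))
    rcases eq_or_ne n m with rfl | h
    · rwa [Set.preimage_image_eq _ sigma_mk_injective]
    · convert MeasurableSet.empty
      ext θ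
      simp only [Set.mem_preimage, Set.mem_image, Set.mem_empty_iff_false, iff_false]
      rintro ⟨η, -, hη⟩
      exact h (congrArg Sigma.fst hη).symm

/-- Lebesgue measure on the disjoint union of the spaces `ℝᵐ`. -/
def fockMeasure : Measure (Σ m, Fin m → ℝ) :=
  Measure.sum fun m => (volume : Measure (Fin m → ℝ)).map (Sigma.mk m)

variable {f : (Σ m, Fin m → ℝ) → ℂ}

lemma integrable_fockMeasure (h1 : ∀ m, Integrable fun θ => f ⟨m, θ⟩)
    (h2 : Summable fun m => ∫ θ, ‖f ⟨m, θ⟩‖) : Integrable f fockMeasure := by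
  refine integrable_sum_measure (fun m => ?_) ?_
  · exact (measurableEmbedding_sigmaMk m).integrable_map_iff.2 (h1 m)
  · simpa only [(measurableEmbedding_sigmaMk _).integral_map] using h2

lemma integral_fockMeasure (h : Integrable f fockMeasure) :
    ∫ x, f x ∂fockMeasure = ∑' m, ∫ θ, f ⟨m, θ⟩ := by
  rw [fockMeasure, integral_sum_measure h]
  simp only [(measurableEmbedding_sigmaMk _).integral_map]

lemma integral_comp_perm {m : ℕ} (σ : Equiv.Perm (Fin m)) (u : (Fin m → ℝ) → ℂ) :
    ∫ θ, u (θ ∘ σ) = ∫ θ, u θ := by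
  have : MeasurableEmbedding fun θ : Fin m → ℝ => θ ∘ σ :=
    Homeomorph.measurableEmbedding
      { toFun := fun θ => θ ∘ σ
        invFun := fun θ => θ ∘ σ.symm
        left_inv := fun θ => by ext; simp
        right_inv := fun θ => by ext; simp
        continuous_toFun := by fun_prop
        continuous_invFun := by fun_prop }
  exact (measurePreserving_perm σ).integral_comp this u

/-- A sequence of symmetric functions is determined by its moments with respect to the functions
`P(exp θ) exp(i t E(θ))` with `P ∈ LaurentI` and small `t`. -/
theorem ae_eq_zero_of_moments {H : (m : ℕ) → (Fin m → ℝ) → ℂ}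
    (hint : ∀ P ∈ LaurentI, ∀ m, Integrable fun θ : Fin m → ℝ =>
      H m θ * evalLaurent (fun j => exp (θ j)) P)
    (hsum : ∀ P ∈ LaurentI, Summable fun m => ∫ θ : Fin m → ℝ,
      ‖H m θ * evalLaurent (fun j => exp (θ j)) P‖)
    (hs : ∀ m (σ : Equiv.Perm (Fin m)), ∀ᵐ θ : Fin m → ℝ, H m (θ ∘ σ) = H m θ)
    {ε : ℝ} (hε : 0 < ε)
    (h0 : ∀ P ∈ LaurentI, ∀ t : ℝ, |t| < ε → ∑' m, ∫ θ : Fin m → ℝ,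
      H m θ * evalLaurent (fun j => exp (θ j)) P * exp (I * t * energy θ) = 0)
    (m : ℕ) : ∀ᵐ θ : Fin m → ℝ, H m θ = 0 := by
  let En : (Σ m, Fin m → ℝ) → ℝ := fun x => energy x.2
  have hEn : Measurable En := measurable_sigma fun m => measurable_energy
  have hEn0 : ∀ x, 0 ≤ En x := fun x => (Nat.cast_nonneg _).trans (card_le_energy x.2)
  let ev : SymLaurent → (Σ m, Fin m → ℝ) → ℂ := fun P x =>
    evalLaurent (fun j => exp (x.2 j)) P
  have hev : ∀ P, Measurable (ev P) := fun P =>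
    measurable_sigma fun m => measurable_evalLaurent_exp P
  let H' : (Σ m, Fin m → ℝ) → ℂ := fun x => H x.1 x.2
  have hHP : ∀ P ∈ LaurentI, Integrable (fun x => H' x * ev P x) fockMeasure := fun P hP =>
    integrable_fockMeasure (hint P hP) (hsum P hP)
  have hH : Integrable H' fockMeasure := by
    have := hHP 1 (one_mem _)
    refine this.congr (.of_forall fun x => ?_)
    have h1 : ev 1 x = 1 := map_one _
    simp only [h1, mul_one]
  have hexp : ∀ P ∈ LaurentI, ∀ t : ℝ, |t| < ε →
      ∫ x, H' x * ev P x * exp (I * t * En x) ∂fockMeasure = 0 := by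
    intro P hP t ht
    rw [integral_fockMeasure]
    · exact h0 P hP t ht
    · refine (hHP P hP).norm.mono' ((hHP P hP).aestronglyMeasurable.mul (by fun_prop))
        (.of_forall fun x => ?_)
      rw [norm_mul]
      exact mul_le_of_le_one_right (norm_nonneg _)
        (norm_exp_I_mul_le (by simp) (hEn0 x))
  have key : ∀ R : ℝ, ∀ᵐ θ : Fin m → ℝ, energy θ < R → H m θ = 0 := by
    intro R
    let ψ : ℝ → ℝ := fun u => max 0 (min u 1 - Real.exp (-R))
    have hψc : Continuous ψ := by fun_prop
    have hψb : ∀ u, ‖(ψ u : ℂ)‖ ≤ 1 := fun u => by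
      rw [Complex.norm_real, norm_of_nonneg (le_max_left _ _)]
      exact max_le zero_le_one (by linarith [min_le_right u 1, exp_pos (-R)])
    have hψ0 : ∀ e : ℝ, R < e → ψ (Real.exp (-e)) = 0 := fun e he => by
      refine max_eq_left ?_
      have : Real.exp (-e) ≤ Real.exp (-R) := Real.exp_le_exp.2 (by linarith)
      linarith [min_le_left (Real.exp (-e)) 1]
    have hψm : Measurable fun x => (ψ (Real.exp (-En x)) : ℂ) := by
      have : Measurable fun x => Real.exp (-En x) := by fun_prop
      exact Complex.measurable_ofReal.comp (hψc.measurable.comp this)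
    let G : (Σ m, Fin m → ℝ) → ℂ := fun x => H' x * ψ (Real.exp (-En x))
    have hG : Integrable G fockMeasure := by
      refine hH.norm.mono' (hH.aestronglyMeasurable.mul hψm.aestronglyMeasurable)
        (.of_forall fun x => ?_)
      simp only [G]
      rw [norm_mul]
      exact mul_le_of_le_one_right (norm_nonneg _) (hψb _)
    have hGP : ∀ P ∈ LaurentI, ∫ x, G x * ev P x ∂fockMeasure = 0 := by
      intro P hP
      have := integral_mul_comp_eq_zero (hHP P hP) hEn hEn0 hε (hexp P hP) hψc
      rw [← this]
      congr 1
      funext x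
      simp only [G]
      ring
    have hGPi : ∀ P ∈ LaurentI, Integrable (fun x => G x * ev P x) fockMeasure := by
      intro P hP
      refine (hHP P hP).norm.mono' (hG.aestronglyMeasurable.mul (hev P).aestronglyMeasurable)
        (.of_forall fun x => ?_)
      rw [show G x * ev P x = H' x * ev P x * ψ (Real.exp (-En x)) by simp only [G]; ring, norm_mul]
      exact mul_le_of_le_one_right (norm_nonneg _) (hψb _)
    have hGf : ∀ F : (m : ℕ) → (Fin m → ℝ) → ℝ, (∀ m, Continuous (F m)) →
        (∀ m θ (σ : Equiv.Perm (Fin m)), F m (θ ∘ σ) = F m θ) →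
        Integrable (fun x => G x * F x.1 x.2) fockMeasure →
        ∫ x, G x * F x.1 x.2 ∂fockMeasure = 0 := by
      intro F hF hFs hFi
      refine eq_zero_of_forall_le (C := ∫ x, ‖G x‖ ∂fockMeasure) fun δ hδ => ?_
      obtain ⟨P, hP, hPF⟩ := exists_laurentI_near hF hFs R hδ
      have h1 := integral_sub hFi (hGPi P hP)
      rw [hGP P hP, sub_zero] at h1
      rw [← h1, ← integral_mul_const]
      refine (norm_integral_le_integral_norm _).trans (integral_mono_of_nonneg
        (.of_forall fun _ => norm_nonneg _) (hG.norm.mul_const δ)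
          (.of_forall fun x => ?_))
      simp only [← mul_sub, norm_mul]
      rcases le_or_gt (En x) R with hx | hx
      · refine mul_le_mul_of_nonneg_left ?_ (norm_nonneg _)
        rw [norm_sub_rev]
        exact hPF x.1 x.2 hx
      · simp only [G]
        rw [hψ0 _ hx]
        simp
    have hGm : Integrable fun θ : Fin m → ℝ => G ⟨m, θ⟩ := by
      have := integrable_sum_measure_iff.1 hG
      exact (measurableEmbedding_sigmaMk m).integrable_map_iff.1 (this.1 m)
    have hGs : ∀ σ : Equiv.Perm (Fin m), ∀ᵐ θ : Fin m → ℝ, G ⟨m, θ ∘ σ⟩ = G ⟨m, θ⟩ := by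
      intro σ
      filter_upwards [hs m σ] with θ hθ
      simp only [G, H', En]
      rw [hθ, energy_comp_perm]
    have hzero : ∀ᵐ θ : Fin m → ℝ, G ⟨m, θ⟩ = 0 := by
      refine ae_eq_zero_of_integral_contDiff_smul_eq_zero hGm.locallyIntegrable fun φ hφ hφc => ?_
      let F : (n : ℕ) → (Fin n → ℝ) → ℝ := fun n θ => ∑ e : Fin m ≃ Fin n, φ (θ ∘ e)
      obtain ⟨K, hK⟩ := hφ.continuous.bounded_above_of_compact_support hφc
      have hi : ∀ σ : Equiv.Perm (Fin m), Integrable fun θ : Fin m → ℝ =>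
          G ⟨m, θ⟩ * (φ (θ ∘ σ) : ℂ) := by
        intro σ
        refine (hGm.norm.mul_const K).mono' (hGm.aestronglyMeasurable.mul ?_)
          (.of_forall fun θ => ?_)
        · exact (Complex.continuous_ofReal.comp
            (hφ.continuous.comp (by fun_prop))).aestronglyMeasurable
        · rw [norm_mul, Complex.norm_real]
          exact mul_le_mul_of_nonneg_left (hK _) (norm_nonneg _)
      have hempty : ∀ n, n ≠ m → ∀ θ, F n θ = 0 := by
        intro n hn θ
        have : IsEmpty (Fin m ≃ Fin n) := ⟨fun e => hn (by simpa using (Fintype.card_congr e).symm)⟩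
        simp [F]
      have him : Integrable fun θ : Fin m → ℝ => G ⟨m, θ⟩ * (F m θ : ℂ) := by
        simp only [F, Complex.ofReal_sum, Finset.mul_sum]
        exact integrable_finsetSum _ fun σ _ => hi σ
      have hFi : Integrable (fun x => G x * F x.1 x.2) fockMeasure := by
        refine integrable_fockMeasure (fun n => ?_) ?_
        · rcases eq_or_ne n m with rfl | hn
          · exact him
          · simp only [hempty n hn, Complex.ofReal_zero, mul_zero]
            exact integrable_zero _ _ _
        · refine summable_of_ne_finset_zero (s := {m}) fun n hn => ?_
          have hn' : n ≠ m := by simpa using hn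
          simp [hempty n hn']
      have h1 := hGf F (fun n => by fun_prop) (fun n θ σ => ?_) hFi
      · rw [integral_fockMeasure hFi, tsum_eq_single m fun n hn => by simp [hempty n hn]] at h1
        simp only [F, Complex.ofReal_sum, Finset.mul_sum] at h1
        rw [integral_finsetSum _ fun σ _ => hi σ] at h1
        have h2 : ∀ σ : Equiv.Perm (Fin m), ∫ θ : Fin m → ℝ, G ⟨m, θ⟩ * (φ (θ ∘ σ) : ℂ) =
            ∫ θ : Fin m → ℝ, φ θ • G ⟨m, θ⟩ := by
          intro σ
          rw [← integral_comp_perm σ fun θ => φ θ • G ⟨m, θ⟩]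
          refine integral_congr_ae ?_
          filter_upwards [hGs σ] with θ hθ
          rw [hθ, Complex.real_smul, mul_comm]
        simp only [h2, Finset.sum_const, nsmul_eq_mul] at h1
        refine (mul_eq_zero.1 h1).resolve_left ?_
        exact Nat.cast_ne_zero.2 (Finset.card_ne_zero.2 ⟨1, mem_univ _⟩)
      · simp only [F]
        refine Fintype.sum_equiv ((Equiv.refl _).equivCongr σ) _ _ fun e => ?_
        rfl
    filter_upwards [hzero] with θ hθ hR
    refine (mul_eq_zero.1 hθ).resolve_right (Complex.ofReal_ne_zero.2 (ne_of_gt ?_))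
    refine lt_max_of_lt_right (sub_pos.2 (lt_min (Real.exp_lt_exp.2 (by
      change -R < -energy θ; linarith)) ?_))
    have := (Nat.cast_nonneg (α := ℝ) m).trans (card_le_energy θ)
    rw [← Real.exp_zero]
    exact Real.exp_lt_exp.2 (by linarith)
  have := ae_all_iff.2 fun n : ℕ => key n
  filter_upwards [this] with θ hθ
  obtain ⟨n, hn⟩ := exists_nat_gt (energy θ)
  exact hθ n hn

end Moments



section Bump

/-- A smooth bump function supported in `[-δ, δ]`; its Fourier transform decays faster than
`exp(-c |p| ^ α)` for `α < s / (s + 1)`. -/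
def bump (s : ℕ) (δ x : ℝ) : ℝ := expNegInvGlue ((δ + x) ^ s) * expNegInvGlue ((δ - x) ^ s)

/-- The holomorphic extension of `bump`. -/
def bumpExt (s : ℕ) (δ : ℝ) (z : ℂ) : ℂ :=
  exp (-((δ + z) ^ s)⁻¹ - ((δ - z) ^ s)⁻¹)

/-- The Fourier–Laplace transform of `bump`. -/
def bumpFourier (s : ℕ) (δ : ℝ) (ζ : ℂ) : ℂ :=
  ∫ x : ℝ, exp (I * ζ * x) * (bump s δ x : ℂ)

variable {s : ℕ} {δ : ℝ}

lemma bump_neg (x : ℝ) : bump s δ (-x) = bump s δ x := by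
  rw [bump, bump, mul_comm, sub_neg_eq_add, ← sub_eq_add_neg]

lemma contDiff_bump : ContDiff ℝ ∞ (bump s δ) := by
  unfold bump
  exact (expNegInvGlue.contDiff.comp (by fun_prop)).mul (expNegInvGlue.contDiff.comp (by fun_prop))

lemma bump_nonneg (x : ℝ) : 0 ≤ bump s δ x :=
  mul_nonneg (expNegInvGlue.nonneg _) (expNegInvGlue.nonneg _)

lemma bump_zero_pos (hδ : 0 < δ) : 0 < bump s δ 0 := by
  rw [bump, add_zero, sub_zero]
  exact mul_pos (expNegInvGlue.pos_of_pos (pow_pos hδ s)) (expNegInvGlue.pos_of_pos (pow_pos hδ s))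

lemma bump_eq_zero (hs : Odd s) {x : ℝ} (hx : δ ≤ |x|) : bump s δ x = 0 := by
  rw [bump]
  rcases le_abs.1 hx with h | h
  · rw [expNegInvGlue.zero_of_nonpos (x := (δ - x) ^ s) (hs.pow_nonpos (by linarith)), mul_zero]
  · rw [expNegInvGlue.zero_of_nonpos (x := (δ + x) ^ s) (hs.pow_nonpos (by linarith)), zero_mul]

lemma bump_eq_bumpExt {x : ℝ} (hx : |x| < δ) : (bump s δ x : ℂ) = bumpExt s δ x := by
  have h := abs_lt.1 hx
  have h1 : 0 < (δ + x) ^ s := pow_pos (by linarith) s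
  have h2 : 0 < (δ - x) ^ s := pow_pos (by linarith) s
  rw [bump, bumpExt, expNegInvGlue, expNegInvGlue, if_neg h1.not_ge, if_neg h2.not_ge, ← Real.exp_add]
  push_cast
  ring_nf

lemma hasCompactSupport_bump (hs : Odd s) : HasCompactSupport (bump s δ) :=
  .intro (isCompact_Icc (a := -δ) (b := δ)) fun x hx => bump_eq_zero hs (by
    by_contra h
    exact hx (abs_le.1 (not_le.1 h).le))

lemma integrable_exp_mul_bump (hs : Odd s) (ζ : ℂ) :
    Integrable fun x : ℝ => exp (I * ζ * x) * (bump s δ x : ℂ) :=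
  Continuous.integrable_of_hasCompactSupport (by
    have := (contDiff_bump (s := s) (δ := δ)).continuous
    fun_prop) (((hasCompactSupport_bump hs).comp_left Complex.ofReal_zero).mul_left)

lemma bumpFourier_neg (ζ : ℂ) : bumpFourier s δ (-ζ) = bumpFourier s δ ζ := by
  rw [bumpFourier, ← integral_neg_eq_self, bumpFourier]
  congr 1
  funext x
  rw [bump_neg]
  push_cast
  ring_nf

lemma bumpFourier_ne_zero (hs : Odd s) (hδ : 0 < δ) {p : ℝ} (hp : |p| * δ ≤ 1) :
    bumpFourier s δ p ≠ 0 := by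
  have hre : (bumpFourier s δ p).re = ∫ x : ℝ, Real.cos (p * x) * bump s δ x := by
    rw [bumpFourier, ← RCLike.re_eq_complex_re, ← integral_re (integrable_exp_mul_bump hs p)]
    congr 1
    funext x
    rw [RCLike.re_eq_complex_re, Complex.re_mul_ofReal,
      show I * (p : ℂ) * x = ((p * x : ℝ) : ℂ) * I by push_cast; ring,
      Complex.exp_ofReal_mul_I_re]
  have hpos : 0 < ∫ x : ℝ, Real.cos (p * x) * bump s δ x := by
    refine Continuous.integral_pos_of_hasCompactSupport_nonneg_nonzero (x := 0) ?_ ?_ ?_ ?_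
    · have := (contDiff_bump (s := s) (δ := δ)).continuous
      fun_prop
    · exact (hasCompactSupport_bump hs).mul_left
    · intro x
      rcases le_or_gt δ |x| with hx | hx
      · simp [bump_eq_zero hs hx]
      · refine mul_nonneg (Real.cos_nonneg_of_mem_Icc ?_) (bump_nonneg x)
        have h1 : |p * x| ≤ 1 := by
          rw [abs_mul]
          exact (mul_le_mul_of_nonneg_left hx.le (abs_nonneg p)).trans hp
        have h2 := abs_le.1 h1
        have h3 := Real.pi_gt_three
        constructor <;> linarith [h2.1, h2.2]
    · simpa using (bump_zero_pos hδ).ne'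
  intro h
  rw [h] at hre
  simp only [Complex.zero_re] at hre
  linarith

lemma differentiable_bumpFourier (hs : Odd s) : Differentiable ℂ (bumpFourier s δ) := by
  intro ζ
  have hb := (contDiff_bump (s := s) (δ := δ)).continuous
  have hint := integrable_exp_mul_bump (s := s) (δ := δ) hs
  have hbi : Integrable (bump s δ) := hb.integrable_of_hasCompactSupport (hasCompactSupport_bump hs)
  refine (hasDerivAt_integral_of_dominated_loc_of_deriv_le (μ := volume)
    (F := fun ζ (x : ℝ) => exp (I * ζ * x) * (bump s δ x : ℂ))
    (F' := fun ζ (x : ℝ) => exp (I * ζ * x) * (I * x) * (bump s δ x : ℂ))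
    (bound := fun x => Real.exp ((‖ζ‖ + 1) * |δ|) * |δ| * bump s δ x) (s := Metric.ball ζ 1)
    (Metric.ball_mem_nhds ζ one_pos) (.of_forall fun z => (hint z).aestronglyMeasurable)
    (hint ζ) ?_ ?_ (hbi.const_mul _) ?_).2.differentiableAt
  · exact Continuous.aestronglyMeasurable (by fun_prop)
  · refine .of_forall fun x z hz => ?_
    rcases le_or_gt δ |x| with hx | hx
    · simp [bump_eq_zero hs hx]
    · have hz' : ‖z‖ ≤ ‖ζ‖ + 1 := by
        have := norm_sub_norm_le z ζ
        have := mem_ball_iff_norm.1 hz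
        linarith
      have hx' : |x| ≤ |δ| := hx.le.trans (le_abs_self δ)
      rw [norm_mul, norm_mul, norm_mul, Complex.norm_I, one_mul, Complex.norm_real, Complex.norm_real,
        norm_of_nonneg (bump_nonneg x)]
      refine mul_le_mul_of_nonneg_right (mul_le_mul ?_ hx' (norm_nonneg _) (exp_pos _).le)
        (bump_nonneg x)
      refine (Complex.norm_exp_le_exp_norm _).trans (Real.exp_le_exp.2 ?_)
      rw [norm_mul, norm_mul, Complex.norm_I, one_mul, Complex.norm_real]
      exact mul_le_mul hz' hx' (norm_nonneg _) (by positivity)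
  · refine .of_forall fun x z _ => ?_
    have h1 : HasDerivAt (fun w : ℂ => I * w * x) (I * x) z := by
      simpa using ((hasDerivAt_id z).const_mul I).mul_const (x : ℂ)
    exact h1.cexp.mul_const _

lemma exists_re_inv_pow_ge (s : ℕ) : ∃ c : ℝ, 0 < c ∧ c ≤ 1 ∧ ∀ a y : ℝ, 0 < a → |y| ≤ c * a →
    (a ^ s)⁻¹ / 2 ≤ (((a + y * I : ℂ) ^ s)⁻¹).re := by
  have h : ContinuousAt (fun w : ℂ => (((1 + w) ^ s)⁻¹).re) 0 := by
    refine Complex.continuous_re.continuousAt.comp (ContinuousAt.inv₀ (by fun_prop) (by simp))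
  have h2 : ∀ᶠ w : ℂ in 𝓝 0, 1 / 2 < (((1 + w) ^ s)⁻¹).re :=
    h.eventually (lt_mem_nhds (by norm_num))
  obtain ⟨c, hc, hball⟩ := Metric.eventually_nhds_iff_ball.1 h2
  refine ⟨min (c / 2) 1, by positivity, min_le_right _ _, fun a y ha hy => ?_⟩
  have h3 := hball (y / a * I) (by
    rw [mem_ball_zero_iff, norm_mul, Complex.norm_I, mul_one, norm_div, Complex.norm_real,
      Complex.norm_real, norm_of_nonneg ha.le, Real.norm_eq_abs, div_lt_iff₀ ha]
    calc |y| ≤ c / 2 * a := hy.trans (mul_le_mul_of_nonneg_right (min_le_left _ _) ha.le)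
      _ < c * a := by nlinarith)
  have ha' : (a : ℂ) ≠ 0 := Complex.ofReal_ne_zero.2 ha.ne'
  have h4 : (((a + y * I : ℂ) ^ s)⁻¹).re = (a ^ s)⁻¹ * (((1 + y / a * I) ^ s)⁻¹).re := by
    rw [show (a + y * I : ℂ) = a * (1 + y / a * I) by field_simp, mul_pow, mul_inv,
      ← Complex.ofReal_pow, ← Complex.ofReal_inv, Complex.re_ofReal_mul]
  rw [h4, div_eq_mul_one_div]
  exact mul_le_mul_of_nonneg_left h3.le (by positivity)

lemma rpow_le_mul_add_inv_pow {s : ℕ} (hs : 0 < s) {p d : ℝ} (hp : 0 ≤ p) (hd : 0 < d) :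
    p ^ ((s : ℝ) / (s + 1)) ≤ p * d + (d ^ s)⁻¹ := by
  have hs' : (0 : ℝ) < s := Nat.cast_pos.2 hs
  rcases hp.eq_or_lt with rfl | hp
  · rw [Real.zero_rpow (by positivity)]
    positivity
  set q := p ^ (-(1 / ((s : ℝ) + 1))) with hq
  have hq0 : 0 < q := Real.rpow_pos_of_pos hp _
  have h1 : p * q = p ^ ((s : ℝ) / (s + 1)) := by
    rw [hq, ← Real.rpow_one_add' hp.le]
    · congr 1; field_simp; ring
    · have : 1 / ((s : ℝ) + 1) < 1 := (div_lt_one (by positivity)).2 (by linarith)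
      linarith
  have h2 : (q ^ s)⁻¹ = p ^ ((s : ℝ) / (s + 1)) := by
    rw [hq, ← Real.rpow_natCast, ← Real.rpow_mul hp.le, ← Real.rpow_neg hp.le]
    congr 1
    ring
  rcases le_or_gt q d with h | h
  · have : 0 < (d ^ s)⁻¹ := by positivity
    nlinarith
  · have h3 : (q ^ s)⁻¹ ≤ (d ^ s)⁻¹ := by
      have := pow_le_pow_left₀ hd.le h.le s
      gcongr
    have : 0 < p * d := by positivity
    linarith

/-- Shifting the contour of integration into the complex domain. -/
lemma exists_norm_bumpFourier_le (hs : Odd s) (hδ : 0 < δ) : ∃ κ : ℝ, 0 < κ ∧ ∃ C : ℝ, ∀ ζ : ℂ,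
    0 ≤ ζ.re → |ζ.im| ≤ 1 → ‖bumpFourier s δ ζ‖ ≤ C * Real.exp (-κ * ζ.re ^ ((s : ℝ) / (s + 1))) := by
  obtain ⟨c, hc, hc1, hcone⟩ := exists_re_inv_pow_ge s
  refine ⟨c / 2, by positivity, 2 * Real.exp δ * (2 * δ), fun ζ hre him => ?_⟩
  set p := ζ.re with hp
  set M := Real.exp (-(c / 2) * p ^ ((s : ℝ) / (s + 1))) with hM
  set l := c / (2 * δ) with hl
  have hl0 : 0 < l := by positivity
  have hlδ : l * δ = c / 2 := by rw [hl]; field_simp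
  have hG : DifferentiableOn ℂ (fun z => exp (I * ζ * z) * bumpExt s δ z)
      (Metric.ball 0 δ) := by
    intro z hz
    have hz' : ‖z‖ < δ := by simpa using hz
    have h1 : (δ : ℂ) + z ≠ 0 := fun h => by
      have := congrArg norm (eq_neg_of_add_eq_zero_right h)
      rw [norm_neg, Complex.norm_real, norm_of_nonneg hδ.le] at this
      linarith
    have h2 : (δ : ℂ) - z ≠ 0 := fun h => by
      have := congrArg norm (sub_eq_zero.1 h)
      rw [Complex.norm_real, norm_of_nonneg hδ.le] at this
      linarith
    refine DifferentiableAt.differentiableWithinAt ?_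
    unfold bumpExt
    refine DifferentiableAt.mul (by fun_prop) (DifferentiableAt.cexp ?_)
    have q1 : DifferentiableAt ℂ (fun z : ℂ => (δ + z) ^ s) z := by fun_prop
    have q2 : DifferentiableAt ℂ (fun z : ℂ => (δ - z) ^ s) z := by fun_prop
    exact (q1.inv (pow_ne_zero s h1)).neg.sub (q2.inv (pow_ne_zero s h2))
  obtain ⟨Φ, hΦ⟩ := hG.isExactOn_ball
  have key : ∀ b ∈ Set.Ioo 0 δ, ‖∫ x in (-b)..b, exp (I * ζ * x) * (bump s δ x : ℂ)‖ ≤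
      2 * Real.exp δ * Real.exp (p * l * (δ ^ 2 - b ^ 2)) * M * (2 * b) := by
    rintro b ⟨hb0, hbδ⟩
    have hb : -b ≤ b := by linarith
    let γ : ℝ → ℂ := fun x => x + (l * (b ^ 2 - x ^ 2) : ℝ) * I
    let γ' : ℝ → ℂ := fun x => 1 + (l * (-(2 * x)) : ℝ) * I
    have hγ : ∀ x : ℝ, HasDerivAt γ (γ' x) x := by
      intro x
      have h1 : HasDerivAt (fun x : ℝ => l * (b ^ 2 - x ^ 2)) (l * (-(2 * x))) x := by
        simpa using ((hasDerivAt_pow 2 x).const_sub (b ^ 2)).const_mul l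
      have h2 := h1.ofReal_comp
      exact ((hasDerivAt_id x).ofReal_comp).add (h2.mul_const I)
    have hγb : ∀ x ∈ Set.Icc (-b) b, γ x ∈ Metric.ball (0 : ℂ) δ := by
      intro x hx
      have h1 : x ^ 2 ≤ b ^ 2 := by nlinarith [hx.1, hx.2]
      have h2 : l ^ 2 * (b ^ 2 - x ^ 2) ≤ 1 := by
        have : l ^ 2 * (b ^ 2 - x ^ 2) ≤ (l * δ) ^ 2 := by
          rw [mul_pow]
          exact mul_le_mul_of_nonneg_left (by nlinarith [sq_nonneg x]) (by positivity)
        rw [hlδ] at this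
        nlinarith
      have h3 : ‖γ x‖ ^ 2 = x ^ 2 + (l * (b ^ 2 - x ^ 2)) ^ 2 := by
        rw [← Complex.normSq_eq_norm_sq]
        exact Complex.normSq_add_mul_I _ _
      rw [mem_ball_zero_iff]
      refine lt_of_pow_lt_pow_left₀ 2 hδ.le ?_
      rw [h3]
      have h4 : (l * (b ^ 2 - x ^ 2)) ^ 2 ≤ b ^ 2 - x ^ 2 := by
        have := mul_le_mul_of_nonneg_right h2 (sub_nonneg.2 h1)
        linarith
      nlinarith
    have hreal : ∀ x ∈ Set.Icc (-b) b, (x : ℂ) ∈ Metric.ball (0 : ℂ) δ := by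
      intro x hx
      rw [mem_ball_zero_iff, Complex.norm_real]
      exact lt_of_le_of_lt (abs_le.2 hx) hbδ
    have e1 : ∫ x in (-b)..b, exp (I * ζ * x) * (bump s δ x : ℂ) =
        ∫ x in (-b)..b, exp (I * ζ * x) * bumpExt s δ x := by
      refine intervalIntegral.integral_congr fun x hx => ?_
      rw [Set.uIcc_of_le hb] at hx
      rw [bump_eq_bumpExt (lt_of_le_of_lt (abs_le.2 hx) hbδ)]
    have e2 : ∫ x in (-b)..b, exp (I * ζ * x) * bumpExt s δ x = Φ b - Φ (-b : ℝ) := by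
      refine intervalIntegral.integral_eq_sub_of_hasDerivAt (f := fun x : ℝ => Φ x) (fun x hx => ?_) ?_
      · rw [Set.uIcc_of_le hb] at hx
        exact (hΦ _ (hreal x hx)).comp_ofReal
      · refine ContinuousOn.intervalIntegrable ?_
        rw [Set.uIcc_of_le hb]
        exact hG.continuousOn.comp Complex.continuous_ofReal.continuousOn hreal
    have e3 : ∫ x in (-b)..b, (exp (I * ζ * γ x) * bumpExt s δ (γ x)) * γ' x =
        Φ (γ b) - Φ (γ (-b)) := by
      refine intervalIntegral.integral_eq_sub_of_hasDerivAt (f := fun x : ℝ => Φ (γ x))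
        (fun x hx => ?_) ?_
      · rw [Set.uIcc_of_le hb] at hx
        exact HasDerivAt.comp x (hΦ _ (hγb x hx)) (hγ x)
      · refine ContinuousOn.intervalIntegrable ?_
        rw [Set.uIcc_of_le hb]
        refine ContinuousOn.mul (hG.continuousOn.comp (by fun_prop) hγb) (by fun_prop)
    have e4 : γ b = b := by simp [γ]
    have e5 : γ (-b) = (-b : ℝ) := by simp [γ]
    rw [e4, e5] at e3
    rw [e1, e2, ← e3]
    have hbound : ∀ x ∈ Set.uIoc (-b) b,
        ‖(exp (I * ζ * γ x) * bumpExt s δ (γ x)) * γ' x‖ ≤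
          2 * Real.exp δ * Real.exp (p * l * (δ ^ 2 - b ^ 2)) * M := by
      intro x hx
      have hx' : x ∈ Set.Icc (-b) b := by
        rw [Set.uIoc_of_le hb] at hx
        exact Set.Ioc_subset_Icc_self hx
      have hxb : |x| ≤ b := abs_le.2 hx'
      have hd : 0 < δ - |x| := by linarith
      set y := l * (b ^ 2 - x ^ 2) with hy
      have hy0 : 0 ≤ y := mul_nonneg hl0.le (by nlinarith [hx'.1, hx'.2])
      have n1 : ‖exp (I * ζ * γ x)‖ ≤ Real.exp (δ - p * y) := by
        rw [Complex.norm_exp]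
        refine Real.exp_le_exp.2 ?_
        have : (I * ζ * γ x).re = -(p * y) - ζ.im * x := by
          simp only [γ, Complex.mul_re, Complex.mul_im, Complex.add_re, Complex.add_im,
            Complex.ofReal_re, Complex.ofReal_im, Complex.I_re, Complex.I_im]
          rw [← hp, ← hy]
          ring
        rw [this]
        have h1 : |ζ.im * x| ≤ 1 * δ := by
          rw [abs_mul]
          exact mul_le_mul him (by linarith) (abs_nonneg _) zero_le_one
        linarith [neg_abs_le (ζ.im * x)]
      have n2 : ‖bumpExt s δ (γ x)‖ ≤ Real.exp (-(((δ - |x|) ^ s)⁻¹ / 2)) := by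
        rw [bumpExt, Complex.norm_exp]
        refine Real.exp_le_exp.2 ?_
        have a1 : 0 < δ + x := by linarith [hx'.1]
        have a2 : 0 < δ - x := by linarith [hx'.2]
        have hy2 : y = c / (2 * δ) * ((b - x) * (b + x)) := by rw [hy, hl]; ring
        have b1 : |y| ≤ c * (δ + x) := by
          rw [abs_of_nonneg hy0, hy2]
          have : (b - x) * (b + x) ≤ 2 * δ * (δ + x) :=
            mul_le_mul (by linarith [hx'.1]) (by linarith) (by linarith [hx'.1]) (by linarith)
          calc c / (2 * δ) * ((b - x) * (b + x)) ≤ c / (2 * δ) * (2 * δ * (δ + x)) := by gcongr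
            _ = _ := by field_simp
        have b2 : |-y| ≤ c * (δ - x) := by
          rw [abs_neg, abs_of_nonneg hy0, hy2]
          have : (b + x) * (b - x) ≤ 2 * δ * (δ - x) :=
            mul_le_mul (by linarith [hx'.2]) (by linarith) (by linarith [hx'.2]) (by linarith)
          calc c / (2 * δ) * ((b - x) * (b + x)) ≤ c / (2 * δ) * (2 * δ * (δ - x)) := by
                rw [mul_comm (b - x)]; gcongr
            _ = _ := by field_simp
        have c1 := hcone _ _ a1 b1
        have c2 := hcone _ _ a2 b2
        have r1 : (δ : ℂ) + γ x = ((δ + x : ℝ) : ℂ) + y * I := by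
          simp only [γ, hy]; push_cast; ring
        have r2 : (δ : ℂ) - γ x = ((δ - x : ℝ) : ℂ) + (-y : ℝ) * I := by
          simp only [γ, hy]; push_cast; ring
        rw [r1, r2, Complex.sub_re, Complex.neg_re]
        have d1 : 0 < ((δ + x) ^ s)⁻¹ := by positivity
        have d2 : 0 < ((δ - x) ^ s)⁻¹ := by positivity
        rcases abs_choice x with h | h
        · rw [h]; linarith
        · rw [h, sub_neg_eq_add]; linarith
      have n3 : ‖γ' x‖ ≤ 2 := by
        refine (norm_add_le _ _).trans ?_
        rw [norm_one, norm_mul, Complex.norm_I, mul_one, Complex.norm_real, Real.norm_eq_abs, abs_mul,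
          abs_neg, abs_mul, abs_two, abs_of_pos hl0]
        nlinarith
      have hexp : Real.exp (δ - p * y) * Real.exp (-(((δ - |x|) ^ s)⁻¹ / 2)) ≤
          Real.exp δ * Real.exp (p * l * (δ ^ 2 - b ^ 2)) * M := by
        rw [hM, ← Real.exp_add, ← Real.exp_add, ← Real.exp_add]
        refine Real.exp_le_exp.2 ?_
        have h1 := rpow_le_mul_add_inv_pow (s := s) hs.pos hre hd
        have h2 : 0 < ((δ - |x|) ^ s)⁻¹ := by positivity
        have h3 : l * (δ * (δ - |x|)) ≤ l * (δ ^ 2 - x ^ 2) := by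
          refine mul_le_mul_of_nonneg_left ?_ hl0.le
          rw [← sq_abs x]
          nlinarith [abs_nonneg x]
        have h4 : p * (c / 2 * (δ - |x|)) ≤ p * (l * (δ ^ 2 - x ^ 2)) := by
          refine mul_le_mul_of_nonneg_left ?_ hre
          rw [← hlδ]
          linarith
        have h5 : p * y = p * (l * (δ ^ 2 - x ^ 2)) - p * l * (δ ^ 2 - b ^ 2) := by rw [hy]; ring
        have h6 := mul_le_mul_of_nonneg_left h1 (show 0 ≤ c / 2 by positivity)
        have h7 : c / 2 * ((δ - |x|) ^ s)⁻¹ ≤ ((δ - |x|) ^ s)⁻¹ / 2 := by nlinarith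
        linarith
      rw [norm_mul, norm_mul]
      calc _ ≤ (Real.exp (δ - p * y) * Real.exp (-(((δ - |x|) ^ s)⁻¹ / 2))) * 2 := by gcongr
        _ ≤ (Real.exp δ * Real.exp (p * l * (δ ^ 2 - b ^ 2)) * M) * 2 := by gcongr
        _ = _ := by ring
    have := intervalIntegral.norm_integral_le_of_norm_le_const hbound
    rwa [sub_neg_eq_add, ← two_mul, abs_of_pos (by positivity)] at this
  have hint := integrable_exp_mul_bump (s := s) (δ := δ) hs ζ
  have hI : bumpFourier s δ ζ =
      ∫ x in (-δ)..δ, exp (I * ζ * x) * (bump s δ x : ℂ) := by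
    rw [bumpFourier, intervalIntegral.integral_of_le (by linarith),
      setIntegral_eq_integral_of_forall_compl_eq_zero]
    intro x hx
    rw [bump_eq_zero hs, Complex.ofReal_zero, mul_zero]
    by_contra h
    have := abs_lt.1 (not_le.1 h)
    exact hx ⟨this.1, this.2.le⟩
  rw [hI]
  have hcont : Continuous fun b : ℝ =>
      ∫ x in (-b)..b, exp (I * ζ * x) * (bump s δ x : ℂ) := by
    have hii : ∀ a b, IntervalIntegrable
        (fun x : ℝ => exp (I * ζ * x) * (bump s δ x : ℂ)) volume a b :=
      fun a b => hint.intervalIntegrable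
    have h1 := intervalIntegral.continuous_primitive hii 0
    have h2 := h1.sub (h1.comp continuous_neg)
    convert h2 using 1
    funext b
    exact (intervalIntegral.integral_interval_sub_left (hii _ _) (hii _ _)).symm
  have l1 : Tendsto (fun b : ℝ =>
      ‖∫ x in (-b)..b, exp (I * ζ * x) * (bump s δ x : ℂ)‖) (𝓝[<] δ)
      (𝓝 ‖∫ x in (-δ)..δ, exp (I * ζ * x) * (bump s δ x : ℂ)‖) :=
    (hcont.norm.tendsto δ).mono_left nhdsWithin_le_nhds
  have l2 : Tendsto (fun b : ℝ => 2 * Real.exp δ * Real.exp (p * l * (δ ^ 2 - b ^ 2)) * M * (2 * b))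
      (𝓝[<] δ) (𝓝 (2 * Real.exp δ * (2 * δ) * M)) := by
    have : Continuous fun b : ℝ =>
        2 * Real.exp δ * Real.exp (p * l * (δ ^ 2 - b ^ 2)) * M * (2 * b) := by fun_prop
    have h := (this.tendsto δ).mono_left (nhdsWithin_le_nhds (s := Set.Iio δ))
    convert h using 2
    rw [sub_self, mul_zero, Real.exp_zero]
    ring
  refine le_of_tendsto_of_tendsto l1 l2 ?_
  filter_upwards [Ioo_mem_nhdsLT hδ] with b hb
  exact key b hb

end Bump



section TestFunction

variable {s : ℕ} {δ α : ℝ}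

/-- Decay faster than `exp(-c |Re ζ| ^ α)` for all `c` in a strip around the real line. -/
def StripDecay (α : ℝ) (U : ℂ → ℂ) : Prop :=
  ∀ c : ℝ, 0 < c → ∃ C : ℝ, ∀ ζ : ℂ, |ζ.im| ≤ 1 → ‖U ζ‖ ≤ C * Real.exp (-c * |ζ.re| ^ α)

lemma exists_mul_rpow_le {β κ : ℝ} (hα : 0 < α) (hαβ : α < β) (hκ : 0 < κ) {c : ℝ} (hc : 0 < c) :
    ∃ C : ℝ, ∀ p : ℝ, 0 ≤ p → c * p ^ α ≤ C + κ * p ^ β := by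
  set P := (c / κ) ^ (1 / (β - α)) with hP
  have hP0 : 0 < P := Real.rpow_pos_of_pos (by positivity) _
  refine ⟨c * P ^ α, fun p hp => ?_⟩
  rcases le_or_gt p P with h | h
  · have h1 := Real.rpow_le_rpow hp h hα.le
    have h2 := Real.rpow_nonneg hp β
    nlinarith [mul_nonneg hκ.le h2]
  · have hp' := hP0.trans h
    have h1 : c / κ ≤ p ^ (β - α) := by
      have h2 := Real.rpow_le_rpow hP0.le h.le (sub_pos.2 hαβ).le
      rwa [hP, ← Real.rpow_mul (by positivity), one_div_mul_cancel (sub_pos.2 hαβ).ne',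
        Real.rpow_one] at h2
    have h3 : p ^ β = p ^ (β - α) * p ^ α := by
      rw [← Real.rpow_add hp', sub_add_cancel]
    rw [div_le_iff₀ hκ] at h1
    have h4 := Real.rpow_nonneg hp α
    have h5 := mul_le_mul_of_nonneg_right h1 h4
    have h6 := Real.rpow_nonneg hP0.le α
    rw [h3]
    nlinarith [mul_nonneg hc.le h6]

lemma stripDecay_bumpFourier (hs : Odd s) (hδ : 0 < δ) (hα : 0 < α) (hαs : α < (s : ℝ) / (s + 1)) :
    StripDecay α (bumpFourier s δ) := by
  intro c hc
  obtain ⟨κ, hκ, C, hC⟩ := exists_norm_bumpFourier_le hs hδ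
  obtain ⟨D, hD⟩ := exists_mul_rpow_le hα hαs hκ hc
  have hC0 : 0 ≤ C := by
    have h1 := hC 0 (by simp) (by simp)
    exact nonneg_of_mul_nonneg_left ((norm_nonneg _).trans h1) (exp_pos _)
  have key : ∀ ζ : ℂ, 0 ≤ ζ.re → |ζ.im| ≤ 1 →
      ‖bumpFourier s δ ζ‖ ≤ C * Real.exp D * Real.exp (-c * |ζ.re| ^ α) := by
    intro ζ h1 h2
    refine (hC ζ h1 h2).trans ?_
    rw [mul_assoc, ← Real.exp_add, abs_of_nonneg h1]
    refine mul_le_mul_of_nonneg_left (Real.exp_le_exp.2 ?_) hC0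
    linarith [hD _ h1]
  refine ⟨C * Real.exp D, fun ζ hζ => ?_⟩
  rcases le_total 0 ζ.re with h | h
  · exact key ζ h hζ
  · have := key (-ζ) (by simpa using h) (by simpa using hζ)
    rwa [bumpFourier_neg, Complex.neg_re, abs_neg] at this

lemma StripDecay.exp_mul {U : ℂ → ℂ} (hU : StripDecay α U) (a : ℝ) :
    StripDecay α fun ζ => exp (I * ζ * a) * U ζ := by
  intro c hc
  obtain ⟨C, hC⟩ := hU c hc
  refine ⟨Real.exp |a| * C, fun ζ hζ => ?_⟩
  rw [norm_mul, mul_assoc (Real.exp |a|)]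
  refine mul_le_mul ?_ (hC ζ hζ) (norm_nonneg _) (exp_pos _).le
  rw [Complex.norm_exp]
  refine Real.exp_le_exp.2 ?_
  have : (I * ζ * a).re = -(ζ.im * a) := by simp
  rw [this]
  have h : |ζ.im * a| ≤ 1 * |a| := by
    rw [abs_mul]
    exact mul_le_mul_of_nonneg_right hζ (abs_nonneg a)
  linarith [neg_abs_le (ζ.im * a)]

lemma iteratedDeriv_comp_ofReal {U : ℂ → ℂ} (hU : Differentiable ℂ U) (k : ℕ) :
    iteratedDeriv k (fun q : ℝ => U q) = fun q : ℝ => iteratedDeriv k U q := by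
  induction k with
  | zero => simp
  | succ k ih =>
    funext q
    rw [iteratedDeriv_succ, ih, iteratedDeriv_succ]
    have h : Differentiable ℂ (iteratedDeriv k U) :=
      (hU.contDiff (n := (k + 1 : ℕ))).differentiable_iteratedDeriv k (by exact_mod_cast Nat.lt_succ_self k)
    exact ((h q).hasDerivAt.comp_ofReal).deriv

lemma StripDecay.norm_iteratedDeriv_le {U : ℂ → ℂ} (hU : StripDecay α U) (hd : Differentiable ℂ U)
    (hα : 0 < α) (hα1 : α ≤ 1) (k : ℕ) {c : ℝ} (hc : 0 < c) : ∃ C : ℝ, ∀ p : ℝ,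
      ‖iteratedDeriv k (fun q : ℝ => U q) p‖ ≤ C * Real.exp (-c * |p| ^ α) := by
  obtain ⟨C, hC⟩ := hU c hc
  have hC0 : 0 ≤ C :=
    nonneg_of_mul_nonneg_left ((norm_nonneg _).trans (hC 0 (by simp))) (exp_pos _)
  refine ⟨k.factorial * (C * Real.exp c), fun p => ?_⟩
  rw [iteratedDeriv_comp_ofReal hd]
  have := Complex.norm_iteratedDeriv_le_of_forall_mem_sphere_norm_le (c := (p : ℂ)) (R := 1)
    (C := C * Real.exp c * Real.exp (-c * |p| ^ α)) (f := U) k one_pos hd.diffContOnCl fun z hz => ?_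
  · rw [one_pow, div_one] at this
    rw [mul_assoc]
    exact this
  · have hz1 : ‖z - p‖ = 1 := mem_sphere_iff_norm.1 hz
    have him : |z.im| ≤ 1 := by
      have := Complex.abs_im_le_norm (z - p)
      simpa [hz1] using this
    have hre : |p| ≤ |z.re| + 1 := by
      have h1 := Complex.abs_re_le_norm (z - p)
      rw [hz1, Complex.sub_re, Complex.ofReal_re, abs_sub_comm] at h1
      have h2 := abs_sub_abs_le_abs_sub p z.re
      linarith
    refine (hC z him).trans ?_
    rw [mul_assoc, ← Real.exp_add]
    refine mul_le_mul_of_nonneg_left (Real.exp_le_exp.2 ?_) hC0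
    have h1 := Real.rpow_le_rpow (abs_nonneg p) hre hα.le
    have h2 := Real.rpow_add_le_add_rpow (abs_nonneg z.re) zero_le_one hα.le hα1
    rw [Real.one_rpow] at h2
    nlinarith

/-- A test function supported in a box around `a`. -/
def testFn (s : ℕ) (δ : ℝ) (a x : ℝ × ℝ) : ℂ := (bump s δ (x.1 - a.1) : ℂ) * (bump s δ (x.2 - a.2) : ℂ)

lemma contDiff_testFn (a : ℝ × ℝ) : ContDiff ℝ ∞ (testFn s δ a) := by
  have h := contDiff_bump (s := s) (δ := δ)
  have h1 : ContDiff ℝ ∞ fun x : ℝ × ℝ => bump s δ (x.1 - a.1) := h.comp (by fun_prop)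
  have h2 : ContDiff ℝ ∞ fun x : ℝ × ℝ => bump s δ (x.2 - a.2) := h.comp (by fun_prop)
  exact (Complex.ofRealCLM.contDiff.comp h1).mul (Complex.ofRealCLM.contDiff.comp h2)

lemma testFn_eq_zero (hs : Odd s) {a x : ℝ × ℝ} (hx : x ∉ Metric.closedBall a δ) :
    testFn s δ a x = 0 := by
  rw [mem_closedBall_iff_norm, Prod.norm_def, max_le_iff, not_and_or] at hx
  rw [testFn]
  rcases hx with h | h
  · rw [bump_eq_zero hs (x := x.1 - a.1) (not_le.1 h).le, Complex.ofReal_zero, zero_mul]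
  · rw [bump_eq_zero hs (x := x.2 - a.2) (not_le.1 h).le, Complex.ofReal_zero, mul_zero]

lemma hasCompactSupport_testFn (hs : Odd s) (a : ℝ × ℝ) : HasCompactSupport (testFn s δ a) :=
  .intro (isCompact_closedBall a δ) fun _ hx => testFn_eq_zero hs hx

lemma tsupport_testFn_subset (hs : Odd s) (a : ℝ × ℝ) :
    tsupport (testFn s δ a) ⊆ Metric.closedBall a δ :=
  closure_minimal (fun x hx => by
    by_contra h
    exact hx (testFn_eq_zero hs h)) Metric.isClosed_closedBall

lemma integral_exp_mul_bump_sub (ζ : ℂ) (a : ℝ) :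
    ∫ x : ℝ, exp (I * ζ * x) * (bump s δ (x - a) : ℂ) =
      exp (I * ζ * a) * bumpFourier s δ ζ := by
  rw [← integral_add_right_eq_self _ a, bumpFourier, ← integral_const_mul]
  congr 1
  funext x
  rw [add_sub_cancel_right, ← mul_assoc, ← Complex.exp_add]
  push_cast
  ring_nf

lemma fourier_testFn (a : ℝ × ℝ) (p : ℂ × ℂ) : fourier (testFn s δ a) p =
    (2 * (Real.pi : ℂ))⁻¹ * ((exp (I * p.1 * a.1) * bumpFourier s δ p.1) *
      (exp (I * p.2 * ((-a.2 : ℝ) : ℂ)) * bumpFourier s δ p.2)) := by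
  rw [fourier]
  congr 1
  have h : ∀ x : ℝ × ℝ, exp (I * (p.1 * (x.1 : ℂ) - p.2 * (x.2 : ℂ))) * testFn s δ a x =
      (exp (I * p.1 * x.1) * (bump s δ (x.1 - a.1) : ℂ)) *
        (exp (I * (-p.2) * x.2) * (bump s δ (x.2 - a.2) : ℂ)) := by
    intro x
    rw [testFn, mul_mul_mul_comm, ← Complex.exp_add]
    ring_nf
  simp only [h]
  have := integral_prod_mul (μ := (volume : Measure ℝ)) (ν := (volume : Measure ℝ))
    (fun x : ℝ => exp (I * p.1 * x) * (bump s δ (x - a.1) : ℂ))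
    (fun x : ℝ => exp (I * (-p.2) * x) * (bump s δ (x - a.2) : ℂ))
  rw [← Measure.volume_eq_prod] at this
  rw [this, integral_exp_mul_bump_sub, integral_exp_mul_bump_sub, bumpFourier_neg]
  congr 3
  push_cast
  ring

lemma fourier_testFn_time (a : ℝ × ℝ) (t : ℝ) (p : ℂ × ℂ) :
    fourier (testFn s δ (a.1 + t, a.2)) p =
      exp (I * p.1 * t) * fourier (testFn s δ a) p := by
  rw [fourier_testFn, fourier_testFn]
  push_cast
  rw [mul_add, Complex.exp_add]
  ring

lemma fourier_testFn_ne_zero (hs : Odd s) (hδ : 0 < δ) (a : ℝ × ℝ) {p₀ p₁ : ℝ} (h₀ : |p₀| * δ ≤ 1)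
    (h₁ : |p₁| * δ ≤ 1) : fourier (testFn s δ a) (p₀, p₁) ≠ 0 := by
  rw [fourier_testFn]
  refine mul_ne_zero (inv_ne_zero (mul_ne_zero two_ne_zero
    (Complex.ofReal_ne_zero.2 Real.pi_ne_zero))) (mul_ne_zero ?_ ?_)
  · exact mul_ne_zero (Complex.exp_ne_zero _) (bumpFourier_ne_zero hs hδ h₀)
  · exact mul_ne_zero (Complex.exp_ne_zero _) (bumpFourier_ne_zero hs hδ h₁)

lemma testFn_mem (hs : Odd s) (hδ : 0 < δ) (hα : 0 < α) (hαs : α < (s : ℝ) / (s + 1)) {a : ℝ × ℝ}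
    {O : Set (ℝ × ℝ)} (hO : Metric.closedBall a δ ⊆ O) : testFn s δ a ∈ testSpace α O := by
  refine ⟨contDiff_testFn a, hasCompactSupport_testFn hs a, (tsupport_testFn_subset hs a).trans hO,
    fun k₀ k₁ c hc => ?_⟩
  have hα1 : α ≤ 1 := hαs.le.trans (div_le_one_of_le₀ (by linarith) (by positivity))
  have hb := stripDecay_bumpFourier hs hδ hα hαs
  have hdb := differentiable_bumpFourier (s := s) (δ := δ) hs
  let U : ℝ → ℂ → ℂ := fun a ζ => exp (I * ζ * a) * bumpFourier s δ ζ
  have hU : ∀ a, StripDecay α (U a) := fun a => hb.exp_mul a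
  have hdU : ∀ a, Differentiable ℂ (U a) := fun a => by
    simp only [U]
    fun_prop
  obtain ⟨C₀, hC₀⟩ := (hU a.1).norm_iteratedDeriv_le (hdU _) hα hα1 k₀ hc
  obtain ⟨C₁, hC₁⟩ := (hU (-a.2)).norm_iteratedDeriv_le (hdU _) hα hα1 k₁ hc
  have hf : ∀ q₀ p₁ : ℝ, iteratedDeriv k₁ (fun q₁ : ℝ => fourier (testFn s δ a) ((q₀ : ℂ), (q₁ : ℂ))) p₁ =
      ((2 * (Real.pi : ℂ))⁻¹ * iteratedDeriv k₁ (fun q₁ : ℝ => U (-a.2) q₁) p₁) * U a.1 q₀ := by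
    intro q₀ p₁
    have : (fun q₁ : ℝ => fourier (testFn s δ a) ((q₀ : ℂ), (q₁ : ℂ))) =
        fun q₁ : ℝ => ((2 * (Real.pi : ℂ))⁻¹ * U a.1 q₀) * U (-a.2) q₁ := by
      funext q₁
      rw [fourier_testFn]
      simp only [U]
      ring
    rw [this, iteratedDeriv_const_mul_field]
    ring
  refine ⟨‖(2 * (Real.pi : ℂ))⁻¹‖ * (C₁ * C₀), fun p₀ p₁ => ?_⟩
  simp only [hf]
  rw [iteratedDeriv_const_mul_field, norm_mul, norm_mul, norm_mul, Complex.norm_real,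
    norm_of_nonneg (exp_pos _).le]
  have h1 := hC₀ p₀
  have h2 := hC₁ p₁
  have h3 : Real.exp (c * max |p₀| |p₁| ^ α) ≤ Real.exp (c * |p₁| ^ α) * Real.exp (c * |p₀| ^ α) := by
    rw [← Real.exp_add]
    refine Real.exp_le_exp.2 ?_
    have h4 := mul_nonneg hc.le (Real.rpow_nonneg (abs_nonneg p₀) α)
    have h5 := mul_nonneg hc.le (Real.rpow_nonneg (abs_nonneg p₁) α)
    rcases max_choice |p₀| |p₁| with h | h <;> rw [h] <;> linarith
  have h0 : Real.exp (c * |p₀| ^ α) * ‖iteratedDeriv k₀ (fun q : ℝ => U a.1 q) p₀‖ ≤ C₀ := by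
    refine (mul_le_mul_of_nonneg_left h1 (exp_pos _).le).trans (le_of_eq ?_)
    rw [mul_left_comm, ← Real.exp_add]
    simp
  have h0' : Real.exp (c * |p₁| ^ α) * ‖iteratedDeriv k₁ (fun q : ℝ => U (-a.2) q) p₁‖ ≤ C₁ := by
    refine (mul_le_mul_of_nonneg_left h2 (exp_pos _).le).trans (le_of_eq ?_)
    rw [mul_left_comm, ← Real.exp_add]
    simp
  have hC₁0 : 0 ≤ C₁ := (mul_nonneg (exp_pos _).le (norm_nonneg _)).trans h0'
  calc _ ≤ (Real.exp (c * |p₁| ^ α) * Real.exp (c * |p₀| ^ α)) *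
        (‖(2 * (Real.pi : ℂ))⁻¹‖ * ‖iteratedDeriv k₁ (fun q : ℝ => U (-a.2) q) p₁‖ *
          ‖iteratedDeriv k₀ (fun q : ℝ => U a.1 q) p₀‖) := by gcongr
    _ = ‖(2 * (Real.pi : ℂ))⁻¹‖ *
        ((Real.exp (c * |p₁| ^ α) * ‖iteratedDeriv k₁ (fun q : ℝ => U (-a.2) q) p₁‖) *
        (Real.exp (c * |p₀| ^ α) * ‖iteratedDeriv k₀ (fun q : ℝ => U a.1 q) p₀‖)) := by ring
    _ ≤ _ := by gcongr

lemma exists_odd_lt (hα1 : α < 1) : ∃ s : ℕ, Odd s ∧ α < (s : ℝ) / (s + 1) := by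
  obtain ⟨n, hn⟩ := exists_nat_gt (1 / (1 - α))
  refine ⟨2 * n + 1, ⟨n, rfl⟩, ?_⟩
  have h1 : 0 < 1 - α := by linarith
  rw [div_lt_iff₀ h1] at hn
  rw [lt_div_iff₀ (by positivity)]
  have h2 : (0 : ℝ) ≤ n := Nat.cast_nonneg n
  push_cast
  nlinarith

end TestFunction



section Density

variable {α μ : ℝ} {P : SymLaurent} {g : ℝ × ℝ → ℂ} {m : ℕ}

lemma hasSum_inner_wave (Ψ Φ : Fock) : HasSum (fun n => ∫ θ : Fin n → ℝ,
    starRingEnd ℂ (wave Ψ n θ) * wave Φ n θ) (inner ℂ Ψ Φ) := by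
  have h := lp.hasSum_inner (𝕜 := ℂ) Ψ Φ
  have e : (fun n => ∫ θ : Fin n → ℝ, starRingEnd ℂ (wave Ψ n θ) * wave Φ n θ) =
      fun n => inner ℂ (Ψ n) (Φ n) := by
    funext n
    rw [Submodule.coe_inner, L2.inner_def]
    congr 1
    funext θ
    rw [RCLike.inner_apply, mul_comm]
    rfl
  rwa [e]

lemma summable_integral_norm_wave (Ψ Φ : Fock) : Summable fun n => ∫ θ : Fin n → ℝ,
    ‖starRingEnd ℂ (wave Ψ n θ) * wave Φ n θ‖ := by
  have hsq : ∀ Ψ : Fock, Summable fun n => ‖Ψ n‖ ^ 2 := fun Ψ => by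
    simpa using (lp.hasSum_norm (p := 2) (by norm_num) Ψ).summable
  refine Summable.of_nonneg_of_le (fun n => integral_nonneg fun _ => norm_nonneg _) (fun n => ?_)
    ((hsq Ψ).add (hsq Φ))
  rw [← l2_wave, ← l2_wave, l2_sq, l2_sq, ← integral_add (sqInt_wave Ψ n).int (sqInt_wave Φ n).int]
  refine integral_mono_of_nonneg (.of_forall fun _ => norm_nonneg _)
    ((sqInt_wave Ψ n).int.add (sqInt_wave Φ n).int) (.of_forall fun θ => ?_)
  simp only [norm_mul, RCLike.norm_conj]
  nlinarith [sq_nonneg (‖wave Ψ n θ‖ - ‖wave Φ n θ‖), sq_nonneg ‖wave Ψ n θ‖, sq_nonneg ‖wave Φ n θ‖]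

/-- `v` is the vector obtained by applying the form `A` to the vacuum. -/
def IsVacuumImage (hα : 0 < α) (A : SForm α) (v : Fock) : Prop :=
  ∀ Ψ : finiteOmega α, inner ℂ (Ψ : Fock) v = A Ψ ⟨vacuum, vacuum_mem hα⟩

lemma IsVacuumImage.unique {hα : 0 < α} {A : SForm α} {v w : Fock} (hv : IsVacuumImage hα A v)
    (hw : IsVacuumImage hα A w) : v = w :=
  eq_of_forall_inner (dense_finiteOmega hα) fun Ψ => (hv Ψ).trans (hw Ψ).symm

lemma IsOmegaClosure.isVacuumImage {hα : 0 < α} {A : SForm α} {T : Fock →ₗ.[ℂ] Fock}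
    (h : IsOmegaClosure α A T) :
    IsVacuumImage hα A (T ⟨vacuum, h.le_domain (vacuum_mem hα)⟩) :=
  fun Ψ => h.agrees Ψ ⟨vacuum, vacuum_mem hα⟩

lemma exists_isVacuumImage (hα : 0 < α) {A : SForm α} (hA : A ∈ OmegaBounded α) :
    ∃ v, IsVacuumImage hα A v := by
  obtain ⟨T, hT, -⟩ := OmegaBounded.existsUnique_closure hα hA
  exact ⟨_, hT.isVacuumImage⟩

/-- The vectors obtained by applying the elements of `Qodd` to the vacuum. -/
def oddImages (hα : 0 < α) (μ : ℝ) (O : Set (ℝ × ℝ)) : Submodule ℂ Fock where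
  carrier := {v | ∃ A ∈ Qodd μ α O, IsVacuumImage hα A v}
  zero_mem' := ⟨0, zero_mem _, fun Ψ => by simp⟩
  add_mem' := by
    rintro v w ⟨A, hA, hv⟩ ⟨B, hB, hw⟩
    exact ⟨A + B, add_mem hA hB, fun Ψ => by rw [inner_add_right, hv, hw]; rfl⟩
  smul_mem' := by
    rintro c v ⟨A, hA, hv⟩
    exact ⟨c • A, Submodule.smul_mem _ c hA, fun Ψ => by rw [inner_smul_right, hv]; rfl⟩

lemma setOf_closure_vacuum (hμ : 0 < μ) (hα : 0 < α) (O : Set (ℝ × ℝ)) :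
    {v : Fock | ∃ A ∈ Qodd μ α O, ∃ T : Fock →ₗ.[ℂ] Fock, IsOmegaClosure α A T ∧
      ∃ w : T.domain, (w : Fock) = vacuum ∧ T w = v} = (oddImages hα μ O : Set Fock) := by
  ext v
  constructor
  · rintro ⟨A, hA, T, hT, ⟨w, hw'⟩, hw, rfl⟩
    obtain rfl : w = vacuum := hw
    exact ⟨A, hA, hT.isVacuumImage⟩
  · rintro ⟨A, hA, hv⟩
    obtain ⟨T, hT, -⟩ := OmegaBounded.existsUnique_closure hα (Qodd_le_omegaBounded hμ hα O hA)
    exact ⟨A, hA, T, hT, _, rfl, hT.isVacuumImage.unique hv⟩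

/-- The wave functions of the vacuum image of `A^{[1,P,g]}` are the form factors. -/
lemma wave_vacuumImage (hμ : 0 < μ) (hα : 0 < α) (hg : ContDiff ℝ ∞ g) (hc : HasCompactSupport g)
    {h : ∀ m n, ∃ C, DampRight α μ P g m n C} {v : Fock} (hv : IsVacuumImage hα (formA hα h) v)
    (m : ℕ) : wave v m =ᵐ[volume] fun θ => (blockCoeff m 0 0 * oddConst m : ℂ) * ffVac μ P g θ := by
  let ψ : WaveSeq := fun n θ => if n ≤ m then (blockCoeff n 0 0 * oddConst n : ℂ) * ffVac μ P g θ else 0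
  obtain ⟨W, hW, hWm⟩ := exists_represents (N := m) (ψ := ψ) (fun n => by
      by_cases hn : n ≤ m
      · simpa only [ψ, if_pos hn] using (sqInt_ffVac hμ hg hc P n).const_mul _
      · simp only [ψ, if_neg hn]
        exact ⟨measurable_const, by simp⟩)
    (fun n i j hij θ => by
      simp only [ψ]
      split_ifs
      · rw [ffVac_swap θ hij, mul_neg]
      · simp)
    (fun n hn => by
      funext θ
      exact if_neg hn.not_ge)
  have h1 : ∀ Ψ : finiteOmega α, AtMost m (Ψ : Fock) → inner ℂ (Ψ : Fock) (v - W) = 0 := by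
    intro Ψ hΨ
    rw [inner_sub_right, hv Ψ, formA_vacuum hμ hα hg hc h Ψ hΨ, sub_eq_zero]
    refine ((hasSum_inner_wave (Ψ : Fock) W).unique ?_).symm
    have h2 : ∀ n ∉ range (m + 1), ∫ θ : Fin n → ℝ,
        starRingEnd ℂ (wave (Ψ : Fock) n θ) * wave W n θ = 0 := by
      intro n hn
      have hn' : m < n := by simpa using hn
      refine integral_eq_zero_of_ae ?_
      filter_upwards [wave_eq_zero (hΨ n hn')] with θ hθ
      rw [hθ, map_zero, zero_mul]
      rfl
    have h3 := hasSum_sum_of_ne_finset_zero (L := .unconditional ℕ) h2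
    refine (congrArg (HasSum _ ·) (sum_congr rfl fun n hn => ?_)).mp h3
    rw [← integral_const_mul]
    refine integral_congr_ae ?_
    filter_upwards [hW n] with θ hθ
    rw [hθ]
    simp only [ψ]
    rw [if_pos (by simpa [Nat.lt_succ_iff] using hn)]
    ring
  have h2 : ∀ Φ : Fock, AtMost m Φ → inner ℂ Φ (v - W) = 0 := by
    intro Φ hΦ
    refine eq_zero_of_forall_le (C := ‖v - W‖) fun ε hε => ?_
    obtain ⟨-, Ψ, -, -, hΨ, hd⟩ := exists_test_approx hα hΦ hε
    have h3 : inner ℂ Φ (v - W) = inner ℂ (Φ - Ψ) (v - W) := by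
      rw [inner_sub_left, h1 Ψ hΨ, sub_zero]
    rw [h3, mul_comm]
    exact (norm_inner_le_norm _ _).trans (mul_le_mul_of_nonneg_right hd (norm_nonneg _))
  have h3 := h2 (lp.single 2 m ((v - W) m)) fun n hn => lp.single_apply_ne _ _ _ hn.ne'
  rw [lp.inner_single_left, inner_self_eq_zero, lp.coeFn_sub, Pi.sub_apply, sub_eq_zero] at h3
  have h4 : wave v m = wave W m := by rw [wave, wave, h3]
  rw [h4]
  refine (hW m).trans (.of_forall fun θ => ?_)
  exact if_pos le_rfl

lemma oddImages_le (hμ : 0 < μ) (hα : 0 < α) (O : Set (ℝ × ℝ)) :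
    oddImages hα μ O ≤ oddSubspace := by
  rintro v ⟨A, hA, hv⟩
  suffices ∃ w ∈ oddSubspace, IsVacuumImage hα A w by
    obtain ⟨w, hw, h⟩ := this
    rwa [hv.unique h]
  refine Submodule.span_induction (p := fun A _ => ∃ w ∈ oddSubspace, IsVacuumImage hα A w)
    ?_ ?_ ?_ ?_ hA
  · rintro A ⟨P, -, g, hg, hAP⟩
    obtain ⟨h, h1, h2⟩ := exists_formA hμ hα P hg.1 hg.2.1
    rw [hAP.unique hα h2]
    obtain ⟨w, hw⟩ := exists_isVacuumImage hα h1
    refine ⟨w, fun n hn => eq_zero_of_wave ?_, hw⟩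
    filter_upwards [wave_vacuumImage hμ hα hg.1 hg.2.1 hw n] with θ hθ
    rw [hθ, oddConst, if_neg (Nat.not_odd_iff_even.2 hn)]
    simp
  · exact ⟨0, zero_mem _, fun Ψ => by simp⟩
  · rintro A B - - ⟨v, h1, hv⟩ ⟨w, h2, hw⟩
    exact ⟨v + w, add_mem h1 h2, fun Ψ => by rw [inner_add_right, hv, hw]; rfl⟩
  · rintro c A - ⟨v, h1, hv⟩
    exact ⟨c • v, Submodule.smul_mem _ c h1, fun Ψ => by rw [inner_smul_right, hv]; rfl⟩

lemma isClosed_oddSubspace : IsClosed (oddSubspace : Set Fock) := by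
  refine isClosed_of_closure_subset fun v hv n hn => ?_
  refine norm_le_zero_iff.1 (le_of_forall_pos_le_add fun ε hε => ?_)
  obtain ⟨w, hw, h⟩ := Metric.mem_closure_iff.1 hv ε hε
  have h1 := lp.norm_apply_le_norm (by norm_num : (2 : ℝ≥0∞) ≠ 0) (v - w) n
  rw [lp.coeFn_sub, Pi.sub_apply, hw n hn, sub_zero, ← dist_eq_norm] at h1
  linarith

lemma ae_injective : ∀ᵐ θ : Fin m → ℝ, Function.Injective θ := by
  have h : ∀ i j : Fin m, i ≠ j → ∀ᵐ θ : Fin m → ℝ, θ i ≠ θ j := by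
    intro i j hij
    let S : Submodule ℝ (Fin m → ℝ) := LinearMap.ker
      (LinearMap.proj (R := ℝ) (φ := fun _ => ℝ) i - LinearMap.proj j)
    have hS : S ≠ ⊤ := fun hS => by
      have h1 : (Pi.single i 1 : Fin m → ℝ) ∈ S := hS ▸ Submodule.mem_top
      simp [S, hij.symm] at h1
    have h2 := Measure.addHaar_submodule (volume : Measure (Fin m → ℝ)) S hS
    filter_upwards [measure_eq_zero_iff_ae_notMem.1 h2] with θ hθ h3
    refine hθ ?_
    simp [S, h3]
  have h2 := ae_all_iff.2 fun i : Fin m => ae_all_iff.2 fun j : Fin m =>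
    (show ∀ᵐ θ : Fin m → ℝ, i ≠ j → θ i ≠ θ j from by
      by_cases hij : i = j
      · exact .of_forall fun θ h => absurd hij h
      · filter_upwards [h i j hij] with θ hθ _ using hθ)
  filter_upwards [h2] with θ hθ i j hij
  by_contra hne
  exact hθ i j hne hij

lemma tprod_exp_ne_zero {θ : Fin m → ℝ} (hθ : Function.Injective θ) :
    (tprod fun i => exp (θ i)) ≠ 0 := by
  refine Finset.prod_ne_zero_iff.2 fun i _ => Finset.prod_ne_zero_iff.2 fun j hj => ?_
  have hij : i ≠ j := (Finset.mem_Ioi.1 hj).ne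
  simp only [← Complex.ofReal_exp]
  rw [← Complex.ofReal_sub, ← Complex.ofReal_add, ← Complex.ofReal_div]
  have h1 := exp_pos (θ i)
  have h2 := exp_pos (θ j)
  refine Complex.ofReal_ne_zero.2 (div_ne_zero (sub_ne_zero.2 fun h => ?_) (by positivity))
  exact hij (hθ (Real.exp_injective h))

lemma abs_cMomentum_le (hμ : 0 < μ) (θ : Fin m → ℝ) : |(realMomentum μ θ).1| ≤ μ * energy θ ∧
    |(realMomentum μ θ).2| ≤ μ * energy θ := by
  have hE : 0 ≤ energy θ := (Nat.cast_nonneg _).trans (card_le_energy θ)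
  constructor
  · rw [realMomentum, abs_of_nonneg (mul_nonneg hμ.le hE)]
  · rw [realMomentum, abs_mul, abs_of_pos hμ]
    refine mul_le_mul_of_nonneg_left ((Finset.abs_sum_le_sum_abs _ _).trans
      (sum_le_sum fun j _ => ?_)) hμ.le
    rw [Real.abs_sinh, ← Real.cosh_abs]
    exact (Real.sinh_lt_cosh _).le

lemma blockCoeff_ne_zero (m : ℕ) : (blockCoeff m 0 0 : ℂ) ≠ 0 := by
  refine Complex.ofReal_ne_zero.2 (ne_of_gt ?_)
  unfold blockCoeff annihFactor
  positivity

lemma oddConst_ne_zero (hm : Odd m) : oddConst m ≠ 0 := by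
  rw [oddConst, if_pos hm]
  exact inv_ne_zero (pow_ne_zero _ Complex.two_pi_I_ne_zero)

/-- An odd vector orthogonal to the vacuum images vanishes on the energy shells below `R`. -/
lemma wave_eq_zero_of_orthogonal (hμ : 0 < μ) (hα : 0 < α) (hα1 : α < 1) {O : Set (ℝ × ℝ)}
    {a : ℝ × ℝ} (hO : O ∈ 𝓝 a) {b : Fock} (hb : ∀ v ∈ oddImages hα μ O, inner ℂ b v = 0)
    (hm : Odd m) (R : ℝ) : ∀ᵐ θ : Fin m → ℝ, energy θ ≤ R → wave b m θ = 0 := by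
  obtain ⟨s, hs, hαs⟩ := exists_odd_lt hα1
  obtain ⟨r, hr, hball⟩ := Metric.nhds_basis_closedBall.mem_iff.1 hO
  set δ := min (r / 2) (1 / (μ * (|R| + 1))) with hδ
  have hδ0 : 0 < δ := by positivity
  have hδR : μ * |R| * δ ≤ 1 := by
    have h1 : δ ≤ 1 / (μ * (|R| + 1)) := min_le_right _ _
    rw [le_div_iff₀ (by positivity)] at h1
    nlinarith [mul_pos hμ hδ0]
  have hmem : ∀ t : ℝ, |t| < δ → testFn s δ (a.1 + t, a.2) ∈ testSpace α O := by
    intro t ht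
    refine testFn_mem hs hδ0 hα hαs (subset_trans ?_ hball)
    refine Metric.closedBall_subset_closedBall' ?_
    have h1 : δ ≤ r / 2 := min_le_left _ _
    have h2 : dist (a.1 + t, a.2) a = |t| := by
      rw [Prod.dist_eq, dist_self, Real.dist_eq, add_sub_cancel_left, max_eq_left (abs_nonneg t)]
    rw [h2]
    linarith
  have hffVac : ∀ (P : SymLaurent) (t : ℝ) (n : ℕ) (θ : Fin n → ℝ),
      ffVac μ P (testFn s δ (a.1 + t, a.2)) θ = ffVac μ 1 (testFn s δ a) θ *
        evalLaurent (fun j => exp (θ j)) P *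
          exp (I * ((μ * t : ℝ) : ℂ) * energy θ) := by
    intro P t n θ
    have h1 : evalLaurent (fun j => exp (θ j)) 1 = 1 := map_one _
    rw [ffVac, ffVac, fourier_testFn_time, h1, cMomentum, realMomentum]
    push_cast
    ring_nf
  have himage : ∀ P ∈ LaurentI, ∀ t : ℝ, |t| < δ → ∃ v : Fock, inner ℂ b v = 0 ∧
      ∀ n, wave v n =ᵐ[volume] fun θ : Fin n → ℝ => (blockCoeff n 0 0 * oddConst n : ℂ) *
        ffVac μ P (testFn s δ (a.1 + t, a.2)) θ := by
    intro P hP t ht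
    have hg := hmem t ht
    obtain ⟨h, h1, h2⟩ := exists_formA hμ hα P hg.1 hg.2.1
    obtain ⟨v, hv⟩ := exists_isVacuumImage hα h1
    exact ⟨v, hb v ⟨_, Submodule.subset_span ⟨P, hP, _, hg, h2⟩, hv⟩,
      wave_vacuumImage hμ hα hg.1 hg.2.1 hv⟩
  let H : (n : ℕ) → (Fin n → ℝ) → ℂ := fun n θ => starRingEnd ℂ (wave b n θ) *
    ((blockCoeff n 0 0 * oddConst n : ℂ) * ffVac μ 1 (testFn s δ a) θ)
  have hprod : ∀ (P : SymLaurent) (t : ℝ) (n : ℕ) (θ : Fin n → ℝ),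
      H n θ * evalLaurent (fun j => exp (θ j)) P *
        exp (I * ((μ * t : ℝ) : ℂ) * energy θ) = starRingEnd ℂ (wave b n θ) *
        ((blockCoeff n 0 0 * oddConst n : ℂ) * ffVac μ P (testFn s δ (a.1 + t, a.2)) θ) := by
    intro P t n θ
    rw [hffVac]
    simp only [H]
    ring
  have hprod0 : ∀ (P : SymLaurent) (n : ℕ) (θ : Fin n → ℝ),
      H n θ * evalLaurent (fun j => exp (θ j)) P = starRingEnd ℂ (wave b n θ) *
        ((blockCoeff n 0 0 * oddConst n : ℂ) * ffVac μ P (testFn s δ (a.1 + 0, a.2)) θ) := by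
    intro P n θ
    rw [← hprod]
    simp
  have key : ∀ᵐ θ : Fin m → ℝ, H m θ = 0 := by
    refine ae_eq_zero_of_moments (H := H) (ε := μ * δ) ?_ ?_ ?_ (by positivity) ?_ m
    · intro P hP n
      obtain ⟨v, -, hv⟩ := himage P hP 0 (by simpa using hδ0)
      refine ((sqInt_wave b n).star.integrable_mul (sqInt_wave v n)).congr ?_
      filter_upwards [hv n] with θ hθ
      rw [hprod0, hθ]
    · intro P hP
      obtain ⟨v, -, hv⟩ := himage P hP 0 (by simpa using hδ0)
      refine (summable_integral_norm_wave b v).congr fun n => integral_congr_ae ?_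
      filter_upwards [hv n] with θ hθ
      rw [hprod0, hθ]
    · intro n σ
      filter_upwards [wave_comp_perm (b n) σ] with θ hθ
      have hθ' : wave b n (θ ∘ σ) = ((Equiv.Perm.sign σ : ℤ) : ℂ) * wave b n θ := hθ
      have hsq : ((Equiv.Perm.sign σ : ℤ) : ℂ) * ((Equiv.Perm.sign σ : ℤ) : ℂ) = 1 := by
        rw [← Int.cast_mul, ← Units.val_mul, Int.units_mul_self]; simp
      simp only [H]
      rw [hθ', ffVac_comp_perm, map_mul, map_intCast]
      linear_combination (starRingEnd ℂ (wave b n θ) *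
        ((blockCoeff n 0 0 * oddConst n : ℂ) * ffVac μ 1 (testFn s δ a) θ)) * hsq
    · intro P hP t ht
      have ht' : |t / μ| < δ := by
        rw [abs_div, abs_of_pos hμ, div_lt_iff₀ hμ]
        linarith
      obtain ⟨v, h0, hv⟩ := himage P hP (t / μ) ht'
      rw [← h0, ← (hasSum_inner_wave b v).tsum_eq]
      refine tsum_congr fun n => integral_congr_ae ?_
      filter_upwards [hv n] with θ hθ
      have := hprod P (t / μ) n θ
      rw [mul_div_cancel₀ _ hμ.ne'] at this
      rw [this, hθ]
  filter_upwards [key, ae_injective] with θ hθ hinj hR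
  have h1 := abs_cMomentum_le hμ θ
  have hER : μ * energy θ * δ ≤ 1 := by
    refine le_trans ?_ hδR
    gcongr
    exact hR.trans (le_abs_self R)
  have h2 : fourier (testFn s δ a) (cMomentum μ θ) ≠ 0 := fourier_testFn_ne_zero hs hδ0 a
    ((mul_le_mul_of_nonneg_right h1.1 hδ0.le).trans hER)
    ((mul_le_mul_of_nonneg_right h1.2 hδ0.le).trans hER)
  have h3 : evalLaurent (fun j => exp (θ j)) 1 = 1 := map_one _
  have h4 : ffVac μ 1 (testFn s δ a) θ ≠ 0 := by
    rw [ffVac, h3, mul_one]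
    exact mul_ne_zero h2 (tprod_exp_ne_zero hinj)
  have h5 := (mul_eq_zero.1 hθ).resolve_right
    (mul_ne_zero (mul_ne_zero (blockCoeff_ne_zero m) (oddConst_ne_zero hm)) h4)
  exact (map_eq_zero _).1 h5

theorem closure_oddImages (hμ : 0 < μ) (hα : 0 < α) (hα1 : α < 1) {O : Set (ℝ × ℝ)}
    {a : ℝ × ℝ} (hO : O ∈ 𝓝 a) :
    closure (oddImages hα μ O : Set Fock) = (oddSubspace : Set Fock) := by
  refine subset_antisymm (closure_minimal (oddImages_le hμ hα O) isClosed_oddSubspace) ?_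
  intro Φ hΦ
  let K := (oddImages hα μ O).topologicalClosure
  have hK : K ≤ oddSubspace :=
    Submodule.topologicalClosure_minimal _ (oddImages_le hμ hα O) isClosed_oddSubspace
  have : CompleteSpace K := (Submodule.isClosed_topologicalClosure _).completeSpace_coe
  obtain ⟨c, hc, b, hb, rfl⟩ := K.exists_add_mem_mem_orthogonal Φ
  have hbo : b ∈ oddSubspace := by simpa using sub_mem hΦ (hK hc)
  have hb' : ∀ v ∈ oddImages hα μ O, inner ℂ b v = 0 := fun v hv =>
    (Submodule.mem_orthogonal' _ _).1 hb v (Submodule.le_topologicalClosure _ hv)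
  have hb0 : b = 0 := by
    refine lp.ext (funext fun n => ?_)
    rcases Nat.even_or_odd n with hn | hn
    · exact hbo n hn
    · refine eq_zero_of_wave ?_
      have := ae_all_iff.2 fun k : ℕ => wave_eq_zero_of_orthogonal hμ hα hα1 hO hb' hn k
      filter_upwards [this] with θ hθ
      obtain ⟨k, hk⟩ := exists_nat_gt (energy θ)
      exact hθ k hk.le
  rw [hb0, add_zero]
  exact hc

lemma doubleCone_mem_nhds {x y : ℝ × ℝ} (hxy : y - x ∈ rightWedge) :
    doubleCone x y ∈ 𝓝 ((1 / 2 : ℝ) • (x + y)) := by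
  have ho : IsOpen rightWedge :=
    isOpen_lt (by fun_prop) continuous_snd
  have hD : IsOpen (doubleCone x y) :=
    (ho.preimage (continuous_id.sub continuous_const)).inter
      (ho.preimage (continuous_const.sub continuous_id))
  refine hD.mem_nhds ?_
  have h : (1 / 2 : ℝ) • (y - x) ∈ rightWedge := by
    simp only [rightWedge, Set.mem_ofPred_eq, Prod.smul_fst, Prod.smul_snd, smul_eq_mul, abs_mul] at hxy ⊢
    rw [abs_of_pos (by norm_num : (0 : ℝ) < 1 / 2)]
    linarith
  constructor
  · convert h using 1
    ext <;> simp <;> ring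
  · convert h using 1
    ext <;> simp <;> ring

end Density

end

end IsingModel


theorem proposition5p7 (μ α : ℝ) (hμ : 0 < μ) (hα₀ : 0 < α) (hα₁ : α < 1)
    (x y : ℝ × ℝ) (hxy : y - x ∈ IsingModel.rightWedge) :
    (∀ P ∈ IsingModel.LaurentI, ∀ g ∈ IsingModel.testSpace α (IsingModel.doubleCone x y),
      ∃! A : IsingModel.SForm α, IsingModel.IsAssociatedForm α (IsingModel.Fodd μ P g) A) ∧
    (∀ A ∈ IsingModel.Qodd μ α (IsingModel.doubleCone x y),
      ∃! T : IsingModel.Fock →ₗ.[ℂ] IsingModel.Fock, IsingModel.IsOmegaClosure α A T) ∧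
    closure {v : IsingModel.Fock | ∃ A ∈ IsingModel.Qodd μ α (IsingModel.doubleCone x y),
        ∃ T : IsingModel.Fock →ₗ.[ℂ] IsingModel.Fock, IsingModel.IsOmegaClosure α A T ∧
          ∃ w : T.domain, (w : IsingModel.Fock) = IsingModel.vacuum ∧ T w = v} =
      (IsingModel.oddSubspace : Set IsingModel.Fock) := by
  open IsingModel in
  refine ⟨fun P _ g hg => ?_, fun A hA => ?_, ?_⟩
  · obtain ⟨h, -, hA⟩ := exists_formA hμ hα₀ P hg.1 hg.2.1
    exact ⟨_, hA, fun B hB => hB.unique hα₀ hA⟩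
  · exact OmegaBounded.existsUnique_closure hα₀ (Qodd_le_omegaBounded hμ hα₀ _ hA)
  · rw [setOf_closure_vacuum hμ hα₀]
    exact closure_oddImages hμ hα₀ hα₁ (doubleCone_mem_nhds hxy)
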